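/- **Setting.** Let $n\ge 1$ and let $\omega:\mathbb{R}^n\to(0,\infty)$ be a measurable weight in the Muckenhoupt class $A_2$, i.e. $\sup_Q\big(\frac1{|Q|}\int_Q\omega\,dx\big)\big(\frac1{|Q|}\int_Q\omega^{-1}\,dx\big)<\infty$ over all cubes $Q$ with sides parallel to the axes. Put $d\omega=\omega(x)\,dx$, $d\mu=d\omega\,dt$, $\omega_r(x)=\omega(B(x,\sqrt r))$, $L^2_\omega=L^2(\mathbb{R}^n,d\omega;\mathbb{C})$ with inner product $\langle f,g\rangle_{2,\omega}=\int f\bar g\,d\omega$, and $H^1_\omega=\{f\in L^2_\omega:\nabla_x f\in (L^2_\omega)^n\}$ (distributional gradient). Let $A:\mathbb{R}\times\mathbb{R}^n\to M_n(\mathbb{C})$ be measurable with, for some $M,\nu>0$, $|A(t,x)\xi\cdot\zeta|\le M\omega(x)|\xi||\zeta|$ and $\nu|\xi|^2\omega(x)\le\mathrm{Re}(A(t,x)\xi\cdot\bar\xi)$ for all $t,x$ and all $\xi,\zeta\in\mathbb{C}^n$. Let $$\mathcal{H}=\partial_t-\omega^{-1}\mathrm{div}_x(A(t,\cdot)\nabla_x),\qquad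 \mathcal{H}^\star=-\partial_s-\omega^{-1}\mathrm{div}_x(A^\star(s,\cdot)\nabla_x),$$ with $A^\star$ the Hermitian adjoint of $A$. Equations are understood in $\mathcal{D}'(\mathbb{R}\times\mathbb{R}^n)$ with the duality taken with respect to $d\mu$: $\mathcal{H}u=f$ means $\iint(-u\,\partial_t\varphi+\omega^{-1}A\nabla_xu\cdot\nabla_x\varphi)\,d\mu=\iint f\varphi\,d\mu$ for all $\varphi\in\mathcal{D}(\mathbb{R}\times\mathbb{R}^n)$, and similarly for $\mathcal{H}^\star$. **Fundamental solution.** The fundamental solution of $\mathcal{H}$ is the family $(\Gamma(t,s))_{t,s\in\mathbb{R}}$ of bounded operators on $L^2_\omega$ such that: (i) $\sup_{t,s}\|\Gamma(t,s)\|<\infty$; (ii) $\Gamma(t,s)=0$ if $s>t$; (iii) $(t,s)\mapsto\langle\Gamma(t,s)\psi,\tilde\psi\rangle_{2,\omega}$ is Borel for all $\psi,\tilde\psi\in\mathcal{D}(\mathbb{R}^n)$; (iv) for all $\phi\in\mathcal{D}(\mathbb{R})$, $\psi\in\mathcal{D}(\mathbb{R}^n)$, every $u\in L^1_{\rm loc}(\mathbb{R};H^1_\omega)$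 with $\int_{\mathbb{R}}\|\nabla_xu(t)\|_{2,\omega}^2\,dt<\infty$ and $\mathcal{H}u=\phi\otimes\psi$ satisfies $\langle u(t),\tilde\psi\rangle_{2,\omega}=\int_{-\infty}^t\phi(s)\langle\Gamma(t,s)\psi,\tilde\psi\rangle_{2,\omega}\,ds$ for all $\tilde\psi\in\mathcal{D}(\mathbb{R}^n)$ and almost every $t$; (v) for all $\psi,\tilde\psi\in L^2_\omega$, $\langle\Gamma(t,s)\psi,\tilde\psi\rangle_{2,\omega}$ is continuous in $t\in[s,\infty)$ for each $s$ and in $s\in(-\infty,t]$ for each $t$. The fundamental solution $(\tilde\Gamma(s,t))_{s,t\in\mathbb{R}}$ of $\mathcal{H}^\star$ is defined in the same manner: $\tilde\Gamma(s,t)=0$ if $s>t$, and solutions $v$ of $\mathcal{H}^\star v=\phi\otimes\psi$ are represented by $\langle v(s),\tilde\psi\rangle_{2,\omega}=\int_s^{\infty}\phi(t)\langle\tilde\Gamma(s,t)\psi,\tilde\psi\rangle_{2,\omega}\,dt$. **Gaussian upper bounds.** $\mathcal{H}$ has Gaussian upper bounds if it has a fundamental solution $\Gamma$ such that for all $t>s$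 the operator $\Gamma(t,s)$ has a measurable kernel $\Gamma(t,x;s,y)$ with respect to $d\omega$, that is $(\Gamma(t,s)f)(x)=\int\Gamma(t,x;s,y)f(y)\,d\omega(y)$ (absolutely convergent) for every $f\in L^2_\omega$ and almost every $x$, with $$|\Gamma(t,x;s,y)|\le\frac{K_0}{\sqrt{\omega_{t-s}(x)}\sqrt{\omega_{t-s}(y)}}\,e^{-k_0\frac{|x-y|^2}{t-s}}\quad\text{for almost every }(x,y)\in\mathbb{R}^{2n},$$ where $K_0,k_0>0$ do not depend on $t,s,x,y$. For $\mathcal{H}^\star$ the definition is the same, with $\tilde\Gamma(s,t)$ and its kernel $\tilde\Gamma(s,y;t,x)$ (acting by integration in $x$), with the same form of bound. **Proposition.** $\mathcal{H}$ has Gaussian upper bounds if and only if $\mathcal{H}^\star$ does. In this case, let $\Gamma$, $\tilde\Gamma$ be the fundamental solutions of $\mathcal{H}$, $\mathcal{H}^\star$, with kernels $\Gamma(t,x;s,y)$, $\tilde\Gamma(s,y;t,x)$. Then for all $t>s$: 1. $\tilde\Gamma(s,y;t,x)=\overline{\Gamma(t,x;s,y)}$ for almost every $(x,y)\in\mathbb{R}^{2n}$;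 2. if $t>r>s$, then $\int_{\mathbb{R}^n}\Gamma(t,x;r,z)\,\Gamma(r,z;s,y)\,d\omega(z)=\Gamma(t,x;s,y)$ for almost every $(x,y)\in\mathbb{R}^{2n}$, the integral being absolutely convergent; 3. $\int_{\mathbb{R}^n}\Gamma(t,x;s,y)\,d\omega(y)=1$ for almost every $x\in\mathbb{R}^n$, the integral being absolutely convergent. -/

import Mathlib

open MeasureTheory Set
open scoped ENNReal Matrix ComplexConjugate

noncomputable section

namespace DegParabolic

/-- Real Euclidean space of dimension `n`. -/
abbrev E (n : ℕ) : Type := EuclideanSpace ℝ (Fin n)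

/-- Complex vectors of length `n`, with the Hermitian norm. -/
abbrev V (n : ℕ) : Type := EuclideanSpace ℂ (Fin n)

variable {n : ℕ}

/-! ### The weight -/

/-- The closed cube with sides parallel to the axes, lower corner `a` and side length `r`. -/
def cube (a : E n) (r : ℝ) : Set (E n) := {x | ∀ i, a i ≤ x i ∧ x i ≤ a i + r}

/-- The Muckenhoupt constant `[ω]_{A₂}`, a supremum over all cubes, with values in `[0, ∞]`. -/
def a2Const (ω : E n → ℝ) : ℝ≥0∞ :=
  ⨆ (a : E n) (r : ℝ) (_ : 0 < r),
    ((volume (cube a r))⁻¹ * ∫⁻ x in cube a r, ENNReal.ofReal (ω x)) *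
      ((volume (cube a r))⁻¹ * ∫⁻ x in cube a r, ENNReal.ofReal ((ω x)⁻¹))

/-- `ω` is a weight in the Muckenhoupt class `A₂`. -/
structure IsA2Weight (ω : E n → ℝ) : Prop where
  meas : AEMeasurable ω volume
  pos : ∀ x, 0 < ω x
  finite : a2Const ω < ∞

/-- The measure `dω = ω(x) dx`. -/
def wMeasure (ω : E n → ℝ) : Measure (E n) :=
  volume.withDensity (fun x => ENNReal.ofReal (ω x))

/-- `ω_r(x)`, the `ω`-measure of the ball with centre `x` and radius `√r`. -/
def ballMass (ω : E n → ℝ) (r : ℝ) (x : E n) : ℝ :=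
  (wMeasure ω).real (Metric.ball x (Real.sqrt r))

/-- The Hilbert space `L²_ω(ℝⁿ)` of complex-valued functions. -/
abbrev L2w (ω : E n → ℝ) : Type := Lp ℂ 2 (wMeasure ω)

/-- The Hilbert space `L²_ω(ℝⁿ)ⁿ` of complex vector fields. -/
abbrev L2wVec (ω : E n → ℝ) : Type := Lp (V n) 2 (wMeasure ω)

/-- `⟨f, g⟩_{2,ω} = ∫ f conj(g) dω`, linear in the first argument. -/
def ip {ω : E n → ℝ} (f g : L2w ω) : ℂ := inner ℂ g f

/-! ### Test functions and weak gradients -/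

/-- Smooth, compactly supported, complex-valued functions. -/
def IsTest {F : Type*} [NormedAddCommGroup F] [NormedSpace ℝ F] (η : F → ℂ) : Prop :=
  ContDiff ℝ ((⊤ : ℕ∞) : WithTop ℕ∞) η ∧ HasCompactSupport η

/-- The element `ψ` of `L²_ω` is (the class of) a test function. -/
def IsTestClass {ω : E n → ℝ} (ψ : L2w ω) : Prop :=
  ∃ η : E n → ℂ, IsTest η ∧ (ψ : E n → ℂ) =ᵐ[volume] η

/-- The vector of the partial derivatives of `η` at `x`. -/
def grad (η : E n → ℂ) (x : E n) : Fin n → ℂ :=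
  fun i => fderiv ℝ η x (EuclideanSpace.single i 1)

/-- `g` is the distributional gradient of `f` (with respect to Lebesgue measure). Thus
`f ∈ H¹_ω(ℝⁿ)` with gradient `g` if and only if this holds. -/
def HasWeakGradient {ω : E n → ℝ} (f : L2w ω) (g : L2wVec ω) : Prop :=
  ∀ η : E n → ℂ, IsTest η → ∀ i : Fin n,
    ∫ x, f x * grad η x i = - ∫ x, g x i * η x

/-- `u ∈ L¹_loc(ℝ; H¹_ω)` with gradient `∇ₓu = G ∈ L²(ℝ; L²_ω)`. -/
structure InEnergyClass {ω : E n → ℝ} (u : ℝ → L2w ω) (G : ℝ → L2wVec ω) : Prop where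
  locInt : LocallyIntegrable u volume
  gradMem : MemLp G 2 volume
  isGrad : ∀ᵐ t : ℝ, HasWeakGradient (u t) (G t)

/-! ### The degenerate parabolic operators -/

/-- Time-dependent matrix-valued coefficients. -/
abbrev Coeff (n : ℕ) : Type := ℝ → E n → Matrix (Fin n) (Fin n) ℂ

/-- `A` is measurable, with `|Aξ·ζ| ≤ M ω |ξ| |ζ|` and `ν |ξ|² ω ≤ Re (Aξ·conj ξ)`. -/
structure IsElliptic (ω : E n → ℝ) (A : Coeff n) (M ν : ℝ) : Prop where
  meas : ∀ i j, AEMeasurable (fun p : ℝ × E n => A p.1 p.2 i j) volume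
  upper : ∀ t x, ∀ ξ ζ : V n, ‖(A t x *ᵥ ξ.ofLp) ⬝ᵥ ζ.ofLp‖ ≤ M * ω x * ‖ξ‖ * ‖ζ‖
  lower : ∀ t x, ∀ ξ : V n, ν * ‖ξ‖ ^ 2 * ω x ≤ ((A t x *ᵥ ξ.ofLp) ⬝ᵥ star ξ.ofLp).re

/-- `Hu = ∂ₜu - ω⁻¹ divₓ(A ∇ₓu) = f` in the sense of distributions on `ℝ × ℝⁿ`, where
`G = ∇ₓu` and the duality is taken with respect to `dμ = dω dt`. -/
def SolvesForward (ω : E n → ℝ) (A : Coeff n) (u : ℝ → L2w ω) (G : ℝ → L2wVec ω)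
    (f : ℝ → E n → ℂ) : Prop :=
  ∀ η : ℝ × E n → ℂ, IsTest η →
    ∫ t : ℝ, ∫ x, (- (u t x * deriv (fun τ : ℝ => η (τ, x)) t)
        + ((ω x : ℂ))⁻¹ * ((A t x *ᵥ (G t x).ofLp) ⬝ᵥ grad (fun y => η (t, y)) x)) ∂(wMeasure ω)
      = ∫ t : ℝ, ∫ x, f t x * η (t, x) ∂(wMeasure ω)

/-- `H⋆v = -∂ₛv - ω⁻¹ divₓ(A⋆ ∇ₓv) = f` in the sense of distributions on `ℝ × ℝⁿ`, where
`G = ∇ₓv` and `A⋆` is the conjugate transpose of `A`. -/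
def SolvesBackward (ω : E n → ℝ) (A : Coeff n) (v : ℝ → L2w ω) (G : ℝ → L2wVec ω)
    (f : ℝ → E n → ℂ) : Prop :=
  ∀ η : ℝ × E n → ℂ, IsTest η →
    ∫ s : ℝ, ∫ x, (v s x * deriv (fun τ : ℝ => η (τ, x)) s
        + ((ω x : ℂ))⁻¹ * (((A s x)ᴴ *ᵥ (G s x).ofLp) ⬝ᵥ grad (fun y => η (s, y)) x)) ∂(wMeasure ω)
      = ∫ s : ℝ, ∫ x, f s x * η (s, x) ∂(wMeasure ω)

/-! ### Fundamental solutions -/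

/-- `Γ = (Γ(t,s))` is the fundamental solution of `H`. The conditions `bdd`, `causal`, `meas` and
`repr` only see `Γ` up to null sets of pairs `(t, s)`; the weak continuity in each of the two
variables, on `s ≤ t`, singles out the representative. -/
structure IsFundSol (ω : E n → ℝ) (A : Coeff n) (Γ : ℝ → ℝ → (L2w ω →L[ℂ] L2w ω)) : Prop where
  bdd : ∃ C : ℝ, ∀ t s, ‖Γ t s‖ ≤ C
  causal : ∀ t s, t < s → Γ t s = 0
  meas : ∀ ψ ψ' : L2w ω, IsTestClass ψ → IsTestClass ψ' →
    Measurable (fun p : ℝ × ℝ => ip (Γ p.1 p.2 ψ) ψ')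
  repr : ∀ (φ : ℝ → ℂ) (ψ : L2w ω), IsTest φ → IsTestClass ψ →
    ∀ (u : ℝ → L2w ω) (G : ℝ → L2wVec ω), InEnergyClass u G →
      SolvesForward ω A u G (fun t x => φ t * ψ x) →
      ∀ ψ' : L2w ω, IsTestClass ψ' →
        ∀ᵐ t : ℝ, ip (u t) ψ' = ∫ s in Iic t, φ s * ip (Γ t s ψ) ψ'
  cont_fst : ∀ (s : ℝ) (ψ ψ' : L2w ω), ContinuousOn (fun t => ip (Γ t s ψ) ψ') (Ici s)
  cont_snd : ∀ (t : ℝ) (ψ ψ' : L2w ω), ContinuousOn (fun s => ip (Γ t s ψ) ψ') (Iic t)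

/-- `Γ' = (Γ'(s,t))` is the fundamental solution of the backward operator `H⋆`. -/
structure IsAdjFundSol (ω : E n → ℝ) (A : Coeff n) (Γ' : ℝ → ℝ → (L2w ω →L[ℂ] L2w ω)) :
    Prop where
  bdd : ∃ C : ℝ, ∀ s t, ‖Γ' s t‖ ≤ C
  causal : ∀ s t, t < s → Γ' s t = 0
  meas : ∀ ψ ψ' : L2w ω, IsTestClass ψ → IsTestClass ψ' →
    Measurable (fun p : ℝ × ℝ => ip (Γ' p.1 p.2 ψ) ψ')
  repr : ∀ (φ : ℝ → ℂ) (ψ : L2w ω), IsTest φ → IsTestClass ψ →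
    ∀ (v : ℝ → L2w ω) (G : ℝ → L2wVec ω), InEnergyClass v G →
      SolvesBackward ω A v G (fun s x => φ s * ψ x) →
      ∀ ψ' : L2w ω, IsTestClass ψ' →
        ∀ᵐ s : ℝ, ip (v s) ψ' = ∫ t in Ici s, φ t * ip (Γ' s t ψ) ψ'
  cont_fst : ∀ (t : ℝ) (ψ ψ' : L2w ω), ContinuousOn (fun s => ip (Γ' s t ψ) ψ') (Iic t)
  cont_snd : ∀ (s : ℝ) (ψ ψ' : L2w ω), ContinuousOn (fun t => ip (Γ' s t ψ) ψ') (Ici s)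

/-! ### Kernels and Gaussian upper bounds -/

/-- `T` is an integral operator with the measurable kernel `k` with respect to `dω`. -/
def HasKernel {ω : E n → ℝ} (T : L2w ω →L[ℂ] L2w ω) (k : E n → E n → ℂ) : Prop :=
  AEStronglyMeasurable (fun p : E n × E n => k p.1 p.2) volume ∧
  ∀ f : L2w ω, ∀ᵐ x : E n, Integrable (fun y => k x y * f y) (wMeasure ω) ∧
    (T f) x = ∫ y, k x y * f y ∂(wMeasure ω)

/-- The right-hand side of the Gaussian upper bound, at the time lag `r = t - s`. -/
def gaussBound (ω : E n → ℝ) (K₀ k₀ r : ℝ) (x y : E n) : ℝ :=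
  K₀ / (Real.sqrt (ballMass ω r x) * Real.sqrt (ballMass ω r y)) *
    Real.exp (-(k₀ * (‖x - y‖ ^ 2 / r)))

/-- `H` has Gaussian upper bounds; `k t x s y` stands for `Γ(t,x;s,y)`. -/
def HasGaussianUpperBounds (ω : E n → ℝ) (A : Coeff n) : Prop :=
  ∃ Γ : ℝ → ℝ → (L2w ω →L[ℂ] L2w ω), IsFundSol ω A Γ ∧
    ∃ (k : ℝ → E n → ℝ → E n → ℂ) (K₀ k₀ : ℝ), 0 < K₀ ∧ 0 < k₀ ∧
      ∀ t s : ℝ, s < t →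
        HasKernel (Γ t s) (fun x y => k t x s y) ∧
        ∀ᵐ p : E n × E n, ‖k t p.1 s p.2‖ ≤ gaussBound ω K₀ k₀ (t - s) p.1 p.2

/-- `H⋆` has Gaussian upper bounds; `k' s y t x` stands for the kernel at `(s,y;t,x)`. -/
def AdjHasGaussianUpperBounds (ω : E n → ℝ) (A : Coeff n) : Prop :=
  ∃ Γ' : ℝ → ℝ → (L2w ω →L[ℂ] L2w ω), IsAdjFundSol ω A Γ' ∧
    ∃ (k' : ℝ → E n → ℝ → E n → ℂ) (K₀ k₀ : ℝ), 0 < K₀ ∧ 0 < k₀ ∧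
      ∀ t s : ℝ, s < t →
        HasKernel (Γ' s t) (fun y x => k' s y t x) ∧
        ∀ᵐ p : E n × E n, ‖k' s p.2 t p.1‖ ≤ gaussBound ω K₀ k₀ (t - s) p.1 p.2

end DegParabolic

end

open Filter Topology

noncomputable section

namespace DegParabolic

set_option linter.unusedSectionVars false

/-! ### Mollification -/

section Mollify

/-! The equation is read as an abstract evolution u' = -D⋆B(t)Du + f in H = L²_ω, where D is the
weak gradient, given by its closed graph `𝒢` in H × K, and B(t) is multiplication by ω⁻¹A(t,·),
bounded and coercive by ellipticity. A product rule for ⟨u₁,u₂⟩ (`IsData.product`), obtained by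
mollifying in time, gives the energy estimates. Lions' theorem for a damped problem on the whole
line gives existence (`exists_solution`). Uniqueness (`IsData.eq_zero`) holds in a class where only
∇u is square integrable in time, so decay of u at -∞ has to be proved: comparing u(s+τ) with u(s-τ)
shows that u has a limit there, the limit has zero gradient, and it vanishes because A₂ doubling
forces ω(ℝⁿ) = ∞. The A₂ condition also bounds mollification on L²_ω; this makes test functions
dense in H¹_ω (`mem_closure_testPair`) and identifies the distributional formulation with the
abstract one.

Duality. The reflection t ↦ -t turns H⋆ into a forward operator with coefficients A⋆(-t,·). If u
solves the forward and v the reversed problem, then ⟨v(-t),u(t)⟩ changes only through the sources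
(`IsSol.pairing`). Inserting the representation formula shows that Γ(-s,-t)⋆ is a fundamental
solution of the reversed operator (`IsFundSol.rev`). Weak continuity makes fundamental solutions
unique for every pair s < t (`IsFundSol.unique`), so the fundamental solution of H⋆ at (s,t) is
Γ(t,s)⋆. The same pairing gives u(t) = Γ(t,r)u(r) once the source is over, whence Γ(t,s) =
Γ(t,r)Γ(r,s) (`IsFundSol.comp`).

Kernels. By doubling, the Gaussian bound implies decay like exp(-|x|) in one variable, locally
uniformly in the other. This justifies Fubini, so that adjoints and compositions pass to kernels
(`KernelOp.adjoint`, `KernelOp.comp`), and kernels are unique almost everywhere (`kernel_ae_eq`).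

Conservation. The solution is tested with a cutoff at scale R, whose gradient lives where |x| ≥ R. A
weighted energy estimate, with a weight equal to 1 on the support of ψ and to exp R where |x| ≥ R,
and with logarithmic gradient bounded independently of R, bounds the error by a multiple of Rⁿ
exp(-R) (`IsData.weighted_energy`, `IsFundSol.tendsto_inner_cutoff`). Hence ∫Γ(t,s)ψ dω = ∫ψ dω, so
the kernel has integral one in x. The same fact for the reversed operator is the assertion in y. -/

theorem lintegral_mul_sq_le {α : Type*} [MeasurableSpace α] {μ : Measure α} {f g : α → ℝ≥0∞}
    (hf : AEMeasurable f μ) (hg : AEMeasurable g μ) :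
    (∫⁻ x, f x * g x ∂μ) ^ 2 ≤ (∫⁻ x, f x ^ 2 ∂μ) * ∫⁻ x, g x ^ 2 ∂μ := by
  have h := ENNReal.lintegral_mul_le_Lp_mul_Lq μ Real.HolderConjugate.two_two hf hg
  simp only [Pi.mul_apply, ENNReal.rpow_two] at h
  calc (∫⁻ x, f x * g x ∂μ) ^ 2
      ≤ ((∫⁻ x, f x ^ 2 ∂μ) ^ (1 / 2 : ℝ) * (∫⁻ x, g x ^ 2 ∂μ) ^ (1 / 2 : ℝ)) ^ 2 := by gcongr
    _ = _ := by
      rw [mul_pow, ← ENNReal.rpow_two, ← ENNReal.rpow_two, ← ENNReal.rpow_mul, ← ENNReal.rpow_mul]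
      norm_num

/-- A weighted Schur test. -/
theorem weighted_schur {α : Type*} [MeasurableSpace α] {μ : Measure α} [SFinite μ]
    {p : α → α → ℝ≥0∞} (hp : Measurable (Function.uncurry p)) {w v F : α → ℝ≥0∞}
    (hw : AEMeasurable w μ) (hv : AEMeasurable v μ) (hF : AEMeasurable F μ)
    (hwv : ∀ᵐ x ∂μ, w x * v x = 1) {C : ℝ≥0∞}
    (hC : ∀ᵐ y ∂μ, ∫⁻ x, w x * p x y * ∫⁻ z, p x z * v z ∂μ ∂μ ≤ C) :
    ∫⁻ x, (∫⁻ y, p x y * F y ∂μ) ^ 2 * w x ∂μ ≤ C * ∫⁻ y, F y ^ 2 * w y ∂μ := by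
  have hpx : ∀ x, Measurable (p x) := fun x => hp.comp measurable_prodMk_left
  -- Cauchy–Schwarz for the splitting p F = (p^{1/2} F w^{1/2}) (p^{1/2} v^{1/2}), legitimate
  -- because w v = 1. After Tonelli the second factor is exactly what `hC` controls.
  have h1 : ∀ x, (∫⁻ y, p x y * F y ∂μ) ^ 2 ≤
      (∫⁻ y, p x y * (F y ^ 2 * w y) ∂μ) * ∫⁻ y, p x y * v y ∂μ := by
    intro x
    have e1 : ∫⁻ y, p x y * F y ∂μ =
        ∫⁻ y, (p x y ^ (1 / 2 : ℝ) * F y * w y ^ (1 / 2 : ℝ)) *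
          (p x y ^ (1 / 2 : ℝ) * v y ^ (1 / 2 : ℝ)) ∂μ := by
      refine lintegral_congr_ae (hwv.mono fun y hy => ?_)
      have e2 : (w y) ^ (1 / 2 : ℝ) * v y ^ (1 / 2 : ℝ) = 1 := by
        rw [← ENNReal.mul_rpow_of_nonneg _ _ (by norm_num), hy, ENNReal.one_rpow]
      have e3 : (p x y) ^ (1 / 2 : ℝ) * (p x y) ^ (1 / 2 : ℝ) = p x y := by
        rw [← ENNReal.rpow_add_of_nonneg _ _ (by norm_num) (by norm_num)]; norm_num
      dsimp only
      calc p x y * F y = (p x y ^ (1 / 2 : ℝ) * p x y ^ (1 / 2 : ℝ)) * F y *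
            (w y ^ (1 / 2 : ℝ) * v y ^ (1 / 2 : ℝ)) := by rw [e2, e3, mul_one]
        _ = _ := by ring
    rw [e1]
    have hsq : ∀ a : ℝ≥0∞, (a ^ (1 / 2 : ℝ)) ^ 2 = a := fun a => by
      rw [← ENNReal.rpow_two, ← ENNReal.rpow_mul]; norm_num
    refine (lintegral_mul_sq_le ?_ ?_).trans (le_of_eq ?_)
    · exact (((hpx x).aemeasurable.pow_const _).mul hF).mul (hw.pow_const _)
    · exact ((hpx x).aemeasurable.pow_const _).mul (hv.pow_const _)
    · congr 1 <;> refine lintegral_congr fun y => ?_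
      · rw [mul_pow, mul_pow, hsq, hsq]; ring
      · rw [mul_pow, hsq, hsq]
  have hI : AEMeasurable (fun x => ∫⁻ z, p x z * v z ∂μ) μ := by
    have : AEMeasurable (fun q : α × α => p q.1 q.2 * v q.2) (μ.prod μ) :=
      hp.aemeasurable.mul hv.comp_snd
    exact this.lintegral_prod_right'
  calc ∫⁻ x, (∫⁻ y, p x y * F y ∂μ) ^ 2 * w x ∂μ
      ≤ ∫⁻ x, ∫⁻ y, (F y ^ 2 * w y) * (w x * p x y * ∫⁻ z, p x z * v z ∂μ) ∂μ ∂μ := by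
        refine lintegral_mono fun x => ?_
        calc _ ≤ ((∫⁻ y, p x y * (F y ^ 2 * w y) ∂μ) * ∫⁻ y, p x y * v y ∂μ) * w x := by
              gcongr; exact h1 x
          _ = (∫⁻ y, p x y * (F y ^ 2 * w y) ∂μ) * ((∫⁻ y, p x y * v y ∂μ) * w x) := by ring
          _ = _ := by
            have hm : AEMeasurable (fun y => p x y * (F y ^ 2 * w y)) μ :=
              (hpx x).aemeasurable.mul ((hF.pow_const 2).mul hw)
            rw [← lintegral_mul_const'' _ hm]
            exact lintegral_congr fun y => by ring
    _ = ∫⁻ y, ∫⁻ x, (F y ^ 2 * w y) * (w x * p x y * ∫⁻ z, p x z * v z ∂μ) ∂μ ∂μ := by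
        apply lintegral_lintegral_swap
        exact (((hF.pow_const 2).mul hw).comp_snd).mul ((hw.comp_fst.mul hp.aemeasurable).mul
          hI.comp_fst)
    _ = ∫⁻ y, (F y ^ 2 * w y) * ∫⁻ x, (w x * p x y * ∫⁻ z, p x z * v z ∂μ) ∂μ ∂μ := by
        refine lintegral_congr fun y => ?_
        rw [lintegral_const_mul'']
        exact (hw.mul (hp.comp (measurable_prodMk_right)).aemeasurable).mul hI
    _ ≤ ∫⁻ y, (F y ^ 2 * w y) * C ∂μ := by
        refine lintegral_mono_ae (hC.mono fun y hy => ?_)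
        gcongr
    _ = C * ∫⁻ y, F y ^ 2 * w y ∂μ := by
        have hm : AEMeasurable (fun y => F y ^ 2 * w y) μ := (hF.pow_const 2).mul hw
        rw [lintegral_mul_const'' _ hm, mul_comm]

variable {X : Type*} [NormedAddCommGroup X] [NormedSpace ℝ X] [FiniteDimensional ℝ X]
  [MeasureSpace X] [BorelSpace X] [(volume : Measure X).IsAddHaarMeasure]
variable {F : Type*} [NormedAddCommGroup F] [NormedSpace ℝ F]

variable (X) in
/-- Bump functions at `0` supported in the ball of radius `1 / (k + 1)`. -/
def stdBump (k : ℕ) : ContDiffBump (0 : X) where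
  rIn := 1 / (2 * (k + 1))
  rOut := 1 / (k + 1)
  rIn_pos := by positivity
  rIn_lt_rOut := by
    apply one_div_lt_one_div_of_lt <;> [positivity; nlinarith [k.cast_nonneg (α := ℝ)]]

variable (X) in
/-- The normalised bump functions. -/
def bumpKernel (k : ℕ) : X → ℝ := (stdBump X k).normed volume

/-- Convolution with the normalised bump function. -/
def mollify (k : ℕ) (f : X → F) : X → F :=
  convolution (bumpKernel X k) f (ContinuousLinearMap.lsmul ℝ ℝ) volume

theorem mollify_apply (k : ℕ) (f : X → F) (x : X) :
    mollify k f x = ∫ y, bumpKernel X k (x - y) • f y := convolution_lsmul_swap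

theorem bumpKernel_contDiff (k : ℕ) : ContDiff ℝ ((⊤ : ℕ∞) : WithTop ℕ∞) (bumpKernel X k) :=
  ContDiffBump.contDiff_normed _

theorem bumpKernel_continuous (k : ℕ) : Continuous (bumpKernel X k) :=
  ContDiffBump.continuous_normed _

theorem bumpKernel_hasCompactSupport (k : ℕ) : HasCompactSupport (bumpKernel X k) :=
  ContDiffBump.hasCompactSupport_normed _

theorem bumpKernel_nonneg (k : ℕ) (x : X) : 0 ≤ bumpKernel X k x :=
  ContDiffBump.nonneg_normed _ x

theorem bumpKernel_eq_zero {k : ℕ} {x : X} (hx : 1 / ((k : ℝ) + 1) ≤ ‖x‖) :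
    bumpKernel X k x = 0 := by
  have : x ∉ Function.support (bumpKernel X k) := by
    rw [bumpKernel, ContDiffBump.support_normed_eq]
    simpa [stdBump] using hx
  simpa using this

theorem integral_bumpKernel (k : ℕ) : ∫ x, bumpKernel X k x = 1 :=
  ContDiffBump.integral_normed _

theorem lintegral_bumpKernel (k : ℕ) : ∫⁻ x, ENNReal.ofReal (bumpKernel X k x) = 1 := by
  rw [← ofReal_integral_eq_lintegral_ofReal, integral_bumpKernel, ENNReal.ofReal_one]
  · exact (bumpKernel_continuous k).integrable_of_hasCompactSupport (bumpKernel_hasCompactSupport k)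
  · exact Eventually.of_forall (bumpKernel_nonneg k)

/-- The inner radius is half the outer one, which costs the factor 2 to the dimension. A bound by a
multiple of 1/volume is what lets the A₂ condition on a single ball yield the Schur condition. -/
theorem bumpKernel_le (k : ℕ) (x : X) :
    bumpKernel X k x ≤ 2 ^ Module.finrank ℝ X /
      (volume : Measure X).real (Metric.closedBall 0 (1 / ((k : ℝ) + 1))) := by
  refine ContDiffBump.normed_le_div_measure_closedBall_rOut (stdBump X k) volume 2 ?_ x
  simp only [stdBump]
  apply le_of_eq
  field_simp

theorem integrable_bumpKernel_smul (k : ℕ) {f : X → F} (hf : LocallyIntegrable f) (x : X) :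
    Integrable (fun y => bumpKernel X k (x - y) • f y) := by
  have h := (bumpKernel_hasCompactSupport (X := X) k).convolutionExists_left
    (ContinuousLinearMap.lsmul ℝ ℝ : ℝ →L[ℝ] F →L[ℝ] F) (bumpKernel_continuous k) hf x
  exact h.integrable_swap

theorem mollify_ae_tendsto [CompleteSpace F] {f : X → F} (hf : LocallyIntegrable f) :
    ∀ᵐ x, Tendsto (fun k => mollify k f x) atTop (𝓝 (f x)) := by
  refine ContDiffBump.ae_convolution_tendsto_right_of_locallyIntegrable (φ := stdBump X)
    (K := 2) ?_ ?_ hf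
  · exact tendsto_one_div_add_atTop_nhds_zero_nat
  · refine Eventually.of_forall fun k => ?_
    simp only [stdBump]
    apply le_of_eq
    field_simp

theorem mollify_contDiff [CompleteSpace F] (k : ℕ) {f : X → F} (hf : LocallyIntegrable f) :
    ContDiff ℝ ((⊤ : ℕ∞) : WithTop ℕ∞) (mollify k f) :=
  (bumpKernel_hasCompactSupport k).contDiff_convolution_left _ (bumpKernel_contDiff k) hf

theorem mollify_sub (k : ℕ) {f g : X → F} (hf : LocallyIntegrable f) (hg : LocallyIntegrable g)
    (x : X) : mollify k (f - g) x = mollify k f x - mollify k g x := by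
  simp only [mollify_apply, Pi.sub_apply, smul_sub]
  exact integral_sub (integrable_bumpKernel_smul k hf x) (integrable_bumpKernel_smul k hg x)

theorem mollify_congr_of_ball {k : ℕ} {f g : X → F} {x : X}
    (h : ∀ y ∈ Metric.ball x 1, f y = g y) : mollify k f x = mollify k g x := by
  simp only [mollify_apply]
  congr 1 with y
  by_cases hy : y ∈ Metric.ball x 1
  · rw [h y hy]
  · rw [bumpKernel_eq_zero, zero_smul, zero_smul]
    rw [Metric.mem_ball, not_lt, dist_comm, dist_eq_norm] at hy
    refine le_trans ?_ hy
    rw [div_le_one (by positivity)]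
    linarith [k.cast_nonneg (α := ℝ)]

theorem enorm_mollify_le (k : ℕ) (f : X → F) (x : X) :
    ‖mollify k f x‖ₑ ≤ ∫⁻ y, ENNReal.ofReal (bumpKernel X k (x - y)) * ‖f y‖ₑ := by
  rw [mollify_apply]
  refine (enorm_integral_le_lintegral_enorm _).trans (le_of_eq (lintegral_congr fun y => ?_))
  rw [enorm_smul, Real.enorm_of_nonneg (bumpKernel_nonneg k _)]

theorem eLpNorm_two_sq {α : Type*} [MeasurableSpace α] (μ : Measure α) {G : Type*}
    [NormedAddCommGroup G] (f : α → G) : eLpNorm f 2 μ ^ 2 = ∫⁻ x, ‖f x‖ₑ ^ 2 ∂μ := by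
  rw [eLpNorm_eq_lintegral_rpow_enorm_toReal (by norm_num) (by norm_num)]
  simp only [ENNReal.toReal_ofNat, ENNReal.rpow_two]
  rw [← ENNReal.rpow_two, ← ENNReal.rpow_mul]
  norm_num

/-- Mollification is bounded on `L²(w dx)` as soon as a Schur type condition holds. -/
theorem eLpNorm_mollify_le {w v : X → ℝ≥0∞} (hw : AEMeasurable w) (hv : AEMeasurable v)
    (hwv : ∀ᵐ x, w x * v x = 1) {C : ℝ≥0∞} (k : ℕ)
    (hC : ∀ y, ∫⁻ x, w x * ENNReal.ofReal (bumpKernel X k (x - y)) *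
      ∫⁻ z, ENNReal.ofReal (bumpKernel X k (x - z)) * v z ≤ C ^ 2)
    {f : X → F} (hf : AEStronglyMeasurable f) :
    eLpNorm (mollify k f) 2 (volume.withDensity w) ≤ C * eLpNorm f 2 (volume.withDensity w) := by
  have hfin : ∀ᵐ x, w x < ∞ := hwv.mono fun x hx => by
    rw [lt_top_iff_ne_top]; intro h; rw [h] at hx
    rcases eq_or_ne (v x) 0 with h0 | h0
    · simp [h0] at hx
    · simp [ENNReal.top_mul h0] at hx
  have key : eLpNorm (mollify k f) 2 (volume.withDensity w) ^ 2 ≤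
      (C * eLpNorm f 2 (volume.withDensity w)) ^ 2 := by
    rw [mul_pow, eLpNorm_two_sq, eLpNorm_two_sq, lintegral_withDensity_eq_lintegral_mul₀' hw,
      lintegral_withDensity_eq_lintegral_mul₀' hw]
    · have hs := weighted_schur (μ := (volume : Measure X))
        (p := fun x y => ENNReal.ofReal (bumpKernel X k (x - y)))
        (by
          have : Continuous fun q : X × X => bumpKernel X k (q.1 - q.2) :=
            (bumpKernel_continuous k).comp (continuous_fst.sub continuous_snd)
          exact this.measurable.ennreal_ofReal) hw hv (F := fun y => ‖f y‖ₑ) hf.enorm hwv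
        (Eventually.of_forall hC)
      simp only [Pi.mul_apply]
      calc _ ≤ ∫⁻ x, (∫⁻ y, ENNReal.ofReal (bumpKernel X k (x - y)) * ‖f y‖ₑ) ^ 2 * w x := by
            refine lintegral_mono fun x => ?_
            dsimp only
            rw [mul_comm]
            gcongr
            exact enorm_mollify_le k f x
        _ ≤ _ := hs
        _ = _ := by simp only [mul_comm]
    · exact (hf.enorm.pow_const 2).mono_ac (withDensity_absolutelyContinuous _ _)
    · have : AEStronglyMeasurable (mollify k f) (volume : Measure X) := by
        have h2 : AEStronglyMeasurable (fun q : X × X => bumpKernel X k (q.1 - q.2) • f q.2)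
            ((volume : Measure X).prod volume) :=
          (((bumpKernel_continuous k).comp (continuous_fst.sub continuous_snd)).aestronglyMeasurable).smul
            hf.comp_snd
        refine h2.integral_prod_right'.congr (Eventually.of_forall fun x => ?_)
        exact (mollify_apply k f x).symm
      exact (this.enorm.pow_const 2).mono_ac (withDensity_absolutelyContinuous _ _)
  exact (ENNReal.pow_le_pow_left_iff (by norm_num)).1 key

theorem dist_mollify_le [CompleteSpace F] {k : ℕ} {f : X → F} (hf : AEStronglyMeasurable f) {ε : ℝ}
    {x : X} (h : ∀ y, dist y x < 1 / ((k : ℝ) + 1) → dist (f y) (f x) ≤ ε) :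
    dist (mollify k f x) (f x) ≤ ε :=
  ContDiffBump.dist_normed_convolution_le (φ := stdBump X k) hf fun y hy => h y hy

/-- Uniform boundedness reduces the claim to continuous compactly supported functions, which are
approximated uniformly with supports in one compact set. The hypotheses `hbd` and `hloc` isolate
what the measure must provide, so that the result serves both Lebesgue measure in time and dω in
space. -/
theorem tendsto_eLpNorm_mollify_sub [CompleteSpace F] {μ : Measure X} [μ.Regular] {C : ℝ≥0∞}
    (hC : C ≠ ∞)
    (hbd : ∀ k, ∀ f : X → F, MemLp f 2 μ → eLpNorm (mollify k f) 2 μ ≤ C * eLpNorm f 2 μ)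
    (hloc : ∀ f : X → F, MemLp f 2 μ → LocallyIntegrable f)
    {f : X → F} (hf : MemLp f 2 μ) :
    Tendsto (fun k => eLpNorm (mollify k f - f) 2 μ) atTop (𝓝 0) := by
  rw [ENNReal.tendsto_nhds_zero]
  intro ε hε
  obtain ⟨δ, hδ0, hδ⟩ : ∃ δ : ℝ≥0∞, δ ≠ 0 ∧ C * δ + (ε / 3 + δ) ≤ ε := by
    refine ⟨min (ε / 3 / (C + 1)) (ε / 3), ?_, ?_⟩
    · have : ε / 3 ≠ 0 := (ENNReal.div_pos hε.ne' (by norm_num)).ne'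
      rw [← pos_iff_ne_zero]
      refine lt_min (ENNReal.div_pos this ?_) (pos_iff_ne_zero.2 this)
      exact ENNReal.add_ne_top.2 ⟨hC, by norm_num⟩
    · calc _ ≤ (C + 1) * (ε / 3 / (C + 1)) + (ε / 3 + ε / 3) := by
            gcongr
            · exact le_self_add
            · exact min_le_left _ _
            · exact min_le_right _ _
        _ ≤ ε / 3 + (ε / 3 + ε / 3) := by gcongr; exact ENNReal.mul_div_le
        _ = ε := by rw [← add_assoc]; exact ENNReal.add_thirds ε
  obtain ⟨g, hgc, hfg, hgcont, hgm⟩ := hf.exists_hasCompactSupport_eLpNorm_sub_le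
    (by norm_num) hδ0
  have hgloc : LocallyIntegrable g (volume : Measure X) := hgcont.locallyIntegrable
  have hfloc := hloc f hf
  -- All bumps have radius at most 1, so this set contains the supports of g and of all its
  -- mollifications.
  set K : Set X := Metric.cthickening 1 (tsupport g) with hK
  have hKc : IsCompact K := IsCompact.cthickening hgc
  have hKm : MeasurableSet K := hKc.isClosed.measurableSet
  have hvan : ∀ k, ∀ x ∉ K, mollify k g x = 0 := by
    intro k x hx
    rw [mollify_congr_of_ball (g := fun _ => (0 : F))]
    · simp [mollify_apply]
    · intro y hy
      by_contra hne
      refine hx (Metric.mem_cthickening_of_dist_le x y 1 _ (subset_tsupport g hne) ?_)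
      rw [dist_comm]; exact (Metric.mem_ball.1 hy).le
  obtain ⟨c, hc0, hc⟩ : ∃ c : ℝ, 0 < c ∧ ENNReal.ofReal c * μ K ^ (1 / (2 : ℝ≥0∞).toReal) ≤ ε / 3 := by
    have hfin : μ K ^ (1 / (2 : ℝ≥0∞).toReal) ≠ ∞ :=
      ENNReal.rpow_ne_top_of_nonneg (by norm_num) hKc.measure_lt_top.ne
    -- Since ε may be ∞, the minimum with 1 keeps the quotient below finite, and c can be a positive
    -- real number.
    have hε3 : 0 < min (ε / 3) 1 := lt_min (ENNReal.div_pos hε.ne' (by norm_num)) one_pos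
    set m := μ K ^ (1 / (2 : ℝ≥0∞).toReal)
    have hq : min (ε / 3) 1 / (m + 1) ≠ ∞ :=
      ENNReal.div_ne_top (ne_top_of_le_ne_top ENNReal.one_ne_top (min_le_right _ _)) (by simp)
    refine ⟨(min (ε / 3) 1 / (m + 1)).toReal, ENNReal.toReal_pos ?_ hq, ?_⟩
    · exact (ENNReal.div_pos hε3.ne' (ENNReal.add_ne_top.2 ⟨hfin, by norm_num⟩)).ne'
    · rw [ENNReal.ofReal_toReal hq]
      calc _ ≤ min (ε / 3) 1 / (m + 1) * (m + 1) := by gcongr; exact le_self_add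
        _ = min (ε / 3) 1 := ENNReal.div_mul_cancel (by simp) (ENNReal.add_ne_top.2 ⟨hfin, by norm_num⟩)
        _ ≤ _ := min_le_left _ _
  have hu := hgcont.uniformContinuous_of_tendsto_cocompact (x := (0 : F))
    (hgc.is_zero_at_infty)
  obtain ⟨r, hr0, hr⟩ := Metric.uniformContinuous_iff.1 hu c hc0
  obtain ⟨N, hN⟩ := exists_nat_one_div_lt hr0
  filter_upwards [eventually_ge_atTop N] with k hk
  have hsmall : eLpNorm (mollify k g - g) 2 μ ≤ ε / 3 := by
    refine (eLpNorm_sub_le_of_dist_bdd μ (by norm_num) hKm hc0.le (fun x => ?_) ?_ ?_).trans hc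
    · refine dist_mollify_le hgcont.aestronglyMeasurable fun y hy => (hr ?_).le
      refine hy.trans_le (le_trans ?_ hN.le)
      apply one_div_le_one_div_of_le (by positivity)
      have : (N : ℝ) ≤ k := by exact_mod_cast hk
      linarith
    · intro x hx
      by_contra hne
      exact hx (hvan k x hne)
    · intro x hx
      by_contra hne
      exact hne (Metric.self_subset_cthickening _ (subset_tsupport g hx))
  have hdec : mollify k f - f = mollify k (f - g) + ((mollify k g - g) + (g - f)) := by
    ext x
    simp only [Pi.add_apply, Pi.sub_apply, mollify_sub k hfloc hgloc x]
    abel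
  have hfgm : MemLp (f - g) 2 μ := hf.sub hgm
  have hmm : ∀ h : X → F, MemLp h 2 μ → AEStronglyMeasurable (mollify k h) μ := fun h hh =>
    (mollify_contDiff k (hloc h hh)).continuous.aestronglyMeasurable
  rw [hdec]
  refine (eLpNorm_add_le (hmm _ hfgm) (((hmm _ hgm).sub hgm.1).add (hgm.1.sub hf.1))
    (by norm_num)).trans ?_
  refine le_trans ?_ hδ
  refine add_le_add ((hbd k _ hfgm).trans (by gcongr)) ?_
  refine (eLpNorm_add_le ((hmm _ hgm).sub hgm.1) (hgm.1.sub hf.1) (by norm_num)).trans ?_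
  refine add_le_add hsmall ?_
  rw [eLpNorm_sub_comm]; exact hfg

end Mollify

/-! ### Locally square integrable functions of time -/

section Time

variable {F : Type*} [NormedAddCommGroup F] [NormedSpace ℝ F]

/-- Square integrability on bounded intervals. -/
def L2loc (f : ℝ → F) : Prop := ∀ a b : ℝ, MemLp f 2 (volume.restrict (Icc a b))

theorem L2loc.integrableOn {f : ℝ → F} (hf : L2loc f) (a b : ℝ) : IntegrableOn f (Icc a b) :=
  (hf a b).integrable (by norm_num)

theorem L2loc.locallyIntegrable {f : ℝ → F} (hf : L2loc f) : LocallyIntegrable f := by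
  rw [locallyIntegrable_iff]
  intro K hK
  obtain ⟨a, ha⟩ := hK.bddBelow
  obtain ⟨b, hb⟩ := hK.bddAbove
  exact (hf.integrableOn a b).mono_set fun x hx => ⟨ha hx, hb hx⟩

theorem L2loc.aestronglyMeasurable {f : ℝ → F} (hf : L2loc f) : AEStronglyMeasurable f :=
  hf.locallyIntegrable.aestronglyMeasurable

theorem _root_.MeasureTheory.MemLp.l2loc {f : ℝ → F} (hf : MemLp f 2) : L2loc f :=
  fun _ _ => hf.restrict _

theorem _root_.Continuous.l2loc {f : ℝ → F} (hf : Continuous f) : L2loc f := by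
  intro a b
  have hc : IsCompact (Icc a b) := isCompact_Icc
  obtain ⟨C, hC⟩ := hc.exists_bound_of_continuousOn hf.continuousOn
  refine MemLp.of_bound hf.aestronglyMeasurable C ?_
  exact (ae_restrict_iff' measurableSet_Icc).2 (Eventually.of_forall hC)

theorem L2loc.add {f g : ℝ → F} (hf : L2loc f) (hg : L2loc g) : L2loc (f + g) :=
  fun a b => (hf a b).add (hg a b)

theorem L2loc.sub {f g : ℝ → F} (hf : L2loc f) (hg : L2loc g) : L2loc (f - g) :=
  fun a b => (hf a b).sub (hg a b)

theorem L2loc.neg {f : ℝ → F} (hf : L2loc f) : L2loc (-f) :=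
  fun a b => (hf a b).neg

theorem mollify_time_eLpNorm_le [CompleteSpace F] (k : ℕ) {f : ℝ → F} (hf : MemLp f 2) :
    eLpNorm (mollify k f) 2 volume ≤ 1 * eLpNorm f 2 volume := by
  have h := eLpNorm_mollify_le (X := ℝ) (w := 1) (v := 1) aemeasurable_const aemeasurable_const
    (by simp) (C := 1) k ?_ hf.1
  · simpa using h
  · intro y
    have h1 : ∀ x : ℝ, ∫⁻ z, ENNReal.ofReal (bumpKernel ℝ k (x - z)) = 1 := fun x => by
      rw [lintegral_sub_left_eq_self (fun z => ENNReal.ofReal (bumpKernel ℝ k z)) x,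
        lintegral_bumpKernel]
    have h2 : ∫⁻ x, ENNReal.ofReal (bumpKernel ℝ k (x - y)) = 1 := by
      rw [lintegral_sub_right_eq_self (fun z => ENNReal.ofReal (bumpKernel ℝ k z)) y,
        lintegral_bumpKernel]
    simp [h1, h2]

/-- The bumps have radius at most 1, so truncating f to [a-1, b+1] does not change its
mollifications on [a, b]; the global result applies to the truncation. -/
theorem L2loc.tendsto_mollify [CompleteSpace F] {f : ℝ → F} (hf : L2loc f) (a b : ℝ) :
    Tendsto (fun k => eLpNorm (mollify k f - f) 2 (volume.restrict (Icc a b))) atTop (𝓝 0) := by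
  set g : ℝ → F := (Icc (a - 1) (b + 1)).indicator f with hg
  have hgm : MemLp g 2 := (memLp_indicator_iff_restrict measurableSet_Icc).2 (hf _ _)
  have h := tendsto_eLpNorm_mollify_sub (μ := (volume : Measure ℝ)) (C := 1) (by norm_num)
    (fun k f hf => mollify_time_eLpNorm_le k hf)
    (fun f hf => hf.locallyIntegrable (by norm_num)) hgm
  refine tendsto_of_tendsto_of_tendsto_of_le_of_le tendsto_const_nhds h (fun _ => bot_le)
    fun k => ?_
  refine le_trans (le_of_eq (eLpNorm_congr_ae ?_)) (eLpNorm_mono_measure _ Measure.restrict_le_self)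
  refine (ae_restrict_iff' measurableSet_Icc).2 (Eventually.of_forall fun t ht => ?_)
  have hin : ∀ s ∈ Metric.ball t 1, f s = g s := by
    intro s hs
    rw [Metric.mem_ball, Real.dist_eq, abs_lt] at hs
    rw [hg, indicator_of_mem]
    exact ⟨by linarith [ht.1, hs.1], by linarith [ht.2, hs.2]⟩
  simp only [Pi.sub_apply]
  rw [mollify_congr_of_ball hin, hin t (Metric.mem_ball_self one_pos)]

end Time


/-! ### The `L²` pairing -/

section Pairing

variable {α : Type*} [MeasurableSpace α] {μ : Measure α}
variable {F : Type*} [NormedAddCommGroup F] [InnerProductSpace ℂ F]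

theorem integrable_inner {f g : α → F} (hf : MemLp f 2 μ) (hg : MemLp g 2 μ) :
    Integrable (fun x => inner ℂ (f x) (g x)) μ := by
  refine ((L2.integrable_inner (𝕜 := ℂ) hf.toLp hg.toLp)).congr ?_
  filter_upwards [hf.coeFn_toLp, hg.coeFn_toLp] with x h1 h2
  rw [h1, h2]

theorem integral_inner_eq {f g : α → F} (hf : MemLp f 2 μ) (hg : MemLp g 2 μ) :
    ∫ x, inner ℂ (f x) (g x) ∂μ = inner ℂ hf.toLp hg.toLp := by
  rw [L2.inner_def]
  refine integral_congr_ae ?_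
  filter_upwards [hf.coeFn_toLp, hg.coeFn_toLp] with x h1 h2
  rw [h1, h2]

theorem tendsto_integral_inner {ι : Type*} {l : Filter ι} {f g : ι → α → F} {f₀ g₀ : α → F}
    (hf : ∀ i, MemLp (f i) 2 μ) (hg : ∀ i, MemLp (g i) 2 μ) (hf₀ : MemLp f₀ 2 μ)
    (hg₀ : MemLp g₀ 2 μ) (h1 : Tendsto (fun i => eLpNorm (f i - f₀) 2 μ) l (𝓝 0))
    (h2 : Tendsto (fun i => eLpNorm (g i - g₀) 2 μ) l (𝓝 0)) :
    Tendsto (fun i => ∫ x, inner ℂ (f i x) (g i x) ∂μ) l (𝓝 (∫ x, inner ℂ (f₀ x) (g₀ x) ∂μ)) := by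
  simp only [integral_inner_eq (hf _) (hg _), integral_inner_eq hf₀ hg₀]
  exact ((Lp.tendsto_Lp_iff_tendsto_eLpNorm'' f hf f₀ hf₀).2 h1).inner
    ((Lp.tendsto_Lp_iff_tendsto_eLpNorm'' g hg g₀ hg₀).2 h2)

theorem integral_norm_mul_norm_le {E₁ E₂ : Type*} [NormedAddCommGroup E₁] [NormedAddCommGroup E₂]
    {f : α → E₁} {g : α → E₂} (hf : MemLp f 2 μ) (hg : MemLp g 2 μ) :
    Integrable (fun x => ‖f x‖ * ‖g x‖) μ ∧
    ∫ x, ‖f x‖ * ‖g x‖ ∂μ ≤ (eLpNorm f 2 μ).toReal * (eLpNorm g 2 μ).toReal := by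
  have e : (fun x => inner ℝ (hf.norm.toLp (fun x => ‖f x‖) x) (hg.norm.toLp (fun x => ‖g x‖) x))
      =ᵐ[μ] fun x => ‖f x‖ * ‖g x‖ := by
    filter_upwards [hf.norm.coeFn_toLp, hg.norm.coeFn_toLp] with x h1 h2
    rw [h1, h2]; simp [mul_comm]
  refine ⟨(L2.integrable_inner (𝕜 := ℝ) hf.norm.toLp hg.norm.toLp).congr e, ?_⟩
  rw [← integral_congr_ae e, ← L2.inner_def]
  refine (real_inner_le_norm _ _).trans (le_of_eq ?_)
  rw [Lp.norm_toLp, Lp.norm_toLp, eLpNorm_norm, eLpNorm_norm]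

end Pairing

/-! ### Abstract evolution data -/

section Abstract

variable {H K : Type*} [NormedAddCommGroup H] [InnerProductSpace ℂ H] [CompleteSpace H]
  [NormedAddCommGroup K] [InnerProductSpace ℂ K] [CompleteSpace K]

/-- `u` is a locally integrable function with values in the domain of the operator `D` whose
graph is `𝒢`, with `D u = G`, and `u' = D⋆ g + h` in the weak sense. -/
structure IsData (𝒢 : Submodule ℂ (WithLp 2 (H × K))) (u : ℝ → H) (G g : ℝ → K) (h : ℝ → H) :
    Prop where
  locInt : LocallyIntegrable u
  gradL2 : L2loc G
  fluxL2 : L2loc g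
  srcL2 : L2loc h
  mem : ∀ᵐ t : ℝ, WithLp.toLp 2 (u t, G t) ∈ 𝒢
  weak : ∀ χ : ℝ → ℂ, IsTest χ → ∀ p ∈ 𝒢,
    - ∫ t, deriv χ t * inner ℂ p.fst (u t) =
      ∫ t, χ t * (inner ℂ p.snd (g t) + inner ℂ p.fst (h t))

/-- The everywhere differentiable version of `IsData`. -/
structure IsSmoothData (𝒢 : Submodule ℂ (WithLp 2 (H × K))) (u : ℝ → H) (G g : ℝ → K)
    (h : ℝ → H) : Prop where
  contG : Continuous G
  contg : Continuous g
  conth : Continuous h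
  mem : ∀ t : ℝ, WithLp.toLp 2 (u t, G t) ∈ 𝒢
  deriv : ∀ t : ℝ, ∃ d : H, HasDerivAt u d t ∧ ∀ p ∈ 𝒢,
    inner ℂ p.fst d = inner ℂ p.snd (g t) + inner ℂ p.fst (h t)

variable {𝒢 : Submodule ℂ (WithLp 2 (H × K))}

theorem IsSmoothData.cont {u G g h} (hu : IsSmoothData 𝒢 u G g h) : Continuous u :=
  continuous_iff_continuousAt.2 fun t => (hu.deriv t).choose_spec.1.continuousAt

theorem IsSmoothData.sub {u₁ G₁ g₁ h₁ u₂ G₂ g₂ h₂} (h1 : IsSmoothData 𝒢 u₁ G₁ g₁ h₁)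
    (h2 : IsSmoothData 𝒢 u₂ G₂ g₂ h₂) :
    IsSmoothData 𝒢 (u₁ - u₂) (G₁ - G₂) (g₁ - g₂) (h₁ - h₂) where
  contG := h1.contG.sub h2.contG
  contg := h1.contg.sub h2.contg
  conth := h1.conth.sub h2.conth
  mem t := 𝒢.sub_mem (h1.mem t) (h2.mem t)
  deriv t := by
    obtain ⟨d1, hd1, e1⟩ := h1.deriv t
    obtain ⟨d2, hd2, e2⟩ := h2.deriv t
    refine ⟨d1 - d2, hd1.sub hd2, fun p hp => ?_⟩
    simp only [Pi.sub_apply, inner_sub_right, e1 p hp, e2 p hp]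
    ring

/-- Each derivative is tested with the other path, which lies in the domain of D at every time. This
turns D⋆g, known only by duality, into the pairing of g with a gradient. -/
theorem IsSmoothData.product {u₁ G₁ g₁ h₁ u₂ G₂ g₂ h₂} (h1 : IsSmoothData 𝒢 u₁ G₁ g₁ h₁)
    (h2 : IsSmoothData 𝒢 u₂ G₂ g₂ h₂) (a b : ℝ) :
    inner ℂ (u₁ b) (u₂ b) - inner ℂ (u₁ a) (u₂ a) =
      ∫ t in a..b, (inner ℂ (g₁ t) (G₂ t) + inner ℂ (h₁ t) (u₂ t) + inner ℂ (G₁ t) (g₂ t) +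
        inner ℂ (u₁ t) (h₂ t)) := by
  symm
  apply intervalIntegral.integral_eq_sub_of_hasDerivAt (f := fun t => inner ℂ (u₁ t) (u₂ t))
  · intro t _
    obtain ⟨d1, hd1, e1⟩ := h1.deriv t
    obtain ⟨d2, hd2, e2⟩ := h2.deriv t
    have e1' := e1 _ (h2.mem t)
    have e2' := e2 _ (h1.mem t)
    simp only [WithLp.toLp_fst, WithLp.toLp_snd] at e1' e2'
    have hd := hd1.inner ℂ hd2
    rw [e2', ← inner_conj_symm d1 (u₂ t), e1', map_add, inner_conj_symm, inner_conj_symm] at hd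
    refine hd.congr_deriv ?_
    ring
  · apply Continuous.intervalIntegrable
    exact (((h1.contg.inner h2.contG).add (h1.conth.inner h2.cont)).add
      (h1.contG.inner h2.contg)).add (h1.cont.inner h2.conth)

/-- The `L²` norm over `[a, b]`. -/
def nrm {F : Type*} [NormedAddCommGroup F] (a b : ℝ) (f : ℝ → F) : ℝ :=
  (eLpNorm f 2 (volume.restrict (Icc a b))).toReal

theorem le_add_sqrt_of_sq_le {x α β : ℝ} (hα : 0 ≤ α) (hβ : 0 ≤ β) (h : x ^ 2 ≤ α + β * x) :
    x ≤ β + √α := by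
  by_contra! hlt
  have h1 := Real.sqrt_nonneg α
  have h2 := Real.sq_sqrt hα
  nlinarith

/-- The energy identity is used between s and the time m at which the norm is maximal. The maximum
enters the source term linearly, so a quadratic inequality bounds it. The bound sees u at one time
only and otherwise L² norms of G, g and h; no L² norm of u is needed, as u is merely locally
integrable in `IsData`. -/
theorem IsSmoothData.bound {u G g h} (hu : IsSmoothData 𝒢 u G g h) {a b s : ℝ}
    (hs : s ∈ Icc a b) {t : ℝ} (ht : t ∈ Icc a b) :
    ‖u t‖ ≤ 2 * (nrm a b h * nrm a b (fun _ => (1 : ℝ))) +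
      √(‖u s‖ ^ 2 + 2 * (nrm a b g * nrm a b G)) := by
  have hab : a ≤ b := hs.1.trans hs.2
  obtain ⟨m, hm, hmax⟩ := isCompact_Icc.exists_isMaxOn (nonempty_Icc.2 hab) hu.cont.norm.continuousOn
  refine le_trans (hmax ht) ?_
  have hgG := integral_norm_mul_norm_le (hu.contg.l2loc a b) (hu.contG.l2loc a b)
  have hh1 := integral_norm_mul_norm_le (hu.conth.l2loc a b)
    ((continuous_const (y := (1 : ℝ))).l2loc a b)
  simp only [norm_one, mul_one] at hh1
  apply le_add_sqrt_of_sq_le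
  · have : (0 : ℝ) ≤ nrm a b g * nrm a b G := mul_nonneg ENNReal.toReal_nonneg ENNReal.toReal_nonneg
    positivity
  · have : (0 : ℝ) ≤ nrm a b h * nrm a b (fun _ => (1 : ℝ)) :=
      mul_nonneg ENNReal.toReal_nonneg ENNReal.toReal_nonneg
    positivity
  have hp := hu.product hu s m
  have hb : ‖∫ t in s..m, (inner ℂ (g t) (G t) + inner ℂ (h t) (u t) + inner ℂ (G t) (g t) +
        inner ℂ (u t) (h t))‖ ≤ ∫ t in Icc a b, (2 * (‖g t‖ * ‖G t‖) + 2 * ‖u m‖ * ‖h t‖) := by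
    refine (intervalIntegral.norm_integral_le_integral_norm_uIoc).trans ?_
    have hsub : uIoc s m ⊆ Icc a b :=
      (uIoc_subset_uIcc).trans (uIcc_subset_Icc hs hm)
    refine le_trans (setIntegral_mono_set (t := Icc a b) ?_ ?_ hsub.eventuallyLE) ?_
    · apply Continuous.integrableOn_Icc
      exact ((((hu.contg.inner hu.contG).add (hu.conth.inner hu.cont)).add
        (hu.contG.inner hu.contg)).add (hu.cont.inner hu.conth)).norm
    · exact Eventually.of_forall fun _ => norm_nonneg _
    refine setIntegral_mono_on ?_ ?_ measurableSet_Icc fun t ht => ?_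
    · apply Continuous.integrableOn_Icc
      exact ((((hu.contg.inner hu.contG).add (hu.conth.inner hu.cont)).add
        (hu.contG.inner hu.contg)).add (hu.cont.inner hu.conth)).norm
    · exact (hgG.1.const_mul 2).add (hh1.1.const_mul _)
    · have i1 := norm_inner_le_norm (𝕜 := ℂ) (g t) (G t)
      have i2 := norm_inner_le_norm (𝕜 := ℂ) (h t) (u t)
      have i3 := norm_inner_le_norm (𝕜 := ℂ) (G t) (g t)
      have i4 := norm_inner_le_norm (𝕜 := ℂ) (u t) (h t)
      have i5 : ‖u t‖ ≤ ‖u m‖ := hmax ht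
      have i6 : ‖u t‖ * ‖h t‖ ≤ ‖u m‖ * ‖h t‖ := by gcongr
      have := norm_add₄_le (a := inner ℂ (g t) (G t)) (b := inner ℂ (h t) (u t))
        (c := inner ℂ (G t) (g t)) (d := inner ℂ (u t) (h t))
      nlinarith
  rw [integral_add (hgG.1.const_mul 2) (hh1.1.const_mul _), integral_const_mul,
    integral_const_mul] at hb
  rw [← hp] at hb
  have hre : ‖u m‖ ^ 2 - ‖u s‖ ^ 2 ≤ ‖inner ℂ (u m) (u m) - inner ℂ (u s) (u s)‖ := by
    refine le_trans (le_of_eq ?_) (Complex.re_le_norm _)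
    rw [inner_self_eq_norm_sq_to_K, inner_self_eq_norm_sq_to_K]
    norm_cast
  have k1 : ∫ t in Icc a b, ‖g t‖ * ‖G t‖ ≤ nrm a b g * nrm a b G := hgG.2
  have k2 : ∫ t in Icc a b, ‖h t‖ ≤ nrm a b h * nrm a b (fun _ => (1 : ℝ)) := hh1.2
  have k3 : ‖u m‖ * ∫ t in Icc a b, ‖h t‖ ≤ ‖u m‖ * (nrm a b h * nrm a b (fun _ => (1 : ℝ))) := by
    gcongr
  nlinarith

theorem inner_mollify {F : Type*} [NormedAddCommGroup F] [InnerProductSpace ℂ F] [CompleteSpace F]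
    (k : ℕ) {f : ℝ → F} (hf : LocallyIntegrable f) (c : F) (t : ℝ) :
    inner ℂ c (mollify k f t) = ∫ s, (bumpKernel ℝ k (t - s) : ℂ) * inner ℂ c (f s) := by
  rw [mollify_apply, ← integral_inner (integrable_bumpKernel_smul k hf t)]
  congr 1 with s
  rw [inner_smul_right_eq_smul, Complex.real_smul]

theorem isTest_bumpKernel (k : ℕ) (t : ℝ) : IsTest (fun s : ℝ => (bumpKernel ℝ k (t - s) : ℂ)) := by
  constructor
  · exact Complex.ofRealCLM.contDiff.comp
      ((bumpKernel_contDiff k).comp (contDiff_const.sub contDiff_id))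
  · have h1 : HasCompactSupport (fun s : ℝ => bumpKernel ℝ k (t - s)) :=
      (bumpKernel_hasCompactSupport (X := ℝ) k).comp_homeomorph (Homeomorph.subLeft t)
    exact h1.comp_left (g := fun x : ℝ => (x : ℂ)) Complex.ofReal_zero

/-- A closed subspace is its own double orthogonal. Membership thus becomes a family of scalar
identities, which pass through convolution integrals. -/
theorem mem_of_orthogonal (hG : IsClosed (𝒢 : Set (WithLp 2 (H × K)))) {p : WithLp 2 (H × K)}
    (hp : ∀ q ∈ 𝒢ᗮ, inner ℂ q.fst p.fst + inner ℂ q.snd p.snd = 0) : p ∈ 𝒢 := by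
  have : CompleteSpace 𝒢 := hG.completeSpace_coe
  rw [← Submodule.orthogonal_orthogonal 𝒢, Submodule.mem_orthogonal]
  intro q hq
  rw [WithLp.prod_inner_apply]
  exact hp q hq

/-- For fixed t the bump s ↦ ρ(t - s) is an admissible test function with s-derivative -ρ'(t - s),
so the weak equation tested with it is the strong equation for the mollified data at t. -/
theorem IsData.mollify (hG : IsClosed (𝒢 : Set (WithLp 2 (H × K)))) {u G g h}
    (hu : IsData 𝒢 u G g h) (k : ℕ) :
    IsSmoothData 𝒢 (mollify k u) (mollify k G) (mollify k g) (mollify k h) where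
  contG := (mollify_contDiff k hu.gradL2.locallyIntegrable).continuous
  contg := (mollify_contDiff k hu.fluxL2.locallyIntegrable).continuous
  conth := (mollify_contDiff k hu.srcL2.locallyIntegrable).continuous
  mem t := by
    refine mem_of_orthogonal hG fun q hq => ?_
    have i1 : Integrable fun s => (bumpKernel ℝ k (t - s) : ℂ) * inner ℂ q.fst (u s) :=
      ((integrable_bumpKernel_smul k hu.locInt t).const_inner q.fst).congr
        (Eventually.of_forall fun s => by simp [inner_smul_right_eq_smul])
    have i2 : Integrable fun s => (bumpKernel ℝ k (t - s) : ℂ) * inner ℂ q.snd (G s) :=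
      ((integrable_bumpKernel_smul k hu.gradL2.locallyIntegrable t).const_inner q.snd).congr
        (Eventually.of_forall fun s => by simp [inner_smul_right_eq_smul])
    simp only [WithLp.toLp_fst, WithLp.toLp_snd]
    rw [inner_mollify k hu.locInt, inner_mollify k hu.gradL2.locallyIntegrable, ← integral_add i1 i2]
    refine integral_eq_zero_of_ae (hu.mem.mono fun s hs => ?_)
    have := (Submodule.mem_orthogonal' _ _).1 hq _ hs
    rw [WithLp.prod_inner_apply] at this
    simp only [Pi.zero_apply]
    rw [← mul_add]
    simp only [WithLp.ofLp_fst, WithLp.ofLp_snd] at this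
    erw [this, mul_zero]
  deriv t := by
    refine ⟨_, (bumpKernel_hasCompactSupport (X := ℝ) k).hasDerivAt_convolution_left
      (ContinuousLinearMap.lsmul ℝ ℝ) ((bumpKernel_contDiff k).of_le (by exact_mod_cast le_top)) hu.locInt t, fun p hp => ?_⟩
    have hw := hu.weak _ (isTest_bumpKernel k t) p hp
    have hd : ∀ s, _root_.deriv (fun s : ℝ => (bumpKernel ℝ k (t - s) : ℂ)) s =
        -((_root_.deriv (bumpKernel ℝ k) (t - s) : ℝ) : ℂ) := by
      intro s
      have h1 : HasDerivAt (bumpKernel ℝ k) (_root_.deriv (bumpKernel ℝ k) (t - s)) (t - s) :=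
        ((bumpKernel_contDiff k).differentiable (by simp) _).hasDerivAt
      have h2 := (h1.comp_const_sub t s).ofReal_comp
      rw [h2.deriv]; push_cast; rfl
    simp only [hd] at hw
    have i1 : Integrable fun s => (bumpKernel ℝ k (t - s) : ℂ) * inner ℂ p.fst (h s) :=
      ((integrable_bumpKernel_smul k hu.srcL2.locallyIntegrable t).const_inner p.fst).congr
        (Eventually.of_forall fun s => by simp [inner_smul_right_eq_smul])
    have i2 : Integrable fun s => (bumpKernel ℝ k (t - s) : ℂ) * inner ℂ p.snd (g s) :=
      ((integrable_bumpKernel_smul k hu.fluxL2.locallyIntegrable t).const_inner p.snd).congr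
        (Eventually.of_forall fun s => by simp [inner_smul_right_eq_smul])
    simp only [mul_add] at hw
    rw [inner_mollify k hu.srcL2.locallyIntegrable, inner_mollify k hu.fluxL2.locallyIntegrable,
      ← integral_add i2 i1, ← hw, convolution_lsmul_swap, ← integral_inner]
    · rw [← integral_neg]
      congr 1 with s
      rw [inner_smul_right_eq_smul, Complex.real_smul]; ring
    · have := ((bumpKernel_hasCompactSupport (X := ℝ) k).deriv).convolutionExists_left
        (ContinuousLinearMap.lsmul ℝ ℝ : ℝ →L[ℝ] H →L[ℝ] H)
        ((bumpKernel_contDiff k).continuous_deriv (by simp)) hu.locInt t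
      exact this.integrable_swap

theorem tendsto_nrm_mollify {F : Type*} [NormedAddCommGroup F] [NormedSpace ℝ F] [CompleteSpace F]
    {f : ℝ → F} (hf : L2loc f) (a b : ℝ) :
    Tendsto (fun q : ℕ × ℕ => nrm a b (mollify q.1 f - mollify q.2 f)) atTop (𝓝 0) := by
  have h1 := (ENNReal.tendsto_toReal ENNReal.zero_ne_top).comp (hf.tendsto_mollify a b)
  rw [ENNReal.toReal_zero] at h1
  have h2 := (h1.comp (tendsto_fst (f := atTop) (g := (atTop : Filter ℕ)))).add
    (h1.comp (tendsto_snd (f := (atTop : Filter ℕ)) (g := atTop)))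
  rw [add_zero, prod_atTop_atTop_eq] at h2
  refine squeeze_zero (fun _ => ENNReal.toReal_nonneg) (fun q => ?_) h2
  have hm : ∀ k, MemLp (mollify k f - f) 2 (volume.restrict (Icc a b)) := fun k =>
    ((mollify_contDiff k hf.locallyIntegrable).continuous.l2loc a b).sub (hf a b)
  have e : mollify q.1 f - mollify q.2 f = (mollify q.1 f - f) - (mollify q.2 f - f) := by abel
  simp only [Function.comp_apply, nrm]
  rw [e, ← ENNReal.toReal_add (hm _).eLpNorm_ne_top (hm _).eLpNorm_ne_top]
  exact ENNReal.toReal_mono (ENNReal.add_ne_top.2 ⟨(hm _).eLpNorm_ne_top, (hm _).eLpNorm_ne_top⟩)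
    (eLpNorm_sub_le (hm _).1 (hm _).1 (by norm_num))

/-- Evolution data have a continuous representative. -/
theorem IsData.exists_continuous (hG : IsClosed (𝒢 : Set (WithLp 2 (H × K)))) {u G g h}
    (hu : IsData 𝒢 u G g h) : ∃ v : ℝ → H, Continuous v ∧ u =ᵐ[volume] v := by
  have hae := mollify_ae_tendsto hu.locInt
  -- One time at which the mollifications converge suffices: `IsSmoothData.bound`, applied to
  -- differences of mollifications, propagates the Cauchy property from s uniformly to any interval
  -- centred at s.
  obtain ⟨s, hs⟩ := hae.exists
  have hC : ∀ R : ℝ, UniformCauchySeqOn (fun k => DegParabolic.mollify k u) atTop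
      (Icc (s - R) (s + R)) := by
    intro R
    rcases lt_or_ge R 0 with hR | hR
    · rw [Icc_eq_empty (by linarith)]
      intro U _
      simp
    set a := s - R
    set b := s + R
    have hsm : s ∈ Icc a b := ⟨by simp [a, hR], by simp [b, hR]⟩
    have hsC : Tendsto (fun q : ℕ × ℕ => ‖DegParabolic.mollify q.1 u s - DegParabolic.mollify q.2 u s‖) atTop (𝓝 0) := by
      have h1 := ((hs.comp (tendsto_fst (f := atTop) (g := (atTop : Filter ℕ)))).sub
        (hs.comp (tendsto_snd (f := (atTop : Filter ℕ)) (g := atTop)))).norm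
      rw [sub_self, norm_zero, prod_atTop_atTop_eq] at h1
      exact h1
    have hlim : Tendsto (fun q : ℕ × ℕ =>
        2 * (nrm a b (DegParabolic.mollify q.1 h - DegParabolic.mollify q.2 h) * nrm a b (fun _ => (1 : ℝ))) +
        √(‖DegParabolic.mollify q.1 u s - DegParabolic.mollify q.2 u s‖ ^ 2 +
          2 * (nrm a b (DegParabolic.mollify q.1 g - DegParabolic.mollify q.2 g) *
            nrm a b (DegParabolic.mollify q.1 G - DegParabolic.mollify q.2 G)))) atTop (𝓝 0) := by
      have t1 := ((tendsto_nrm_mollify hu.srcL2 a b).mul_const (nrm a b (fun _ => (1 : ℝ)))).const_mul 2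
      have t2 := ((tendsto_nrm_mollify hu.fluxL2 a b).mul (tendsto_nrm_mollify hu.gradL2 a b)).const_mul 2
      have t3 := t1.add ((hsC.pow 2).add t2).sqrt
      simpa using t3
    rw [Metric.uniformCauchySeqOn_iff]
    intro ε hε
    obtain ⟨N, hN⟩ := (hlim.eventually (gt_mem_nhds hε)).exists_forall_of_atTop
    refine ⟨max N.1 N.2, fun m hm n hn t ht => ?_⟩
    rw [dist_eq_norm]
    refine lt_of_le_of_lt ?_ (hN (m, n) ⟨(le_max_left _ _).trans hm, (le_max_right _ _).trans hn⟩)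
    exact ((hu.mollify hG m).sub (hu.mollify hG n)).bound hsm ht
  have hlim : ∀ t, ∃ l, Tendsto (fun k => DegParabolic.mollify k u t) atTop (𝓝 l) := by
    intro t
    have := (hC |t - s|).cauchy_map (x := t)
      ⟨by linarith [neg_abs_le (t - s)], by linarith [le_abs_self (t - s)]⟩
    exact cauchy_map_iff_exists_tendsto.1 this
  choose v hv using hlim
  refine ⟨v, ?_, hae.mono fun t ht => tendsto_nhds_unique ht (hv t)⟩
  rw [continuous_iff_continuousAt]
  intro t
  have hR : t ∈ Ioo (s - (|t - s| + 1)) (s + (|t - s| + 1)) :=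
    ⟨by linarith [neg_abs_le (t - s)], by linarith [le_abs_self (t - s)]⟩
  have hun := (hC (|t - s| + 1)).tendstoUniformlyOn_of_tendsto fun x _ => hv x
  refine (hun.continuousOn (Frequently.of_forall fun k =>
    (hu.mollify hG k).cont.continuousOn)).continuousAt ?_
  exact mem_of_superset (Ioo_mem_nhds hR.1 hR.2) Ioo_subset_Icc_self

theorem tendsto_integral_inner_mollify {F : Type*} [NormedAddCommGroup F] [InnerProductSpace ℂ F]
    [CompleteSpace F] (a b : ℝ) {f e : ℝ → F} (hf : L2loc f) (he : L2loc e) :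
    Tendsto (fun k => ∫ t in Icc a b, inner ℂ (mollify k f t) (mollify k e t)) atTop
      (𝓝 (∫ t in Icc a b, inner ℂ (f t) (e t))) :=
  tendsto_integral_inner
    (fun k => (mollify_contDiff k hf.locallyIntegrable).continuous.l2loc a b)
    (fun k => (mollify_contDiff k he.locallyIntegrable).continuous.l2loc a b) (hf a b) (he a b)
    (hf.tendsto_mollify a b) (he.tendsto_mollify a b)

/-- The product rule for evolution data. -/
theorem IsData.product (hG : IsClosed (𝒢 : Set (WithLp 2 (H × K)))) {u₁ G₁ g₁ h₁ u₂ G₂ g₂ h₂}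
    (h1 : IsData 𝒢 u₁ G₁ g₁ h₁) (h2 : IsData 𝒢 u₂ G₂ g₂ h₂) (c1 : Continuous u₁)
    (c2 : Continuous u₂) {a b : ℝ} (hab : a ≤ b) :
    inner ℂ (u₁ b) (u₂ b) - inner ℂ (u₁ a) (u₂ a) =
      (∫ t in Icc a b, inner ℂ (g₁ t) (G₂ t)) + (∫ t in Icc a b, inner ℂ (h₁ t) (u₂ t)) +
      (∫ t in Icc a b, inner ℂ (G₁ t) (g₂ t)) + ∫ t in Icc a b, inner ℂ (u₁ t) (h₂ t) := by
  have hpt : ∀ {u : ℝ → H}, Continuous u → ∀ t,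
      Tendsto (fun k => DegParabolic.mollify k u t) atTop (𝓝 (u t)) := fun {u} hc t =>
    ContDiffBump.convolution_tendsto_right_of_continuous (φ := stdBump ℝ)
      tendsto_one_div_add_atTop_nhds_zero_nat hc t
  have hL := (((hpt c1 b).inner (𝕜 := ℂ) (hpt c2 b)).sub ((hpt c1 a).inner (𝕜 := ℂ) (hpt c2 a)))
  have hR := (((tendsto_integral_inner_mollify a b h1.fluxL2 h2.gradL2).add (tendsto_integral_inner_mollify a b h1.srcL2 c2.l2loc)).add
    (tendsto_integral_inner_mollify a b h1.gradL2 h2.fluxL2)).add (tendsto_integral_inner_mollify a b c1.l2loc h2.srcL2)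
  refine tendsto_nhds_unique hL (hR.congr fun k => ?_)
  have m1 := h1.mollify hG k
  have m2 := h2.mollify hG k
  rw [m1.product m2, intervalIntegral.integral_of_le hab, ← integral_Icc_eq_integral_Ioc]
  rw [← integral_add, ← integral_add, ← integral_add]
  all_goals apply Continuous.integrableOn_Icc
  · exact ((m1.contg.inner m2.contG).add (m1.conth.inner m2.cont)).add (m1.contG.inner m2.contg)
  · exact m1.cont.inner m2.conth
  · exact (m1.contg.inner m2.contG).add (m1.conth.inner m2.cont)
  · exact m1.contG.inner m2.contg
  · exact m1.contg.inner m2.contG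
  · exact m1.conth.inner m2.cont

end Abstract


/-! ### Elliptic families and the Lions representation theorem -/

section Elliptic

variable {H K : Type*} [NormedAddCommGroup H] [InnerProductSpace ℂ H] [CompleteSpace H]
  [NormedAddCommGroup K] [InnerProductSpace ℂ K] [CompleteSpace K]

/-- A weakly measurable map into a separable Hilbert space is strongly measurable. -/
theorem aestronglyMeasurable_of_inner [SecondCountableTopology K] {α : Type*} [MeasurableSpace α]
    {μ : Measure α} {f : α → K} (h : ∀ x, AEStronglyMeasurable (fun t => inner ℂ x (f t)) μ) :
    AEStronglyMeasurable f μ := by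
  obtain ⟨w, b, hb⟩ := exists_hilbertBasis ℂ K
  -- Distinct orthonormal vectors are at distance √2, hence at least 1. A Hilbert basis is therefore
  -- discrete, and countable in a second countable space.
  have hd : DiscreteTopology w := by
    refine DiscreteTopology.of_forall_le_dist (r := 1) one_pos fun x y hxy => ?_
    have ho := b.orthonormal
    rw [hb] at ho
    have h0 : inner ℂ (x : K) (y : K) = 0 := ho.2 hxy
    have hx : ‖(x : K)‖ = 1 := ho.1 x
    have hy : ‖(y : K)‖ = 1 := ho.1 y
    have := @norm_sub_sq ℂ K _ _ _ (x : K) (y : K)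
    rw [h0, hx, hy] at this
    change (1 : ℝ) ≤ dist x y
    rw [Subtype.dist_eq, dist_eq_norm]
    norm_num at this
    nlinarith [norm_nonneg ((x : K) - y)]
  have hc : Countable w := countable_of_Lindelof_of_discrete
  refine aestronglyMeasurable_of_tendsto_ae (u := (atTop : Filter (Finset w)))
    (f := fun s t => ∑ i ∈ s, b.repr (f t) i • b i) (fun s => ?_) (Eventually.of_forall fun t => b.hasSum_repr (f t))
  have : ∀ i ∈ s, AEStronglyMeasurable (fun t => b.repr (f t) i • b i) μ := fun i _ => by
    simp only [b.repr_apply_apply]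
    exact (h (b i)).smul_const _
  exact Finset.aestronglyMeasurable_fun_sum s this

/-- A bounded, coercive, weakly measurable family of operators. -/
structure IsEllipticFamily (B : ℝ → K →L[ℂ] K) (M ν : ℝ) : Prop where
  meas : ∀ x y, AEStronglyMeasurable (fun t => inner ℂ x (B t y))
  upper : ∀ t g, ‖B t g‖ ≤ M * ‖g‖
  lower : ∀ t g, ν * ‖g‖ ^ 2 ≤ (inner ℂ g (B t g)).re

/-- The family governing the time reversed adjoint problem. -/
def revFamily (B : ℝ → K →L[ℂ] K) : ℝ → K →L[ℂ] K := fun t => ContinuousLinearMap.adjoint (B (-t))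

variable {B : ℝ → K →L[ℂ] K} {M ν : ℝ}

theorem IsEllipticFamily.adjoint_upper (hB : IsEllipticFamily B M ν) (hM : 0 ≤ M) (t : ℝ) (g : K) :
    ‖ContinuousLinearMap.adjoint (B t) g‖ ≤ M * ‖g‖ := by
  have h1 : ‖B t‖ ≤ M := ContinuousLinearMap.opNorm_le_bound _ hM (hB.upper t)
  have h2 : ‖ContinuousLinearMap.adjoint (B t)‖ ≤ M := by
    rwa [LinearIsometryEquiv.norm_map]
  exact ContinuousLinearMap.le_of_opNorm_le _ h2 g

/-- The family B is only weakly measurable, so for a moving vector g it is transferred to the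
adjoint: ⟨x, B g⟩ = ⟨B⋆x, g⟩ is the pairing of two strongly measurable functions. -/
theorem IsEllipticFamily.aesm_apply [SecondCountableTopology K] (hB : IsEllipticFamily B M ν)
    {α : Type*} [MeasurableSpace α] {μ : Measure α} {τ : α → ℝ}
    (hτ : Measure.QuasiMeasurePreserving τ μ volume) {g : α → K} (hg : AEStronglyMeasurable g μ) :
    AEStronglyMeasurable (fun t => B (τ t) (g t)) μ ∧
      AEStronglyMeasurable (fun t => ContinuousLinearMap.adjoint (B (τ t)) (g t)) μ := by
  have hm := fun x y => (hB.meas x y).comp_quasiMeasurePreserving hτ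
  have h1 : ∀ x, AEStronglyMeasurable (fun t => ContinuousLinearMap.adjoint (B (τ t)) x) μ := by
    intro x
    refine aestronglyMeasurable_of_inner fun y => ?_
    refine (Complex.continuous_conj.comp_aestronglyMeasurable (hm x y)).congr
      (Eventually.of_forall fun t => ?_)
    simp only [Function.comp_apply]
    rw [ContinuousLinearMap.adjoint_inner_right, inner_conj_symm]
  have h2 : ∀ x, AEStronglyMeasurable (fun t => B (τ t) x) μ := fun x =>
    aestronglyMeasurable_of_inner fun y => hm y x
  constructor <;> refine aestronglyMeasurable_of_inner fun x => ?_
  · refine ((h1 x).inner (𝕜 := ℂ) hg).congr (Eventually.of_forall fun t => ?_)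
    simp only [ContinuousLinearMap.adjoint_inner_left]
  · refine ((h2 x).inner (𝕜 := ℂ) hg).congr (Eventually.of_forall fun t => ?_)
    simp only [ContinuousLinearMap.adjoint_inner_right]

theorem IsEllipticFamily.memLp [SecondCountableTopology K] (hB : IsEllipticFamily B M ν)
    {s : Set ℝ} {g : ℝ → K} (hg : MemLp g 2 (volume.restrict s)) :
    MemLp (fun t => B t (g t)) 2 (volume.restrict s) :=
  hg.of_le_mul (hB.aesm_apply (τ := id)
    ((Measure.QuasiMeasurePreserving.id volume).mono_left Measure.restrict_le_self.absolutelyContinuous) hg.1).1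
    (Eventually.of_forall fun t => hB.upper t (g t))

theorem IsEllipticFamily.memLp' [SecondCountableTopology K] (hB : IsEllipticFamily B M ν)
    {g : ℝ → K} (hg : MemLp g 2) : MemLp (fun t => B t (g t)) 2 := by
  have := hB.memLp (s := univ) (g := g) (by rwa [Measure.restrict_univ])
  rwa [Measure.restrict_univ] at this

theorem IsEllipticFamily.memLp_adjoint [SecondCountableTopology K] (hB : IsEllipticFamily B M ν)
    (hM : 0 ≤ M) {g : ℝ → K} (hg : MemLp g 2) :
    MemLp (fun t => ContinuousLinearMap.adjoint (B t) (g t)) 2 :=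
  hg.of_le_mul (hB.aesm_apply (τ := id) (Measure.QuasiMeasurePreserving.id volume) hg.1).2
    (Eventually.of_forall fun t => hB.adjoint_upper hM t (g t))

theorem IsEllipticFamily.l2loc [SecondCountableTopology K] (hB : IsEllipticFamily B M ν)
    {g : ℝ → K} (hg : L2loc g) : L2loc (fun t => B t (g t)) := fun a b => hB.memLp (hg a b)

/-- **Lions' representation theorem**. -/
theorem lions_representation {F : Type*} [NormedAddCommGroup F] [InnerProductSpace ℂ F]
    [CompleteSpace F] (P : Submodule ℂ (F × F)) {α : ℝ} (hα : 0 < α)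
    (hP : ∀ p ∈ P, α * ‖p.1‖ ^ 2 ≤ (inner ℂ p.2 p.1).re) (f : F) :
    ∃ w : F, ∀ p ∈ P, inner ℂ p.2 w = inner ℂ p.1 f := by
  -- P is the relation between a test vector and its image under the transposed operator. Coercivity
  -- with Cauchy–Schwarz bounds that operator from below.
  have hbd : ∀ p ∈ P, ‖p.1‖ ≤ α⁻¹ * ‖p.2‖ := by
    intro p hp
    have h1 := (hP p hp).trans ((Complex.re_le_norm _).trans (norm_inner_le_norm _ _))
    rcases (norm_nonneg p.1).eq_or_lt with h0 | h0
    · rw [← h0]; positivity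
    · rw [← div_eq_inv_mul, le_div_iff₀ hα]
      nlinarith
  let T : P →ₗ[ℂ] F := (LinearMap.snd ℂ F F).comp P.subtype
  have hT : Function.Injective T := by
    rw [← LinearMap.ker_eq_bot, LinearMap.ker_eq_bot']
    rintro ⟨p, hp⟩ h0
    have h2 : p.2 = 0 := h0
    have h1 := hbd p hp
    rw [h2, norm_zero, mul_zero] at h1
    have h1' : p.1 = 0 := norm_le_zero_iff.1 h1
    exact Subtype.ext (Prod.ext h1' h2)
  let e := LinearEquiv.ofInjective T hT
  let ℓ : T.range →ₗ[ℂ] ℂ :=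
    (((innerSL ℂ f : F →L[ℂ] ℂ) : F →ₗ[ℂ] ℂ).comp ((LinearMap.fst ℂ F F).comp P.subtype)).comp
      (e.symm : T.range →ₗ[ℂ] P)
  have hℓ : ∀ x, ‖ℓ x‖ ≤ (‖f‖ * α⁻¹) * ‖x‖ := by
    intro x
    obtain ⟨p, rfl⟩ := e.surjective x
    have e1 : ℓ (e p) = inner ℂ f (p : F × F).1 := by simp [ℓ]
    have e2 : ‖e p‖ = ‖(p : F × F).2‖ := rfl
    rw [e1, e2]
    refine (norm_inner_le_norm _ _).trans ?_
    rw [mul_assoc]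
    gcongr
    exact hbd p p.2
  obtain ⟨g, hg, -⟩ := exists_extension_norm_eq T.range (ℓ.mkContinuous _ hℓ)
  refine ⟨(InnerProductSpace.toDual ℂ F).symm g, fun p hp => ?_⟩
  have h1 := hg (e ⟨p, hp⟩)
  have e1 : ℓ (e ⟨p, hp⟩) = inner ℂ f p.1 := by simp [ℓ]
  have e2 : ((e ⟨p, hp⟩ : T.range) : F) = p.2 := rfl
  rw [LinearMap.mkContinuous_apply, e1, e2] at h1
  rw [← inner_conj_symm, InnerProductSpace.toDual_symm_apply, h1, inner_conj_symm]

/-- Compactly supported test paths in the domain of the operator with graph `𝒢`. -/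
structure IsTestPath (𝒢 : Submodule ℂ (WithLp 2 (H × K))) (e e' : ℝ → H) (E : ℝ → K) : Prop where
  cont' : Continuous e'
  contE : Continuous E
  deriv : ∀ t, HasDerivAt e (e' t) t
  supp : HasCompactSupport e
  suppE : HasCompactSupport E
  mem : ∀ t, WithLp.toLp 2 (e t, E t) ∈ 𝒢

variable {𝒢 : Submodule ℂ (WithLp 2 (H × K))}

theorem IsTestPath.cont {e e' : ℝ → H} {E : ℝ → K} (h : IsTestPath 𝒢 e e' E) : Continuous e :=
  continuous_iff_continuousAt.2 fun t => (h.deriv t).continuousAt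

theorem IsTestPath.supp' {e e' : ℝ → H} {E : ℝ → K} (h : IsTestPath 𝒢 e e' E) :
    HasCompactSupport e' := by
  have : e' = _root_.deriv e := funext fun t => (h.deriv t).deriv.symm
  rw [this]; exact h.supp.deriv

theorem IsTestPath.add {e₁ e₁' e₂ e₂' : ℝ → H} {E₁ E₂ : ℝ → K} (h₁ : IsTestPath 𝒢 e₁ e₁' E₁)
    (h₂ : IsTestPath 𝒢 e₂ e₂' E₂) : IsTestPath 𝒢 (e₁ + e₂) (e₁' + e₂') (E₁ + E₂) where
  cont' := h₁.cont'.add h₂.cont'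
  contE := h₁.contE.add h₂.contE
  deriv t := (h₁.deriv t).add (h₂.deriv t)
  supp := h₁.supp.add h₂.supp
  suppE := h₁.suppE.add h₂.suppE
  mem t := 𝒢.add_mem (h₁.mem t) (h₂.mem t)

theorem IsTestPath.const_smul {e e' : ℝ → H} {E : ℝ → K} (h : IsTestPath 𝒢 e e' E) (c : ℂ) :
    IsTestPath 𝒢 (c • e) (c • e') (c • E) where
  cont' := h.cont'.const_smul c
  contE := h.contE.const_smul c
  deriv t := (h.deriv t).const_smul c
  supp := h.supp.smul_left (f := fun _ => c)
  suppE := h.suppE.smul_left (f := fun _ => c)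
  mem t := 𝒢.smul_mem c (h.mem t)

theorem IsTestPath.mul {e e' : ℝ → H} {E : ℝ → K} (h : IsTestPath 𝒢 e e' E) {θ θ' : ℝ → ℂ}
    (hθ : ∀ t, HasDerivAt θ (θ' t) t) (hθ' : Continuous θ') :
    IsTestPath 𝒢 (fun t => θ t • e t) (fun t => θ t • e' t + θ' t • e t) (fun t => θ t • E t) :=
  have hc : Continuous θ := continuous_iff_continuousAt.2 fun t => (hθ t).continuousAt
  { cont' := (hc.smul h.cont').add (hθ'.smul h.cont)
    contE := hc.smul h.contE
    deriv := fun t => (hθ t).smul (h.deriv t)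
    supp := h.supp.smul_left
    suppE := h.suppE.smul_left
    mem := fun t => 𝒢.smul_mem _ (h.mem t) }

/-- The graph-space projection of the pair `(x, y)`. -/
def graphProj (𝒢 : Submodule ℂ (WithLp 2 (H × K))) [𝒢.HasOrthogonalProjection] (x : H) (y : K) : 𝒢 :=
  𝒢.orthogonalProjectionOnto (WithLp.toLp 2 (x, y))

/-- The projection onto `𝒢` represents the functional w ↦ ⟨x, Dw-independent part⟩ + ⟨y, gradient
part⟩ by a vector of `𝒢`, so that an equation in the dual of the domain becomes one in the Hilbert
space `𝒢`. -/
theorem inner_graphProj_left [𝒢.HasOrthogonalProjection] (x : H) (y : K) (w : 𝒢) :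
    inner ℂ (graphProj 𝒢 x y) w =
      inner ℂ x (w : WithLp 2 (H × K)).fst + inner ℂ y (w : WithLp 2 (H × K)).snd := by
  rw [graphProj, Submodule.inner_orthogonalProjectionOnto_eq_of_mem_right, WithLp.prod_inner_apply]
  rfl

theorem memLp_graphProj [𝒢.HasOrthogonalProjection] {x : ℝ → H} {y : ℝ → K} (hx : MemLp x 2)
    (hy : MemLp y 2) : MemLp (fun t => graphProj 𝒢 (x t) (y t)) 2 := by
  have hsum : MemLp (fun t => ‖x t‖ + ‖y t‖) 2 := hx.norm.add hy.norm
  refine hsum.of_le_mul (c := 1) ?_ (Eventually.of_forall fun t => ?_)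
  · have hc : Continuous fun p : H × K => graphProj 𝒢 p.1 p.2 :=
      (𝒢.orthogonalProjectionOnto).continuous.comp (WithLp.prod_continuous_toLp 2 H K)
    exact hc.comp_aestronglyMeasurable (hx.1.prodMk hy.1)
  · rw [one_mul, graphProj]
    refine ((𝒢.orthogonalProjectionOnto).le_opNorm _).trans ?_
    refine (mul_le_of_le_one_left (norm_nonneg _) (𝒢.orthogonalProjectionOnto_norm_le)).trans ?_
    rw [WithLp.prod_norm_eq_of_L2, Real.norm_of_nonneg (by positivity)]
    simp only [WithLp.toLp_fst, WithLp.toLp_snd]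
    rw [Real.sqrt_le_left (by positivity)]
    nlinarith [mul_nonneg (norm_nonneg (x t)) (norm_nonneg (y t))]

/-- Twice the real part is the integral of the derivative of ‖e‖². The time derivative is skew, so
it does not disturb coercivity. -/
theorem re_integral_inner_deriv {e e' : ℝ → H} {E : ℝ → K} (h : IsTestPath 𝒢 e e' E) :
    (∫ t, inner ℂ (e' t) (e t)).re = 0 := by
  have i1 : Integrable fun t => inner ℂ (e' t) (e t) :=
    (h.cont'.inner h.cont).integrable_of_hasCompactSupport
      (h.supp.mono fun t ht => by
        contrapose! ht; simp only [Function.mem_support, not_not] at ht ⊢; rw [ht, inner_zero_right])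
  have i2 : Integrable fun t => inner ℂ (e t) (e' t) :=
    (h.cont.inner h.cont').integrable_of_hasCompactSupport
      (h.supp.mono fun t ht => by
        contrapose! ht; simp only [Function.mem_support, not_not] at ht ⊢; rw [ht, inner_zero_left])
  have i3 : Integrable fun t => inner ℂ (e t) (e t) :=
    (h.cont.inner h.cont).integrable_of_hasCompactSupport
      (h.supp.mono fun t ht => by
        contrapose! ht; simp only [Function.mem_support, not_not] at ht ⊢; rw [ht, inner_zero_left])
  have h0 : ∫ t, (inner ℂ (e t) (e' t) + inner ℂ (e' t) (e t)) = 0 :=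
    integral_eq_zero_of_hasDerivAt_of_integrable (fun t => (h.deriv t).inner ℂ (h.deriv t)) (i2.add i1) i3
  rw [integral_add i2 i1] at h0
  have h1 : ∫ t, inner ℂ (e t) (e' t) = conj (∫ t, inner ℂ (e' t) (e t)) := by
    rw [← integral_conj]; congr 1 with t; rw [inner_conj_symm]
  rw [h1] at h0
  have := congrArg Complex.re h0
  simp only [Complex.add_re, Complex.conj_re, Complex.zero_re] at this
  linarith

theorem IsTestPath.memLp {e e' : ℝ → H} {E : ℝ → K} (h : IsTestPath 𝒢 e e' E) :
    MemLp e 2 ∧ MemLp e' 2 ∧ MemLp E 2 :=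
  ⟨h.cont.memLp_of_hasCompactSupport h.supp, h.cont'.memLp_of_hasCompactSupport h.supp',
    h.contE.memLp_of_hasCompactSupport h.suppE⟩

/-- Lions' theorem in L²(ℝ; `𝒢`) for ∂ₜ + 1 + D⋆BD. The zero order term makes the form coercive for
the full graph norm, with constant min 1 ν; without it only the gradient would be controlled. -/
theorem exists_damped_solution [SecondCountableTopology K]
    (hG : IsClosed (𝒢 : Set (WithLp 2 (H × K)))) (hB : IsEllipticFamily B M ν) (hM : 0 ≤ M)
    (hν : 0 < ν) {f : ℝ → H} (hf : MemLp f 2) :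
    ∃ (w : ℝ → H) (W : ℝ → K), MemLp w 2 ∧ MemLp W 2 ∧ (∀ t, WithLp.toLp 2 (w t, W t) ∈ 𝒢) ∧
      ∀ e e' E, IsTestPath 𝒢 e e' E →
        ∫ t, (- inner ℂ (e' t) (w t) + inner ℂ (e t) (w t) + inner ℂ (E t) (B t (W t))) =
          ∫ t, inner ℂ (e t) (f t) := by
  have : CompleteSpace 𝒢 := hG.completeSpace_coe
  -- The transposed operator on a test path: -e' + e is paired with w and B⋆E with its gradient.
  let κ : (ℝ → H) → (ℝ → H) → (ℝ → K) → ℝ → 𝒢 := fun e e' E t =>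
    graphProj 𝒢 (-(e' t) + e t) (ContinuousLinearMap.adjoint (B t) (E t))
  have hκ : ∀ {e e' E}, IsTestPath 𝒢 e e' E → MemLp (κ e e' E) 2 := fun {e e' E} h =>
    memLp_graphProj (h.memLp.2.1.neg.add h.memLp.1) (hB.memLp_adjoint hM h.memLp.2.2)
  let ι : (ℝ → H) → (ℝ → K) → ℝ → 𝒢 := fun e E t => graphProj 𝒢 (e t) (E t)
  have hι : ∀ {e e' E}, IsTestPath 𝒢 e e' E → MemLp (ι e E) 2 := fun {e e' E} h =>
    memLp_graphProj h.memLp.1 h.memLp.2.2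
  have hιc : ∀ {e e' E}, IsTestPath 𝒢 e e' E → ∀ t,
      (ι e E t : WithLp 2 (H × K)) = WithLp.toLp 2 (e t, E t) := fun {e e' E} h t =>
    Submodule.starProjection_eq_self_iff.2 (h.mem t)
  let P : Submodule ℂ (Lp 𝒢 2 (volume : Measure ℝ) × Lp 𝒢 2 (volume : Measure ℝ)) :=
    { carrier := {p | ∃ e e' E, IsTestPath 𝒢 e e' E ∧ (p.1 : ℝ → 𝒢) =ᵐ[volume] ι e E ∧
        (p.2 : ℝ → 𝒢) =ᵐ[volume] κ e e' E}
      zero_mem' := by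
        refine ⟨0, 0, 0, ⟨continuous_const, continuous_const, fun t => hasDerivAt_const _ _,
          HasCompactSupport.zero, HasCompactSupport.zero, fun t => 𝒢.zero_mem⟩, ?_, ?_⟩
        · refine (Lp.coeFn_zero _ _ _).trans (Eventually.of_forall fun t => ?_)
          exact (map_zero 𝒢.orthogonalProjectionOnto).symm
        · refine (Lp.coeFn_zero _ _ _).trans (Eventually.of_forall fun t => ?_)
          simp only [κ, Pi.zero_apply, map_zero, neg_zero, add_zero]
          exact (map_zero 𝒢.orthogonalProjectionOnto).symm
      add_mem' := by
        rintro p q ⟨e1, e1', E1, h1, hp1, hp2⟩ ⟨e2, e2', E2, h2, hq1, hq2⟩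
        refine ⟨_, _, _, h1.add h2, ?_, ?_⟩
        · filter_upwards [Lp.coeFn_add p.1 q.1, hp1, hq1] with t ht a b
          simp only [Prod.fst_add, ht, Pi.add_apply, a, b, ι, graphProj]
          rw [← map_add]; rfl
        · filter_upwards [Lp.coeFn_add p.2 q.2, hp2, hq2] with t ht a b
          simp only [Prod.snd_add, ht, Pi.add_apply, a, b, κ, graphProj]
          rw [← map_add, map_add (ContinuousLinearMap.adjoint (B t)), neg_add,
            add_add_add_comm]; rfl
      smul_mem' := by
        rintro c p ⟨e1, e1', E1, h1, hp1, hp2⟩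
        refine ⟨_, _, _, h1.const_smul c, ?_, ?_⟩
        · filter_upwards [Lp.coeFn_smul c p.1, hp1] with t ht a
          simp only [Prod.smul_fst, ht, Pi.smul_apply, a, ι, graphProj]
          rw [← map_smul]; rfl
        · filter_upwards [Lp.coeFn_smul c p.2, hp2] with t ht a
          simp only [Prod.smul_snd, ht, Pi.smul_apply, a, κ, graphProj]
          rw [← map_smul, map_smul (ContinuousLinearMap.adjoint (B t)), ← smul_neg, ← smul_add]; rfl }
  have hP : ∀ p ∈ P, min 1 ν * ‖p.1‖ ^ 2 ≤ (inner ℂ p.2 p.1).re := by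
    rintro p ⟨e, e', E, h, hp1, hp2⟩
    have hn : ‖p.1‖ ^ 2 = ∫ t, (‖e t‖ ^ 2 + ‖E t‖ ^ 2) := by
      have hns := inner_self_eq_norm_sq (𝕜 := ℂ) p.1
      refine hns.symm.trans ?_
      rw [L2.inner_def]
      rw [← integral_re (L2.integrable_inner p.1 p.1)]
      refine integral_congr_ae (hp1.mono fun t ht => ?_)
      simp only [ht]
      rw [inner_self_eq_norm_sq, Submodule.coe_norm, hιc h, WithLp.prod_norm_sq_eq_of_L2]
      rfl
    have i1 := integrable_inner h.memLp.2.1 h.memLp.1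
    have i2 := integrable_inner h.memLp.1 h.memLp.1
    have i3 := integrable_inner (hB.memLp_adjoint hM h.memLp.2.2) h.memLp.2.2
    have i1' : Integrable fun t => -inner ℂ (e' t) (e t) := i1.neg
    have i23 : Integrable fun t => inner ℂ (e t) (e t) +
        inner ℂ (ContinuousLinearMap.adjoint (B t) (E t)) (E t) := i2.add i3
    have hin : inner ℂ p.2 p.1 = -(∫ t, inner ℂ (e' t) (e t)) +
        ∫ t, (inner ℂ (e t) (e t) + inner ℂ (ContinuousLinearMap.adjoint (B t) (E t)) (E t)) := by
      rw [L2.inner_def, ← integral_neg, ← integral_add i1' i23]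
      refine integral_congr_ae ?_
      filter_upwards [hp1, hp2] with t ht1 ht2
      rw [ht1, ht2, inner_graphProj_left, hιc h]
      simp only [WithLp.toLp_fst, WithLp.toLp_snd, inner_add_left, inner_neg_left]
      ring
    rw [hin, Complex.add_re, Complex.neg_re, re_integral_inner_deriv h, neg_zero, zero_add, hn]
    rw [← RCLike.re_eq_complex_re, ← integral_re i23, ← integral_const_mul]
    refine integral_mono ?_ i23.re fun t => ?_
    · exact ((h.memLp.1.integrable_norm_pow (by norm_num)).add
        (h.memLp.2.2.integrable_norm_pow (by norm_num))).const_mul _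
    · have h3 := hB.lower t (E t)
      simp only [map_add, inner_self_eq_norm_sq]
      rw [ContinuousLinearMap.adjoint_inner_left]
      change _ ≤ _ + (inner ℂ (E t) (B t (E t))).re
      have := min_le_left 1 ν
      have := min_le_right 1 ν
      nlinarith [sq_nonneg ‖e t‖, sq_nonneg ‖E t‖]
  have hf' : MemLp (fun t => graphProj 𝒢 (f t) 0) 2 :=
    memLp_graphProj hf MemLp.zero
  obtain ⟨w, hw⟩ := lions_representation P (lt_min one_pos hν) hP hf'.toLp
  have hwm := Lp.memLp w
  have c1 : ∀ v : WithLp 2 (H × K), ‖v.fst‖ ≤ ‖v‖ := fun v => by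
    rw [WithLp.prod_norm_eq_of_L2]
    exact Real.le_sqrt_of_sq_le (by nlinarith [sq_nonneg ‖v.snd‖])
  have c2 : ∀ v : WithLp 2 (H × K), ‖v.snd‖ ≤ ‖v‖ := fun v => by
    rw [WithLp.prod_norm_eq_of_L2]
    exact Real.le_sqrt_of_sq_le (by nlinarith [sq_nonneg ‖v.fst‖])
  have hw1 : MemLp (fun t => (w t : WithLp 2 (H × K)).fst) 2 := by
    refine hwm.of_le_mul (c := 1) ?_ (Eventually.of_forall fun t => ?_)
    · exact (continuous_fst.comp ((WithLp.prod_continuous_ofLp 2 H K).comp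
        continuous_subtype_val)).comp_aestronglyMeasurable hwm.1
    · rw [one_mul]; exact c1 _
  have hw2 : MemLp (fun t => (w t : WithLp 2 (H × K)).snd) 2 := by
    refine hwm.of_le_mul (c := 1) ?_ (Eventually.of_forall fun t => ?_)
    · exact (continuous_snd.comp ((WithLp.prod_continuous_ofLp 2 H K).comp
        continuous_subtype_val)).comp_aestronglyMeasurable hwm.1
    · rw [one_mul]; exact c2 _
  refine ⟨fun t => (w t : WithLp 2 (H × K)).fst, fun t => (w t : WithLp 2 (H × K)).snd, hw1, hw2,
    fun t => (w t).2, fun e e' E h => ?_⟩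
  have hk := hw ((hι h).toLp, (hκ h).toLp) ⟨e, e', E, h, (hι h).coeFn_toLp, (hκ h).coeFn_toLp⟩
  simp only at hk
  rw [L2.inner_def, L2.inner_def] at hk
  convert hk using 1
  · refine integral_congr_ae ((hκ h).coeFn_toLp.mono fun t ht => ?_)
    simp only [ht, κ]
    rw [inner_graphProj_left, inner_add_left, inner_neg_left,
      ContinuousLinearMap.adjoint_inner_left]
  · refine integral_congr_ae ?_
    filter_upwards [(hι h).coeFn_toLp, hf'.coeFn_toLp] with t ht ht2
    rw [ht, ht2, ← inner_conj_symm (ι e E t), inner_graphProj_left, hιc h]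
    simp only [WithLp.toLp_fst, WithLp.toLp_snd, inner_zero_left, add_zero, inner_conj_symm]

end Elliptic


/-! ### Existence and uniqueness for the abstract evolution equation -/

section Evolution

variable {H K : Type*} [NormedAddCommGroup H] [InnerProductSpace ℂ H] [CompleteSpace H]
  [NormedAddCommGroup K] [InnerProductSpace ℂ K] [CompleteSpace K]
variable {B : ℝ → K →L[ℂ] K} {M ν : ℝ} {𝒢 : Submodule ℂ (WithLp 2 (H × K))}

theorem IsData.congr {u v : ℝ → H} {G g : ℝ → K} {h : ℝ → H} (hu : IsData 𝒢 u G g h)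
    (huv : u =ᵐ[volume] v) : IsData 𝒢 v G g h where
  locInt := hu.locInt.congr huv
  gradL2 := hu.gradL2
  fluxL2 := hu.fluxL2
  srcL2 := hu.srcL2
  mem := by filter_upwards [hu.mem, huv] with t h1 h2; rwa [← h2]
  weak χ hχ p hp := by
    rw [← hu.weak χ hχ p hp]
    congr 1
    exact integral_congr_ae (huv.mono fun t ht => by simp only [ht])

theorem IsTest.continuous {χ : ℝ → ℂ} (hχ : IsTest χ) : Continuous χ := hχ.1.continuous

theorem IsTest.hasDerivAt {χ : ℝ → ℂ} (hχ : IsTest χ) (t : ℝ) : HasDerivAt χ (deriv χ t) t :=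
  (hχ.1.differentiable (by simp) t).hasDerivAt

theorem IsTest.continuous_deriv {χ : ℝ → ℂ} (hχ : IsTest χ) : Continuous (deriv χ) :=
  hχ.1.continuous_deriv (by simp)

theorem IsTest.conj {F : Type*} [NormedAddCommGroup F] [NormedSpace ℝ F] {χ : F → ℂ}
    (hχ : IsTest χ) : IsTest (fun t => conj (χ t)) :=
  ⟨Complex.conjCLE.contDiff.comp hχ.1, hχ.2.comp_left (g := conj) (map_zero _)⟩

theorem isTestPath_tensor {χ : ℝ → ℂ} (hχ : IsTest χ) {p : WithLp 2 (H × K)} (hp : p ∈ 𝒢) :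
    IsTestPath 𝒢 (fun t => χ t • p.fst) (fun t => deriv χ t • p.fst) (fun t => χ t • p.snd) where
  cont' := hχ.continuous_deriv.smul continuous_const
  contE := hχ.continuous.smul continuous_const
  deriv t := (hχ.hasDerivAt t).smul_const _
  supp := hχ.2.smul_right
  suppE := hχ.2.smul_right
  mem t := 𝒢.smul_mem (χ t) hp

theorem integrable_mul_test {χ : ℝ → ℂ} (hc : Continuous χ) (hs : HasCompactSupport χ) {f : ℝ → ℂ}
    (hf : LocallyIntegrable f) : Integrable (fun t => χ t * f t) :=
  hf.integrable_smul_left_of_hasCompactSupport hc hs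

theorem locallyIntegrable_inner_const {F : Type*} [NormedAddCommGroup F] [InnerProductSpace ℂ F]
    {u : ℝ → F} (hu : LocallyIntegrable u) (c : F) :
    LocallyIntegrable (fun t => inner ℂ c (u t)) := by
  rw [locallyIntegrable_iff] at hu ⊢
  exact fun k hk => (hu k hk).const_inner c

/-- The weak formulation tested with paths. -/
def SolvesPaths (𝒢 : Submodule ℂ (WithLp 2 (H × K))) (B : ℝ → K →L[ℂ] K) (u : ℝ → H) (G : ℝ → K)
    (f : ℝ → H) : Prop :=
  ∀ e e' E, IsTestPath 𝒢 e e' E →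
    ∫ t, (- inner ℂ (e' t) (u t) + inner ℂ (E t) (B t (G t))) = ∫ t, inner ℂ (e t) (f t)

/-- The paths used are χ ⊗ p with χ conjugated, since the inner product is antilinear in its first
variable whereas `IsData` is linear in χ. -/
theorem SolvesPaths.isData [SecondCountableTopology K] (hB : IsEllipticFamily B M ν) {u : ℝ → H}
    {G : ℝ → K} {f : ℝ → H} (hu : LocallyIntegrable u) (hG : L2loc G) (hf : L2loc f)
    (hmem : ∀ᵐ t : ℝ, WithLp.toLp 2 (u t, G t) ∈ 𝒢) (h : SolvesPaths 𝒢 B u G f) :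
    IsData 𝒢 u G (fun t => -(B t (G t))) f where
  locInt := hu
  gradL2 := hG
  fluxL2 := (hB.l2loc hG).neg
  srcL2 := hf
  mem := hmem
  weak χ hχ p hp := by
    have h1 := h _ _ _ (isTestPath_tensor hχ.conj hp)
    have hd : ∀ t, deriv (fun t => (starRingEnd ℂ) (χ t)) t = (starRingEnd ℂ) (deriv χ t) := fun t =>
      (Complex.conjCLE.hasFDerivAt.comp_hasDerivAt t (hχ.hasDerivAt t)).deriv
    simp only [hd, inner_smul_left, Complex.conj_conj] at h1
    have i1 := integrable_mul_test hχ.continuous_deriv hχ.2.deriv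
      (locallyIntegrable_inner_const hu p.fst)
    have i2 := integrable_mul_test hχ.continuous hχ.2
      (locallyIntegrable_inner_const (hB.l2loc hG).locallyIntegrable p.snd)
    have i3 := integrable_mul_test hχ.continuous hχ.2
      (locallyIntegrable_inner_const hf.locallyIntegrable p.fst)
    have e1 : ∫ t, χ t * (inner ℂ p.snd (-(B t (G t))) + inner ℂ p.fst (f t)) =
        -(∫ t, χ t * inner ℂ p.snd (B t (G t))) + ∫ t, χ t * inner ℂ p.fst (f t) := by
      have i2' : Integrable fun t => -(χ t * inner ℂ p.snd (B t (G t))) := i2.neg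
      rw [← integral_neg, ← integral_add i2' i3]
      congr 1 with t
      simp only [inner_neg_right]; ring
    have i1' : Integrable fun t => -(deriv χ t * inner ℂ p.fst (u t)) := i1.neg
    rw [integral_add i1' i2, integral_neg] at h1
    rw [e1, ← h1]; ring

/-- The real part of the product rule for u with itself. Coercivity enters through both flux terms,
which gives 2ν. -/
theorem IsData.energy [SecondCountableTopology K] (hcl : IsClosed (𝒢 : Set (WithLp 2 (H × K))))
    (hB : IsEllipticFamily B M ν) {u : ℝ → H} {G : ℝ → K} {f : ℝ → H}
    (hu : IsData 𝒢 u G (fun t => -(B t (G t))) f) (hc : Continuous u) {a b : ℝ} (hab : a ≤ b) :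
    ‖u b‖ ^ 2 + 2 * ν * ∫ t in Icc a b, ‖G t‖ ^ 2 ≤
      ‖u a‖ ^ 2 + 2 * ∫ t in Icc a b, ‖f t‖ * ‖u t‖ := by
  have hp := congrArg Complex.re (hu.product hcl hu hc hc hab)
  have iBG := integrable_inner (hu.fluxL2 a b) (hu.gradL2 a b)
  have iGB := integrable_inner (hu.gradL2 a b) (hu.fluxL2 a b)
  have ifu := integrable_inner (hu.srcL2 a b) (hc.l2loc a b)
  have iuf := integrable_inner (hc.l2loc a b) (hu.srcL2 a b)
  have ifu' := (integral_norm_mul_norm_le (hu.srcL2 a b) (hc.l2loc a b)).1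
  have iG := (hu.gradL2 a b).integrable_norm_pow (p := 2) (by norm_num)
  simp only [Complex.add_re, Complex.sub_re] at hp
  simp only [← RCLike.re_eq_complex_re] at hp
  rw [← integral_re iBG, ← integral_re iGB, ← integral_re ifu, ← integral_re iuf,
    inner_self_eq_norm_sq, inner_self_eq_norm_sq] at hp
  have e1 : ∫ t in Icc a b, RCLike.re (inner ℂ (-(B t (G t))) (G t)) ≤
      ∫ t in Icc a b, -ν * ‖G t‖ ^ 2 := by
    refine integral_mono iBG.re (iG.const_mul _) fun t => ?_
    have := hB.lower t (G t)
    rw [← inner_conj_symm, Complex.conj_re] at this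
    simp only [inner_neg_left, map_neg, RCLike.re_eq_complex_re]
    linarith
  have e2 : ∫ t in Icc a b, RCLike.re (inner ℂ (G t) (-(B t (G t)))) ≤
      ∫ t in Icc a b, -ν * ‖G t‖ ^ 2 := by
    refine integral_mono iGB.re (iG.const_mul _) fun t => ?_
    have := hB.lower t (G t)
    simp only [inner_neg_right, map_neg, RCLike.re_eq_complex_re]
    linarith
  have e3 : ∫ t in Icc a b, RCLike.re (inner ℂ (f t) (u t)) ≤ ∫ t in Icc a b, ‖f t‖ * ‖u t‖ :=
    integral_mono ifu.re ifu' fun t => (RCLike.re_le_norm _).trans (norm_inner_le_norm _ _)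
  have e4 : ∫ t in Icc a b, RCLike.re (inner ℂ (u t) (f t)) ≤ ∫ t in Icc a b, ‖f t‖ * ‖u t‖ :=
    integral_mono iuf.re ifu' fun t => (RCLike.re_le_norm _).trans
      ((norm_inner_le_norm _ _).trans (le_of_eq (mul_comm _ _)))
  rw [integral_const_mul] at e1 e2
  linarith

/-- A half-line has infinite length, so an integrable function has no positive lower bound on it.
This is how square integrability in time forces vanishing towards -∞. -/
theorem eq_zero_of_sq_le_integrable {q : ℝ → ℝ} {X c : ℝ} (hq : Integrable q) (hc : 0 ≤ c)
    (h : ∀ᵐ t, t ≤ X → c ≤ q t) : c = 0 := by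
  have : IntegrableOn (fun _ : ℝ => c) (Iic X) := by
    refine (hq.integrableOn (s := Iic X)).mono' aestronglyMeasurable_const ?_
    refine (ae_restrict_iff' measurableSet_Iic).2 (h.mono fun t ht hX => ?_)
    rw [Real.norm_of_nonneg hc]; exact ht hX
  rw [integrableOn_const_iff] at this
  simpa using this

theorem l2loc_exp_smul {F : Type*} [NormedAddCommGroup F] [NormedSpace ℂ F] {x : ℝ → F}
    (hx : MemLp x 2) : L2loc fun t => Complex.exp (t : ℂ) • x t := by
  intro c d
  have hc : Continuous fun t : ℝ => Complex.exp (t : ℂ) := by fun_prop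
  refine (hx.restrict _).of_le_mul (c := Real.exp d) (hc.aestronglyMeasurable.smul hx.1.restrict) ?_
  refine (ae_restrict_iff' measurableSet_Icc).2 (Eventually.of_forall fun t ht => ?_)
  rw [norm_smul, Complex.norm_exp, Complex.ofReal_re]
  gcongr
  exact ht.2

/-- Existence of a solution which vanishes before the source is turned on. -/
theorem exists_solution [SecondCountableTopology K] (hcl : IsClosed (𝒢 : Set (WithLp 2 (H × K))))
    (hB : IsEllipticFamily B M ν) (hM : 0 ≤ M) (hν : 0 < ν) {f : ℝ → H} (hf : Continuous f)
    {a b : ℝ} (hsupp : ∀ t ∉ Icc a b, f t = 0) :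
    ∃ (u : ℝ → H) (G : ℝ → K), Continuous u ∧ MemLp G 2 ∧
      (∀ᵐ t : ℝ, WithLp.toLp 2 (u t, G t) ∈ 𝒢) ∧ (∀ t ≤ a, u t = 0) ∧ SolvesPaths 𝒢 B u G f := by
  have hfc : HasCompactSupport f := HasCompactSupport.intro isCompact_Icc hsupp
  have hexpc : Continuous fun t : ℝ => Complex.exp (-(t : ℂ)) := by fun_prop
  have hexpc' : Continuous fun t : ℝ => Complex.exp (t : ℂ) := by fun_prop
  -- The substitution u = exp(t) w removes the damping term, at the price of knowing only w, and not
  -- u, to be square integrable on ℝ.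
  obtain ⟨w, W, hw, hW, hmem, hsol⟩ := exists_damped_solution hcl hB hM hν
    (f := fun t => Complex.exp (-(t : ℂ)) • f t)
    ((hexpc.smul hf).memLp_of_hasCompactSupport hfc.smul_left)
  set u₀ : ℝ → H := fun t => Complex.exp (t : ℂ) • w t with hu₀
  set G : ℝ → K := fun t => Complex.exp (t : ℂ) • W t with hG
  have hexp : ∀ t : ℝ, HasDerivAt (fun t : ℝ => Complex.exp (t : ℂ)) (Complex.exp (t : ℂ)) t := by
    intro t
    simpa using (Complex.ofRealCLM.hasDerivAt (x := t)).cexp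
  have hconj : ∀ t : ℝ, (starRingEnd ℂ) (Complex.exp (t : ℂ)) = Complex.exp (t : ℂ) := fun t => by
    rw [← Complex.exp_conj, Complex.conj_ofReal]
  have hsol₀ : SolvesPaths 𝒢 B u₀ G f := by
    intro e e' E h
    have h1 := hsol _ _ _ (h.mul hexp hexpc')
    refine Eq.trans ?_ (h1.trans ?_)
    · congr 1 with t
      simp only [hu₀, hG, inner_add_left, inner_smul_left, inner_smul_right, hconj, map_smul]
      ring
    · congr 1 with t
      simp only [inner_smul_left, inner_smul_right, hconj]
      rw [← mul_assoc, ← Complex.exp_add]; simp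
  have hGl : L2loc G := l2loc_exp_smul hW
  have hmem₀ : ∀ᵐ t : ℝ, WithLp.toLp 2 (u₀ t, G t) ∈ 𝒢 :=
    Eventually.of_forall fun t => 𝒢.smul_mem _ (hmem t)
  have hdata₀ := hsol₀.isData hB (l2loc_exp_smul hw).locallyIntegrable hGl hf.l2loc hmem₀
  obtain ⟨u, huc, hu⟩ := hdata₀.exists_continuous hcl
  have hdata := hdata₀.congr hu
  have hfz : ∀ {s t : ℝ}, (t ≤ a ∨ b ≤ s) → ∫ τ in Icc s t, ‖f τ‖ * ‖u τ‖ = 0 := by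
    intro s t hst
    rw [integral_Icc_eq_integral_Ioo]
    refine setIntegral_eq_zero_of_forall_eq_zero fun τ hτ => ?_
    rw [hsupp, norm_zero, zero_mul]
    rintro ⟨h1, h2⟩
    rcases hst with h | h
    · linarith [hτ.2]
    · linarith [hτ.1]
  have hmono : ∀ {s t : ℝ}, s ≤ t → t ≤ a → ‖u t‖ ^ 2 ≤ ‖u s‖ ^ 2 := by
    intro s t hst hta
    have h1 := hdata.energy hcl hB huc hst
    rw [hfz (Or.inl hta)] at h1
    have : 0 ≤ ∫ t in Icc s t, ‖G t‖ ^ 2 := integral_nonneg fun _ => by positivity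
    have : 0 ≤ 2 * ν * ∫ t in Icc s t, ‖G t‖ ^ 2 := by positivity
    linarith
  -- Before the source starts, ‖u‖ is nonincreasing in time. Hence ‖w(s)‖ = exp(-s)‖u(s)‖ ≥
  -- exp(-t)‖u(t)‖ for almost every s ≤ t, a constant lower bound for a square integrable function.
  have hzero : ∀ t ≤ a, u t = 0 := by
    intro t hta
    have hq := hw.integrable_norm_pow (p := 2) (by norm_num)
    have h0 := eq_zero_of_sq_le_integrable (X := t) (c := (Real.exp (-t) * ‖u t‖) ^ 2) hq
      (by positivity) (hu.mono fun s hs hst => by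
        have h1 := hmono hst hta
        have h2 : ‖u s‖ = Real.exp s * ‖w s‖ := by
          rw [← hs]; dsimp only; rw [norm_smul, Complex.norm_exp, Complex.ofReal_re]
        have h3 : ‖u t‖ ≤ ‖u s‖ := (pow_le_pow_iff_left₀ (norm_nonneg _) (norm_nonneg _) two_ne_zero).1 h1
        gcongr
        rw [Real.exp_neg, inv_mul_le_iff₀ (Real.exp_pos t)]
        refine h3.trans (h2.le.trans ?_)
        gcongr)
    have h4 := Real.exp_pos (-t)
    have h5 : ‖u t‖ = 0 := by
      rcases mul_eq_zero.1 (pow_eq_zero_iff two_ne_zero |>.1 h0) with h | h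
      · exact absurd h h4.ne'
      · exact h
    exact norm_eq_zero.1 h5
  have hGmem : MemLp G 2 := by
    rw [memLp_two_iff_integrable_sq_norm hGl.aestronglyMeasurable]
    have iG : ∀ c d : ℝ, IntegrableOn (fun t => ‖G t‖ ^ 2) (Icc c d) := fun c d => by
      have := (hGl c d).integrable_norm_pow (p := 2) (by norm_num)
      exact this
    -- As u(-n) = 0 for large n, the energy inequality on [-n, n] bounds the gradient uniformly in
    -- n.
    set C := (∫ t in Icc a b, ‖f t‖ * ‖u t‖) / ν with hC
    refine integrable_of_intervalIntegral_norm_bounded (l := (atTop : Filter ℕ))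
      (a := fun n : ℕ => -(n : ℝ)) (b := fun n : ℕ => (n : ℝ)) C
      (fun n => (iG _ _).mono_set Ioc_subset_Icc_self)
      (tendsto_neg_atTop_atBot.comp tendsto_natCast_atTop_atTop) tendsto_natCast_atTop_atTop ?_
    obtain ⟨N, hN⟩ := exists_nat_ge (max (-a) b)
    filter_upwards [eventually_ge_atTop N] with n hn
    have hNn : (N : ℝ) ≤ n := by exact_mod_cast hn
    have ha : -(n : ℝ) ≤ a := by linarith [le_max_left (-a) b]
    have hb : b ≤ n := by linarith [le_max_right (-a) b]
    have hnn : -(n : ℝ) ≤ n := by linarith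
    rw [intervalIntegral.integral_of_le hnn, ← integral_Icc_eq_integral_Ioc]
    have h1 := hdata.energy hcl hB huc hnn
    rw [hzero _ ha] at h1
    have h2 : ∫ t in Icc (-(n : ℝ)) n, ‖f t‖ * ‖u t‖ = ∫ t in Icc a b, ‖f t‖ * ‖u t‖ := by
      refine setIntegral_eq_of_subset_of_forall_sdiff_eq_zero measurableSet_Icc
        (Icc_subset_Icc ha hb) fun t ht => ?_
      rw [hsupp t ht.2, norm_zero, zero_mul]
    rw [h2] at h1
    simp only [norm_pow, norm_norm]
    rw [hC, le_div_iff₀ hν]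
    have := sq_nonneg ‖u (n : ℝ)‖
    simp only [norm_zero] at h1
    nlinarith
  refine ⟨u, G, huc, hGmem, hdata.mem, hzero, fun e e' E h => ?_⟩
  rw [← hsol₀ e e' E h]
  exact integral_congr_ae (hu.mono fun t ht => by simp only [hu₀, ← ht])

theorem measurePreserving_subLeft (s : ℝ) : MeasurePreserving (fun t : ℝ => s - t) := by
  have h := (measurePreserving_add_left (volume : Measure ℝ) s).comp
    (Measure.measurePreserving_neg (volume : Measure ℝ))
  exact h

theorem L2loc.reflect {F : Type*} [NormedAddCommGroup F] [NormedSpace ℝ F] {f : ℝ → F}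
    (hf : L2loc f) (s : ℝ) : L2loc fun t => f (s - t) := by
  intro a b
  have h1 := ((measurePreserving_subLeft s).restrict_preimage (s := Icc (s - b) (s - a))
    measurableSet_Icc)
  have h2 : (fun t : ℝ => s - t) ⁻¹' Icc (s - b) (s - a) = Icc a b := by
    ext t
    simp only [mem_preimage, mem_Icc]
    constructor <;> rintro ⟨_, _⟩ <;> constructor <;> linarith
  rw [h2] at h1
  exact (hf (s - b) (s - a)).comp_measurePreserving h1

/-- Time reflection of evolution data. -/
theorem IsData.reflect {u : ℝ → H} {G g : ℝ → K} {h : ℝ → H} (hu : IsData 𝒢 u G g h) (s : ℝ) :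
    IsData 𝒢 (fun t => u (s - t)) (fun t => G (s - t)) (fun t => -g (s - t))
      (fun t => -h (s - t)) := by
  have hmp := measurePreserving_subLeft s
  refine ⟨?_, hu.gradL2.reflect s, (hu.fluxL2.reflect s).neg, (hu.srcL2.reflect s).neg, ?_, ?_⟩
  · rw [locallyIntegrable_iff]
    intro k hk
    have h1 := (locallyIntegrable_iff.1 hu.locInt) _ (hk.image (f := fun t => s - t) (by fun_prop))
    have hemb : MeasurableEmbedding (fun t : ℝ => s - t) :=
      (Homeomorph.subLeft s).measurableEmbedding
    exact (hmp.integrableOn_image hemb).1 h1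
  · exact hmp.quasiMeasurePreserving.tendsto_ae.eventually hu.mem
  · intro χ hχ p hp
    have hχ' : IsTest (fun t => χ (s - t)) :=
      ⟨hχ.1.comp (contDiff_const.sub contDiff_id), hχ.2.comp_homeomorph (Homeomorph.subLeft s)⟩
    have h1 := hu.weak _ hχ' p hp
    have hd : ∀ t, _root_.deriv (fun t => χ (s - t)) t = -_root_.deriv χ (s - t) := fun t =>
      ((hχ.hasDerivAt (s - t)).comp_const_sub s t).deriv
    simp only [hd] at h1
    rw [← integral_sub_left_eq_self (fun t => χ t * (inner ℂ p.snd (-g (s - t)) + inner ℂ p.fst (-h (s - t)))) volume s,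
      ← integral_sub_left_eq_self (fun t => _root_.deriv χ t * inner ℂ p.fst (u (s - t))) volume s]
    simp only [sub_sub_cancel, inner_neg_right]
    have e : ∫ t, χ (s - t) * (-inner ℂ p.snd (g t) + -inner ℂ p.fst (h t)) =
        -∫ t, χ (s - t) * (inner ℂ p.snd (g t) + inner ℂ p.fst (h t)) := by
      rw [← integral_neg]; congr 1 with t; ring
    rw [e, ← h1, neg_neg, ← integral_neg]
    congr 1 with t; ring

end Evolution


/-! ### Decay at infinity, uniqueness and duality -/

section Decay

variable {H K : Type*} [NormedAddCommGroup H] [InnerProductSpace ℂ H] [CompleteSpace H]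
  [NormedAddCommGroup K] [InnerProductSpace ℂ K] [CompleteSpace K]
variable {B : ℝ → K →L[ℂ] K} {M ν : ℝ} {𝒢 : Submodule ℂ (WithLp 2 (H × K))}

theorem norm_setIntegral_inner_le {f g : ℝ → K} {q₁ q₂ : ℝ → ℝ} {a b J₁ J₂ : ℝ}
    (h1 : ∀ t, ‖f t‖ ^ 2 ≤ q₁ t) (h2 : ∀ t, ‖g t‖ ^ 2 ≤ q₂ t) (i1 : IntegrableOn q₁ (Icc a b))
    (i2 : IntegrableOn q₂ (Icc a b)) (j1 : ∫ t in Icc a b, q₁ t ≤ J₁)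
    (j2 : ∫ t in Icc a b, q₂ t ≤ J₂) :
    ‖∫ t in Icc a b, inner ℂ (f t) (g t)‖ ≤ (J₁ + J₂) / 2 := by
  have h := norm_integral_le_of_norm_le (f := fun t => inner ℂ (f t) (g t))
    (g := fun t => (q₁ t + q₂ t) / 2) (μ := volume.restrict (Icc a b)) ((i1.add i2).div_const 2)
    (Eventually.of_forall fun t => by
      refine (norm_inner_le_norm _ _).trans ?_
      nlinarith [h1 t, h2 t, sq_nonneg (‖f t‖ - ‖g t‖)])
  rw [integral_div, integral_add i1 i2] at h
  linarith

theorem setIntegral_comp_sub_left (q : ℝ → ℝ) (s a b : ℝ) :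
    ∫ t in Icc a b, q (s - t) = ∫ t in Icc (s - b) (s - a), q t := by
  rw [← integral_indicator measurableSet_Icc, ← integral_indicator measurableSet_Icc,
    ← integral_sub_left_eq_self _ volume s]
  congr 1 with t
  by_cases ht : s - t ∈ Icc a b
  · rw [indicator_of_mem ht, indicator_of_mem, sub_sub_cancel]
    exact ⟨by linarith [ht.2], by linarith [ht.1]⟩
  · rw [indicator_of_notMem ht, indicator_of_notMem]
    intro h
    exact ht ⟨by linarith [h.2], by linarith [h.1]⟩

/-- Nothing is assumed about the size of u, only D u and the flux are in L². Energy differences give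
convergence of ‖u(t)‖ but not of u(t); the missing information is the pairing of u at two different
times, obtained from the product rule for u and its reflection about their midpoint. The limit is
then in the kernel of D. -/
theorem IsData.tendsto_atBot (hcl : IsClosed (𝒢 : Set (WithLp 2 (H × K))))
    (hinj : ∀ x : H, WithLp.toLp 2 (x, (0 : K)) ∈ 𝒢 → x = 0) {u : ℝ → H} {G g : ℝ → K}
    (hu : IsData 𝒢 u G g 0) (hc : Continuous u) (hG : MemLp G 2) (hg : MemLp g 2) :
    Tendsto u atBot (𝓝 0) := by
  have iG := hG.integrable_norm_pow (p := 2) (by norm_num)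
  have ig := hg.integrable_norm_pow (p := 2) (by norm_num)
  set q : ℝ → ℝ := fun t => ‖G t‖ ^ 2 + ‖g t‖ ^ 2 with hq
  have iq : Integrable q := iG.add ig
  have q0 : ∀ t, 0 ≤ q t := fun t => by positivity
  have hGq : ∀ t, ‖G t‖ ^ 2 ≤ q t := fun t => by simp only [hq]; nlinarith [sq_nonneg ‖g t‖]
  have hgq : ∀ t, ‖g t‖ ^ 2 ≤ q t := fun t => by simp only [hq]; nlinarith [sq_nonneg ‖G t‖]
  -- The tail of the energy, which bounds all errors to the left of X.
  set T : ℝ → ℝ := fun X => ∫ t in Iic X, q t with hT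
  have hTlim : Tendsto T atBot (𝓝 0) := by
    have h1 := intervalIntegral_tendsto_integral_Iic (f := q) 0 iq.integrableOn tendsto_id
    have h2 : ∀ X, T X = T 0 - ∫ t in X..0, q t := fun X => by
      rw [← intervalIntegral.integral_Iic_sub_Iic iq.integrableOn iq.integrableOn]; simp [hT]
    have h3 := h1.const_sub (T 0)
    rw [show T 0 - ∫ t in Iic 0, q t = 0 from sub_self _] at h3
    exact h3.congr fun X => (h2 X).symm
  have hle : ∀ {a b X : ℝ}, b ≤ X → ∫ t in Icc a b, q t ≤ T X := fun {a b X} hb =>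
    setIntegral_mono_set iq.integrableOn (Eventually.of_forall q0)
      (Eventually.of_forall fun t (ht : t ∈ Icc a b) => ht.2.trans hb)
  -- the square of the norm
  have hn : ∀ {a b X : ℝ}, a ≤ b → b ≤ X → ‖inner ℂ (u b) (u b) - inner ℂ (u a) (u a)‖ ≤ 2 * T X := by
    intro a b X hab hb
    rw [hu.product hcl hu hc hc hab]
    have e1 := norm_setIntegral_inner_le hgq hGq iq.integrableOn iq.integrableOn
      (hle (a := a) hb) (hle (a := a) hb)
    have e2 := norm_setIntegral_inner_le hGq hgq iq.integrableOn iq.integrableOn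
      (hle (a := a) hb) (hle (a := a) hb)
    simp only [Pi.zero_apply, inner_zero_left, inner_zero_right, integral_zero, add_zero]
    refine (norm_add_le _ _).trans ?_
    linarith
  -- reflection
  have hr : ∀ {s τ X : ℝ}, 0 ≤ τ → s + τ ≤ X →
      ‖inner ℂ (u (s + τ)) (u (s - τ)) - inner ℂ (u s) (u s)‖ ≤ 2 * T X := by
    intro s τ X hτ hX
    have d1 := (hu.reflect s)
    -- Reflecting twice produces the branch t ↦ u(s + t), to be paired with t ↦ u(s - t); at t = 0
    -- both equal u(s).
    have d2 := d1.reflect 0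
    have hu1 : Continuous fun t => u (s - t) := hc.comp (by fun_prop)
    have hp := d2.product hcl d1 (hu1.comp (by fun_prop)) hu1 hτ
    simp only [zero_sub, sub_neg_eq_add, sub_zero, add_zero, Pi.zero_apply, neg_zero, neg_neg,
      inner_zero_left, inner_zero_right, integral_zero] at hp
    rw [hp]
    have hin : ∀ t, s + t = 2 * s - (s - t) := fun t => by ring
    have i1 : Integrable fun t => q (s + t) := iq.comp_add_left s
    have i2 : Integrable fun t => q (s - t) := iq.comp_sub_left s
    have j1 : ∫ t in Icc 0 τ, q (s + t) ≤ T X := by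
      have h3 := setIntegral_comp_sub_left (fun t => q (2 * s - t)) s 0 τ
      simp only [← hin, sub_zero] at h3
      rw [h3, setIntegral_comp_sub_left q (2 * s) (s - τ) s]
      exact hle (by linarith)
    have j2 : ∫ t in Icc 0 τ, q (s - t) ≤ T X := by
      rw [setIntegral_comp_sub_left]
      exact hle (by linarith)
    have e1 := norm_setIntegral_inner_le (f := fun t => g (s + t)) (g := fun t => G (s - t))
      (fun t => hgq (s + t)) (fun t => hGq (s - t)) i1.integrableOn i2.integrableOn j1 j2
    have e2 := norm_setIntegral_inner_le (f := fun t => G (s + t)) (g := fun t => -g (s - t))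
      (fun t => hGq (s + t)) (fun t => by rw [norm_neg]; exact hgq (s - t)) i1.integrableOn
      i2.integrableOn j1 j2
    refine (norm_add_le _ _).trans ?_
    linarith
  -- In ‖u b‖² + ‖u a‖² - 2 Re⟨u b, u a⟩ each of the three terms is replaced by its value at the
  -- midpoint s, where they cancel; every replacement costs a multiple of the tail.
  have hdiff : ∀ {a b X : ℝ}, a ≤ b → b ≤ X → ‖u b - u a‖ ^ 2 ≤ 12 * T X := by
    intro a b X hab hb
    set s := (a + b) / 2 with hs
    have hsb : s ≤ b := by rw [hs]; linarith
    have has : a ≤ s := by rw [hs]; linarith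
    have e1 := hn hsb hb
    have e2 := hn has (hsb.trans hb)
    have e3 := hr (s := s) (τ := (b - a) / 2) (X := X) (by linarith) (by rw [hs]; linarith)
    rw [show s + (b - a) / 2 = b by rw [hs]; ring, show s - (b - a) / 2 = a by rw [hs]; ring] at e3
    have f1 := (Complex.abs_re_le_norm _).trans e1
    have f2 := (Complex.abs_re_le_norm _).trans e2
    have f3 := (Complex.abs_re_le_norm _).trans e3
    have hre : ∀ x : H, (inner ℂ x x : ℂ).re = ‖x‖ ^ 2 := fun x => inner_self_eq_norm_sq (𝕜 := ℂ) x
    simp only [Complex.sub_re, hre] at f1 f2 f3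
    have h4 := @norm_sub_sq ℂ H _ _ _ (u b) (u a)
    rw [RCLike.re_eq_complex_re] at h4
    rw [abs_le] at f1 f2 f3
    linarith [f1.1, f1.2, f2.1, f2.2, f3.1, f3.2]
  have hcau : Cauchy (map u atBot) := by
    rw [Metric.cauchy_iff]
    refine ⟨inferInstance, fun ε hε => ?_⟩
    obtain ⟨X, hX⟩ := (hTlim.eventually (gt_mem_nhds (show 0 < ε ^ 2 / 12 by positivity))).exists
    refine ⟨u '' Iic X, image_mem_map (Iic_mem_atBot X), ?_⟩
    have key : ∀ {a b : ℝ}, a ≤ b → b ≤ X → ‖u b - u a‖ < ε := fun {a b} hab hb => by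
      have := hdiff hab hb
      refine lt_of_pow_lt_pow_left₀ 2 hε.le ?_
      linarith
    rintro _ ⟨a, ha, rfl⟩ _ ⟨b, hb, rfl⟩
    rcases le_total a b with hab | hab
    · rw [dist_comm, dist_eq_norm]; exact key hab hb
    · rw [dist_eq_norm]; exact key hab ha
  obtain ⟨l, hl⟩ := cauchy_map_iff_exists_tendsto.1 hcau
  -- Square integrability gives arbitrarily early times at which G is small. As the graph is closed,
  -- (l, 0) belongs to it.
  have hl0 : l = 0 := by
    apply hinj
    rw [← SetLike.mem_coe, ← hcl.closure_eq, Metric.mem_closure_iff]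
    intro ε hε
    obtain ⟨X, hX⟩ := (hl.eventually (Metric.ball_mem_nhds l (half_pos hε))).exists_forall_of_atBot
    have hex : ∃ t ≤ X, WithLp.toLp 2 (u t, G t) ∈ 𝒢 ∧ ‖G t‖ < ε / 2 := by
      by_contra! hcon
      have := eq_zero_of_sq_le_integrable (X := X) (c := (ε / 2) ^ 2) iG (by positivity)
        (hu.mem.mono fun t ht htX => by
          have := hcon t htX ht
          gcongr)
      exact absurd this (by positivity)
    obtain ⟨t, htX, hmem, hGt⟩ := hex
    refine ⟨_, hmem, ?_⟩
    have h1 : ‖l - u t‖ < ε / 2 := by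
      have := hX t htX
      rwa [dist_comm, dist_eq_norm] at this
    rw [dist_eq_norm, ← WithLp.toLp_sub, WithLp.prod_norm_eq_of_L2]
    simp only [Prod.mk_sub_mk, zero_sub, WithLp.toLp_fst, WithLp.toLp_snd, norm_neg]
    rw [Real.sqrt_lt' hε]
    nlinarith [norm_nonneg (l - u t), norm_nonneg (G t)]
  rwa [hl0] at hl

/-- Uniqueness in the energy class. -/
theorem IsData.eq_zero [SecondCountableTopology K] (hcl : IsClosed (𝒢 : Set (WithLp 2 (H × K))))
    (hinj : ∀ x : H, WithLp.toLp 2 (x, (0 : K)) ∈ 𝒢 → x = 0)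
    (hB : IsEllipticFamily B M ν) (hν : 0 < ν) {u : ℝ → H} {G : ℝ → K}
    (hu : IsData 𝒢 u G (fun t => -(B t (G t))) 0) (hc : Continuous u) (hG : MemLp G 2) : u = 0 := by
  have hlim := hu.tendsto_atBot hcl hinj hc hG (hB.memLp' hG).neg
  have hlim2 : Tendsto (fun s => ‖u s‖ ^ 2) atBot (𝓝 0) := by
    simpa using (hlim.norm.pow 2)
  ext t
  have : ‖u t‖ ^ 2 ≤ 0 := by
    refine ge_of_tendsto hlim2 ?_
    filter_upwards [eventually_le_atBot t] with s hs
    have h1 := hu.energy hcl hB hc hs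
    have h2 : 0 ≤ 2 * ν * ∫ t in Icc s t, ‖G t‖ ^ 2 :=
      mul_nonneg (by positivity) (integral_nonneg fun _ => by positivity)
    simp only [Pi.zero_apply, norm_zero, zero_mul, integral_zero, mul_zero, add_zero] at h1
    linarith
  have h3 : ‖u t‖ = 0 := by nlinarith [norm_nonneg (u t)]
  exact norm_eq_zero.1 h3

theorem IsData.sub {u₁ u₂ : ℝ → H} {G₁ g₁ G₂ g₂ : ℝ → K} {h₁ h₂ : ℝ → H}
    (d1 : IsData 𝒢 u₁ G₁ g₁ h₁) (d2 : IsData 𝒢 u₂ G₂ g₂ h₂) :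
    IsData 𝒢 (u₁ - u₂) (G₁ - G₂) (g₁ - g₂) (h₁ - h₂) where
  locInt := d1.locInt.sub d2.locInt
  gradL2 := d1.gradL2.sub d2.gradL2
  fluxL2 := d1.fluxL2.sub d2.fluxL2
  srcL2 := d1.srcL2.sub d2.srcL2
  mem := by
    filter_upwards [d1.mem, d2.mem] with t h1 h2
    exact 𝒢.sub_mem h1 h2
  weak χ hχ p hp := by
    have e1 := d1.weak χ hχ p hp
    have e2 := d2.weak χ hχ p hp
    have loc : ∀ {u g h}, LocallyIntegrable u → L2loc g → L2loc h →
        Integrable (fun t => _root_.deriv χ t * inner ℂ p.fst (u t)) ∧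
        Integrable (fun t => χ t * (inner ℂ p.snd (g t) + inner ℂ p.fst (h t))) :=
      fun {u g h} hu hg hh =>
      ⟨integrable_mul_test hχ.continuous_deriv hχ.2.deriv (locallyIntegrable_inner_const hu _),
        integrable_mul_test hχ.continuous hχ.2
        ((locallyIntegrable_inner_const hg.locallyIntegrable _).add
          (locallyIntegrable_inner_const hh.locallyIntegrable _))⟩
    have l1 := loc d1.locInt d1.fluxL2 d1.srcL2
    have l2 := loc d2.locInt d2.fluxL2 d2.srcL2
    have a1 : ∫ t, _root_.deriv χ t * inner ℂ p.fst ((u₁ - u₂) t) =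
        (∫ t, _root_.deriv χ t * inner ℂ p.fst (u₁ t)) -
          ∫ t, _root_.deriv χ t * inner ℂ p.fst (u₂ t) := by
      rw [← integral_sub l1.1 l2.1]
      congr 1 with t
      simp only [Pi.sub_apply, inner_sub_right]; ring
    have a2 : ∫ t, χ t * (inner ℂ p.snd ((g₁ - g₂) t) + inner ℂ p.fst ((h₁ - h₂) t)) =
        (∫ t, χ t * (inner ℂ p.snd (g₁ t) + inner ℂ p.fst (h₁ t))) -
          ∫ t, χ t * (inner ℂ p.snd (g₂ t) + inner ℂ p.fst (h₂ t)) := by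
      rw [← integral_sub l1.2 l2.2]
      congr 1 with t
      simp only [Pi.sub_apply, inner_sub_right]; ring
    rw [a1, a2, ← e1, ← e2]; ring

/-- Two solutions in the energy class with the same source agree. -/
theorem IsData.unique [SecondCountableTopology K] (hcl : IsClosed (𝒢 : Set (WithLp 2 (H × K))))
    (hinj : ∀ x : H, WithLp.toLp 2 (x, (0 : K)) ∈ 𝒢 → x = 0)
    (hB : IsEllipticFamily B M ν) (hν : 0 < ν) {u v : ℝ → H} {G F : ℝ → K} {f : ℝ → H}
    (hu : IsData 𝒢 u G (fun t => -(B t (G t))) f) (hG : MemLp G 2)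
    (hv : IsData 𝒢 v F (fun t => -(B t (F t))) f) (hF : MemLp F 2) : u =ᵐ[volume] v := by
  have hd := hu.sub hv
  rw [sub_self] at hd
  have hfl : (fun t => -(B t (G t))) - (fun t => -(B t (F t))) = fun t => -(B t ((G - F) t)) := by
    ext t; simp only [Pi.sub_apply, map_sub]; abel
  rw [hfl] at hd
  obtain ⟨w, hwc, hw⟩ := hd.exists_continuous hcl
  have h0 := (hd.congr hw).eq_zero hcl hinj hB hν hwc (hG.sub hF)
  filter_upwards [hw] with t ht
  rw [h0] at ht
  exact sub_eq_zero.1 ht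

/-- Duality between a solution and a solution of the time reversed adjoint problem. -/
theorem IsData.pairing (hcl : IsClosed (𝒢 : Set (WithLp 2 (H × K)))) {u v : ℝ → H} {G F : ℝ → K}
    {f g : ℝ → H} (hu : IsData 𝒢 u G (fun t => -(B t (G t))) f) (huc : Continuous u)
    (hv : IsData 𝒢 v F (fun t => -(revFamily B t (F t))) g) (hvc : Continuous v) {a b : ℝ}
    (hab : a ≤ b) :
    inner ℂ (v (-b)) (u b) - inner ℂ (v (-a)) (u a) =
      (∫ t in Icc a b, inner ℂ (v (-t)) (f t)) - ∫ t in Icc a b, inner ℂ (g (-t)) (u t) := by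
  -- The reflected v has flux B(t)⋆F(-t), so the two flux terms ⟨B⋆F, G⟩ and -⟨F, BG⟩ cancel and
  -- only the sources remain.
  have hp := (hv.reflect 0).product hcl hu (hvc.comp (by fun_prop)) huc hab
  simp only [zero_sub, neg_neg, revFamily, inner_neg_left, inner_neg_right,
    ContinuousLinearMap.adjoint_inner_left, integral_neg] at hp
  rw [hp]; ring

end Decay


/-! ### Weighted energy estimates -/

section Weighted

variable {H K : Type*} [NormedAddCommGroup H] [InnerProductSpace ℂ H] [CompleteSpace H]
  [NormedAddCommGroup K] [InnerProductSpace ℂ K] [CompleteSpace K]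
variable {B : ℝ → K →L[ℂ] K} {M ν : ℝ} {𝒢 : Submodule ℂ (WithLp 2 (H × K))}

/-- An abstract multiplication operator `m` on `H` and `K`, with commutator `N` controlled
by `m`. -/
structure IsMultiplier (𝒢 : Submodule ℂ (WithLp 2 (H × K))) (B : ℝ → K →L[ℂ] K) (m : H →L[ℂ] H)
    (m' : K →L[ℂ] K) (N : H →L[ℂ] K) (L : ℝ) : Prop where
  symm : ∀ x y, inner ℂ (m x) y = inner ℂ x (m y)
  symm' : ∀ x y, inner ℂ (m' x) y = inner ℂ x (m' y)
  comm : ∀ t g, m' (B t g) = B t (m' g)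
  bound : ∀ x, ‖N x‖ ≤ L * ‖m x‖
  commN : ∀ x, N (m x) = m' (N x)
  mem : ∀ x g, WithLp.toLp 2 (x, g) ∈ 𝒢 → WithLp.toLp 2 (m x, m' g + N x) ∈ 𝒢

theorem L2loc.clm_apply {F F' : Type*} [NormedAddCommGroup F] [NormedSpace ℂ F]
    [NormedAddCommGroup F'] [NormedSpace ℂ F'] {f : ℝ → F} (hf : L2loc f) (T : F →L[ℂ] F') :
    L2loc fun t => T (f t) := fun a b => T.comp_memLp' (hf a b)

/-- The weak equation is tested with m p, whose gradient is m' q + N p. Moving m and m' across by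
symmetry leaves the commutator term, which becomes the source N⋆g. -/
theorem IsData.mult {m : H →L[ℂ] H} {m' : K →L[ℂ] K} {N : H →L[ℂ] K} {L : ℝ}
    (hm : IsMultiplier 𝒢 B m m' N L) {u : ℝ → H} {G g : ℝ → K} {h : ℝ → H} (hc : Continuous u)
    (hu : IsData 𝒢 u G g h) :
    IsData 𝒢 (fun t => m (u t)) (fun t => m' (G t) + N (u t)) (fun t => m' (g t))
      (fun t => ContinuousLinearMap.adjoint N (g t) + m (h t)) where
  locInt := (m.continuous.comp hc).locallyIntegrable
  gradL2 := (hu.gradL2.clm_apply m').add (hc.l2loc.clm_apply N)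
  fluxL2 := hu.fluxL2.clm_apply m'
  srcL2 := (hu.fluxL2.clm_apply _).add (hu.srcL2.clm_apply m)
  mem := hu.mem.mono fun t ht => hm.mem _ _ ht
  weak χ hχ p hp := by
    have h1 := hu.weak χ hχ _ (hm.mem p.fst p.snd hp)
    simp only [WithLp.toLp_fst, WithLp.toLp_snd, inner_add_left, hm.symm, hm.symm'] at h1
    rw [h1]
    congr 1 with t
    rw [inner_add_right, ContinuousLinearMap.adjoint_inner_right]
    ring

theorem hasDerivAt_exp_mul (lam t : ℝ) :
    HasDerivAt (fun t : ℝ => ((Real.exp (-lam * t) : ℝ) : ℂ))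
      ((-lam * Real.exp (-lam * t) : ℝ) : ℂ) t := by
  have h1 : HasDerivAt (fun t : ℝ => Real.exp (-lam * t)) (Real.exp (-lam * t) * (-lam)) t := by
    simpa using ((hasDerivAt_id t).const_mul (-lam)).exp
  have := h1.ofReal_comp
  convert this using 2; ring

theorem L2loc.smul_continuous {F : Type*} [NormedAddCommGroup F] [NormedSpace ℂ F] {f : ℝ → F}
    (hf : L2loc f) {θ : ℝ → ℂ} (hθ : Continuous θ) : L2loc fun t => θ t • f t := by
  intro a b
  obtain ⟨C, hC⟩ := isCompact_Icc.exists_bound_of_continuousOn (hθ.continuousOn (s := Icc a b))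
  refine (hf a b).of_le_mul (c := C) (hθ.aestronglyMeasurable.smul (hf a b).1) ?_
  refine (ae_restrict_iff' measurableSet_Icc).2 (Eventually.of_forall fun t ht => ?_)
  rw [norm_smul]
  gcongr
  exact hC t ht

theorem IsData.expMul {u : ℝ → H} {G g : ℝ → K} {h : ℝ → H} (hc : Continuous u)
    (hu : IsData 𝒢 u G g h) (lam : ℝ) :
    IsData 𝒢 (fun t => ((Real.exp (-lam * t) : ℝ) : ℂ) • u t)
      (fun t => ((Real.exp (-lam * t) : ℝ) : ℂ) • G t)
      (fun t => ((Real.exp (-lam * t) : ℝ) : ℂ) • g t)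
      (fun t => ((Real.exp (-lam * t) : ℝ) : ℂ) • h t +
        ((-lam * Real.exp (-lam * t) : ℝ) : ℂ) • u t) := by
  have hθ : Continuous fun t : ℝ => ((Real.exp (-lam * t) : ℝ) : ℂ) := by fun_prop
  have hθ' : Continuous fun t : ℝ => ((-lam * Real.exp (-lam * t) : ℝ) : ℂ) := by fun_prop
  refine ⟨(hθ.smul hc).locallyIntegrable, hu.gradL2.smul_continuous hθ,
    hu.fluxL2.smul_continuous hθ, (hu.srcL2.smul_continuous hθ).add
    (hc.l2loc.smul_continuous hθ'), hu.mem.mono fun t ht => 𝒢.smul_mem _ ht, fun χ hχ p hp => ?_⟩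
  have hsm : ContDiff ℝ ((⊤ : ℕ∞) : WithTop ℕ∞) fun t : ℝ => ((Real.exp (-lam * t) : ℝ) : ℂ) :=
    Complex.ofRealCLM.contDiff.comp (Real.contDiff_exp.comp (contDiff_const.mul contDiff_id))
  have hχθ : IsTest fun t => χ t * ((Real.exp (-lam * t) : ℝ) : ℂ) :=
    ⟨hχ.1.mul hsm, hχ.2.mul_right⟩
  have h1 := hu.weak _ hχθ p hp
  have hd : ∀ t, _root_.deriv (fun t => χ t * ((Real.exp (-lam * t) : ℝ) : ℂ)) t =
      _root_.deriv χ t * ((Real.exp (-lam * t) : ℝ) : ℂ) +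
        χ t * ((-lam * Real.exp (-lam * t) : ℝ) : ℂ) := fun t =>
    ((hχ.hasDerivAt t).mul (hasDerivAt_exp_mul lam t)).deriv
  simp only [hd] at h1
  have l1 := locallyIntegrable_inner_const hu.locInt p.fst
  have l2 := locallyIntegrable_inner_const hu.fluxL2.locallyIntegrable p.snd
  have l3 := locallyIntegrable_inner_const hu.srcL2.locallyIntegrable p.fst
  have i1 : Integrable fun t => (_root_.deriv χ t * ((Real.exp (-lam * t) : ℝ) : ℂ)) *
      inner ℂ p.fst (u t) :=
    integrable_mul_test (hχ.continuous_deriv.mul hθ) hχ.2.deriv.mul_right l1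
  have i2 : Integrable fun t => (χ t * ((-lam * Real.exp (-lam * t) : ℝ) : ℂ)) *
      inner ℂ p.fst (u t) :=
    integrable_mul_test (hχ.continuous.mul hθ') hχ.2.mul_right l1
  have i3 : Integrable fun t => (χ t * ((Real.exp (-lam * t) : ℝ) : ℂ)) *
      (inner ℂ p.snd (g t) + inner ℂ p.fst (h t)) :=
    integrable_mul_test (hχ.continuous.mul hθ) hχ.2.mul_right (l2.add l3)
  simp only [add_mul] at h1
  rw [integral_add i1 i2] at h1
  have e1 : ∫ t, χ t * (inner ℂ p.snd (((Real.exp (-lam * t) : ℝ) : ℂ) • g t) +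
      inner ℂ p.fst (((Real.exp (-lam * t) : ℝ) : ℂ) • h t +
        ((-lam * Real.exp (-lam * t) : ℝ) : ℂ) • u t)) =
      (∫ t, (χ t * ((Real.exp (-lam * t) : ℝ) : ℂ)) * (inner ℂ p.snd (g t) + inner ℂ p.fst (h t))) +
        ∫ t, (χ t * ((-lam * Real.exp (-lam * t) : ℝ) : ℂ)) * inner ℂ p.fst (u t) := by
    rw [← integral_add i3 i2]
    congr 1 with t
    simp only [inner_add_right, inner_smul_right]; ring
  rw [e1, ← h1]
  have e2 : ∫ t, _root_.deriv χ t * inner ℂ p.fst (((Real.exp (-lam * t) : ℝ) : ℂ) • u t) =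
      ∫ t, (_root_.deriv χ t * ((Real.exp (-lam * t) : ℝ) : ℂ)) * inner ℂ p.fst (u t) := by
    congr 1 with t
    rw [inner_smul_right]; ring
  rw [e2]; ring

/-- Coercivity is applied to m' g. The two commutator terms are each at most M L ‖m' g‖ ‖m x‖, and
Young's inequality absorbs them into half of the coercivity. The leftover 2(ML)²/ν ‖m x‖² is what
the exponential damping in time will cancel. -/
theorem weighted_pointwise (hB : IsEllipticFamily B M ν) (hM : 0 ≤ M) (hν : 0 < ν) {m : H →L[ℂ] H}
    {m' : K →L[ℂ] K} {N : H →L[ℂ] K} {L : ℝ} (hm : IsMultiplier 𝒢 B m m' N L) (t : ℝ)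
    (x f : H) (g : K) :
    (inner ℂ (m' (-(B t g))) (m' g + N x)).re +
      (inner ℂ (ContinuousLinearMap.adjoint N (-(B t g)) + m f) (m x)).re -
        (2 * (M * L) ^ 2 / ν) * ‖m x‖ ^ 2 ≤ -(ν / 2) * ‖m' g‖ ^ 2 + ‖m f‖ * ‖m x‖ := by
  have e1 : (inner ℂ (m' (-(B t g))) (m' g) : ℂ).re ≤ -(ν * ‖m' g‖ ^ 2) := by
    have h := hB.lower t (m' g)
    rw [← inner_conj_symm, Complex.conj_re] at h
    rw [map_neg, hm.comm, inner_neg_left, Complex.neg_re]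
    linarith
  have hNx := hm.bound x
  have hBm := hB.upper t (m' g)
  have hprod : ‖B t (m' g)‖ * ‖N x‖ ≤ (M * ‖m' g‖) * (L * ‖m x‖) := by gcongr
  have e2 : (inner ℂ (m' (-(B t g))) (N x) : ℂ).re ≤ (M * ‖m' g‖) * (L * ‖m x‖) := by
    refine (Complex.re_le_norm _).trans ((norm_inner_le_norm _ _).trans ?_)
    rw [map_neg, hm.comm, norm_neg]
    exact hprod
  have e3 : (inner ℂ (ContinuousLinearMap.adjoint N (-(B t g))) (m x) : ℂ).re ≤
      (M * ‖m' g‖) * (L * ‖m x‖) := by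
    refine (Complex.re_le_norm _).trans ?_
    rw [ContinuousLinearMap.adjoint_inner_left, hm.commN, ← hm.symm', map_neg, hm.comm]
    refine (norm_inner_le_norm _ _).trans ?_
    rw [norm_neg]
    exact hprod
  have e4 : (inner ℂ (m f) (m x) : ℂ).re ≤ ‖m f‖ * ‖m x‖ :=
    (Complex.re_le_norm _).trans (norm_inner_le_norm _ _)
  have e5 : 2 * ((M * ‖m' g‖) * (L * ‖m x‖)) ≤
      ν / 2 * ‖m' g‖ ^ 2 + (2 * (M * L) ^ 2 / ν) * ‖m x‖ ^ 2 := by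
    have h1 := sq_nonneg (ν * ‖m' g‖ - 2 * (M * L) * ‖m x‖)
    have h2 : ν / 2 * ‖m' g‖ ^ 2 + (2 * (M * L) ^ 2 / ν) * ‖m x‖ ^ 2 -
        2 * ((M * ‖m' g‖) * (L * ‖m x‖)) = (ν * ‖m' g‖ - 2 * (M * L) * ‖m x‖) ^ 2 / (2 * ν) := by
      field_simp; ring
    have h3 : 0 ≤ (ν * ‖m' g‖ - 2 * (M * L) * ‖m x‖) ^ 2 / (2 * ν) := by positivity
    linarith
  rw [inner_add_right, inner_add_left, Complex.add_re, Complex.add_re]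
  linarith

theorem re_inner_real_smul {F : Type*} [NormedAddCommGroup F] [InnerProductSpace ℂ F] (c d : ℝ)
    (x y : F) :
    RCLike.re (inner ℂ ((c : ℂ) • x) ((d : ℂ) • y) : ℂ) = c * d * RCLike.re (inner ℂ x y : ℂ) := by
  rw [inner_smul_left, inner_smul_right, Complex.conj_ofReal, ← mul_assoc, ← Complex.ofReal_mul]
  simp

/-- The weighted energy estimate for solutions starting from `0` at time `a`. -/
theorem IsData.weighted_energy [SecondCountableTopology K]
    (hcl : IsClosed (𝒢 : Set (WithLp 2 (H × K)))) (hB : IsEllipticFamily B M ν) (hM : 0 ≤ M)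
    (hν : 0 < ν) {m : H →L[ℂ] H} {m' : K →L[ℂ] K} {N : H →L[ℂ] K} {L : ℝ}
    (hm : IsMultiplier 𝒢 B m m' N L) {u : ℝ → H} {G : ℝ → K} {f : ℝ → H}
    (hu : IsData 𝒢 u G (fun t => -(B t (G t))) f) (hc : Continuous u) {a b : ℝ} (hab : a ≤ b)
    (ha : u a = 0) :
    ∫ t in Icc a b, ‖m' (G t)‖ ^ 2 ≤
      4 / ν * Real.exp (2 * (2 * (M * L) ^ 2 / ν) * (b - a)) * (∫ t in Icc a b, ‖m (f t)‖) ^ 2 := by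
  -- The damping rate equals the leftover coefficient in `weighted_pointwise`; with U = exp(-λt) m u
  -- the energy balance has no zero order term.
  set lam : ℝ := 2 * (M * L) ^ 2 / ν with hlam
  have hlam0 : 0 ≤ lam := by positivity
  set θ : ℝ → ℝ := fun t => Real.exp (-lam * t) with hθ
  have hθ0 : ∀ t, 0 < θ t := fun t => Real.exp_pos _
  have hθc : Continuous θ := by fun_prop
  have hmc : Continuous fun t => m (u t) := m.continuous.comp hc
  have hd := (hu.mult hm hc).expMul hmc lam
  set U : ℝ → H := fun t => ((θ t : ℝ) : ℂ) • m (u t) with hU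
  have hUc : Continuous U := by fun_prop
  have hUn : ∀ t, ‖U t‖ = θ t * ‖m (u t)‖ := fun t => by
    rw [hU, norm_smul, Complex.norm_real, Real.norm_of_nonneg (hθ0 t).le]
  obtain ⟨t₀, ht₀, hmax⟩ := isCompact_Icc.exists_isMaxOn (nonempty_Icc.2 hab) hUc.norm.continuousOn
  set S := ‖U t₀‖ with hS
  set J := ∫ t in Icc a b, θ t * ‖m (f t)‖ with hJ
  have hmf : ∀ c d, IntegrableOn (fun t => ‖m (f t)‖) (Icc c d) := fun c d =>
    ((hu.srcL2.clm_apply m).integrableOn c d).norm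
  have hθmf : ∀ c d, IntegrableOn (fun t => θ t * ‖m (f t)‖) (Icc c d) := fun c d =>
    (hmf c d).continuousOn_mul hθc.continuousOn isCompact_Icc
  have hmG : ∀ c d, IntegrableOn (fun t => ‖m' (G t)‖ ^ 2) (Icc c d) := fun c d =>
    ((hu.gradL2.clm_apply m') c d).integrable_norm_pow (p := 2) (by norm_num)
  have hθmG : ∀ c d, IntegrableOn (fun t => θ t ^ 2 * ‖m' (G t)‖ ^ 2) (Icc c d) := fun c d =>
    (hmG c d).continuousOn_mul (hθc.pow 2).continuousOn isCompact_Icc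
  have key : ∀ τ ∈ Icc a b, ‖U τ‖ ^ 2 + ν * ∫ t in Icc a τ, θ t ^ 2 * ‖m' (G t)‖ ^ 2 ≤ 2 * S * J := by
    intro τ hτ
    have hp := congrArg Complex.re (hd.product hcl hd hUc hUc hτ.1)
    have i1 := integrable_inner (hd.fluxL2 a τ) (hd.gradL2 a τ)
    have i2 := integrable_inner (hd.srcL2 a τ) (hUc.l2loc a τ)
    have i3 := integrable_inner (hd.gradL2 a τ) (hd.fluxL2 a τ)
    have i4 := integrable_inner (hUc.l2loc a τ) (hd.srcL2 a τ)
    simp only [Complex.add_re, Complex.sub_re] at hp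
    simp only [← RCLike.re_eq_complex_re] at hp
    have hUa : U a = 0 := by rw [hU]; simp [ha]
    rw [← integral_re i1, ← integral_re i2, ← integral_re i3, ← integral_re i4,
      inner_self_eq_norm_sq, inner_self_eq_norm_sq] at hp
    have e3 : ∀ t, RCLike.re (inner ℂ (((θ t : ℝ) : ℂ) • (m' (G t) + N (u t)))
        (((θ t : ℝ) : ℂ) • m' (-(B t (G t)))) : ℂ) = RCLike.re (inner ℂ
        (((θ t : ℝ) : ℂ) • m' (-(B t (G t)))) (((θ t : ℝ) : ℂ) • (m' (G t) + N (u t))) : ℂ) :=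
      fun t => inner_re_symm _ _
    have e4 : ∀ t, RCLike.re (inner ℂ (U t) (((θ t : ℝ) : ℂ) •
        (ContinuousLinearMap.adjoint N (-(B t (G t))) + m (f t)) +
          ((-lam * θ t : ℝ) : ℂ) • m (u t)) : ℂ) = RCLike.re (inner ℂ (((θ t : ℝ) : ℂ) •
        (ContinuousLinearMap.adjoint N (-(B t (G t))) + m (f t)) +
          ((-lam * θ t : ℝ) : ℂ) • m (u t)) (U t) : ℂ) :=
      fun t => inner_re_symm _ _
    simp only [hUa, norm_zero] at hp
    simp only [hθ] at e3 e4
    simp only [e3, e4] at hp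
    have hpt : ∀ t ∈ Icc a τ, RCLike.re (inner ℂ (((θ t : ℝ) : ℂ) • m' (-(B t (G t))))
        (((θ t : ℝ) : ℂ) • (m' (G t) + N (u t))) : ℂ) +
        RCLike.re (inner ℂ (((θ t : ℝ) : ℂ) •
        (ContinuousLinearMap.adjoint N (-(B t (G t))) + m (f t)) +
          ((-lam * θ t : ℝ) : ℂ) • m (u t)) (U t) : ℂ) ≤
        -(ν / 2) * (θ t ^ 2 * ‖m' (G t)‖ ^ 2) + S * (θ t * ‖m (f t)‖) := by
      intro t ht
      have hw := weighted_pointwise hB hM hν hm t (u t) (f t) (G t)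
      have hle : ‖U t‖ ≤ S := hmax ⟨ht.1, ht.2.trans hτ.2⟩
      rw [hUn] at hle
      have hUt : U t = ((θ t : ℝ) : ℂ) • m (u t) := rfl
      rw [hUt, inner_add_left, map_add, re_inner_real_smul, re_inner_real_smul,
        re_inner_real_smul, inner_self_eq_norm_sq]
      have hm2 : θ t * θ t * (‖m (f t)‖ * ‖m (u t)‖) ≤ S * (θ t * ‖m (f t)‖) := by
        have := mul_le_mul_of_nonneg_right hle
          (mul_nonneg (hθ0 t).le (norm_nonneg (m (f t))))
        nlinarith
      have hmul := mul_le_mul_of_nonneg_left hw (mul_nonneg (hθ0 t).le (hθ0 t).le)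
      simp only [RCLike.re_eq_complex_re]
      nlinarith
    have hint := setIntegral_mono_on (i1.re.add i2.re)
      (((hθmG a τ).const_mul (-(ν / 2))).add ((hθmf a τ).const_mul S)) measurableSet_Icc hpt
    simp only [Pi.add_apply] at hint
    rw [integral_add i1.re i2.re, integral_add ((hθmG a τ).const_mul _) ((hθmf a τ).const_mul S),
      integral_const_mul, integral_const_mul] at hint
    have hJτ : ∫ t in Icc a τ, θ t * ‖m (f t)‖ ≤ J :=
      setIntegral_mono_set (hθmf a b) (Eventually.of_forall fun t =>
        mul_nonneg (hθ0 t).le (norm_nonneg _)) (Icc_subset_Icc_right hτ.2).eventuallyLE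
    have hSJ : S * ∫ t in Icc a τ, θ t * ‖m (f t)‖ ≤ S * J :=
      mul_le_mul_of_nonneg_left hJτ (norm_nonneg _)
    linarith
  have hJ0 : 0 ≤ J := integral_nonneg fun t => mul_nonneg (hθ0 t).le (norm_nonneg _)
  have hS0 : 0 ≤ S := norm_nonneg _
  -- At the time of the maximum the estimate reads S² ≤ 2SJ; the gradient term is nonnegative and is
  -- dropped.
  have hSJ : S ≤ 2 * J := by
    have h1 := key t₀ ht₀
    have h2 : 0 ≤ ν * ∫ t in Icc a t₀, θ t ^ 2 * ‖m' (G t)‖ ^ 2 :=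
      mul_nonneg hν.le (integral_nonneg fun _ => by positivity)
    by_contra! hlt
    have : S ^ 2 ≤ 2 * S * J := by rw [hS] at h1 ⊢; linarith
    nlinarith
  have hfin : ν * ∫ t in Icc a b, θ t ^ 2 * ‖m' (G t)‖ ^ 2 ≤ 4 * J ^ 2 := by
    have h1 := key b ⟨hab, le_rfl⟩
    nlinarith [sq_nonneg ‖U b‖]
  have hJle : J ≤ Real.exp (-lam * a) * ∫ t in Icc a b, ‖m (f t)‖ := by
    rw [← integral_const_mul]
    refine setIntegral_mono_on (hθmf a b) ((hmf a b).const_mul _) measurableSet_Icc fun t ht => ?_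
    gcongr
    simp only [hθ]
    apply Real.exp_le_exp.2
    nlinarith [ht.1]
  have hGle : Real.exp (-lam * b) ^ 2 * ∫ t in Icc a b, ‖m' (G t)‖ ^ 2 ≤
      ∫ t in Icc a b, θ t ^ 2 * ‖m' (G t)‖ ^ 2 := by
    rw [← integral_const_mul]
    refine setIntegral_mono_on ((hmG a b).const_mul _) (hθmG a b) measurableSet_Icc fun t ht => ?_
    gcongr
    simp only [hθ]
    apply Real.exp_le_exp.2
    nlinarith [ht.2]
  set X := ∫ t in Icc a b, ‖m' (G t)‖ ^ 2
  set Y := ∫ t in Icc a b, ‖m (f t)‖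
  have hY0 : 0 ≤ Y := integral_nonneg fun _ => norm_nonneg _
  have h1 : ν * (Real.exp (-lam * b) ^ 2 * X) ≤ 4 * (Real.exp (-lam * a) * Y) ^ 2 := by
    have : J ^ 2 ≤ (Real.exp (-lam * a) * Y) ^ 2 := by gcongr
    have := mul_le_mul_of_nonneg_left hGle hν.le
    linarith
  have h2 : Real.exp (2 * lam * (b - a)) * Real.exp (-lam * b) ^ 2 = Real.exp (-lam * a) ^ 2 := by
    rw [← Real.exp_nat_mul, ← Real.exp_nat_mul, ← Real.exp_add]; congr 1; push_cast; ring
  have hpos : 0 < Real.exp (-lam * b) ^ 2 := by positivity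
  rw [← mul_le_mul_iff_right₀ (mul_pos hν hpos)]
  calc ν * Real.exp (-lam * b) ^ 2 * X ≤ 4 * (Real.exp (-lam * a) * Y) ^ 2 := by linarith
    _ = 4 * (Real.exp (-lam * a) ^ 2) * Y ^ 2 := by ring
    _ = ν * Real.exp (-lam * b) ^ 2 * (4 / ν * Real.exp (2 * lam * (b - a)) * Y ^ 2) := by
      rw [← h2]; field_simp

/-- A fixed element of the domain is stationary data with zero flux. The product rule with it
describes how its pairing with a solution evolves. -/
theorem isData_const {p : WithLp 2 (H × K)} (hp : p ∈ 𝒢) :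
    IsData 𝒢 (fun _ => p.fst) (fun _ => p.snd) 0 0 where
  locInt := continuous_const.locallyIntegrable
  gradL2 := continuous_const.l2loc
  fluxL2 := continuous_const.l2loc
  srcL2 := continuous_const.l2loc
  mem := Eventually.of_forall fun _ => hp
  weak χ hχ q hq := by
    simp only [Pi.zero_apply, inner_zero_right, add_zero, mul_zero, integral_zero]
    rw [integral_mul_const, integral_eq_zero_of_hasDerivAt_of_integrable hχ.hasDerivAt]
    · simp
    · exact hχ.continuous_deriv.integrable_of_hasCompactSupport hχ.2.deriv
    · exact hχ.continuous.integrable_of_hasCompactSupport hχ.2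

/-- Approximate conservation of the pairing with a fixed element `p` of the domain. -/
theorem IsData.pairing_const_le [SecondCountableTopology K]
    (hcl : IsClosed (𝒢 : Set (WithLp 2 (H × K)))) (hB : IsEllipticFamily B M ν) (hM : 0 ≤ M)
    (hν : 0 < ν) {m : H →L[ℂ] H} {m' : K →L[ℂ] K} {N : H →L[ℂ] K} {L : ℝ}
    (hm : IsMultiplier 𝒢 B m m' N L) {u : ℝ → H} {G : ℝ → K} {f : ℝ → H}
    (hu : IsData 𝒢 u G (fun t => -(B t (G t))) f) (hc : Continuous u) {a b : ℝ} (hab : a ≤ b)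
    (ha : u a = 0) {p : H} {q : K} (hp : WithLp.toLp 2 (p, m' q) ∈ 𝒢) :
    ‖inner ℂ p (u b) - ∫ t in Icc a b, inner ℂ p (f t)‖ ≤
      M * ‖q‖ * √(b - a) * √(4 / ν * Real.exp (2 * (2 * (M * L) ^ 2 / ν) * (b - a))) *
        ∫ t in Icc a b, ‖m (f t)‖ := by
  have h1 := (isData_const hp).product hcl hu continuous_const hc hab
  simp only [Pi.zero_apply, inner_zero_left, integral_zero, zero_add, WithLp.toLp_fst,
    WithLp.toLp_snd, ha, inner_zero_right, sub_zero] at h1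
  rw [h1, add_sub_cancel_right]
  have hE := hu.weighted_energy hcl hB hM hν hm hc hab ha
  have hl := hu.gradL2.clm_apply m' a b
  have hcs := integral_norm_mul_norm_le hl ((continuous_const (y := (1 : ℝ))).l2loc a b)
  have n1 : (eLpNorm (fun t => m' (G t)) 2 (volume.restrict (Icc a b))).toReal ^ 2 =
      ∫ t in Icc a b, ‖m' (G t)‖ ^ 2 := by
    have hm2 : AEStronglyMeasurable (fun t => ‖m' (G t)‖ ^ 2) (volume.restrict (Icc a b)) :=
      hl.1.norm.pow 2
    rw [← ENNReal.toReal_pow, eLpNorm_two_sq, integral_eq_lintegral_of_nonneg_ae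
      (Eventually.of_forall fun _ => sq_nonneg _) hm2]
    congr 1
    refine lintegral_congr fun t => ?_
    rw [ENNReal.ofReal_pow (norm_nonneg _), ofReal_norm]
  have n2 : (eLpNorm (fun _ : ℝ => (1 : ℝ)) 2 (volume.restrict (Icc a b))).toReal ^ 2 = b - a := by
    rw [← ENNReal.toReal_pow, eLpNorm_two_sq]
    simp [ENNReal.toReal_ofReal (sub_nonneg.2 hab)]
  have n1' : (eLpNorm (fun t => m' (G t)) 2 (volume.restrict (Icc a b))).toReal =
      √(∫ t in Icc a b, ‖m' (G t)‖ ^ 2) := by rw [← n1, Real.sqrt_sq ENNReal.toReal_nonneg]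
  have n2' : (eLpNorm (fun _ : ℝ => (1 : ℝ)) 2 (volume.restrict (Icc a b))).toReal = √(b - a) := by
    rw [← n2, Real.sqrt_sq ENNReal.toReal_nonneg]
  simp only [norm_one, mul_one] at hcs
  rw [n1', n2'] at hcs
  set Y := ∫ t in Icc a b, ‖m (f t)‖
  have hY0 : 0 ≤ Y := integral_nonneg fun _ => norm_nonneg _
  -- The gradient of p is m' q, so the weight moves onto the flux, where the weighted energy
  -- estimate applies, while only the unweighted norm of q remains.
  have hb := norm_integral_le_of_norm_le (f := fun t => inner ℂ (m' q) (-(B t (G t))))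
    (g := fun t => M * ‖q‖ * ‖m' (G t)‖) (hcs.1.const_mul (M * ‖q‖))
    (Eventually.of_forall fun t => by
      rw [hm.symm', map_neg, hm.comm]
      refine (norm_inner_le_norm _ _).trans ?_
      rw [norm_neg]
      have := hB.upper t (m' (G t))
      calc ‖q‖ * ‖B t (m' (G t))‖ ≤ ‖q‖ * (M * ‖m' (G t)‖) := by gcongr
        _ = _ := by ring)
  rw [integral_const_mul] at hb
  have hsq : √(∫ t in Icc a b, ‖m' (G t)‖ ^ 2) ≤
      √(4 / ν * Real.exp (2 * (2 * (M * L) ^ 2 / ν) * (b - a))) * Y := by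
    refine (Real.sqrt_le_sqrt hE).trans (le_of_eq ?_)
    rw [Real.sqrt_mul (by positivity), Real.sqrt_sq hY0]
  refine hb.trans ?_
  calc M * ‖q‖ * ∫ t in Icc a b, ‖m' (G t)‖
      ≤ M * ‖q‖ * (√(∫ t in Icc a b, ‖m' (G t)‖ ^ 2) * √(b - a)) := by gcongr; exact hcs.2
    _ ≤ M * ‖q‖ * ((√(4 / ν * Real.exp (2 * (2 * (M * L) ^ 2 / ν) * (b - a))) * Y) * √(b - a)) := by
      gcongr
    _ = _ := by ring

end Weighted


/-! ### Muckenhoupt weights -/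

section Weights

variable {n : ℕ} {ω : E n → ℝ}

theorem cube_eq_preimage (a : E n) (r : ℝ) :
    cube a r = WithLp.ofLp ⁻¹' (Icc a.ofLp (fun i => a i + r)) := by
  ext x
  simp only [cube, mem_ofPred_eq, mem_preimage, mem_Icc, Pi.le_def]
  exact forall_and

theorem volume_cube (a : E n) {r : ℝ} (hr : 0 ≤ r) : volume (cube a r) = ENNReal.ofReal (r ^ n) := by
  rw [cube_eq_preimage, (PiLp.volume_preserving_ofLp (Fin n)).measure_preimage
    measurableSet_Icc.nullMeasurableSet, Real.volume_Icc_pi]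
  simp [ENNReal.ofReal_pow hr]

theorem ball_subset_cube (x : E n) (r : ℝ) :
    Metric.ball x r ⊆ cube (WithLp.toLp 2 fun i => x i - r) (2 * r) := by
  intro y hy i
  have h1 := PiLp.norm_apply_le (y - x) i
  rw [Metric.mem_ball, dist_eq_norm] at hy
  have h2 := abs_le.1 ((h1.trans hy.le : |y i - x i| ≤ r))
  simp only [PiLp.sub_apply] at h2
  simp only
  constructor <;> linarith

theorem volume_ball_eq (x : E n) {r : ℝ} (hr : 0 < r) :
    volume (Metric.ball x r) = ENNReal.ofReal (r ^ n) * volume (Metric.ball (0 : E n) 1) := by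
  rw [Measure.addHaar_ball_of_pos _ _ hr]; simp

theorem IsA2Weight.inv (hω : IsA2Weight ω) : IsA2Weight fun x => (ω x)⁻¹ where
  meas := hω.meas.inv
  pos x := inv_pos.2 (hω.pos x)
  finite := by
    have h := hω.finite
    unfold a2Const at h ⊢
    simpa only [inv_inv, mul_comm] using h

theorem IsA2Weight.aemeasurable_ofReal (hω : IsA2Weight ω) :
    AEMeasurable fun x => ENNReal.ofReal (ω x) := hω.meas.ennreal_ofReal

theorem IsA2Weight.ofReal_mul_inv (hω : IsA2Weight ω) (x : E n) :
    ENNReal.ofReal (ω x) * ENNReal.ofReal (ω x)⁻¹ = 1 := by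
  rw [← ENNReal.ofReal_mul (hω.pos x).le, mul_inv_cancel₀ (hω.pos x).ne', ENNReal.ofReal_one]

theorem wMeasure_absolutelyContinuous : wMeasure ω ≪ volume := withDensity_absolutelyContinuous _ _

theorem IsA2Weight.absolutelyContinuous (hω : IsA2Weight ω) : volume ≪ wMeasure ω :=
  withDensity_absolutelyContinuous' hω.aemeasurable_ofReal (Eventually.of_forall fun x => by
    simpa using hω.pos x)

theorem IsA2Weight.ae_eq (hω : IsA2Weight ω) : ae (wMeasure ω) = ae volume :=
  le_antisymm wMeasure_absolutelyContinuous.ae_le hω.absolutelyContinuous.ae_le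

theorem setLIntegral_cube_mul_le (a : E n) {r : ℝ} (hr : 0 < r) :
    (∫⁻ x in cube a r, ENNReal.ofReal (ω x)) * (∫⁻ x in cube a r, ENNReal.ofReal (ω x)⁻¹) ≤
      a2Const ω * volume (cube a r) ^ 2 := by
  have h1 : ((volume (cube a r))⁻¹ * ∫⁻ x in cube a r, ENNReal.ofReal (ω x)) *
      ((volume (cube a r))⁻¹ * ∫⁻ x in cube a r, ENNReal.ofReal ((ω x)⁻¹)) ≤ a2Const ω :=
    le_iSup_of_le a (le_iSup_of_le r (le_iSup_of_le hr le_rfl))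
  set V := volume (cube a r) with hV
  have hV0 : V ≠ 0 := by rw [hV, volume_cube a hr.le]; simpa using pow_pos hr n
  have hVt : V ≠ ∞ := by rw [hV, volume_cube a hr.le]; exact ENNReal.ofReal_ne_top
  calc _ = ((V⁻¹ * ∫⁻ x in cube a r, ENNReal.ofReal (ω x)) *
      (V⁻¹ * ∫⁻ x in cube a r, ENNReal.ofReal ((ω x)⁻¹))) * V ^ 2 := by
        have : V⁻¹ * V = 1 := ENNReal.inv_mul_cancel hV0 hVt
        calc _ = (V⁻¹ * V) * (V⁻¹ * V) * ((∫⁻ x in cube a r, ENNReal.ofReal (ω x)) *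
              (∫⁻ x in cube a r, ENNReal.ofReal (ω x)⁻¹)) := by rw [this]; simp
          _ = _ := by ring
    _ ≤ _ := by gcongr

theorem IsA2Weight.setLIntegral_ne_zero (hω : IsA2Weight ω) {s : Set (E n)} (hs : volume s ≠ 0) :
    ∫⁻ x in s, ENNReal.ofReal (ω x) ≠ 0 := by
  intro h
  rw [lintegral_eq_zero_iff' hω.aemeasurable_ofReal.restrict] at h
  have h2 : ∀ᵐ x ∂(volume.restrict s), False := h.mono fun x hx => by
    have := hω.pos x
    simp only [Pi.zero_apply, ENNReal.ofReal_eq_zero] at hx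
    linarith
  rw [Filter.eventually_false_iff_eq_bot, ae_eq_bot, Measure.restrict_eq_zero] at h2
  exact hs h2

/-- Local integrability is not assumed separately. It follows because the A₂ product is finite and
the integral of ω⁻¹ over a cube is not zero. -/
theorem IsA2Weight.lintegral_cube_ne_top (hω : IsA2Weight ω) (a : E n) {r : ℝ} (hr : 0 < r) :
    ∫⁻ x in cube a r, ENNReal.ofReal (ω x) ≠ ∞ := by
  intro h
  have h1 := setLIntegral_cube_mul_le (ω := ω) a hr
  have h2 := hω.inv.setLIntegral_ne_zero (s := cube a r)
    (by rw [volume_cube a hr.le]; simpa using pow_pos hr n)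
  rw [h, ENNReal.top_mul h2, top_le_iff, volume_cube a hr.le] at h1
  exact ENNReal.mul_ne_top hω.finite.ne (by simp) h1

theorem IsA2Weight.ball_lt_top (hω : IsA2Weight ω) (x : E n) {r : ℝ} :
    wMeasure ω (Metric.ball x r) < ∞ := by
  rcases le_or_gt r 0 with hr | hr
  · simp [Metric.ball_eq_empty.2 hr]
  rw [wMeasure, withDensity_apply _ measurableSet_ball]
  exact (lintegral_mono_set (ball_subset_cube x r)).trans_lt
    (hω.lintegral_cube_ne_top _ (by positivity)).lt_top

theorem IsA2Weight.ball_pos (hω : IsA2Weight ω) (x : E n) {r : ℝ} (hr : 0 < r) :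
    0 < wMeasure ω (Metric.ball x r) := by
  rw [wMeasure, withDensity_apply _ measurableSet_ball]
  exact (hω.setLIntegral_ne_zero (Metric.measure_ball_pos volume x hr).ne').bot_lt

theorem IsA2Weight.isLocallyFiniteMeasure (hω : IsA2Weight ω) :
    IsLocallyFiniteMeasure (wMeasure ω) :=
  ⟨fun x => ⟨Metric.ball x 1, Metric.ball_mem_nhds x one_pos, hω.ball_lt_top x⟩⟩

/-- The constant of the `A₂` condition on balls. -/
def ballConst (ω : E n → ℝ) : ℝ≥0∞ :=
  a2Const ω * (ENNReal.ofReal (2 ^ n) / volume (Metric.ball (0 : E n) 1)) ^ 2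

theorem IsA2Weight.ballConst_ne_top (hω : IsA2Weight ω) : ballConst ω ≠ ∞ := by
  refine ENNReal.mul_ne_top hω.finite.ne (ENNReal.pow_ne_top (ENNReal.div_ne_top ?_ ?_))
  · exact ENNReal.ofReal_ne_top
  · exact (Metric.measure_ball_pos volume _ one_pos).ne'

/-- The ball sits in a cube of side 2r, whose volume is 2ⁿ/|B₁| times that of the ball; this ratio
occurs squared in `ballConst`. -/
theorem wMeasure_ball_mul_le (x : E n) {r : ℝ} (hr : 0 < r) :
    wMeasure ω (Metric.ball x r) * wMeasure (fun x => (ω x)⁻¹) (Metric.ball x r) ≤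
      ballConst ω * volume (Metric.ball x r) ^ 2 := by
  set c := volume (Metric.ball (0 : E n) 1) with hc
  have hc0 : c ≠ 0 := (Metric.measure_ball_pos volume _ one_pos).ne'
  have hct : c ≠ ∞ := measure_ball_lt_top.ne
  rw [wMeasure, wMeasure, withDensity_apply _ measurableSet_ball,
    withDensity_apply _ measurableSet_ball]
  refine (mul_le_mul' (lintegral_mono_set (ball_subset_cube x r))
    (lintegral_mono_set (ball_subset_cube x r))).trans
    ((setLIntegral_cube_mul_le _ (by positivity)).trans (le_of_eq ?_))
  rw [volume_cube _ (by positivity), volume_ball_eq x hr, ballConst, mul_assoc, ← mul_pow, ← hc]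
  congr 2
  rw [mul_pow, ENNReal.ofReal_mul (by positivity), mul_comm (ENNReal.ofReal (r ^ n)), ← mul_assoc,
    ENNReal.div_mul_cancel hc0 hct]

/-- Cauchy–Schwarz applied to 1 = √ω · (√ω)⁻¹. It is the converse direction to A₂ and turns that
condition into a comparison of ω with volume. -/
theorem IsA2Weight.volume_sq_le (hω : IsA2Weight ω) {s : Set (E n)} (hs : MeasurableSet s) :
    volume s ^ 2 ≤ wMeasure ω s * wMeasure (fun x => (ω x)⁻¹) s := by
  have h := lintegral_mul_sq_le (μ := volume.restrict s)
    (f := fun x => ENNReal.ofReal (√(ω x))) (g := fun x => ENNReal.ofReal ((√(ω x))⁻¹))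
    hω.meas.sqrt.ennreal_ofReal.restrict hω.meas.sqrt.inv.ennreal_ofReal.restrict
  have e1 : ∀ x, ENNReal.ofReal (√(ω x)) * ENNReal.ofReal (√(ω x))⁻¹ = 1 := fun x => by
    have := Real.sqrt_pos.2 (hω.pos x)
    rw [← ENNReal.ofReal_mul this.le, mul_inv_cancel₀ this.ne', ENNReal.ofReal_one]
  have e2 : ∀ x, ENNReal.ofReal (√(ω x)) ^ 2 = ENNReal.ofReal (ω x) := fun x => by
    rw [← ENNReal.ofReal_pow (Real.sqrt_nonneg _), Real.sq_sqrt (hω.pos x).le]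
  have e3 : ∀ x, ENNReal.ofReal (√(ω x))⁻¹ ^ 2 = ENNReal.ofReal (ω x)⁻¹ := fun x => by
    rw [← ENNReal.ofReal_pow (inv_nonneg.2 (Real.sqrt_nonneg _)), inv_pow,
      Real.sq_sqrt (hω.pos x).le]
  simp only [e1, e2, e3] at h
  simpa [wMeasure, withDensity_apply _ hs] using h

theorem IsA2Weight.comparison (hω : IsA2Weight ω) (x : E n) {r : ℝ} (hr : 0 < r) {s : Set (E n)}
    (hs : MeasurableSet s) (hsub : s ⊆ Metric.ball x r) :
    volume s ^ 2 * wMeasure ω (Metric.ball x r) ≤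
      ballConst ω * volume (Metric.ball x r) ^ 2 * wMeasure ω s := by
  calc volume s ^ 2 * wMeasure ω (Metric.ball x r)
      ≤ (wMeasure ω s * wMeasure (fun x => (ω x)⁻¹) (Metric.ball x r)) *
        wMeasure ω (Metric.ball x r) := by
        gcongr
        exact (hω.volume_sq_le hs).trans (by gcongr)
    _ = (wMeasure ω (Metric.ball x r) * wMeasure (fun x => (ω x)⁻¹) (Metric.ball x r)) *
        wMeasure ω s := by ring
    _ ≤ _ := mul_le_mul' (wMeasure_ball_mul_le x hr) le_rfl

/-- Doubling. The volume ratio (r/ρ)ⁿ enters `IsA2Weight.comparison` squared, hence the exponent 2n.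
-/
theorem IsA2Weight.ball_comparison (hω : IsA2Weight ω) {x y : E n} {r ρ : ℝ} (hr : 0 < r)
    (hρ : 0 < ρ) (hsub : Metric.ball y ρ ⊆ Metric.ball x r) :
    (wMeasure ω).real (Metric.ball x r) ≤
      (ballConst ω).toReal * (r / ρ) ^ (2 * n) * (wMeasure ω).real (Metric.ball y ρ) := by
  have h := hω.comparison x hr measurableSet_ball hsub
  have h2 := ENNReal.toReal_mono (ENNReal.mul_ne_top (ENNReal.mul_ne_top hω.ballConst_ne_top
    (ENNReal.pow_ne_top measure_ball_lt_top.ne)) (hω.ball_lt_top y).ne) h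
  rw [volume_ball_eq y hρ, volume_ball_eq x hr] at h2
  simp only [ENNReal.toReal_mul, ENNReal.toReal_pow,
    ENNReal.toReal_ofReal (pow_pos hr n).le, ENNReal.toReal_ofReal (pow_pos hρ n).le] at h2
  have hc : 0 < (volume (Metric.ball (0 : E n) 1)).toReal :=
    ENNReal.toReal_pos (Metric.measure_ball_pos volume _ one_pos).ne' measure_ball_lt_top.ne
  set c := (volume (Metric.ball (0 : E n) 1)).toReal
  simp only [Measure.real]
  set X := (wMeasure ω (Metric.ball x r)).toReal
  set Y := (wMeasure ω (Metric.ball y ρ)).toReal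
  set C := (ballConst ω).toReal
  have hp : 0 < (ρ ^ n * c) ^ 2 := by positivity
  rw [← mul_le_mul_iff_right₀ hp]
  refine h2.trans (le_of_eq ?_)
  rw [div_pow]
  have : ρ ^ (2 * n) ≠ 0 := by positivity
  field_simp
  ring

/-- If the mass were finite, the complements of large balls would have mass tending to 0. But the
ball of radius k/2 centred at distance 3k/2 from the origin lies outside B(0,k) and inside B(0,2k),
so by doubling its mass stays above a fixed fraction of that of the unit ball. -/
theorem IsA2Weight.measure_univ (hω : IsA2Weight ω) (hn : 1 ≤ n) : wMeasure ω univ = ∞ := by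
  by_contra hfin
  have : IsFiniteMeasure (wMeasure ω) := ⟨lt_top_iff_ne_top.2 hfin⟩
  set e : E n := EuclideanSpace.single ⟨0, hn⟩ 1 with he
  have hen : ‖e‖ = 1 := by simp [he]
  have hlim : Tendsto (fun k : ℕ => (wMeasure ω).real (Metric.ball 0 (k : ℝ))ᶜ) atTop (𝓝 0) := by
    have h1 := tendsto_measure_iInter_atTop (μ := wMeasure ω)
      (s := fun k : ℕ => (Metric.ball (0 : E n) (k : ℝ))ᶜ)
      (fun k => measurableSet_ball.compl.nullMeasurableSet)
      (fun i j hij => compl_subset_compl.2 (Metric.ball_subset_ball (by exact_mod_cast hij)))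
      ⟨0, measure_ne_top _ _⟩
    rw [← compl_iUnion, Metric.iUnion_ball_nat, compl_univ, measure_empty] at h1
    exact (ENNReal.tendsto_toReal ENNReal.zero_ne_top).comp h1
  set D := (ballConst ω).toReal * 4 ^ (2 * n)
  have hle : ∀ k : ℕ, 1 ≤ k → (wMeasure ω).real (Metric.ball 0 1) ≤
      D * (wMeasure ω).real (Metric.ball 0 (k : ℝ))ᶜ := by
    intro k hk
    have hk' : (1 : ℝ) ≤ k := by exact_mod_cast hk
    have hsub : Metric.ball ((3 / 2 * (k : ℝ)) • e) (k / 2) ⊆ Metric.ball 0 (2 * k) := by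
      refine Metric.ball_subset_ball' ?_
      rw [dist_zero_right, norm_smul, hen, Real.norm_of_nonneg (by positivity)]
      linarith
    have h1 := hω.ball_comparison (by positivity) (by positivity) hsub
    have e4 : (2 * (k : ℝ)) / (k / 2) = 4 := by field_simp; norm_num
    rw [e4] at h1
    refine (measureReal_mono (Metric.ball_subset_ball (by linarith)) (measure_ne_top _ _)).trans
      (h1.trans ?_)
    refine mul_le_mul_of_nonneg_left (measureReal_mono ?_ (measure_ne_top _ _)) (by positivity)
    intro y hy
    rw [mem_compl_iff, Metric.mem_ball, not_lt, dist_zero_right]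
    rw [Metric.mem_ball, dist_eq_norm] at hy
    have h3 := norm_sub_norm_le ((3 / 2 * (k : ℝ)) • e) y
    rw [norm_smul, hen, Real.norm_of_nonneg (by positivity), norm_sub_rev] at h3
    linarith
  have h0 : (wMeasure ω).real (Metric.ball 0 1) ≤ D * 0 :=
    ge_of_tendsto (hlim.const_mul D) ((eventually_ge_atTop 1).mono hle)
  have h1 := ENNReal.toReal_pos (hω.ball_pos 0 one_pos).ne' (hω.ball_lt_top 0).ne
  rw [mul_zero] at h0
  exact absurd h1 (not_lt.2 h0)


/-- The bump at scale r is at most 2ⁿ/|B_r| and vanishes off the ball of radius r, so both integrals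
live in B(y,2r), where A₂ applies. Passing from B_r to B_{2r} adds another 2ⁿ, giving 4ⁿ in total.
-/
theorem IsA2Weight.schur (hω : IsA2Weight ω) (k : ℕ) (y : E n) :
    ∫⁻ x, ENNReal.ofReal (ω x) * ENNReal.ofReal (bumpKernel (E n) k (x - y)) *
      ∫⁻ z, ENNReal.ofReal (bumpKernel (E n) k (x - z)) * ENNReal.ofReal (ω z)⁻¹ ≤
      (ENNReal.ofReal (4 ^ n) ^ 2 * ballConst ω) := by
  set r : ℝ := 1 / ((k : ℝ) + 1) with hr
  have hr0 : 0 < r := by positivity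
  set vol := volume (Metric.ball (0 : E n) r) with hvol
  have hv0 : vol ≠ 0 := (Metric.measure_ball_pos volume _ hr0).ne'
  have hvt : vol ≠ ∞ := measure_ball_lt_top.ne
  set κ : ℝ≥0∞ := ENNReal.ofReal (2 ^ n) / vol with hκ
  have hb : ∀ x : E n, ENNReal.ofReal (bumpKernel (E n) k x) ≤ κ := by
    intro x
    refine (ENNReal.ofReal_le_ofReal (bumpKernel_le k x)).trans ?_
    rw [ENNReal.ofReal_div_of_pos, Measure.real, ENNReal.ofReal_toReal, hκ, hvol,
      finrank_euclideanSpace_fin]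
    · exact ENNReal.div_le_div_left (measure_mono Metric.ball_subset_closedBall) _
    · exact measure_closedBall_lt_top.ne
    · exact ENNReal.toReal_pos (Metric.measure_closedBall_pos volume _ hr0).ne'
        measure_closedBall_lt_top.ne
  have hz : ∀ x y : E n, y ∉ Metric.ball x r → bumpKernel (E n) k (x - y) = 0 := by
    intro x y hy
    apply bumpKernel_eq_zero
    rwa [Metric.mem_ball, not_lt, dist_comm, dist_eq_norm] at hy
  have hin : ∀ x ∈ Metric.ball y r, ∫⁻ z, ENNReal.ofReal (bumpKernel (E n) k (x - z)) *
      ENNReal.ofReal (ω z)⁻¹ ≤ κ * wMeasure (fun x => (ω x)⁻¹) (Metric.ball y (2 * r)) := by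
    intro x hx
    rw [wMeasure, withDensity_apply _ measurableSet_ball, ← lintegral_const_mul'' _
      hω.inv.aemeasurable_ofReal.restrict, ← lintegral_indicator measurableSet_ball]
    refine lintegral_mono fun z => ?_
    by_cases hzz : z ∈ Metric.ball y (2 * r)
    · rw [indicator_of_mem hzz]; gcongr; exact hb _
    · rw [hz x z fun h => hzz ?_]
      · simp
      · rw [Metric.mem_ball] at h hx ⊢
        linarith [dist_triangle z x y]
  set Vm := wMeasure (fun x => (ω x)⁻¹) (Metric.ball y (2 * r))
  calc _ ≤ ∫⁻ x in Metric.ball y (2 * r), κ * (κ * Vm) * ENNReal.ofReal (ω x) := by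
        rw [← lintegral_indicator measurableSet_ball]
        refine lintegral_mono fun x => ?_
        by_cases hx : x ∈ Metric.ball y r
        · rw [indicator_of_mem (Metric.ball_subset_ball (by linarith) hx)]
          calc _ ≤ ENNReal.ofReal (ω x) * κ * (κ * Vm) := by gcongr; exacts [hb _, hin x hx]
            _ = _ := by ring
        · rw [hz x y]
          · simp
          · rwa [Metric.mem_ball, dist_comm, ← Metric.mem_ball]
    _ = κ ^ 2 * (wMeasure ω (Metric.ball y (2 * r)) * Vm) := by
        rw [lintegral_const_mul'' _ hω.aemeasurable_ofReal.restrict, wMeasure,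
          withDensity_apply _ measurableSet_ball]
        ring
    _ ≤ κ ^ 2 * (ballConst ω * volume (Metric.ball y (2 * r)) ^ 2) :=
        mul_le_mul' le_rfl (wMeasure_ball_mul_le y (by positivity))
    _ = (κ * volume (Metric.ball y (2 * r))) ^ 2 * ballConst ω := by ring
    _ = _ := by
        congr 2
        rw [volume_ball_eq y (by positivity : 0 < 2 * r), mul_pow,
          ENNReal.ofReal_mul (by positivity), mul_assoc, ← volume_ball_eq 0 hr0, ← hvol, hκ,
          mul_comm (ENNReal.ofReal (2 ^ n)) vol, ← mul_assoc, ENNReal.div_mul_cancel hv0 hvt,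
          ← ENNReal.ofReal_mul (by positivity), ← mul_pow]
        norm_num

/-- `eLpNorm_mollify_le` wants its constant as a square; b ≤ (b + 1)² avoids a square root. -/
theorem one_le_ballConst_schur (ω : E n → ℝ) :
    ENNReal.ofReal (4 ^ n) ^ 2 * ballConst ω ≤ (ENNReal.ofReal (4 ^ n) * (ballConst ω + 1)) ^ 2 := by
  rw [mul_pow]
  gcongr
  calc ballConst ω ≤ (ballConst ω + 1) * 1 := by rw [mul_one]; exact le_self_add
    _ ≤ (ballConst ω + 1) * (ballConst ω + 1) := by gcongr; exact le_add_self
    _ = _ := by ring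

variable {F : Type*} [NormedAddCommGroup F] [NormedSpace ℝ F]

theorem IsA2Weight.aestronglyMeasurable (hω : IsA2Weight ω) {f : E n → F}
    (hf : AEStronglyMeasurable f (wMeasure ω)) : AEStronglyMeasurable f volume :=
  hf.mono_ac hω.absolutelyContinuous

theorem IsA2Weight.eLpNorm_mollify_le (hω : IsA2Weight ω) (k : ℕ) {f : E n → F}
    (hf : MemLp f 2 (wMeasure ω)) :
    eLpNorm (mollify k f) 2 (wMeasure ω) ≤
      ENNReal.ofReal (4 ^ n) * (ballConst ω + 1) * eLpNorm f 2 (wMeasure ω) :=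
  DegParabolic.eLpNorm_mollify_le hω.aemeasurable_ofReal hω.inv.aemeasurable_ofReal
    (Eventually.of_forall hω.ofReal_mul_inv) k
    (fun y => (hω.schur k y).trans (one_le_ballConst_schur ω)) (hω.aestronglyMeasurable hf.1)

/-- Cauchy–Schwarz with |f| = (|f| √ω)(√ω)⁻¹, since ω⁻¹ is integrable on balls. This gives
distributional derivatives with respect to dx a meaning on L²_ω. -/
theorem IsA2Weight.locallyIntegrable (hω : IsA2Weight ω) {f : E n → F}
    (hf : MemLp f 2 (wMeasure ω)) : LocallyIntegrable f volume := by
  intro x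
  refine ⟨Metric.ball x 1, Metric.ball_mem_nhds x one_pos,
    (hω.aestronglyMeasurable hf.1).restrict, ?_⟩
  have hm := (hω.aestronglyMeasurable hf.1)
  have h := lintegral_mul_sq_le (μ := volume.restrict (Metric.ball x 1))
    (f := fun x => ‖f x‖ₑ * ENNReal.ofReal (√(ω x))) (g := fun x => ENNReal.ofReal ((√(ω x))⁻¹))
    (hm.enorm.mul hω.meas.sqrt.ennreal_ofReal).restrict hω.meas.sqrt.inv.ennreal_ofReal.restrict
  have e1 : ∀ x, ‖f x‖ₑ * ENNReal.ofReal (√(ω x)) * ENNReal.ofReal (√(ω x))⁻¹ = ‖f x‖ₑ := fun x => by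
    have := Real.sqrt_pos.2 (hω.pos x)
    rw [mul_assoc, ← ENNReal.ofReal_mul this.le, mul_inv_cancel₀ this.ne', ENNReal.ofReal_one,
      mul_one]
  have e2 : ∀ x, (‖f x‖ₑ * ENNReal.ofReal (√(ω x))) ^ 2 = ENNReal.ofReal (ω x) * ‖f x‖ₑ ^ 2 :=
    fun x => by
    rw [mul_pow, ← ENNReal.ofReal_pow (Real.sqrt_nonneg _), Real.sq_sqrt (hω.pos x).le, mul_comm]
  have e3 : ∀ x, ENNReal.ofReal (√(ω x))⁻¹ ^ 2 = ENNReal.ofReal (ω x)⁻¹ := fun x => by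
    rw [← ENNReal.ofReal_pow (inv_nonneg.2 (Real.sqrt_nonneg _)), inv_pow,
      Real.sq_sqrt (hω.pos x).le]
  simp only [e1, e2, e3] at h
  have h1 : ∫⁻ x in Metric.ball x 1, ENNReal.ofReal (ω x) * ‖f x‖ₑ ^ 2 < ∞ := by
    refine (lintegral_mono' Measure.restrict_le_self le_rfl).trans_lt ?_
    have h2 := eLpNorm_two_sq (wMeasure ω) f
    rw [wMeasure, lintegral_withDensity_eq_lintegral_mul₀ hω.aemeasurable_ofReal
      (hm.enorm.pow_const 2)] at h2
    simp only [Pi.mul_apply] at h2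
    rw [← h2]
    exact ENNReal.pow_lt_top hf.2
  have h2 : ∫⁻ x in Metric.ball x 1, ENNReal.ofReal (ω x)⁻¹ < ∞ := by
    have := hω.inv.ball_lt_top x (r := 1)
    rwa [wMeasure, withDensity_apply _ measurableSet_ball] at this
  have h3 := h.trans_lt (ENNReal.mul_lt_top h1 h2)
  rw [hasFiniteIntegral_iff_enorm]
  by_contra hcon
  rw [not_lt, top_le_iff] at hcon
  rw [hcon] at h3
  simp at h3

theorem IsA2Weight.tendsto_mollify [CompleteSpace F] (hω : IsA2Weight ω) {f : E n → F}
    (hf : MemLp f 2 (wMeasure ω)) :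
    Tendsto (fun k => eLpNorm (mollify k f - f) 2 (wMeasure ω)) atTop (𝓝 0) := by
  have := hω.isLocallyFiniteMeasure
  refine tendsto_eLpNorm_mollify_sub (C := ENNReal.ofReal (4 ^ n) * (ballConst ω + 1)) ?_
    (fun k f hf => hω.eLpNorm_mollify_le k hf) (fun f hf => hω.locallyIntegrable hf) hf
  exact ENNReal.mul_ne_top ENNReal.ofReal_ne_top (by simpa using hω.ballConst_ne_top)

end Weights


/-! ### Pointwise operators on `L²` -/

section Pointwise

variable {α : Type*} [MeasurableSpace α] {μ : Measure α}
variable {F F' F'' : Type*} [NormedAddCommGroup F] [InnerProductSpace ℂ F] [NormedAddCommGroup F']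
  [InnerProductSpace ℂ F'] [NormedAddCommGroup F''] [InnerProductSpace ℂ F'']

open Classical in
/-- The class of `f` in `L²`, or `0` if `f` is not square integrable. -/
def toL2 (μ : Measure α) (f : α → F) : Lp F 2 μ := if h : MemLp f 2 μ then h.toLp f else 0

theorem toL2_coe {f : α → F} (h : MemLp f 2 μ) : toL2 μ f =ᵐ[μ] f := by
  rw [toL2, dif_pos h]; exact h.coeFn_toLp

theorem toL2_congr {f g : α → F} (h : f =ᵐ[μ] g) : toL2 μ f = toL2 μ g := by
  by_cases hf : MemLp f 2 μ
  · exact Lp.ext ((toL2_coe hf).trans (h.trans (toL2_coe (hf.ae_eq h)).symm))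
  · rw [toL2, toL2, dif_neg hf, dif_neg fun hg => hf (hg.ae_eq h.symm)]

theorem toL2_self (f : Lp F 2 μ) : toL2 μ f = f := Lp.ext (toL2_coe (Lp.memLp f))

theorem toL2_eq_of_ae {f : Lp F 2 μ} {g : α → F} (h : f =ᵐ[μ] g) : f = toL2 μ g := by
  rw [← toL2_congr h, toL2_self]

theorem toL2_sub {f g : α → F} (hf : MemLp f 2 μ) (hg : MemLp g 2 μ) :
    toL2 μ (f - g) = toL2 μ f - toL2 μ g := by
  refine Lp.ext ((toL2_coe (hf.sub hg)).trans ?_)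
  filter_upwards [Lp.coeFn_sub (toL2 μ f) (toL2 μ g), toL2_coe hf, toL2_coe hg] with x h1 h2 h3
  rw [h1, Pi.sub_apply, Pi.sub_apply, h2, h3]

theorem norm_toL2 {f : α → F} (h : MemLp f 2 μ) : ‖toL2 μ f‖ = (eLpNorm f 2 μ).toReal := by
  rw [toL2, dif_pos h, Lp.norm_toLp]

theorem tendsto_toL2 {ι : Type*} {l : Filter ι} {f : ι → α → F} {g : α → F}
    (hf : ∀ k, MemLp (f k) 2 μ)
    (hg : MemLp g 2 μ) (h : Tendsto (fun k => eLpNorm (f k - g) 2 μ) l (𝓝 0)) :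
    Tendsto (fun k => toL2 μ (f k)) l (𝓝 (toL2 μ g)) := by
  rw [tendsto_iff_norm_sub_tendsto_zero]
  simp_rw [← toL2_sub (hf _) hg, norm_toL2 ((hf _).sub hg)]
  exact (ENNReal.tendsto_toReal ENNReal.zero_ne_top).comp h

/-- A bounded measurable field of linear operators. -/
structure IsBddField (μ : Measure α) (T : α → F →L[ℂ] F') (C : ℝ) : Prop where
  meas : AEStronglyMeasurable T μ
  bound : ∀ᵐ x ∂μ, ‖T x‖ ≤ C

theorem IsBddField.apply_aesm {T : α → F →L[ℂ] F'} {C : ℝ} (hT : IsBddField μ T C) {f : α → F}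
    (hf : AEStronglyMeasurable f μ) : AEStronglyMeasurable (fun x => T x (f x)) μ :=
  isBoundedBilinearMap_apply.continuous.comp_aestronglyMeasurable₂ hT.meas hf

theorem IsBddField.ae_le {T : α → F →L[ℂ] F'} {C : ℝ} (hT : IsBddField μ T C) (f : α → F) :
    ∀ᵐ x ∂μ, ‖T x (f x)‖ ≤ C * ‖f x‖ :=
  hT.bound.mono fun x hx => (T x).le_of_opNorm_le hx _

theorem IsBddField.memLp {T : α → F →L[ℂ] F'} {C : ℝ} (hT : IsBddField μ T C) {f : α → F}
    (hf : MemLp f 2 μ) : MemLp (fun x => T x (f x)) 2 μ :=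
  hf.of_le_mul (hT.apply_aesm hf.1) (hT.ae_le f)

theorem IsBddField.norm_toL2_le {T : α → F →L[ℂ] F'} {C : ℝ} (hT : IsBddField μ T C) (hC : 0 ≤ C)
    (f : Lp F 2 μ) :
    ‖toL2 μ (fun x => T x (f x))‖ ≤ C * ‖f‖ := by
  rw [norm_toL2 (hT.memLp (Lp.memLp f)), Lp.norm_def, ← ENNReal.toReal_ofReal hC,
    ← ENNReal.toReal_mul]
  refine ENNReal.toReal_mono (ENNReal.mul_ne_top ENNReal.ofReal_ne_top (Lp.memLp f).2.ne) ?_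
  have h := eLpNorm_le_mul_eLpNorm_of_ae_le_mul (hT.ae_le f) 2
  simpa only [ENNReal.toReal_ofReal hC] using h

open Classical in
/-- The operator on `L²` acting by `(T f)(x) = T(x) f(x)`. -/
def ptOp (μ : Measure α) (T : α → F →L[ℂ] F') : Lp F 2 μ →L[ℂ] Lp F' 2 μ :=
  if h : ∃ C, 0 ≤ C ∧ IsBddField μ T C then
    LinearMap.mkContinuous
      { toFun := fun f => toL2 μ fun x => T x (f x)
        map_add' := fun f g => by
          obtain ⟨C, -, hT⟩ := h
          refine Lp.ext ?_
          filter_upwards [toL2_coe (hT.memLp (Lp.memLp (f + g))), toL2_coe (hT.memLp (Lp.memLp f)),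
            toL2_coe (hT.memLp (Lp.memLp g)), Lp.coeFn_add f g, Lp.coeFn_add
            (toL2 μ fun x => T x (f x)) (toL2 μ fun x => T x (g x))] with x h1 h2 h3 h4 h5
          rw [h1, h5, Pi.add_apply, h2, h3, h4, Pi.add_apply, map_add]
        map_smul' := fun c f => by
          obtain ⟨C, -, hT⟩ := h
          refine Lp.ext ?_
          filter_upwards [toL2_coe (hT.memLp (Lp.memLp (c • f))), toL2_coe (hT.memLp (Lp.memLp f)),
            Lp.coeFn_smul c f, Lp.coeFn_smul c (toL2 μ fun x => T x (f x))] with x h1 h2 h4 h5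
          rw [h1, RingHom.id_apply, h5, Pi.smul_apply, h2, h4, Pi.smul_apply, map_smul] }
      h.choose fun f => h.choose_spec.2.norm_toL2_le h.choose_spec.1 f
  else 0

theorem IsBddField.nonneg_bound {T : α → F →L[ℂ] F'} {C : ℝ} (hT : IsBddField μ T C) :
    IsBddField μ T |C| := ⟨hT.meas, hT.bound.mono fun _ hx => hx.trans (le_abs_self C)⟩

theorem ptOp_apply {T : α → F →L[ℂ] F'} {C : ℝ} (hT : IsBddField μ T C) (f : Lp F 2 μ) :
    ptOp μ T f = toL2 μ fun x => T x (f x) := by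
  rw [ptOp, dif_pos ⟨|C|, abs_nonneg C, hT.nonneg_bound⟩]
  rfl

theorem ptOp_coe {T : α → F →L[ℂ] F'} {C : ℝ} (hT : IsBddField μ T C) (f : Lp F 2 μ) :
    ptOp μ T f =ᵐ[μ] fun x => T x (f x) := by
  rw [ptOp_apply hT]; exact toL2_coe (hT.memLp (Lp.memLp f))

theorem norm_ptOp_le {T : α → F →L[ℂ] F'} {C : ℝ} (hT : IsBddField μ T C) (hC : 0 ≤ C)
    (f : Lp F 2 μ) : ‖ptOp μ T f‖ ≤ C * ‖f‖ := by
  rw [ptOp_apply hT]; exact hT.norm_toL2_le hC f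

theorem ptOp_comm {F''' : Type*} [NormedAddCommGroup F'''] [InnerProductSpace ℂ F''']
    {T : α → F →L[ℂ] F'} {T' : α → F →L[ℂ] F''} {S : α → F' →L[ℂ] F'''}
    {S' : α → F'' →L[ℂ] F'''}
    {C C' D D' : ℝ} (hT : IsBddField μ T C) (hT' : IsBddField μ T' C')
    (hS : IsBddField μ S D) (hS' : IsBddField μ S' D')
    (h : ∀ᵐ x ∂μ, ∀ y, S x (T x y) = S' x (T' x y)) (f : Lp F 2 μ) :
    ptOp μ S (ptOp μ T f) = ptOp μ S' (ptOp μ T' f) := by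
  refine Lp.ext ?_
  filter_upwards [ptOp_coe hS (ptOp μ T f), ptOp_coe hT f, ptOp_coe hS' (ptOp μ T' f),
    ptOp_coe hT' f, h] with x h1 h2 h3 h4 h5
  rw [h1, h2, h3, h4, h5]

variable [CompleteSpace F] [CompleteSpace F']

theorem IsBddField.adjoint {T : α → F →L[ℂ] F'} {C : ℝ} (hT : IsBddField μ T C) :
    IsBddField μ (fun x => ContinuousLinearMap.adjoint (T x)) C where
  meas := (ContinuousLinearMap.adjoint (𝕜 := ℂ) (E := F) (F := F')).continuous.comp_aestronglyMeasurable
    hT.meas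
  bound := hT.bound.mono fun x hx => by rwa [LinearIsometryEquiv.norm_map]

theorem inner_ptOp_left {T : α → F →L[ℂ] F'} {C : ℝ} (hT : IsBddField μ T C) (f : Lp F 2 μ)
    (g : Lp F' 2 μ) : inner ℂ (ptOp μ T f) g =
      inner ℂ f (ptOp μ (fun x => ContinuousLinearMap.adjoint (T x)) g) := by
  rw [L2.inner_def, L2.inner_def]
  refine integral_congr_ae ?_
  filter_upwards [ptOp_coe hT f, ptOp_coe hT.adjoint g] with x h1 h2
  rw [h1, h2, ContinuousLinearMap.adjoint_inner_right]

theorem adjoint_ptOp {T : α → F →L[ℂ] F'} {C : ℝ} (hT : IsBddField μ T C) :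
    ContinuousLinearMap.adjoint (ptOp μ T) =
      ptOp μ (fun x => ContinuousLinearMap.adjoint (T x)) := by
  symm
  rw [ContinuousLinearMap.eq_adjoint_iff]
  intro x y
  rw [← inner_conj_symm, ← inner_ptOp_left hT, inner_conj_symm]

end Pointwise


/-! ### The graph of the weak gradient -/

section Graph

variable {n : ℕ} {ω : E n → ℝ}

theorem IsA2Weight.ae_eq_iff (hω : IsA2Weight ω) {β : Type*} {f g : E n → β} :
    f =ᵐ[wMeasure ω] g ↔ f =ᵐ[volume] g := by
  rw [Filter.EventuallyEq, hω.ae_eq, Filter.EventuallyEq]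

theorem integral_wMeasure (hω : IsA2Weight ω) {F : Type*} [NormedAddCommGroup F] [NormedSpace ℝ F]
    (f : E n → F) : ∫ x, f x ∂(wMeasure ω) = ∫ x, ω x • f x := by
  rw [wMeasure, integral_withDensity_eq_integral_toReal_smul₀ hω.aemeasurable_ofReal
    (Eventually.of_forall fun _ => ENNReal.ofReal_lt_top)]
  congr 1 with x
  rw [ENNReal.toReal_ofReal (hω.pos x).le]

theorem IsA2Weight.memLp_of_cpt (hω : IsA2Weight ω) {F : Type*} [NormedAddCommGroup F]
    {f : E n → F} (hf : Continuous f) (hc : HasCompactSupport f) : MemLp f 2 (wMeasure ω) := by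
  have := hω.isLocallyFiniteMeasure
  exact hf.memLp_of_hasCompactSupport hc

/-- The square of the norm is ∫|θ|²/ω dx, finite because ω⁻¹ is again an A₂ weight. Hence f ↦ ∫fθ dx
is bounded on L²_ω, and the graph of the weak gradient is closed. -/
theorem IsA2Weight.memLp_conj_div (hω : IsA2Weight ω) {θ : E n → ℂ} (hθ : Continuous θ)
    (hc : HasCompactSupport θ) : MemLp (fun x => conj (θ x) / (ω x : ℂ)) 2 (wMeasure ω) := by
  have hm : AEStronglyMeasurable (fun x => conj (θ x) / (ω x : ℂ)) volume :=
    ((Complex.continuous_conj.comp hθ).aemeasurable.div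
      (Complex.measurable_ofReal.comp_aemeasurable hω.meas)).aestronglyMeasurable
  refine ⟨hm.mono_ac wMeasure_absolutelyContinuous, ?_⟩
  have h2 := eLpNorm_two_sq (wMeasure ω) fun x => conj (θ x) / (ω x : ℂ)
  rw [wMeasure, lintegral_withDensity_eq_lintegral_mul₀ hω.aemeasurable_ofReal
      (hm.enorm.pow_const 2)] at h2
  have e1 : ∀ x, ENNReal.ofReal (ω x) * ‖conj (θ x) / (ω x : ℂ)‖ₑ ^ 2 =
      ENNReal.ofReal (ω x)⁻¹ * ‖θ x‖ₑ ^ 2 := fun x => by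
    have hp := hω.pos x
    rw [← ofReal_norm, ← ofReal_norm, norm_div, RCLike.norm_conj, Complex.norm_real,
      Real.norm_of_nonneg hp.le, ← ENNReal.ofReal_pow (by positivity),
      ← ENNReal.ofReal_pow (by positivity), ← ENNReal.ofReal_mul hp.le,
      ← ENNReal.ofReal_mul (by positivity)]
    congr 1
    field_simp
  simp only [Pi.mul_apply, e1] at h2
  have h3 := (hω.inv.memLp_of_cpt hθ hc).2
  have h4 := eLpNorm_two_sq (wMeasure fun x => (ω x)⁻¹) θ
  rw [wMeasure, lintegral_withDensity_eq_lintegral_mul₀ hω.inv.aemeasurable_ofReal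
      (hθ.aestronglyMeasurable.enorm.pow_const 2)] at h4
  simp only [Pi.mul_apply] at h4
  rw [← h4, ← wMeasure, ← wMeasure] at h2
  by_contra hcon
  rw [not_lt, top_le_iff] at hcon
  rw [hcon] at h2
  exact (ENNReal.pow_lt_top h3).ne (by rw [← h2]; simp)

/-- The functional `f ↦ ∫ f θ dx` on `L²_ω`. -/
def intL (ω : E n → ℝ) (θ : E n → ℂ) : L2w ω →L[ℂ] ℂ :=
  innerSL ℂ (toL2 (wMeasure ω) fun x => conj (θ x) / (ω x : ℂ))

theorem intL_apply (hω : IsA2Weight ω) {θ : E n → ℂ} (hθ : Continuous θ) (hc : HasCompactSupport θ)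
    (f : L2w ω) : intL ω θ f = ∫ x, f x * θ x := by
  rw [intL, innerSL_apply_apply, L2.inner_def, integral_wMeasure hω]
  refine integral_congr_ae ?_
  filter_upwards [hω.ae_eq_iff.1 (toL2_coe (hω.memLp_conj_div hθ hc))] with x h1
  have hp : (ω x : ℂ) ≠ 0 := by exact_mod_cast (hω.pos x).ne'
  rw [h1, RCLike.inner_apply, map_div₀, Complex.conj_conj, Complex.conj_ofReal,
    Complex.real_smul]
  field_simp

theorem isBddField_const {α F F' : Type*} [MeasurableSpace α] (μ : Measure α)
    [NormedAddCommGroup F] [InnerProductSpace ℂ F] [NormedAddCommGroup F'] [InnerProductSpace ℂ F']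
    (T : F →L[ℂ] F') : IsBddField μ (fun _ => T) ‖T‖ :=
  ⟨aestronglyMeasurable_const, Eventually.of_forall fun _ => le_rfl⟩

/-- The `i`-th component of a vector field. -/
def compL (ω : E n → ℝ) (i : Fin n) : L2wVec ω →L[ℂ] L2w ω :=
  ptOp (wMeasure ω) fun _ => EuclideanSpace.proj i

theorem compL_coe (hω : IsA2Weight ω) (i : Fin n) (g : L2wVec ω) :
    compL ω i g =ᵐ[volume] fun x => g x i :=
  hω.ae_eq_iff.1 (ptOp_coe (isBddField_const _ _) g)

/-- The graph of the weak gradient in `L²_ω × (L²_ω)ⁿ`. -/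
def gradGraph (ω : E n → ℝ) : Submodule ℂ (WithLp 2 (L2w ω × L2wVec ω)) :=
  ⨅ (η : {η : E n → ℂ // IsTest η}) (i : Fin n),
    LinearMap.ker ((intL ω (fun x => grad η.1 x i)).comp (WithLp.fstL 2 ℂ (L2w ω) (L2wVec ω)) +
      ((intL ω η.1).comp (compL ω i)).comp (WithLp.sndL 2 ℂ (L2w ω) (L2wVec ω)) :
        WithLp 2 (L2w ω × L2wVec ω) →L[ℂ] ℂ).toLinearMap

theorem isClosed_gradGraph (ω : E n → ℝ) :
    IsClosed (gradGraph ω : Set (WithLp 2 (L2w ω × L2wVec ω))) := by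
  simp only [gradGraph, Submodule.coe_iInf]
  exact isClosed_iInter fun η => isClosed_iInter fun i => ContinuousLinearMap.isClosed_ker _

theorem IsTest.cont {F : Type*} [NormedAddCommGroup F] [NormedSpace ℝ F] {η : F → ℂ}
    (hη : IsTest η) : Continuous η := hη.1.continuous

theorem contDiff_grad {η : E n → ℂ} (hη : ContDiff ℝ ((⊤ : ℕ∞) : WithTop ℕ∞) η) (i : Fin n) :
    ContDiff ℝ ((⊤ : ℕ∞) : WithTop ℕ∞) fun x => grad η x i :=
  (hη.fderiv_right (m := ((⊤ : ℕ∞) : WithTop ℕ∞)) (by simp)).clm_apply contDiff_const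

theorem IsTest.grad {η : E n → ℂ} (hη : IsTest η) (i : Fin n) : IsTest fun x => grad η x i :=
  ⟨contDiff_grad hη.1 i, hη.2.fderiv_apply ℝ _⟩

theorem mem_gradGraph (hω : IsA2Weight ω) {p : WithLp 2 (L2w ω × L2wVec ω)} :
    p ∈ gradGraph ω ↔ HasWeakGradient p.fst p.snd := by
  simp only [gradGraph, Submodule.mem_iInf, LinearMap.mem_ker, Subtype.forall, HasWeakGradient]
  refine forall_congr' fun η => forall_congr' fun hη => forall_congr' fun i => ?_
  simp only [ContinuousLinearMap.coe_coe, _root_.add_apply,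
    ContinuousLinearMap.comp_apply, WithLp.fstL_apply, WithLp.sndL_apply]
  rw [intL_apply hω (hη.grad i).cont (hη.grad i).2, intL_apply hω hη.cont hη.2, add_eq_zero_iff_eq_neg]
  have e : ∫ x, compL ω i p.snd x * η x = ∫ x, p.snd x i * η x :=
    integral_congr_ae ((compL_coe hω i p.snd).mono fun x hx => by simp only [hx])
  rw [e]

theorem IsA2Weight.locallyIntegrable_coe (hω : IsA2Weight ω) (f : L2w ω) :
    LocallyIntegrable (f : E n → ℂ) volume := hω.locallyIntegrable (Lp.memLp f)

theorem IsA2Weight.locallyIntegrable_vec (hω : IsA2Weight ω) (f : L2wVec ω) :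
    LocallyIntegrable (f : E n → V n) volume := hω.locallyIntegrable (Lp.memLp f)

theorem IsA2Weight.locallyIntegrable_comp (hω : IsA2Weight ω) (f : L2wVec ω) (i : Fin n) :
    LocallyIntegrable (fun x => f x i) volume :=
  (hω.locallyIntegrable_coe (compL ω i f)).congr (compL_coe hω i f)

/-- The gradient as a vector field. -/
def gradV (η : E n → ℂ) (x : E n) : V n := WithLp.toLp 2 (grad η x)

@[simp] theorem gradV_apply (η : E n → ℂ) (x : E n) (i : Fin n) : gradV η x i = grad η x i := rfl

theorem continuous_gradV {η : E n → ℂ} (hη : ContDiff ℝ ((⊤ : ℕ∞) : WithTop ℕ∞) η) :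
    Continuous (gradV η) :=
  (PiLp.continuous_toLp 2 _).comp (continuous_pi fun i => (contDiff_grad hη i).continuous)

theorem HasCompactSupport.gradV {η : E n → ℂ} (hη : HasCompactSupport η) :
    HasCompactSupport (gradV η) := by
  refine (hη.fderiv (𝕜 := ℝ)).mono fun x hx => ?_
  rw [Function.mem_support] at hx ⊢
  intro h
  apply hx
  ext i
  rw [gradV_apply, DegParabolic.grad, h]
  rfl

/-- The element of the graph defined by a test function. -/
def testPair (ω : E n → ℝ) (η : E n → ℂ) : WithLp 2 (L2w ω × L2wVec ω) :=
  WithLp.toLp 2 (toL2 (wMeasure ω) η, toL2 (wMeasure ω) (gradV η))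

theorem IsTest.toL2_coe (hω : IsA2Weight ω) {η : E n → ℂ} (hη : IsTest η) :
    toL2 (wMeasure ω) η =ᵐ[volume] η :=
  hω.ae_eq_iff.1 (DegParabolic.toL2_coe (hω.memLp_of_cpt hη.cont hη.2))

theorem IsTest.memLp_gradV (hω : IsA2Weight ω) {η : E n → ℂ} (hη : IsTest η) :
    MemLp (gradV η) 2 (wMeasure ω) :=
  hω.memLp_of_cpt (continuous_gradV hη.1) (HasCompactSupport.gradV hη.2)

theorem IsTest.toL2_gradV_coe (hω : IsA2Weight ω) {η : E n → ℂ} (hη : IsTest η) :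
    toL2 (wMeasure ω) (gradV η) =ᵐ[volume] gradV η :=
  hω.ae_eq_iff.1 (DegParabolic.toL2_coe (hη.memLp_gradV hω))

theorem testPair_mem (hω : IsA2Weight ω) {η : E n → ℂ} (hη : IsTest η) :
    testPair ω η ∈ gradGraph ω := by
  rw [mem_gradGraph hω]
  intro ζ hζ i
  have e1 : ∫ x, (testPair ω η).fst x * DegParabolic.grad ζ x i =
      ∫ x, η x * fderiv ℝ ζ x (EuclideanSpace.single i 1) :=
    integral_congr_ae ((hη.toL2_coe hω).mono fun x hx => by
      simp only [testPair, WithLp.toLp_fst, hx]; rfl)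
  have e2 : ∫ x, (testPair ω η).snd x i * ζ x =
      ∫ x, fderiv ℝ η x (EuclideanSpace.single i 1) * ζ x :=
    integral_congr_ae ((hη.toL2_gradV_coe hω).mono fun x hx => by
      simp only [testPair, WithLp.toLp_snd, hx]; rfl)
  rw [e1, e2]
  refine integral_mul_fderiv_eq_neg_fderiv_mul_of_integrable ?_ ?_ ?_
    (fun x _ => hη.1.differentiable (by simp) x) (fun x _ => hζ.1.differentiable (by simp) x)
  · exact ((hη.grad i).cont.mul hζ.cont).integrable_of_hasCompactSupport hζ.2.mul_left
  · exact (hη.cont.mul (hζ.grad i).cont).integrable_of_hasCompactSupport hη.2.mul_right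
  · exact (hη.cont.mul hζ.cont).integrable_of_hasCompactSupport hη.2.mul_right

/-! ### Smooth multipliers -/

/-- Multiplication by a real function. -/
def mulF (F : Type*) [NormedAddCommGroup F] [InnerProductSpace ℂ F] (ζ : E n → ℝ) (x : E n) :
    F →L[ℂ] F := (ζ x : ℂ) • ContinuousLinearMap.id ℂ F

/-- Multiplication of a scalar by the gradient of a real function. -/
def gradF (ζ : E n → ℝ) (x : E n) : ℂ →L[ℂ] V n :=
  (ContinuousLinearMap.id ℂ ℂ).smulRight (gradV (fun y => (ζ y : ℂ)) x)

@[simp] theorem mulF_apply {F : Type*} [NormedAddCommGroup F] [InnerProductSpace ℂ F]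
    (ζ : E n → ℝ) (x : E n) (y : F) : mulF F ζ x y = (ζ x : ℂ) • y := rfl

@[simp] theorem gradF_apply (ζ : E n → ℝ) (x : E n) (z : ℂ) :
    gradF ζ x z = z • gradV (fun y => (ζ y : ℂ)) x := rfl

theorem contDiff_coe {ζ : E n → ℝ} (hζ : ContDiff ℝ ((⊤ : ℕ∞) : WithTop ℕ∞) ζ) :
    ContDiff ℝ ((⊤ : ℕ∞) : WithTop ℕ∞) fun x => (ζ x : ℂ) := Complex.ofRealCLM.contDiff.comp hζ

theorem isBddField_mulF {F : Type*} [NormedAddCommGroup F] [InnerProductSpace ℂ F]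
    (μ : Measure (E n)) {ζ : E n → ℝ} (hζ : Continuous ζ) {C : ℝ} (hC : ∀ x, |ζ x| ≤ C) :
    IsBddField μ (mulF F ζ) C where
  meas := by
    have : Continuous (mulF F ζ) := (Complex.continuous_ofReal.comp hζ).smul continuous_const
    exact this.aestronglyMeasurable
  bound := Eventually.of_forall fun x => by
    refine ContinuousLinearMap.opNorm_le_bound _ ((abs_nonneg _).trans (hC x)) fun y => ?_
    rw [mulF_apply, norm_smul, Complex.norm_real, Real.norm_eq_abs]
    gcongr
    exact hC x

theorem isBddField_gradF (μ : Measure (E n)) {ζ : E n → ℝ}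
    (hζ : ContDiff ℝ ((⊤ : ℕ∞) : WithTop ℕ∞) ζ) {D : ℝ}
    (hD : ∀ x, ‖gradV (fun y => (ζ y : ℂ)) x‖ ≤ D) : IsBddField μ (gradF ζ) D where
  meas := by
    have : Continuous (gradF ζ) :=
      (ContinuousLinearMap.smulRightL ℂ ℂ (V n) (ContinuousLinearMap.id ℂ ℂ)).continuous.comp
        (continuous_gradV (contDiff_coe hζ))
    exact this.aestronglyMeasurable
  bound := Eventually.of_forall fun x => by
    refine ContinuousLinearMap.opNorm_le_bound _ ((norm_nonneg _).trans (hD x)) fun y => ?_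
    rw [gradF_apply, norm_smul, mul_comm]
    gcongr
    exact hD x

theorem grad_mul {η ζ : E n → ℂ} {x : E n} (hη : DifferentiableAt ℝ η x)
    (hζ : DifferentiableAt ℝ ζ x) (i : Fin n) :
    grad (fun y => η y * ζ y) x i = η x * grad ζ x i + grad η x i * ζ x := by
  simp only [grad]
  rw [fderiv_fun_mul hη hζ]
  simp only [_root_.add_apply, _root_.smul_apply, smul_eq_mul]
  ring

/-- The Leibniz rule, read off by testing the weak gradient of f with the product of ζ and the test
function. -/
theorem mul_mem_gradGraph (hω : IsA2Weight ω) {ζ : E n → ℝ}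
    (hζ : ContDiff ℝ ((⊤ : ℕ∞) : WithTop ℕ∞) ζ) {C D : ℝ} (hC : ∀ x, |ζ x| ≤ C)
    (hD : ∀ x, ‖gradV (fun y => (ζ y : ℂ)) x‖ ≤ D) {f : L2w ω} {g : L2wVec ω}
    (h : WithLp.toLp 2 (f, g) ∈ gradGraph ω) :
    WithLp.toLp 2 (ptOp (wMeasure ω) (mulF ℂ ζ) f,
      ptOp (wMeasure ω) (mulF (V n) ζ) g + ptOp (wMeasure ω) (gradF ζ) f) ∈ gradGraph ω := by
  rw [mem_gradGraph hω] at h ⊢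
  simp only [WithLp.toLp_fst, WithLp.toLp_snd] at h ⊢
  intro η hη i
  have hζc := contDiff_coe hζ
  have hζη : IsTest fun x => (ζ x : ℂ) * η x := ⟨hζc.mul hη.1, hη.2.mul_left⟩
  have h1 := h _ hζη i
  simp only [fun x => grad_mul (hζc.differentiable (by simp) x) (hη.1.differentiable (by simp) x) i]
    at h1
  have b1 := isBddField_mulF (F := ℂ) (wMeasure ω) hζ.continuous hC
  have b2 := isBddField_mulF (F := V n) (wMeasure ω) hζ.continuous hC
  have b3 := isBddField_gradF (wMeasure ω) hζ hD
  have e1 : ∫ x, ptOp (wMeasure ω) (mulF ℂ ζ) f x * grad η x i =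
      ∫ x, f x * ((ζ x : ℂ) * grad η x i) :=
    integral_congr_ae ((hω.ae_eq_iff.1 (ptOp_coe b1 f)).mono fun x hx => by
      simp only [hx, mulF_apply, smul_eq_mul]; ring)
  have e2 : ∫ x, (ptOp (wMeasure ω) (mulF (V n) ζ) g + ptOp (wMeasure ω) (gradF ζ) f) x i * η x =
      ∫ x, (g x i * ((ζ x : ℂ) * η x) + f x * (grad (fun y => (ζ y : ℂ)) x i * η x)) := by
    refine integral_congr_ae ?_
    filter_upwards [hω.ae_eq_iff.1 (ptOp_coe b2 g), hω.ae_eq_iff.1 (ptOp_coe b3 f),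
      hω.ae_eq_iff.1 (Lp.coeFn_add (ptOp (wMeasure ω) (mulF (V n) ζ) g)
        (ptOp (wMeasure ω) (gradF ζ) f))] with x h1 h2 h3
    rw [h3, Pi.add_apply, h1, h2, mulF_apply, gradF_apply]
    simp only [PiLp.add_apply, PiLp.smul_apply, smul_eq_mul, gradV_apply]
    ring
  have hf := hω.locallyIntegrable_coe f
  have c1 : Continuous fun x => (ζ x : ℂ) * grad η x i := hζc.continuous.mul (hη.grad i).cont
  have c2 : Continuous fun x => grad (fun y => (ζ y : ℂ)) x i * η x :=
    (contDiff_grad hζc i).continuous.mul hη.cont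
  have i1 : Integrable fun x => f x * ((ζ x : ℂ) * grad η x i) :=
    hf.integrable_smul_right_of_hasCompactSupport c1 (hη.grad i).2.mul_left
  have i2 : Integrable fun x => f x * (grad (fun y => (ζ y : ℂ)) x i * η x) :=
    hf.integrable_smul_right_of_hasCompactSupport c2 hη.2.mul_left
  have i3 : Integrable fun x => g x i * ((ζ x : ℂ) * η x) :=
    (hω.locallyIntegrable_comp g i).integrable_smul_right_of_hasCompactSupport hζη.cont hζη.2
  simp only [mul_add] at h1
  rw [integral_add i1 i2] at h1
  rw [e1, e2, integral_add i3 i2, neg_add, ← h1]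
  ring

end Graph


/-! ### Density of test functions -/

section Density

variable {n : ℕ} {ω : E n → ℝ}

/-- The unit bump, equal to one on the unit ball and to zero off the ball of radius two. -/
def unitBump (n : ℕ) : ContDiffBump (0 : E n) := ⟨1, 2, one_pos, one_lt_two⟩

/-- The smooth cutoff at scale `R`. -/
def cutoff (n : ℕ) (R : ℝ) (x : E n) : ℝ := unitBump n (R⁻¹ • x)

theorem cutoff_contDiff (R : ℝ) : ContDiff ℝ ((⊤ : ℕ∞) : WithTop ℕ∞) (cutoff n R) :=
  (unitBump n).contDiff.comp (contDiff_const_smul _)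

theorem cutoff_abs_le (R : ℝ) (x : E n) : |cutoff n R x| ≤ 1 := by
  rw [cutoff, abs_of_nonneg (unitBump n).nonneg]; exact (unitBump n).le_one

theorem cutoff_eq_one {R : ℝ} (hR : 0 < R) {x : E n} (hx : ‖x‖ ≤ R) : cutoff n R x = 1 := by
  refine (unitBump n).one_of_mem_closedBall ?_
  rw [mem_closedBall_zero_iff, norm_smul, norm_inv, Real.norm_of_nonneg hR.le]
  rw [inv_mul_le_iff₀ hR]
  simpa [unitBump] using hx

theorem cutoff_eq_zero {R : ℝ} (hR : 0 < R) {x : E n} (hx : 2 * R ≤ ‖x‖) : cutoff n R x = 0 := by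
  refine (unitBump n).zero_of_le_dist ?_
  rw [dist_zero_right, norm_smul, norm_inv, Real.norm_of_nonneg hR.le, le_inv_mul_iff₀ hR]
  simpa [unitBump, mul_comm] using hx

theorem cutoff_hasCompactSupport {R : ℝ} (hR : 0 < R) : HasCompactSupport (cutoff n R) :=
  HasCompactSupport.intro (isCompact_closedBall (0 : E n) (2 * R)) fun x hx =>
    cutoff_eq_zero hR (by rw [mem_closedBall_zero_iff, not_le] at hx; exact hx.le)

theorem cutoff_isTest {R : ℝ} (hR : 0 < R) : IsTest fun x : E n => (cutoff n R x : ℂ) :=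
  ⟨contDiff_coe (cutoff_contDiff R), (cutoff_hasCompactSupport hR).comp_left Complex.ofReal_zero⟩

/-- The cutoffs are dilates of the one at scale 1, so the gradient scales like 1/R with the constant
of that scale. -/
theorem exists_cutoff_grad_le (n : ℕ) : ∃ C : ℝ, 0 ≤ C ∧ ∀ R : ℝ, 0 < R → ∀ x : E n,
    ‖gradV (fun y => (cutoff n R y : ℂ)) x‖ ≤ C / R := by
  have h1 := cutoff_isTest (n := n) one_pos
  obtain ⟨C, hC⟩ := (continuous_gradV h1.1).bounded_above_of_compact_support
    (HasCompactSupport.gradV h1.2)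
  refine ⟨C, (norm_nonneg _).trans (hC 0), fun R hR x => ?_⟩
  have e : gradV (fun y => (cutoff n R y : ℂ)) x =
      (R⁻¹ : ℝ) • gradV (fun y => (cutoff n 1 y : ℂ)) (R⁻¹ • x) := by
    ext i
    have h2 : (fun y => (cutoff n R y : ℂ)) = fun y => (fun y => (cutoff n 1 y : ℂ)) (R⁻¹ • y) := by
      funext y; simp [cutoff]
    rw [gradV_apply, grad, h2, fderiv_comp_smul (f := fun y : E n => (cutoff n 1 y : ℂ)) (R⁻¹)]
    rfl
  rw [e, norm_smul, norm_inv, Real.norm_of_nonneg hR.le, div_eq_inv_mul]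
  gcongr
  exact hC _

theorem cutoff_grad_eq_zero {R : ℝ} (hR : 0 < R) {x : E n} (hx : ‖x‖ < R ∨ 2 * R < ‖x‖) :
    gradV (fun y => (cutoff n R y : ℂ)) x = 0 := by
  have h1 : ∃ c : ℂ, (fun y : E n => (cutoff n R y : ℂ)) =ᶠ[𝓝 x] fun _ => c := by
    rcases hx with hx | hx
    · refine ⟨1, ?_⟩
      filter_upwards [(isOpen_lt continuous_norm continuous_const).mem_nhds hx] with y hy
      rw [cutoff_eq_one hR (le_of_lt hy), Complex.ofReal_one]
    · refine ⟨0, ?_⟩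
      filter_upwards [(isOpen_lt continuous_const continuous_norm).mem_nhds hx] with y hy
      rw [cutoff_eq_zero hR (le_of_lt hy), Complex.ofReal_zero]
  obtain ⟨c, hc⟩ := h1
  ext i
  rw [gradV_apply, grad, hc.fderiv_eq]
  simp

theorem tendsto_ptOp_cutoff (F : Type*) [NormedAddCommGroup F] [InnerProductSpace ℂ F]
    (μ : Measure (E n)) (f : Lp F 2 μ) :
    Tendsto (fun k : ℕ => ptOp μ (mulF F (cutoff n ((k : ℝ) + 1))) f) atTop (𝓝 f) := by
  have hb := fun k : ℕ => isBddField_mulF (F := F) μ (cutoff_contDiff (n := n) ((k : ℝ) + 1)).continuous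
    (cutoff_abs_le _)
  conv in 𝓝 f => rw [← toL2_self f]
  simp_rw [fun k => ptOp_apply (hb k) f]
  refine tendsto_toL2 (fun k => (hb k).memLp (Lp.memLp f)) (Lp.memLp f) ?_
  have h2 : Tendsto (fun k : ℕ => ∫⁻ x, ‖((fun x => mulF F (cutoff n ((k : ℝ) + 1)) x (f x)) - f) x‖ₑ ^ 2 ∂μ)
      atTop (𝓝 (∫⁻ _, 0 ∂μ)) := by
    refine tendsto_lintegral_of_dominated_convergence' (fun x => ‖f x‖ₑ ^ 2)
      (fun k => (((hb k).memLp (Lp.memLp f)).sub (Lp.memLp f)).1.enorm.pow_const 2)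
      (fun k => Eventually.of_forall fun x => ?_) ?_ (Eventually.of_forall fun x => ?_)
    · simp only [Pi.sub_apply, mulF_apply]
      gcongr
      have e : (cutoff n ((k : ℝ) + 1) x : ℂ) • f x - f x =
          ((cutoff n ((k : ℝ) + 1) x - 1 : ℝ) : ℂ) • f x := by
        push_cast; rw [sub_smul, one_smul]
      have h0 : 0 ≤ cutoff n ((k : ℝ) + 1) x := (unitBump n).nonneg
      have h1 : cutoff n ((k : ℝ) + 1) x ≤ 1 := (unitBump n).le_one
      rw [e, ← ofReal_norm, ← ofReal_norm, norm_smul, Complex.norm_real]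
      refine ENNReal.ofReal_le_ofReal (mul_le_of_le_one_left (norm_nonneg _) ?_)
      rw [Real.norm_eq_abs, abs_le]
      constructor <;> linarith
    · rw [← eLpNorm_two_sq]
      exact (ENNReal.pow_lt_top (Lp.memLp f).2).ne
    · obtain ⟨N, hN⟩ := exists_nat_ge ‖x‖
      refine tendsto_const_nhds.congr' ((eventually_ge_atTop N).mono fun k hk => ?_)
      have : (N : ℝ) ≤ k := by exact_mod_cast hk
      simp only [Pi.sub_apply, mulF_apply]
      rw [cutoff_eq_one (by positivity) (by linarith), Complex.ofReal_one, one_smul, sub_self]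
      simp
  simp_rw [← eLpNorm_two_sq] at h2
  rw [lintegral_zero] at h2
  have h3 := (ENNReal.continuous_rpow_const (y := 1 / 2)).continuousAt.tendsto.comp h2
  refine (h3.congr fun k => ?_).trans (by simp)
  simp only [Function.comp_apply]
  rw [← ENNReal.rpow_natCast, ← ENNReal.rpow_mul]
  norm_num

/-- The derivative falls on the bump, and y ↦ ρ(x - y) is a test function for the weak gradient.
Free choice of the representatives `f₀`, `g₀` allows a compactly supported one. -/
theorem grad_mollify (hω : IsA2Weight ω) {f : L2w ω} {g : L2wVec ω} (h : HasWeakGradient f g)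
    {f₀ : E n → ℂ} {g₀ : E n → V n} (hf : f =ᵐ[volume] f₀) (hg : g =ᵐ[volume] g₀) (k : ℕ) (x : E n) :
    gradV (mollify k f₀) x = mollify k g₀ x := by
  have hfl : LocallyIntegrable f₀ volume := (hω.locallyIntegrable_coe f).congr hf
  have hgl : LocallyIntegrable g₀ volume := (hω.locallyIntegrable_vec g).congr hg
  have hρ1 : ContDiff ℝ 1 (bumpKernel (E n) k) := (bumpKernel_contDiff k).of_le (by simp)
  ext i
  have h1 := (bumpKernel_hasCompactSupport (X := E n) k).hasFDerivAt_convolution_left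
    (ContinuousLinearMap.lsmul ℝ ℝ : ℝ →L[ℝ] ℂ →L[ℝ] ℂ) hρ1 hfl x
  have hc : Continuous fun y => fderiv ℝ (bumpKernel (E n) k) y := hρ1.continuous_fderiv (by simp)
  have hint := (((bumpKernel_hasCompactSupport (X := E n) k).fderiv (𝕜 := ℝ)).convolutionExists_left
    ((ContinuousLinearMap.lsmul ℝ ℝ : ℝ →L[ℝ] ℂ →L[ℝ] ℂ).precompL (E n)) hc hfl x).integrable_swap
  rw [gradV_apply, grad, mollify, h1.fderiv, convolution_eq_swap,
    ContinuousLinearMap.integral_apply hint]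
  set η : E n → ℂ := fun y => (bumpKernel (E n) k (x - y) : ℂ) with hη
  have hηt : IsTest η := by
    refine ⟨contDiff_coe ((bumpKernel_contDiff k).comp (contDiff_const.sub contDiff_id)), ?_⟩
    exact ((bumpKernel_hasCompactSupport (X := E n) k).comp_homeomorph
      (Homeomorph.subLeft x)).comp_left Complex.ofReal_zero
  have hgr : ∀ y, grad η y i = -(fderiv ℝ (bumpKernel (E n) k) (x - y) (EuclideanSpace.single i 1) : ℂ) := by
    intro y
    have h2 : HasFDerivAt (bumpKernel (E n) k) (fderiv ℝ (bumpKernel (E n) k) (x - y)) (x - y) :=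
      (hρ1.differentiable (by simp) _).hasFDerivAt
    have h3 := h2.comp y ((hasFDerivAt_id y).const_sub x)
    have h4 : HasFDerivAt η _ y := Complex.ofRealCLM.hasFDerivAt.comp y h3
    rw [grad, h4.fderiv]
    simp
  have hw := h η hηt i
  have e1 : ∫ y, f y * grad η y i = ∫ y, -((fderiv ℝ (bumpKernel (E n) k) (x - y)
      (EuclideanSpace.single i 1) : ℂ) * f₀ y) :=
    integral_congr_ae (hf.mono fun y hy => by simp only [hy, hgr]; ring)
  have e2 : ∫ y, g y i * η y = ∫ y, bumpKernel (E n) k (x - y) • g₀ y i :=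
    integral_congr_ae (hg.mono fun y hy => by
      simp only [hy, hη, Complex.real_smul]; ring)
  rw [e1, e2, integral_neg, neg_inj] at hw
  have e3 : mollify k g₀ x i = ∫ y, bumpKernel (E n) k (x - y) • g₀ y i := by
    rw [mollify_apply]
    exact ((EuclideanSpace.proj i : V n →L[ℂ] ℂ).restrictScalars ℝ).integral_comp_comm
      (integrable_bumpKernel_smul k hgl x) |>.symm
  rw [e3, ← hw]
  rfl

theorem mollify_isTest {f : E n → ℂ} (hf : LocallyIntegrable f volume) (hc : HasCompactSupport f)
    (k : ℕ) : IsTest (mollify k f) :=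
  ⟨mollify_contDiff k hf, (bumpKernel_hasCompactSupport k).convolution _ hc⟩

/-- Test functions are dense in `H¹_ω`. -/
theorem mem_closure_testPair (hω : IsA2Weight ω) {p : WithLp 2 (L2w ω × L2wVec ω)}
    (hp : p ∈ gradGraph ω) : p ∈ closure {q | ∃ η, IsTest η ∧ q = testPair ω η} := by
  set S := {q | ∃ η, IsTest η ∧ q = testPair ω η} with hS
  -- With a compactly supported representative, mollification already produces test functions
  -- converging together with their gradients; the general case is reduced to it by cutoffs.
  have step1 : ∀ (f : L2w ω) (g : L2wVec ω) (f₀ : E n → ℂ) (g₀ : E n → V n),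
      HasWeakGradient f g → f =ᵐ[volume] f₀ → g =ᵐ[volume] g₀ → HasCompactSupport f₀ →
      WithLp.toLp 2 (f, g) ∈ closure S := by
    intro f g f₀ g₀ h hf hg hc
    have hfl : LocallyIntegrable f₀ volume := (hω.locallyIntegrable_coe f).congr hf
    have mf : MemLp f₀ 2 (wMeasure ω) := (Lp.memLp f).ae_eq (hω.ae_eq_iff.2 hf)
    have mg : MemLp g₀ 2 (wMeasure ω) := (Lp.memLp g).ae_eq (hω.ae_eq_iff.2 hg)
    have ht := fun k => mollify_isTest hfl hc k
    have hgm : ∀ k, gradV (mollify k f₀) = mollify k g₀ := fun k =>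
      funext fun x => grad_mollify hω h hf hg k x
    have t1 := tendsto_toL2 (fun k => hω.memLp_of_cpt (ht k).cont (ht k).2) mf (hω.tendsto_mollify mf)
    have t2 := tendsto_toL2 (fun k => by rw [← hgm k]; exact (ht k).memLp_gradV hω) mg
      (hω.tendsto_mollify mg)
    rw [← toL2_eq_of_ae (hω.ae_eq_iff.2 hf)] at t1
    rw [← toL2_eq_of_ae (hω.ae_eq_iff.2 hg)] at t2
    have t3 := ((WithLp.prodContinuousLinearEquiv 2 ℂ (L2w ω) (L2wVec ω)).symm.continuous.tendsto
      (f, g)).comp (t1.prodMk_nhds t2)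
    refine mem_closure_of_tendsto t3 (Eventually.of_forall fun k => ⟨mollify k f₀, ht k, ?_⟩)
    simp only [testPair, hgm k]
    rfl
  obtain ⟨C, hC0, hC⟩ := exists_cutoff_grad_le n
  set f := p.fst with hf
  set g := p.snd with hg
  have hb : ∀ k : ℕ, IsBddField (wMeasure ω) (gradF (cutoff n ((k : ℝ) + 1))) (C / ((k : ℝ) + 1)) :=
    fun k => isBddField_gradF _ (cutoff_contDiff _) (hC _ (by positivity))
  have b1 := fun k : ℕ => isBddField_mulF (F := ℂ) (wMeasure ω)
    (cutoff_contDiff (n := n) ((k : ℝ) + 1)).continuous (cutoff_abs_le _)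
  have t1 := tendsto_ptOp_cutoff ℂ (wMeasure ω) f
  have t2 := tendsto_ptOp_cutoff (V n) (wMeasure ω) g
  -- The commutator of gradient and cutoff is of size C/(k + 1) and disappears in the limit.
  have t3 : Tendsto (fun k : ℕ => ptOp (wMeasure ω) (gradF (cutoff n ((k : ℝ) + 1))) f) atTop (𝓝 0) := by
    refine squeeze_zero_norm (fun k => norm_ptOp_le (hb k) (by positivity) f) ?_
    have := (tendsto_one_div_add_atTop_nhds_zero_nat (𝕜 := ℝ)).const_mul (C * ‖f‖)
    rw [mul_zero] at this
    refine this.congr fun k => ?_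
    ring
  have t4 := t2.add t3
  rw [add_zero] at t4
  have t5 := ((WithLp.prodContinuousLinearEquiv 2 ℂ (L2w ω) (L2wVec ω)).symm.continuous.tendsto
      (f, g)).comp (t1.prodMk_nhds t4)
  refine isClosed_closure.mem_of_tendsto t5 (Eventually.of_forall fun k => ?_)
  have hpos : (0 : ℝ) < (k : ℝ) + 1 := by positivity
  have hm := mul_mem_gradGraph hω (cutoff_contDiff _) (cutoff_abs_le _) (hC _ hpos)
    (f := f) (g := g) hp
  rw [mem_gradGraph hω] at hm
  exact step1 _ _ (fun x => (cutoff n ((k : ℝ) + 1) x : ℂ) • f x) _ hm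
    (hω.ae_eq_iff.1 (ptOp_coe (b1 k) f)) (ae_eq_refl _) ((cutoff_isTest hpos).2.smul_right)

/-- A function in `L²_ω` with vanishing weak gradient is zero. -/
theorem eq_zero_of_weakGradient_zero (hω : IsA2Weight ω) (hn : 1 ≤ n) {f : L2w ω}
    (h : HasWeakGradient f 0) : f = 0 := by
  have hfl := hω.locallyIntegrable_coe f
  have hg0 : ((0 : L2wVec ω) : E n → V n) =ᵐ[volume] fun _ => 0 :=
    hω.ae_eq_iff.1 (Lp.coeFn_zero _ _ _)
  -- Mollifications of f have zero gradient, so they are constant; their almost everywhere limit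
  -- shows that f is constant.
  have hconst : ∀ k x y, mollify k (f : E n → ℂ) x = mollify k (f : E n → ℂ) y := by
    intro k
    refine is_const_of_fderiv_eq_zero (𝕜 := ℝ) ((mollify_contDiff k hfl).differentiable (by simp))
      fun x => ?_
    have h1 := grad_mollify hω h (ae_eq_refl _) hg0 k x
    have h2 : mollify k (fun _ : E n => (0 : V n)) x = 0 := by simp [mollify_apply]
    rw [h2] at h1
    refine ContinuousLinearMap.coe_injective
      ((EuclideanSpace.basisFun (Fin n) ℝ).toBasis.ext fun i => ?_)
    have h3 := congrArg (fun v : V n => v i) h1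
    simpa [grad] using h3
  have hae := mollify_ae_tendsto hfl
  obtain ⟨x₀, hx₀⟩ := hae.exists
  have hc : (f : E n → ℂ) =ᵐ[volume] fun _ => f x₀ := hae.mono fun y hy =>
    tendsto_nhds_unique hy (hx₀.congr fun k => hconst k x₀ y)
  -- Because ω(ℝⁿ) = ∞, the only square integrable constant is zero.
  have hm : MemLp (fun _ : E n => f x₀) 2 (wMeasure ω) :=
    (Lp.memLp f).ae_eq (hω.ae_eq_iff.2 hc)
  rw [memLp_const_iff (by norm_num) (by norm_num), hω.measure_univ hn] at hm
  have h0 : f x₀ = 0 := by simpa using hm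
  rw [Lp.eq_zero_iff_ae_eq_zero]
  refine (hω.ae_eq_iff.2 hc).trans (Eventually.of_forall fun _ => h0)

end Density


/-! ### The coefficient operators -/

section Coefficients

variable {n : ℕ} {ω : E n → ℝ} {A : Coeff n} {M ν : ℝ}

/-- The field of operators `ω⁻¹ A(t, ·)`. -/
def coefF (ω : E n → ℝ) (A : Coeff n) (t : ℝ) (x : E n) : V n →L[ℂ] V n :=
  ((ω x)⁻¹ : ℂ) • Matrix.toEuclideanCLM (𝕜 := ℂ) (A t x)

theorem coefF_apply (t : ℝ) (x : E n) (v : V n) :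
    coefF ω A t x v = ((ω x)⁻¹ : ℂ) • WithLp.toLp 2 (A t x *ᵥ v.ofLp) := rfl

theorem inner_eq_dotProduct (v w : V n) : inner ℂ v w = w.ofLp ⬝ᵥ star v.ofLp := by
  rw [EuclideanSpace.inner_eq_star_dotProduct]

theorem IsElliptic.norm_coefF_le (hω : IsA2Weight ω) (hM : 0 ≤ M) (hA : IsElliptic ω A M ν) (t : ℝ)
    (x : E n) : ‖coefF ω A t x‖ ≤ M := by
  refine ContinuousLinearMap.opNorm_le_bound _ hM fun v => ?_
  have hp := hω.pos x
  set y : V n := WithLp.toLp 2 (A t x *ᵥ v.ofLp) with hy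
  -- The dot product in the hypothesis is bilinear, so the choice of ζ as the conjugate of A v
  -- produces ‖A v‖².
  have h1 := hA.upper t x v (WithLp.toLp 2 (star y.ofLp))
  have h2 : (A t x *ᵥ v.ofLp) ⬝ᵥ star y.ofLp = ((‖y‖ ^ 2 : ℝ) : ℂ) := by
    have := inner_eq_dotProduct y y
    rw [inner_self_eq_norm_sq_to_K] at this
    push_cast
    exact this.symm
  have h3 : ‖(WithLp.toLp 2 (star y.ofLp) : V n)‖ = ‖y‖ := by
    simp [EuclideanSpace.norm_eq]
  rw [h2, h3, Complex.norm_real, Real.norm_of_nonneg (by positivity)] at h1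
  rw [coefF_apply, ← hy, norm_smul, norm_inv, Complex.norm_real, Real.norm_of_nonneg hp.le,
    inv_mul_le_iff₀ hp]
  rcases eq_or_lt_of_le (norm_nonneg y) with h0 | h0
  · rw [← h0]; positivity
  · have : ‖y‖ * ‖y‖ ≤ (ω x * (M * ‖v‖)) * ‖y‖ := by nlinarith
    exact le_of_mul_le_mul_right this h0

theorem IsElliptic.coefF_lower (hω : IsA2Weight ω) (hA : IsElliptic ω A M ν) (t : ℝ) (x : E n)
    (v : V n) : ν * ‖v‖ ^ 2 ≤ (inner ℂ v (coefF ω A t x v)).re := by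
  have hp := hω.pos x
  have h1 := hA.lower t x v
  rw [coefF_apply, inner_smul_right, inner_eq_dotProduct, ← Complex.ofReal_inv,
    Complex.re_ofReal_mul, ← div_eq_inv_mul, le_div_iff₀ hp]
  exact h1

/-- Needed so that the default value ν·id of `coefOp` at exceptional times obeys the same upper
bound M. A unit vector exists because n ≥ 1. -/
theorem IsElliptic.le (hω : IsA2Weight ω) (hn : 1 ≤ n) (hM : 0 ≤ M) (hA : IsElliptic ω A M ν) :
    ν ≤ M := by
  set e : V n := EuclideanSpace.single ⟨0, hn⟩ 1
  have hen : ‖e‖ = 1 := by simp [e]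
  have h1 := hA.coefF_lower hω 0 0 e
  have h2 : (inner ℂ e (coefF ω A 0 0 e)).re ≤ ‖e‖ * (M * ‖e‖) :=
    (Complex.re_le_norm _).trans ((norm_inner_le_norm _ _).trans (by
      gcongr; exact (coefF ω A 0 0).le_of_opNorm_le (hA.norm_coefF_le hω hM 0 0) e))
  rw [hen] at h1 h2
  linarith

theorem IsElliptic.coefF_aesm (hω : IsA2Weight ω) (hA : IsElliptic ω A M ν) :
    AEStronglyMeasurable (fun p : ℝ × E n => coefF ω A p.1 p.2) volume := by
  have e : (fun p : ℝ × E n => coefF ω A p.1 p.2) = fun p => ((ω p.2)⁻¹ : ℂ) •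
      ∑ i, ∑ j, A p.1 p.2 i j • Matrix.toEuclideanCLM (𝕜 := ℂ) (Matrix.single i j (1 : ℂ)) := by
    funext p
    rw [coefF]
    congr 1
    conv_lhs => rw [Matrix.matrix_eq_sum_single (A p.1 p.2)]
    simp only [map_sum]
    refine Finset.sum_congr rfl fun i _ => Finset.sum_congr rfl fun j _ => ?_
    rw [← map_smul, Matrix.smul_single, smul_eq_mul, mul_one]
  rw [e]
  have h1 : AEMeasurable (fun p : ℝ × E n => ((ω p.2)⁻¹ : ℂ)) volume := by
    have : AEMeasurable (fun p : ℝ × E n => ω p.2) volume :=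
      hω.meas.comp_quasiMeasurePreserving Measure.quasiMeasurePreserving_snd
    exact (Complex.measurable_ofReal.comp_aemeasurable this).inv
  refine h1.aestronglyMeasurable.smul ?_
  refine Finset.aestronglyMeasurable_fun_sum _ fun i _ =>
    Finset.aestronglyMeasurable_fun_sum _ fun j _ => ?_
  exact (hA.meas i j).aestronglyMeasurable.smul aestronglyMeasurable_const

theorem IsElliptic.ae_aesm (hω : IsA2Weight ω) (hA : IsElliptic ω A M ν) :
    ∀ᵐ t : ℝ, AEStronglyMeasurable (coefF ω A t) (wMeasure ω) :=
  ((hA.coefF_aesm hω).prodMk_left).mono fun _ ht => ht.mono_ac wMeasure_absolutelyContinuous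

open Classical in
/-- The bounded operator of multiplication by `ω⁻¹ A(t, ·)` (and by `ν` for the exceptional times
at which this field is not measurable). -/
def coefOp (ω : E n → ℝ) (A : Coeff n) (ν t : ℝ) : L2wVec ω →L[ℂ] L2wVec ω :=
  if AEStronglyMeasurable (coefF ω A t) (wMeasure ω) then ptOp (wMeasure ω) (coefF ω A t)
  else (ν : ℂ) • ContinuousLinearMap.id ℂ _

theorem IsElliptic.isBddField (hω : IsA2Weight ω) (hM : 0 ≤ M) (hA : IsElliptic ω A M ν) {t : ℝ}
    (ht : AEStronglyMeasurable (coefF ω A t) (wMeasure ω)) :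
    IsBddField (wMeasure ω) (coefF ω A t) M :=
  ⟨ht, Eventually.of_forall fun x => hA.norm_coefF_le hω hM t x⟩

theorem IsElliptic.isEllipticFamily (hω : IsA2Weight ω) (hn : 1 ≤ n) (hM : 0 ≤ M) (hν : 0 < ν)
    (hA : IsElliptic ω A M ν) : IsEllipticFamily (coefOp ω A ν) M ν where
  meas f g := by
    have := hω.isLocallyFiniteMeasure
    have hac : (volume : Measure ℝ).prod (wMeasure ω) ≪ (volume : Measure (ℝ × E n)) :=
      Measure.AbsolutelyContinuous.rfl.prod wMeasure_absolutelyContinuous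
    have h1 := (hA.coefF_aesm hω).mono_ac hac
    have hg : AEStronglyMeasurable (fun p : ℝ × E n => g p.2) (volume.prod (wMeasure ω)) :=
      (Lp.aestronglyMeasurable g).comp_snd
    have hf : AEStronglyMeasurable (fun p : ℝ × E n => f p.2) (volume.prod (wMeasure ω)) :=
      (Lp.aestronglyMeasurable f).comp_snd
    have h2 : AEStronglyMeasurable (fun p : ℝ × E n => inner ℂ (f p.2) (coefF ω A p.1 p.2 (g p.2)))
        (volume.prod (wMeasure ω)) :=
      hf.inner (isBoundedBilinearMap_apply.continuous.comp_aestronglyMeasurable₂ h1 hg)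
    refine h2.integral_prod_right'.congr ((hA.ae_aesm hω).mono fun t ht => ?_)
    simp only [coefOp, if_pos ht]
    rw [L2.inner_def]
    exact integral_congr_ae ((ptOp_coe (hA.isBddField hω hM ht) g).mono fun x hx => by
      simp only [hx])
  upper t g := by
    by_cases ht : AEStronglyMeasurable (coefF ω A t) (wMeasure ω)
    · simp only [coefOp, if_pos ht]
      exact norm_ptOp_le (hA.isBddField hω hM ht) hM g
    · simp only [coefOp, if_neg ht]
      rw [_root_.smul_apply, ContinuousLinearMap.id_apply, norm_smul, Complex.norm_real,
        Real.norm_of_nonneg hν.le]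
      gcongr
      exact hA.le hω hn hM
  lower t g := by
    by_cases ht : AEStronglyMeasurable (coefF ω A t) (wMeasure ω)
    · simp only [coefOp, if_pos ht]
      have hb := hA.isBddField hω hM ht
      have h1 := (Lp.memLp g).integrable_norm_pow (p := 2) (by norm_num)
      have h2 := L2.integrable_inner (𝕜 := ℂ) g (ptOp (wMeasure ω) (coefF ω A t) g)
      have h3 : ‖g‖ ^ 2 = ∫ x, ‖g x‖ ^ 2 ∂(wMeasure ω) := by
        have h4 := L2.inner_def (𝕜 := ℂ) g g
        rw [inner_self_eq_norm_sq_to_K] at h4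
        simp only [inner_self_eq_norm_sq_to_K] at h4
        have h5 : (∫ x, ((‖g x‖ ^ 2 : ℝ) : ℂ) ∂(wMeasure ω)) = ((‖g‖ ^ 2 : ℝ) : ℂ) := by
          push_cast; exact h4.symm
        have h6 := (integral_ofReal (𝕜 := ℂ) (μ := wMeasure ω) (f := fun x => ‖g x‖ ^ 2)).symm.trans h5
        exact Complex.ofReal_injective h6.symm
      rw [h3, L2.inner_def, ← RCLike.re_eq_complex_re, ← integral_re h2, ← integral_const_mul]
      refine integral_mono_ae (h1.const_mul ν) h2.re ?_
      filter_upwards [ptOp_coe hb g] with x hx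
      rw [hx]
      exact hA.coefF_lower hω t x (g x)
    · simp only [coefOp, if_neg ht]
      rw [_root_.smul_apply, ContinuousLinearMap.id_apply, inner_smul_right,
        Complex.re_ofReal_mul, ← RCLike.re_eq_complex_re, inner_self_eq_norm_sq]

/-! ### Time reversal -/

/-- The coefficients of the time reversed adjoint operator. -/
def revCoeff (A : Coeff n) : Coeff n := fun t x => (A (-t) x)ᴴ

theorem revCoeff_revCoeff (A : Coeff n) : revCoeff (revCoeff A) = A := by
  funext t x; simp [revCoeff]

theorem adjoint_coefF (t : ℝ) (x : E n) :
    ContinuousLinearMap.adjoint (coefF ω A (-t) x) = coefF ω (revCoeff A) t x := by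
  rw [coefF, coefF, map_smulₛₗ, revCoeff, ← ContinuousLinearMap.star_eq_adjoint,
    ← Matrix.star_eq_conjTranspose, map_star]
  simp

theorem adjoint_coefF' (t : ℝ) (x : E n) :
    ContinuousLinearMap.adjoint (coefF ω (revCoeff A) t x) = coefF ω A (-t) x := by
  rw [← adjoint_coefF, ContinuousLinearMap.adjoint_adjoint]

theorem IsElliptic.rev (hω : IsA2Weight ω) (hM : 0 ≤ M) (hA : IsElliptic ω A M ν) :
    IsElliptic ω (revCoeff A) M ν where
  meas i j := by
    have h := (hA.meas j i).comp_quasiMeasurePreserving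
      ((Measure.measurePreserving_neg (volume : Measure ℝ)).prod
        (MeasurePreserving.id (volume : Measure (E n)))).quasiMeasurePreserving
    exact Complex.continuous_conj.measurable.comp_aemeasurable h
  upper t x ξ ζ := by
    have hp := hω.pos x
    have h1 : ‖coefF ω (revCoeff A) t x ξ‖ ≤ M * ‖ξ‖ := by
      rw [← adjoint_coefF]
      refine ContinuousLinearMap.le_of_opNorm_le _ ?_ ξ
      rw [LinearIsometryEquiv.norm_map]
      exact hA.norm_coefF_le hω hM _ _
    have h2 := norm_inner_le_norm (𝕜 := ℂ) (WithLp.toLp 2 (star ζ.ofLp)) (coefF ω (revCoeff A) t x ξ)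
    have h3 : ‖(WithLp.toLp 2 (star ζ.ofLp) : V n)‖ = ‖ζ‖ := by simp [EuclideanSpace.norm_eq]
    rw [inner_eq_dotProduct, h3, coefF_apply] at h2
    simp only [WithLp.ofLp_smul, star_star, smul_dotProduct, norm_smul, norm_inv,
      Complex.norm_real, Real.norm_of_nonneg hp.le] at h2
    rw [coefF_apply] at h1
    simp only [norm_smul, norm_inv, Complex.norm_real, Real.norm_of_nonneg hp.le] at h1
    rw [inv_mul_le_iff₀ hp] at h1 h2
    calc _ ≤ ω x * (‖ζ‖ * ((ω x)⁻¹ * ‖(WithLp.toLp 2 (revCoeff A t x *ᵥ ξ.ofLp) : V n)‖)) := h2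
      _ = ‖(WithLp.toLp 2 (revCoeff A t x *ᵥ ξ.ofLp) : V n)‖ * ‖ζ‖ := by field_simp
      _ ≤ (ω x * (M * ‖ξ‖)) * ‖ζ‖ := by gcongr
      _ = _ := by ring
  lower t x ξ := by
    have hp := hω.pos x
    have h1 : ν * ‖ξ‖ ^ 2 ≤ (inner ℂ ξ (coefF ω (revCoeff A) t x ξ)).re := by
      rw [← adjoint_coefF, ContinuousLinearMap.adjoint_inner_right, ← inner_conj_symm,
        Complex.conj_re]
      exact hA.coefF_lower hω _ _ _
    rw [coefF_apply, inner_smul_right, inner_eq_dotProduct, ← Complex.ofReal_inv,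
      Complex.re_ofReal_mul, ← div_eq_inv_mul, le_div_iff₀ hp] at h1
    exact h1

/-- A field is measurable exactly when its adjoint is, so both sides take the default branch at the
same times; there ν is real and the default is self-adjoint. -/
theorem revFamily_coefOp (hω : IsA2Weight ω) (hM : 0 ≤ M) (hA : IsElliptic ω A M ν) :
    revFamily (coefOp ω A ν) = coefOp ω (revCoeff A) ν := by
  funext t
  rw [revFamily]
  have hadj : (fun x => ContinuousLinearMap.adjoint (coefF ω A (-t) x)) = coefF ω (revCoeff A) t :=
    funext fun x => adjoint_coefF t x
  by_cases ht : AEStronglyMeasurable (coefF ω A (-t)) (wMeasure ω)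
  · have h2 : AEStronglyMeasurable (coefF ω (revCoeff A) t) (wMeasure ω) := by
      rw [← hadj]; exact (hA.isBddField hω hM ht).adjoint.meas
    rw [coefOp, coefOp, if_pos ht, if_pos h2, adjoint_ptOp (hA.isBddField hω hM ht), hadj]
  · have h2 : ¬ AEStronglyMeasurable (coefF ω (revCoeff A) t) (wMeasure ω) := by
      intro h
      apply ht
      have h3 := ((hA.rev hω hM).isBddField hω hM h).adjoint.meas
      simp only [adjoint_coefF'] at h3
      exact h3
    rw [coefOp, coefOp, if_neg ht, if_neg h2, map_smulₛₗ, ContinuousLinearMap.adjoint_id]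
    simp

end Coefficients


/-! ### Test functions on space-time as test paths -/

section Paths

variable {n : ℕ} {ω : E n → ℝ} {A : Coeff n} {M ν : ℝ}
variable {F : Type*} [NormedAddCommGroup F] [InnerProductSpace ℂ F]

theorem IsA2Weight.norm_toL2_le (hω : IsA2Weight ω) {f : E n → F} (hf : MemLp f 2 (wMeasure ω))
    {R ε : ℝ} (hε : 0 ≤ ε) (h1 : ∀ x, ‖f x‖ ≤ ε) (h2 : ∀ x ∉ Metric.ball (0 : E n) R, f x = 0) :
    ‖toL2 (wMeasure ω) f‖ ≤ √((wMeasure ω).real (Metric.ball (0 : E n) R)) * ε := by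
  rw [norm_toL2 hf]
  have hfin := hω.ball_lt_top (0 : E n) (r := R)
  have e : (Metric.ball (0 : E n) R).indicator f = f :=
    indicator_eq_self.2 fun x hx => by_contra fun hx' => hx (h2 x hx')
  rw [← e, eLpNorm_indicator_eq_eLpNorm_restrict measurableSet_ball]
  have h3 := eLpNorm_le_of_ae_bound (p := 2) (μ := (wMeasure ω).restrict (Metric.ball (0 : E n) R))
    (Eventually.of_forall h1)
  rw [Measure.restrict_apply_univ] at h3
  refine (ENNReal.toReal_mono ?_ h3).trans (le_of_eq ?_)
  · exact ENNReal.mul_ne_top (ENNReal.rpow_ne_top_of_nonneg (by norm_num) hfin.ne)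
      ENNReal.ofReal_ne_top
  · rw [ENNReal.toReal_mul, ENNReal.toReal_ofReal hε, Measure.real, ← ENNReal.toReal_rpow,
      Real.sqrt_eq_rpow]
    norm_num

theorem toL2_zero {α : Type*} [MeasurableSpace α] (μ : Measure α) :
    toL2 μ (fun _ => (0 : F)) = 0 := by
  have h : MemLp (fun _ : α => (0 : F)) 2 μ := MemLp.zero'
  exact Lp.ext ((toL2_coe h).trans (Lp.coeFn_zero F 2 μ).symm)

theorem exists_radius {Θ : ℝ × E n → F} (hc : HasCompactSupport Θ) :
    ∃ R : ℝ, 0 < R ∧ ∀ t x, (R ≤ |t| ∨ R ≤ ‖x‖) → Θ (t, x) = 0 := by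
  obtain ⟨R, hR⟩ := hc.isCompact.isBounded.subset_ball (0 : ℝ × E n)
  refine ⟨max R 1, by positivity, fun t x h => image_eq_zero_of_notMem_tsupport fun hm => ?_⟩
  have h1 := hR hm
  rw [mem_ball_zero_iff, Prod.norm_def, max_lt_iff, Real.norm_eq_abs] at h1
  have h2 := le_max_left R 1
  rcases h with h | h <;> linarith [h1.1, h1.2]

theorem hasCompactSupport_slice {Θ : ℝ × E n → F} (hc : HasCompactSupport Θ) (t : ℝ) :
    HasCompactSupport fun x => Θ (t, x) := by
  obtain ⟨R, -, hR⟩ := exists_radius hc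
  exact HasCompactSupport.intro (isCompact_closedBall (0 : E n) R) fun x hx =>
    hR t x (Or.inr (by rw [mem_closedBall_zero_iff, not_le] at hx; exact hx.le))

theorem IsA2Weight.memLp_slice (hω : IsA2Weight ω) {Θ : ℝ × E n → F} (hΘ : Continuous Θ)
    (hc : HasCompactSupport Θ) (t : ℝ) : MemLp (fun x => Θ (t, x)) 2 (wMeasure ω) :=
  hω.memLp_of_cpt (by fun_prop) (hasCompactSupport_slice hc t)

theorem hasCompactSupport_toL2 {Θ : ℝ × E n → F} (hc : HasCompactSupport Θ) :
    HasCompactSupport fun t => toL2 (wMeasure ω) fun x => Θ (t, x) := by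
  obtain ⟨R, -, hR⟩ := exists_radius hc
  refine HasCompactSupport.intro (isCompact_closedBall (0 : ℝ) R) fun t ht => ?_
  rw [mem_closedBall_zero_iff, not_le, Real.norm_eq_abs] at ht
  have h1 : (fun x => Θ (t, x)) = fun _ => 0 := funext fun x => hR t x (Or.inl ht.le)
  rw [h1, toL2_zero]

theorem IsA2Weight.continuous_toL2 (hω : IsA2Weight ω) {Θ : ℝ × E n → F} (hΘ : Continuous Θ)
    (hc : HasCompactSupport Θ) : Continuous fun t => toL2 (wMeasure ω) fun x => Θ (t, x) := by
  obtain ⟨R, -, hR⟩ := exists_radius hc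
  have huc := hc.uniformContinuous_of_continuous hΘ
  set C := √((wMeasure ω).real (Metric.ball (0 : E n) R)) with hC
  rw [Metric.continuous_iff]
  intro t ε hε
  obtain ⟨δ, hδ, h⟩ := Metric.uniformContinuous_iff.1 huc (ε / (C + 1)) (by positivity)
  refine ⟨δ, hδ, fun s hs => ?_⟩
  rw [dist_eq_norm, ← toL2_sub (hω.memLp_slice hΘ hc s) (hω.memLp_slice hΘ hc t)]
  refine (hω.norm_toL2_le (R := R) ((hω.memLp_slice hΘ hc s).sub (hω.memLp_slice hΘ hc t))
    (by positivity : 0 ≤ ε / (C + 1)) (fun x => ?_) fun x hx => ?_).trans_lt ?_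
  · rw [Pi.sub_apply, ← dist_eq_norm]
    refine (h ?_).le
    rw [Prod.dist_eq, dist_self, max_eq_left dist_nonneg]
    exact hs
  · rw [mem_ball_zero_iff, not_lt] at hx
    rw [Pi.sub_apply, hR s x (Or.inr hx), hR t x (Or.inr hx), sub_zero]
  · rw [← hC, ← mul_div_assoc, div_lt_iff₀ (by positivity)]
    nlinarith [Real.sqrt_nonneg ((wMeasure ω).real (Metric.ball (0 : E n) R))]

/-- The time derivative of a function on space-time. -/
def timeDeriv (η : ℝ × E n → ℂ) (p : ℝ × E n) : ℂ := deriv (fun τ => η (τ, p.2)) p.1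

theorem hasDerivAt_slice {η : ℝ × E n → ℂ} (hη : IsTest η) (t : ℝ) (x : E n) :
    HasDerivAt (fun τ => η (τ, x)) (fderiv ℝ η (t, x) (1, 0)) t := by
  have h1 : HasFDerivAt η (fderiv ℝ η (t, x)) (t, x) :=
    (hη.1.differentiable (by simp) _).hasFDerivAt
  have h2 : HasDerivAt (fun τ : ℝ => (τ, x)) ((1 : ℝ), (0 : E n)) t :=
    (hasDerivAt_id t).prodMk (hasDerivAt_const t x)
  exact h1.comp_hasDerivAt t h2

theorem timeDeriv_eq {η : ℝ × E n → ℂ} (hη : IsTest η) :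
    timeDeriv η = fun p => fderiv ℝ η p (1, 0) := by
  funext p; exact (hasDerivAt_slice hη p.1 p.2).deriv

theorem IsTest.timeDeriv {η : ℝ × E n → ℂ} (hη : IsTest η) : IsTest (timeDeriv η) := by
  rw [timeDeriv_eq hη]
  exact ⟨(hη.1.fderiv_right (m := ((⊤ : ℕ∞) : WithTop ℕ∞)) (by simp)).clm_apply contDiff_const,
    hη.2.fderiv_apply ℝ _⟩

/-- The spatial gradient of a function on space-time. -/
def spaceGrad (η : ℝ × E n → ℂ) (p : ℝ × E n) : V n := gradV (fun y => η (p.1, y)) p.2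

theorem spaceGrad_eq {η : ℝ × E n → ℂ} (hη : IsTest η) :
    spaceGrad η = fun p => WithLp.toLp 2 fun i => fderiv ℝ η p (0, EuclideanSpace.single i 1) := by
  funext p
  ext i
  have h1 : HasFDerivAt η (fderiv ℝ η (p.1, p.2)) (p.1, p.2) :=
    (hη.1.differentiable (by simp) _).hasFDerivAt
  have h2 : HasFDerivAt (fun y : E n => (p.1, y)) (ContinuousLinearMap.inr ℝ ℝ (E n)) p.2 :=
    hasFDerivAt_prodMk_right p.1 p.2
  have h3 := h1.comp p.2 h2
  change fderiv ℝ (η ∘ fun y => (p.1, y)) p.2 _ = _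
  rw [h3.fderiv]
  simp

theorem continuous_spaceGrad {η : ℝ × E n → ℂ} (hη : IsTest η) : Continuous (spaceGrad η) := by
  rw [spaceGrad_eq hη]
  refine (PiLp.continuous_toLp 2 _).comp (continuous_pi fun i => ?_)
  exact (hη.1.continuous_fderiv (by simp)).clm_apply continuous_const

theorem hasCompactSupport_spaceGrad {η : ℝ × E n → ℂ} (hη : IsTest η) :
    HasCompactSupport (spaceGrad η) := by
  rw [spaceGrad_eq hη]
  refine (hη.2.fderiv (𝕜 := ℝ)).mono fun x hx => ?_
  rw [Function.mem_support] at hx ⊢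
  intro h
  apply hx
  ext i
  simp [h]

theorem IsTest.slice {η : ℝ × E n → ℂ} (hη : IsTest η) (t : ℝ) : IsTest fun x => η (t, x) :=
  ⟨hη.1.comp (contDiff_const.prodMk contDiff_id), hasCompactSupport_slice hη.2 t⟩

/-- By uniform continuity of ∂ₜη and the mean value inequality, difference quotients converge
uniformly in x; all supports lie in one ball of finite ω-mass, so convergence holds in L²_ω. -/
theorem IsA2Weight.hasDerivAt_toL2 (hω : IsA2Weight ω) {η : ℝ × E n → ℂ} (hη : IsTest η) (t : ℝ) :
    HasDerivAt (fun t => toL2 (wMeasure ω) fun x => η (t, x))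
      (toL2 (wMeasure ω) fun x => timeDeriv η (t, x)) t := by
  have hη' := hη.timeDeriv
  obtain ⟨R, -, hR⟩ := exists_radius hη.2
  obtain ⟨R', -, hR'⟩ := exists_radius hη'.2
  have huc := hη'.2.uniformContinuous_of_continuous hη'.cont
  set Rm := max R R'
  set C := √((wMeasure ω).real (Metric.ball (0 : E n) Rm)) with hC
  rw [hasDerivAt_iff_isLittleO, Asymptotics.isLittleO_iff]
  intro ε hε
  obtain ⟨δ, hδ, h⟩ := Metric.uniformContinuous_iff.1 huc (ε / (C + 1)) (by positivity)
  filter_upwards [Metric.ball_mem_nhds t hδ] with s hs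
  have m1 := hω.memLp_slice hη.cont hη.2 s
  have m2 := hω.memLp_slice hη.cont hη.2 t
  have m3 := (hω.memLp_slice hη'.cont hη'.2 t).const_smul (s - t)
  have e1 : (s - t) • toL2 (wMeasure ω) (fun x => timeDeriv η (t, x)) =
      toL2 (wMeasure ω) ((s - t) • fun x => timeDeriv η (t, x)) := by
    refine Lp.ext ?_
    filter_upwards [Lp.coeFn_smul (s - t) (toL2 (wMeasure ω) (fun x => timeDeriv η (t, x))),
      toL2_coe m3, toL2_coe (hω.memLp_slice hη'.cont hη'.2 t)] with x h1 h2 h3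
    rw [h1, h2, Pi.smul_apply, Pi.smul_apply, h3]
  rw [e1, ← toL2_sub m1 m2, ← toL2_sub (m1.sub m2) m3]
  refine (hω.norm_toL2_le (R := Rm) ((m1.sub m2).sub m3)
    (by positivity : 0 ≤ ε / (C + 1) * ‖s - t‖) (fun x => ?_) fun x hx => ?_).trans ?_
  · simp only [Pi.sub_apply, Pi.smul_apply]
    have hd : ∀ r ∈ Metric.ball t δ, HasDerivWithinAt
        (fun τ => η (τ, x) - (τ - t) • timeDeriv η (t, x))
        (timeDeriv η (r, x) - timeDeriv η (t, x)) (Metric.ball t δ) r := by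
      intro r _
      have h1 := hasDerivAt_slice hη r x
      have h2 := (((hasDerivAt_id r).sub_const t).smul_const (timeDeriv η (t, x)))
      rw [one_smul] at h2
      have h3 : timeDeriv η (r, x) = fderiv ℝ η (r, x) (1, 0) := by rw [timeDeriv_eq hη]
      rw [h3]
      exact (h1.sub h2).hasDerivWithinAt
    have hb : ∀ r ∈ Metric.ball t δ, ‖timeDeriv η (r, x) - timeDeriv η (t, x)‖ ≤ ε / (C + 1) := by
      intro r hr
      rw [← dist_eq_norm]
      refine (h ?_).le
      rw [Prod.dist_eq, dist_self, max_eq_left dist_nonneg]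
      exact hr
    have h4 := Convex.norm_image_sub_le_of_norm_hasDerivWithin_le hd hb (convex_ball t δ)
      (Metric.mem_ball_self hδ) hs
    simp only [sub_self, zero_smul, sub_zero] at h4
    convert h4 using 2
    abel
  · rw [mem_ball_zero_iff, not_lt, max_le_iff] at hx
    simp only [Pi.sub_apply, Pi.smul_apply]
    rw [hR s x (Or.inr hx.1), hR t x (Or.inr hx.1), hR' t x (Or.inr hx.2), smul_zero, sub_zero,
      sub_zero]
  · rw [← hC, ← mul_assoc]
    gcongr
    rw [← mul_div_assoc, div_le_iff₀ (by positivity)]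
    nlinarith [Real.sqrt_nonneg ((wMeasure ω).real (Metric.ball (0 : E n) Rm))]

theorem isTestPath_of_isTest (hω : IsA2Weight ω) {η : ℝ × E n → ℂ} (hη : IsTest η) :
    IsTestPath (gradGraph ω) (fun t => toL2 (wMeasure ω) fun x => η (t, x))
      (fun t => toL2 (wMeasure ω) fun x => timeDeriv η (t, x))
      (fun t => toL2 (wMeasure ω) fun x => spaceGrad η (t, x)) where
  cont' := hω.continuous_toL2 hη.timeDeriv.cont hη.timeDeriv.2
  contE := hω.continuous_toL2 (continuous_spaceGrad hη) (hasCompactSupport_spaceGrad hη)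
  deriv t := hω.hasDerivAt_toL2 hη t
  supp := hasCompactSupport_toL2 hη.2
  suppE := hasCompactSupport_toL2 (hasCompactSupport_spaceGrad hη)
  mem t := testPair_mem hω (hη.slice t)

/-! ### The weak formulation in terms of paths -/

theorem timeDeriv_conj (η : ℝ × E n → ℂ) (p : ℝ × E n) :
    timeDeriv (fun q => conj (η q)) p = conj (timeDeriv η p) := by
  simp only [timeDeriv, ← fderiv_apply_one_eq_deriv]
  have := Complex.conjCLE.comp_fderiv (f := fun τ => η (τ, p.2)) (x := p.1)
  exact congrArg (fun L : ℝ →L[ℝ] ℂ => L 1) this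

theorem grad_conj (η : E n → ℂ) (x : E n) (i : Fin n) :
    grad (fun y => conj (η y)) x i = conj (grad η x i) := by
  have := Complex.conjCLE.comp_fderiv (f := η) (x := x)
  exact congrArg (fun L : E n →L[ℝ] ℂ => L (EuclideanSpace.single i 1)) this

theorem inner_toL2_eq {f : E n → F} (hf : MemLp f 2 (wMeasure ω))
    (g : Lp F 2 (wMeasure ω)) :
    inner ℂ (toL2 (wMeasure ω) f) g = ∫ x, inner ℂ (f x) (g x) ∂(wMeasure ω) := by
  rw [L2.inner_def]
  exact integral_congr_ae ((toL2_coe hf).mono fun x hx => by simp only [hx])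

theorem integrable_inner_toL2 {f : E n → F} (hf : MemLp f 2 (wMeasure ω))
    (g : Lp F 2 (wMeasure ω)) : Integrable (fun x => inner ℂ (f x) (g x)) (wMeasure ω) :=
  integrable_inner hf (Lp.memLp g)

/-- The distributional duality is bilinear and the inner product is not, so the test function is
conjugated on the way. The times at which `coefOp` takes its default value form a null set. -/
theorem solvesForward_iff (hω : IsA2Weight ω) (hM : 0 ≤ M) (hA : IsElliptic ω A M ν)
    {u : ℝ → L2w ω} {G : ℝ → L2wVec ω} {f : ℝ → E n → ℂ} {h : ℝ → L2w ω}
    (hf : ∀ t, f t =ᵐ[volume] h t) :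
    SolvesForward ω A u G f ↔ ∀ η : ℝ × E n → ℂ, IsTest η →
      ∫ t, (- inner ℂ (toL2 (wMeasure ω) fun x => timeDeriv η (t, x)) (u t) +
        inner ℂ (toL2 (wMeasure ω) fun x => spaceGrad η (t, x)) (coefOp ω A ν t (G t))) =
      ∫ t, inner ℂ (toL2 (wMeasure ω) fun x => η (t, x)) (h t) := by
  have key : ∀ η : ℝ × E n → ℂ, IsTest η →
      ((∫ t : ℝ, ∫ x, (- (u t x * deriv (fun τ : ℝ => conj (η (τ, x))) t)
        + ((ω x : ℂ))⁻¹ * ((A t x *ᵥ (G t x).ofLp) ⬝ᵥ grad (fun y => conj (η (t, y))) x))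
          ∂(wMeasure ω)) =
      ∫ t, (- inner ℂ (toL2 (wMeasure ω) fun x => timeDeriv η (t, x)) (u t) +
        inner ℂ (toL2 (wMeasure ω) fun x => spaceGrad η (t, x)) (coefOp ω A ν t (G t)))) ∧
      ((∫ t : ℝ, ∫ x, f t x * conj (η (t, x)) ∂(wMeasure ω)) =
        ∫ t, inner ℂ (toL2 (wMeasure ω) fun x => η (t, x)) (h t)) := by
    intro η hη
    constructor
    · refine integral_congr_ae ((hA.ae_aesm hω).mono fun t ht => ?_)
      have m1 := hω.memLp_slice hη.timeDeriv.cont hη.timeDeriv.2 t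
      have m2 := hω.memLp_slice (continuous_spaceGrad hη) (hasCompactSupport_spaceGrad hη) t
      simp only [coefOp, if_pos ht]
      have i1 : Integrable (fun x => -inner ℂ (timeDeriv η (t, x)) (u t x)) (wMeasure ω) :=
        (integrable_inner_toL2 m1 _).neg
      rw [inner_toL2_eq m1, inner_toL2_eq m2, ← integral_neg, ← integral_add i1
        (integrable_inner_toL2 m2 _)]
      refine integral_congr_ae ?_
      filter_upwards [ptOp_coe (hA.isBddField hω hM ht) (G t)] with x hx
      rw [hx]
      have e1 : deriv (fun τ : ℝ => conj (η (τ, x))) t = conj (timeDeriv η (t, x)) :=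
        timeDeriv_conj η (t, x)
      have e2 : grad (fun y => conj (η (t, y))) x = star (spaceGrad η (t, x)).ofLp :=
        funext fun i => grad_conj _ _ _
      rw [e1, e2, coefF_apply, inner_smul_right, inner_eq_dotProduct, RCLike.inner_apply]
    · congr 1 with t
      rw [inner_toL2_eq (hω.memLp_slice hη.cont hη.2 t)]
      refine integral_congr_ae ((hω.ae_eq_iff.2 (hf t)).mono fun x hx => ?_)
      simp only [hx, RCLike.inner_apply]
  constructor
  · intro H η hη
    rw [← (key η hη).1, ← (key η hη).2]
    exact H _ hη.conj
  · intro H η hη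
    have h1 := key _ hη.conj
    simp only [Complex.conj_conj] at h1
    rw [h1.1, h1.2]
    exact H _ hη.conj

theorem SolvesPaths.solvesForward (hω : IsA2Weight ω) (hM : 0 ≤ M) (hA : IsElliptic ω A M ν)
    {u : ℝ → L2w ω} {G : ℝ → L2wVec ω} {f : ℝ → E n → ℂ} {h : ℝ → L2w ω}
    (hf : ∀ t, f t =ᵐ[volume] h t) (hu : SolvesPaths (gradGraph ω) (coefOp ω A ν) u G h) :
    SolvesForward ω A u G f :=
  (solvesForward_iff hω hM hA hf).2 fun _ hη => hu _ _ _ (isTestPath_of_isTest hω hη)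

end Paths


/-! ### Solutions of the degenerate equation -/

section Solutions

variable {n : ℕ} {ω : E n → ℝ} {A : Coeff n} {M ν : ℝ}

theorem IsA2Weight.secondCountable (hω : IsA2Weight ω) :
    SecondCountableTopology (L2wVec ω) := by
  have := hω.isLocallyFiniteMeasure
  have : Fact ((2 : ℝ≥0∞) ≠ ∞) := ⟨by norm_num⟩
  infer_instance

theorem toL2_smul {α F : Type*} [MeasurableSpace α] {μ : Measure α} [NormedAddCommGroup F]
    [InnerProductSpace ℂ F] (c : ℂ) {f : α → F} (hf : MemLp f 2 μ) :
    toL2 μ (fun x => c • f x) = c • toL2 μ f := by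
  have hc : MemLp (fun x => c • f x) 2 μ := hf.const_smul c
  refine Lp.ext ((toL2_coe hc).trans ?_)
  filter_upwards [toL2_coe hf, Lp.coeFn_smul c (toL2 μ f)] with x h1 h2
  rw [h2, Pi.smul_apply, h1]

/-- The tensor product of two test functions, conjugated in the first factor. -/
def tensor (χ : ℝ → ℂ) (θ : E n → ℂ) (q : ℝ × E n) : ℂ := conj (χ q.1) * θ q.2

theorem isTest_tensor {χ : ℝ → ℂ} {θ : E n → ℂ} (hχ : IsTest χ) (hθ : IsTest θ) :
    IsTest (tensor χ θ) := by
  refine ⟨(hχ.conj.1.comp contDiff_fst).mul (hθ.1.comp contDiff_snd), ?_⟩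
  refine HasCompactSupport.intro (hχ.2.isCompact.prod hθ.2.isCompact) fun q hq => ?_
  rw [mem_prod, not_and_or] at hq
  rcases hq with hq | hq
  · rw [tensor, image_eq_zero_of_notMem_tsupport hq, map_zero, zero_mul]
  · rw [tensor, image_eq_zero_of_notMem_tsupport hq, mul_zero]

theorem timeDeriv_tensor {χ : ℝ → ℂ} (hχ : IsTest χ) (θ : E n → ℂ) (t : ℝ) (x : E n) :
    timeDeriv (tensor χ θ) (t, x) = conj (deriv χ t) • θ x := by
  have h1 : HasDerivAt (fun τ => conj (χ τ) * θ x) (conj (deriv χ t) * θ x) t :=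
    (((Complex.conjCLE : ℂ →L[ℝ] ℂ).hasFDerivAt.comp_hasDerivAt t (hχ.hasDerivAt t))).mul_const _
  exact h1.deriv

theorem spaceGrad_tensor (χ : ℝ → ℂ) {θ : E n → ℂ} (hθ : IsTest θ) (t : ℝ) (x : E n) :
    spaceGrad (tensor χ θ) (t, x) = conj (χ t) • gradV θ x := by
  ext i
  change fderiv ℝ (fun y => conj (χ t) * θ y) x _ = _
  rw [fderiv_const_mul (hθ.1.differentiable (by simp) x)]
  rfl

theorem isClosed_weak_identity {H K : Type*} [NormedAddCommGroup H] [InnerProductSpace ℂ H]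
    [NormedAddCommGroup K] [InnerProductSpace ℂ K] (x y : H) (z : K) :
    IsClosed {p : WithLp 2 (H × K) | -inner ℂ p.fst x = inner ℂ p.snd z + inner ℂ p.fst y} := by
  have hc1 : Continuous fun p : WithLp 2 (H × K) => p.fst := (WithLp.fstL 2 ℂ H K).continuous
  have hc2 : Continuous fun p : WithLp 2 (H × K) => p.snd := (WithLp.sndL 2 ℂ H K).continuous
  exact isClosed_eq (hc1.inner continuous_const).neg
      ((hc2.inner continuous_const).add (hc1.inner continuous_const))

theorem SolvesForward.weak_testPair (hω : IsA2Weight ω) (hM : 0 ≤ M)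
    (hA : IsElliptic ω A M ν) {u : ℝ → L2w ω} {G : ℝ → L2wVec ω} {f : ℝ → E n → ℂ} {h : ℝ → L2w ω}
    (hf : ∀ t, f t =ᵐ[volume] h t) (hS : SolvesForward ω A u G f) {χ : ℝ → ℂ} (hχ : IsTest χ)
    {θ : E n → ℂ} (hθ : IsTest θ) :
    ∫ t, (-(deriv χ t * inner ℂ (toL2 (wMeasure ω) θ) (u t)) +
      χ t * inner ℂ (toL2 (wMeasure ω) (gradV θ)) (coefOp ω A ν t (G t))) =
    ∫ t, χ t * inner ℂ (toL2 (wMeasure ω) θ) (h t) := by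
  have hw := (solvesForward_iff hω hM hA hf).1 hS _ (isTest_tensor hχ hθ)
  have hθm := hω.memLp_of_cpt hθ.cont hθ.2
  have t1 : ∀ t, toL2 (wMeasure ω) (fun x => timeDeriv (tensor χ θ) (t, x)) =
      conj (deriv χ t) • toL2 (wMeasure ω) θ := fun t => by
    rw [← toL2_smul _ hθm]; simp only [timeDeriv_tensor hχ θ]
  have t2 : ∀ t, toL2 (wMeasure ω) (fun x => tensor χ θ (t, x)) =
      conj (χ t) • toL2 (wMeasure ω) θ := fun t => by
    rw [← toL2_smul _ hθm]; simp only [tensor, smul_eq_mul]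
  have t3 : ∀ t, toL2 (wMeasure ω) (fun x => spaceGrad (tensor χ θ) (t, x)) =
      conj (χ t) • toL2 (wMeasure ω) (gradV θ) := fun t => by
    rw [← toL2_smul _ (hθ.memLp_gradV hω)]; simp only [spaceGrad_tensor χ hθ]
  simp only [t1, t2, t3, inner_smul_left, Complex.conj_conj] at hw
  exact hw

/-- The weak form for tests in the graph follows from the distributional formulation. -/
theorem SolvesForward.isData (hω : IsA2Weight ω) (hn : 1 ≤ n) (hM : 0 ≤ M) (hν : 0 < ν)
    (hA : IsElliptic ω A M ν) {u : ℝ → L2w ω} {G : ℝ → L2wVec ω} (hE : InEnergyClass u G)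
    {f : ℝ → E n → ℂ} {h : ℝ → L2w ω} (hf : ∀ t, f t =ᵐ[volume] h t) (hh : Continuous h)
    (hS : SolvesForward ω A u G f) :
    IsData (gradGraph ω) u G (fun t => -(coefOp ω A ν t (G t))) h := by
  have hsc := hω.secondCountable
  have hfl : L2loc fun t => -(coefOp ω A ν t (G t)) :=
    ((hA.isEllipticFamily hω hn hM hν).l2loc hE.gradMem.l2loc).neg
  refine ⟨hE.locInt, hE.gradMem.l2loc, hfl, hh.l2loc,
    hE.isGrad.mono fun t ht => (mem_gradGraph hω).2 ht, fun χ hχ p hp => ?_⟩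
  have i1 : Integrable fun t => deriv χ t • u t :=
    hE.locInt.integrable_smul_left_of_hasCompactSupport hχ.continuous_deriv hχ.2.deriv
  have i2 : Integrable fun t => χ t • -(coefOp ω A ν t (G t)) :=
    hfl.locallyIntegrable.integrable_smul_left_of_hasCompactSupport hχ.continuous hχ.2
  have i3 : Integrable fun t => χ t • h t :=
    hh.locallyIntegrable.integrable_smul_left_of_hasCompactSupport hχ.continuous hχ.2
  have e1 : ∀ x : L2w ω, ∫ t, deriv χ t * inner ℂ x (u t) =
      inner ℂ x (∫ t, deriv χ t • u t) := fun x => by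
    rw [← integral_inner i1]; simp only [inner_smul_right]
  have e2 : ∀ (x : L2w ω) (y : L2wVec ω), ∫ t, χ t * (inner ℂ y (-(coefOp ω A ν t (G t))) +
      inner ℂ x (h t)) = inner ℂ y (∫ t, χ t • -(coefOp ω A ν t (G t))) +
      inner ℂ x (∫ t, χ t • h t) := fun x y => by
    rw [← integral_inner i2, ← integral_inner i3, ← integral_add (i2.const_inner _) (i3.const_inner _)]
    simp only [inner_smul_right, mul_add]
  rw [e1, e2]
  -- With the time integrals moved inside the inner products, both sides are continuous in p for the
  -- graph norm, so it suffices to check the dense set of test pairs.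
  refine closure_minimal ?_ (isClosed_weak_identity _ _ _) (mem_closure_testPair hω hp)
  rintro _ ⟨θ, hθ, rfl⟩
  rw [mem_ofPred_eq, ← e1, ← e2]
  have hw := hS.weak_testPair hω hM hA hf hχ hθ
  have ip1 := i1.const_inner (𝕜 := ℂ) (toL2 (wMeasure ω) θ)
  have ip2 := i2.const_inner (𝕜 := ℂ) (toL2 (wMeasure ω) (gradV θ))
  have ip3 := i3.const_inner (𝕜 := ℂ) (toL2 (wMeasure ω) θ)
  simp only [inner_smul_right, inner_neg_right, mul_neg] at ip1 ip2 ip3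
  have ip2' : Integrable fun t => χ t * inner ℂ (toL2 (wMeasure ω) (gradV θ)) (coefOp ω A ν t (G t)) := by
    simpa only [neg_neg] using ip2.fun_neg
  rw [integral_add ip1.fun_neg ip2', integral_neg] at hw
  simp only [testPair, WithLp.toLp_fst, WithLp.toLp_snd, inner_neg_right, mul_add, mul_neg]
  rw [integral_add ip2 ip3, ← hw, integral_neg]
  ring

/-- `u`, with gradient `G`, is the continuous energy solution with source `φ ⊗ ψ`. -/
structure IsSol (ω : E n → ℝ) (A : Coeff n) (ν : ℝ) (φ : ℝ → ℂ) (ψ : L2w ω) (u : ℝ → L2w ω)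
    (G : ℝ → L2wVec ω) : Prop where
  cont : Continuous u
  gradMem : MemLp G 2 volume
  data : IsData (gradGraph ω) u G (fun t => -(coefOp ω A ν t (G t))) (fun t => φ t • ψ)

theorem gradGraph_injective (hω : IsA2Weight ω) (hn : 1 ≤ n) (x : L2w ω)
    (hx : WithLp.toLp 2 (x, (0 : L2wVec ω)) ∈ gradGraph ω) : x = 0 :=
  eq_zero_of_weakGradient_zero hω hn ((mem_gradGraph hω).1 hx)

theorem IsSol.unique (hω : IsA2Weight ω) (hn : 1 ≤ n) (hM : 0 ≤ M) (hν : 0 < ν)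
    (hA : IsElliptic ω A M ν) {φ : ℝ → ℂ} {ψ : L2w ω} {u v : ℝ → L2w ω} {G F : ℝ → L2wVec ω}
    (hu : IsSol ω A ν φ ψ u G) (hv : IsSol ω A ν φ ψ v F) : u = v := by
  have hsc := hω.secondCountable
  exact Continuous.ae_eq_iff_eq volume hu.cont hv.cont |>.1
    (IsData.unique (isClosed_gradGraph ω) (gradGraph_injective hω hn)
      (hA.isEllipticFamily hω hn hM hν) hν hu.data hu.gradMem hv.data hv.gradMem)

theorem SolvesForward.exists_isSol (hω : IsA2Weight ω) (hn : 1 ≤ n) (hM : 0 ≤ M) (hν : 0 < ν)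
    (hA : IsElliptic ω A M ν) {u : ℝ → L2w ω} {G : ℝ → L2wVec ω} (hE : InEnergyClass u G)
    {φ : ℝ → ℂ} (hφ : Continuous φ) {ψ : L2w ω}
    (hS : SolvesForward ω A u G fun t x => φ t * ψ x) :
    ∃ v, IsSol ω A ν φ ψ v G ∧ u =ᵐ[volume] v := by
  have hsc := hω.secondCountable
  have hd := hS.isData hω hn hM hν hA hE (h := fun t => φ t • ψ)
    (fun t => hω.ae_eq_iff.1 (Lp.coeFn_smul (φ t) ψ).symm) (hφ.smul continuous_const)
  obtain ⟨v, hv, huv⟩ := hd.exists_continuous (isClosed_gradGraph ω)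
  exact ⟨v, ⟨hv, hE.gradMem, hd.congr huv⟩, huv⟩

/-- Existence of the energy solution. -/
theorem exists_isSol (hω : IsA2Weight ω) (hn : 1 ≤ n) (hM : 0 ≤ M) (hν : 0 < ν)
    (hA : IsElliptic ω A M ν) {φ : ℝ → ℂ} (hφ : Continuous φ) (ψ : L2w ω) {a b : ℝ}
    (hsupp : ∀ t ∉ Icc a b, φ t = 0) :
    ∃ u G, IsSol ω A ν φ ψ u G ∧ InEnergyClass u G ∧ (∀ t ≤ a, u t = 0) ∧
      SolvesForward ω A u G fun t x => φ t * ψ x := by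
  have hsc := hω.secondCountable
  have hB := hA.isEllipticFamily hω hn hM hν
  have hc : Continuous fun t => φ t • ψ := hφ.smul continuous_const
  obtain ⟨u, G, hu, hG, hmem, h0, hsol⟩ := exists_solution (isClosed_gradGraph ω) hB hM hν hc
    (a := a) (b := b) fun t ht => by rw [hsupp t ht, zero_smul]
  exact ⟨u, G, ⟨hu, hG, hsol.isData hB hu.locallyIntegrable hG.l2loc hc.l2loc hmem⟩,
    ⟨hu.locallyIntegrable, hG, hmem.mono fun t ht => (mem_gradGraph hω).1 ht⟩, h0,
    hsol.solvesForward hω hM hA fun t => hω.ae_eq_iff.1 (Lp.coeFn_smul (φ t) ψ).symm⟩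

theorem IsSol.eq_zero (hω : IsA2Weight ω) (hn : 1 ≤ n) (hM : 0 ≤ M) (hν : 0 < ν)
    (hA : IsElliptic ω A M ν) {φ : ℝ → ℂ} (hφ : Continuous φ) {ψ : L2w ω} {a b : ℝ}
    (hsupp : ∀ t ∉ Icc a b, φ t = 0) {u : ℝ → L2w ω} {G : ℝ → L2wVec ω}
    (hu : IsSol ω A ν φ ψ u G) {t : ℝ} (ht : t ≤ a) : u t = 0 := by
  obtain ⟨v, F, hv, -, h0, -⟩ := exists_isSol hω hn hM hν hA hφ ψ hsupp
  rw [hu.unique hω hn hM hν hA hv]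
  exact h0 t ht

theorem IsTest.exists_Icc {φ : ℝ → ℂ} (hφ : IsTest φ) :
    ∃ a b : ℝ, ∀ t ∉ Icc a b, φ t = 0 := by
  obtain ⟨a, ha⟩ := hφ.2.isCompact.bddBelow
  obtain ⟨b, hb⟩ := hφ.2.isCompact.bddAbove
  exact ⟨a, b, fun t ht => by_contra fun h =>
    ht ⟨ha (subset_tsupport _ h), hb (subset_tsupport _ h)⟩⟩

/-- The pairing of a solution with a solution of the reversed problem. -/
theorem IsSol.pairing (hω : IsA2Weight ω) (hM : 0 ≤ M)
    (hA : IsElliptic ω A M ν) {φ χ : ℝ → ℂ} {ψ θ : L2w ω} {u v : ℝ → L2w ω} {G F : ℝ → L2wVec ω}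
    (hu : IsSol ω A ν φ ψ u G) (hv : IsSol ω (revCoeff A) ν χ θ v F) {a b : ℝ} (hab : a ≤ b) :
    inner ℂ (v (-b)) (u b) - inner ℂ (v (-a)) (u a) =
      (∫ t in Icc a b, φ t * inner ℂ (v (-t)) ψ) -
        ∫ t in Icc a b, conj (χ (-t)) * inner ℂ θ (u t) := by
  have hd := hv.data
  rw [← revFamily_coefOp hω hM hA] at hd
  have h := hu.data.pairing (isClosed_gradGraph ω) hu.cont hd hv.cont hab
  simpa only [inner_smul_left, inner_smul_right] using h

/-- Test classes are dense in `L²_ω`. -/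
theorem dense_testClass (hω : IsA2Weight ω) : Dense {ψ : L2w ω | IsTestClass ψ} := by
  intro f
  have hpos : ∀ k : ℕ, (0 : ℝ) < (k : ℝ) + 1 := fun k => by positivity
  have b1 := fun k : ℕ => isBddField_mulF (F := ℂ) (wMeasure ω)
    (cutoff_contDiff (n := n) ((k : ℝ) + 1)).continuous (cutoff_abs_le _)
  refine isClosed_closure.mem_of_tendsto (tendsto_ptOp_cutoff ℂ (wMeasure ω) f)
    (Eventually.of_forall fun k => ?_)
  have mf := (b1 k).memLp (Lp.memLp f)
  have hfl := hω.locallyIntegrable mf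
  have hc : HasCompactSupport fun x => mulF ℂ (cutoff n ((k : ℝ) + 1)) x (f x) :=
    (cutoff_isTest (hpos k)).2.smul_right
  have ht := fun j => mollify_isTest hfl hc j
  have t1 := tendsto_toL2 (fun j => hω.memLp_of_cpt (ht j).cont (ht j).2) mf (hω.tendsto_mollify mf)
  rw [ptOp_apply (b1 k)]
  exact mem_closure_of_tendsto t1 (Eventually.of_forall fun j => ⟨_, ht j, (ht j).toL2_coe hω⟩)

end Solutions


/-! ### Testing in time -/

section TimeTests

theorem continuous_mul_of_tsupport {U : Set ℝ} (hU : IsOpen U) {f φ : ℝ → ℂ} (hf : ContinuousOn f U)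
    (hφ : Continuous φ) (hs : tsupport φ ⊆ U) : Continuous fun t => φ t * f t := by
  refine continuous_of_tsupport fun x hx => ?_
  have hx' : x ∈ U := hs (tsupport_mul_subset_left hx)
  exact hφ.continuousAt.mul (hf.continuousAt (hU.mem_nhds hx'))

theorem integrable_mul_of_tsupport {U : Set ℝ} (hU : IsOpen U) {f φ : ℝ → ℂ}
    (hf : ContinuousOn f U) (hφ : IsTest φ) (hs : tsupport φ ⊆ U) :
    Integrable fun t => φ t * f t :=
  (continuous_mul_of_tsupport hU hf hφ.continuous hs).integrable_of_hasCompactSupport hφ.2.mul_right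

/-- Bumps of integral 1 concentrating at s recover f(s). This passes from representation formulas,
which are averaged over the initial time, to a fixed initial time. -/
theorem norm_le_of_test {U : Set ℝ} (hU : IsOpen U) {f : ℝ → ℂ} (hf : ContinuousOn f U) {K : ℝ}
    (h : ∀ φ : ℝ → ℂ, IsTest φ → tsupport φ ⊆ U → ‖∫ t, φ t * f t‖ ≤ K * ∫ t, ‖φ t‖)
    {s : ℝ} (hs : s ∈ U) : ‖f s‖ ≤ K := by
  refine le_of_forall_pos_le_add fun ε hε => ?_
  obtain ⟨δ₁, hδ₁, h1⟩ := Metric.isOpen_iff.1 hU s hs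
  obtain ⟨δ₂, hδ₂, h2⟩ := Metric.continuousAt_iff.1 (hf.continuousAt (hU.mem_nhds hs)) ε hε
  obtain ⟨k, hk⟩ := exists_nat_one_div_lt (lt_min hδ₁ hδ₂)
  set φ : ℝ → ℂ := fun t => (bumpKernel ℝ k (t - s) : ℂ) with hφ
  have hz : ∀ t, t ∉ Metric.ball s (1 / ((k : ℝ) + 1)) → φ t = 0 := fun t ht => by
    rw [Metric.mem_ball, not_lt, dist_eq_norm] at ht
    rw [hφ]; simp only; rw [bumpKernel_eq_zero ht, Complex.ofReal_zero]
  have hcl : tsupport φ ⊆ Metric.closedBall s (1 / ((k : ℝ) + 1)) :=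
    closure_minimal (fun t ht => Metric.ball_subset_closedBall (by_contra fun h => ht (hz t h)))
      Metric.isClosed_closedBall
  have hφt : IsTest φ := by
    refine ⟨Complex.ofRealCLM.contDiff.comp ((bumpKernel_contDiff k).comp
      (contDiff_id.sub contDiff_const)), ?_⟩
    exact HasCompactSupport.of_support_subset_isCompact (isCompact_closedBall s (1 / ((k : ℝ) + 1)))
      ((subset_tsupport _).trans hcl)
  have hsub : tsupport φ ⊆ U := fun t ht => h1 (by
    have := hcl ht
    rw [Metric.mem_closedBall] at this
    exact Metric.mem_ball.2 (this.trans_lt (hk.trans_le (min_le_left _ _))))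
  have hint : ∫ t, φ t = 1 := by
    have : ∫ t, φ t = ((∫ t, bumpKernel ℝ k (t - s) : ℝ) : ℂ) := integral_ofReal
    rw [this, integral_sub_right_eq_self (fun t => bumpKernel ℝ k t), integral_bumpKernel,
      Complex.ofReal_one]
  have hnorm : ∫ t, ‖φ t‖ = 1 := by
    have : ∀ t, ‖φ t‖ = bumpKernel ℝ k (t - s) := fun t => by
      rw [hφ, Complex.norm_real, Real.norm_of_nonneg (bumpKernel_nonneg k _)]
    simp only [this]
    rw [integral_sub_right_eq_self (fun t => bumpKernel ℝ k t), integral_bumpKernel]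
  have hi : Integrable φ := hφt.continuous.integrable_of_hasCompactSupport hφt.2
  have h3 := h φ hφt hsub
  rw [hnorm, mul_one] at h3
  have h4 : f s - ∫ t, φ t * f t = ∫ t, φ t * (f s - f t) := by
    simp only [mul_sub]
    rw [integral_sub (hi.mul_const _) (integrable_mul_of_tsupport hU hf hφt hsub),
      integral_mul_const, hint, one_mul]
  have h5 : ‖f s - ∫ t, φ t * f t‖ ≤ ε := by
    rw [h4]
    refine (norm_integral_le_of_norm_le (hi.norm.mul_const ε) (Eventually.of_forall fun t => ?_)).trans
      (le_of_eq (by rw [integral_mul_const, hnorm, one_mul]))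
    rw [norm_mul]
    by_cases ht : t ∈ Metric.ball s (1 / ((k : ℝ) + 1))
    · gcongr
      have := h2 ((Metric.mem_ball.1 ht).trans (hk.trans_le (min_le_right _ _)))
      rw [← dist_eq_norm, dist_comm]
      exact this.le
    · rw [hz t ht, norm_zero, zero_mul, zero_mul]
  have h6 := norm_sub_norm_le (f s) (∫ t, φ t * f t)
  linarith

theorem eq_of_test {U : Set ℝ} (hU : IsOpen U) {f g : ℝ → ℂ} (hf : ContinuousOn f U)
    (hg : ContinuousOn g U)
    (h : ∀ φ : ℝ → ℂ, IsTest φ → tsupport φ ⊆ U → ∫ t, φ t * f t = ∫ t, φ t * g t)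
    {s : ℝ} (hs : s ∈ U) : f s = g s := by
  have h1 := norm_le_of_test hU (hf.sub hg) (K := 0) (fun φ hφ hsub => by
    simp only [Pi.sub_apply, mul_sub]
    rw [integral_sub (integrable_mul_of_tsupport hU hf hφ hsub)
      (integrable_mul_of_tsupport hU hg hφ hsub), h φ hφ hsub]
    simp) hs
  exact sub_eq_zero.1 (norm_le_zero_iff.1 h1)

end TimeTests

/-! ### Fundamental solutions -/

section FundSol

variable {n : ℕ} {ω : E n → ℝ} {A : Coeff n} {M ν : ℝ} {Γ : ℝ → ℝ → (L2w ω →L[ℂ] L2w ω)}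

theorem IsA2Weight.secondCountable' (hω : IsA2Weight ω) : SecondCountableTopology (L2w ω) := by
  have := hω.isLocallyFiniteMeasure
  have : Fact ((2 : ℝ≥0∞) ≠ ∞) := ⟨by norm_num⟩
  infer_instance

theorem eq_of_inner_testClass (hω : IsA2Weight ω) {x y : L2w ω}
    (h : ∀ ψ, IsTestClass ψ → inner ℂ ψ x = inner ℂ ψ y) : x = y := by
  refine ext_inner_left ℂ fun v => ?_
  have hc : IsClosed {ψ : L2w ω | inner ℂ ψ x = inner ℂ ψ y} :=
    isClosed_eq (continuous_id.inner continuous_const) (continuous_id.inner continuous_const)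
  exact closure_minimal (fun ψ hψ => h ψ hψ) hc (dense_testClass hω v)

theorem clm_ext_testClass (hω : IsA2Weight ω) {S T : L2w ω →L[ℂ] L2w ω}
    (h : ∀ ψ, IsTestClass ψ → S ψ = T ψ) : S = T :=
  ContinuousLinearMap.coeFn_injective
    (S.continuous.ext_on (dense_testClass hω) T.continuous fun ψ hψ => h ψ hψ)

theorem IsFundSol.integral_Iic (hΓ : IsFundSol ω A Γ) (φ : ℝ → ℂ) (ψ ψ' : L2w ω) (t : ℝ) :
    ∫ s in Iic t, φ s * ip (Γ t s ψ) ψ' = ∫ s, φ s * inner ℂ ψ' (Γ t s ψ) := by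
  refine setIntegral_eq_integral_of_forall_compl_eq_zero fun s hs => ?_
  rw [hΓ.causal t s (not_le.1 hs), ip]
  simp

theorem IsFundSol.continuousOn_snd (hΓ : IsFundSol ω A Γ) {t r : ℝ} (hr : r ≤ t) (ψ ψ' : L2w ω) :
    ContinuousOn (fun s => inner ℂ ψ' (Γ t s ψ)) (Iio r) :=
  (hΓ.cont_snd t ψ ψ').mono fun _ hs => (le_of_lt hs).trans hr

/-- Borel measurability of Γ is given only for test classes. For general ψ measurability in s comes
from weak continuity on (-∞, t], which is why the support of φ is kept before t. -/
theorem IsFundSol.integrable (hω : IsA2Weight ω) (hΓ : IsFundSol ω A Γ) {φ : ℝ → ℂ} (hφ : IsTest φ)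
    {t r : ℝ} (hr : r ≤ t) (hs : tsupport φ ⊆ Iio r) (ψ : L2w ω) :
    Integrable fun s => φ s • Γ t s ψ := by
  have hsc := hω.secondCountable'
  obtain ⟨C, hC⟩ := hΓ.bdd
  refine Integrable.mono' (g := fun s => ‖φ s‖ * (C * ‖ψ‖))
    ((hφ.continuous.integrable_of_hasCompactSupport hφ.2).norm.mul_const _) ?_
    (Eventually.of_forall fun s => ?_)
  · refine aestronglyMeasurable_of_inner fun ψ' => ?_
    simp only [inner_smul_right]
    exact (integrable_mul_of_tsupport isOpen_Iio (hΓ.continuousOn_snd hr ψ ψ') hφ hs).1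
  · rw [norm_smul]
    gcongr
    exact (Γ t s).le_of_opNorm_le (hC t s) ψ

/-- `repr` speaks of distributional solutions. By uniqueness u coincides with the constructed
solution, for which the distributional equation is known. -/
theorem IsFundSol.repr_ae (hω : IsA2Weight ω) (hn : 1 ≤ n) (hM : 0 ≤ M) (hν : 0 < ν)
    (hA : IsElliptic ω A M ν) (hΓ : IsFundSol ω A Γ) {φ : ℝ → ℂ} (hφ : IsTest φ) {ψ : L2w ω}
    (hψ : IsTestClass ψ) {u : ℝ → L2w ω} {G : ℝ → L2wVec ω} (hu : IsSol ω A ν φ ψ u G) {ψ' : L2w ω}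
    (hψ' : IsTestClass ψ') :
    ∀ᵐ t : ℝ, inner ℂ ψ' (u t) = ∫ s, φ s * inner ℂ ψ' (Γ t s ψ) := by
  obtain ⟨a, b, hab⟩ := hφ.exists_Icc
  obtain ⟨v, F, hv, hE, -, hS⟩ := exists_isSol hω hn hM hν hA hφ.continuous ψ hab
  rw [hu.unique hω hn hM hν hA hv]
  filter_upwards [hΓ.repr φ ψ hφ hψ v F hE hS ψ' hψ'] with t ht
  rw [hΓ.integral_Iic] at ht
  exact ht

/-- The representation formula holds for every time after the support of the source. -/
theorem IsFundSol.repr_all (hω : IsA2Weight ω) (hn : 1 ≤ n) (hM : 0 ≤ M) (hν : 0 < ν)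
    (hA : IsElliptic ω A M ν) (hΓ : IsFundSol ω A Γ) {φ : ℝ → ℂ} (hφ : IsTest φ) {ψ : L2w ω}
    (hψ : IsTestClass ψ) {u : ℝ → L2w ω} {G : ℝ → L2wVec ω} (hu : IsSol ω A ν φ ψ u G)
    {r t : ℝ} (hs : tsupport φ ⊆ Iio r) (ht : r ≤ t) :
    u t = ∫ s, φ s • Γ t s ψ := by
  refine eq_of_inner_testClass hω fun ψ' hψ' => ?_
  rw [← integral_inner (hΓ.integrable hω hφ ht hs ψ)]
  simp only [inner_smul_right]
  obtain ⟨C, hC⟩ := hΓ.bdd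
  -- On the support of φ one has s < r ≤ t, the region where t ↦ Γ(t,s) is weakly continuous;
  -- dominated convergence carries this over to the integral.
  have hcont : ContinuousOn (fun t => ∫ s, φ s * inner ℂ ψ' (Γ t s ψ)) (Ici r) := by
    refine continuousOn_of_dominated (bound := fun s => ‖φ s‖ * (‖ψ'‖ * (C * ‖ψ‖)))
      (fun τ hτ => (integrable_mul_of_tsupport isOpen_Iio (hΓ.continuousOn_snd hτ ψ ψ') hφ hs).1)
      (fun τ _ => Eventually.of_forall fun s => ?_)
      ((hφ.continuous.integrable_of_hasCompactSupport hφ.2).norm.mul_const _)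
      (Eventually.of_forall fun s => ?_)
    · rw [norm_mul]
      gcongr
      refine (norm_inner_le_norm _ _).trans ?_
      gcongr
      exact (Γ τ s).le_of_opNorm_le (hC τ s) ψ
    · by_cases hsr : s < r
      · exact continuousOn_const.mul ((hΓ.cont_fst s ψ ψ').mono (Ici_subset_Ici.2 hsr.le))
      · have : φ s = 0 := image_eq_zero_of_notMem_tsupport fun h => hsr (hs h)
        simp only [this, zero_mul]
        exact continuousOn_const
  refine Measure.eqOn_of_ae_eq (μ := volume) (X := ℝ)
    (ae_restrict_of_ae (hΓ.repr_ae hω hn hM hν hA hφ hψ hu hψ'))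
    (continuous_const.inner hu.cont).continuousOn hcont ?_ ht
  rw [interior_Ici, closure_Ioi]

/-- Both families represent the same solution, so their averages over s agree for every φ supported
before t, and weak continuity in s separates the individual times. -/
theorem IsFundSol.unique (hω : IsA2Weight ω) (hn : 1 ≤ n) (hM : 0 ≤ M) (hν : 0 < ν)
    (hA : IsElliptic ω A M ν) {Γ₂ : ℝ → ℝ → (L2w ω →L[ℂ] L2w ω)} (hΓ : IsFundSol ω A Γ)
    (hΓ₂ : IsFundSol ω A Γ₂) {t s : ℝ} (hst : s < t) : Γ t s = Γ₂ t s := by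
  refine clm_ext_testClass hω fun ψ hψ => ext_inner_left ℂ fun ψ' => ?_
  refine eq_of_test isOpen_Iio (hΓ.continuousOn_snd le_rfl ψ ψ') (hΓ₂.continuousOn_snd le_rfl ψ ψ')
    (fun φ hφ hs => ?_) (mem_Iio.2 hst)
  obtain ⟨a, b, hab⟩ := hφ.exists_Icc
  obtain ⟨u, G, hu, -, -, -⟩ := exists_isSol hω hn hM hν hA hφ.continuous ψ hab
  have h1 := hΓ.repr_all hω hn hM hν hA hφ hψ hu hs le_rfl
  have h2 := hΓ₂.repr_all hω hn hM hν hA hφ hψ hu hs le_rfl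
  rw [h1] at h2
  have h3 := congrArg (fun x => inner ℂ ψ' x) h2
  rw [← integral_inner (hΓ.integrable hω hφ le_rfl hs ψ),
    ← integral_inner (hΓ₂.integrable hω hφ le_rfl hs ψ)] at h3
  simpa only [inner_smul_right] using h3

/-- The candidate for the fundamental solution of the reversed operator. -/
def revFund (Γ : ℝ → ℝ → (L2w ω →L[ℂ] L2w ω)) (t s : ℝ) : L2w ω →L[ℂ] L2w ω :=
  ContinuousLinearMap.adjoint (Γ (-s) (-t))

theorem ip_revFund (t s : ℝ) (ψ ψ' : L2w ω) :
    ip (revFund Γ t s ψ) ψ' = conj (ip (Γ (-s) (-t) ψ') ψ) := by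
  rw [ip, ip, revFund, ContinuousLinearMap.adjoint_inner_right, inner_conj_symm]

/-- The pairing equates an integral of v(-s) against ψ' with an integral of a forward solution u
against ψ. Only u is represented by Γ; Fubini and the arbitrariness of its source in time transfer
the formula to v. -/
theorem IsFundSol.rev_repr (hω : IsA2Weight ω) (hn : 1 ≤ n) (hM : 0 ≤ M) (hν : 0 < ν)
    (hA : IsElliptic ω A M ν) (hΓ : IsFundSol ω A Γ) {φ : ℝ → ℂ} (hφ : IsTest φ) {ψ : L2w ω}
    (hψ : IsTestClass ψ) {v : ℝ → L2w ω} {G : ℝ → L2wVec ω}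
    (hv : IsSol ω (revCoeff A) ν φ ψ v G) {ψ' : L2w ω} (hψ' : IsTestClass ψ') :
    ∀ᵐ s : ℝ, inner ℂ (v (-s)) ψ' = ∫ t, conj (φ (-t)) * inner ℂ ψ (Γ t s ψ') := by
  obtain ⟨C, hC⟩ := hΓ.bdd
  have hm : Measurable fun p : ℝ × ℝ => inner ℂ ψ (Γ p.1 p.2 ψ') := hΓ.meas ψ' ψ hψ' hψ
  have hφn : IsTest fun t => conj (φ (-t)) :=
    ⟨Complex.conjCLE.contDiff.comp (hφ.1.comp contDiff_neg),
      (hφ.2.comp_homeomorph (Homeomorph.neg ℝ)).comp_left (g := conj) (map_zero _)⟩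
  have hφi : Integrable fun t => conj (φ (-t)) :=
    hφn.continuous.integrable_of_hasCompactSupport hφn.2
  have hbd : ∀ t s, ‖inner ℂ ψ (Γ t s ψ')‖ ≤ ‖ψ‖ * (C * ‖ψ'‖) := fun t s =>
    (norm_inner_le_norm _ _).trans (by gcongr; exact (Γ t s).le_of_opNorm_le (hC t s) ψ')
  set Q : ℝ → ℂ := fun s => ∫ t, conj (φ (-t)) * inner ℂ ψ (Γ t s ψ') with hQ
  have hQm : AEStronglyMeasurable Q volume := by
    have h1 : StronglyMeasurable fun p : ℝ × ℝ => conj (φ (-p.2)) * inner ℂ ψ (Γ p.2 p.1 ψ') :=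
      ((hφn.continuous.measurable.comp measurable_snd).mul
        (hm.comp measurable_swap)).stronglyMeasurable
    exact h1.integral_prod_right'.aestronglyMeasurable
  have hQb : ∀ s, ‖Q s‖ ≤ (∫ t, ‖conj (φ (-t))‖) * (‖ψ‖ * (C * ‖ψ'‖)) := fun s => by
    rw [← integral_mul_const]
    refine norm_integral_le_of_norm_le (hφi.norm.mul_const _) (Eventually.of_forall fun t => ?_)
    rw [norm_mul]
    gcongr
    exact hbd t s
  have hQl : LocallyIntegrable Q volume := by
    have h1 : MemLp Q ∞ volume := memLp_top_of_bound hQm _ (Eventually.of_forall hQb)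
    exact h1.locallyIntegrable (by simp)
  have hvl : LocallyIntegrable (fun s => inner ℂ (v (-s)) ψ') volume :=
    ((hv.cont.comp continuous_neg).inner continuous_const).locallyIntegrable
  -- The test function g serves as the time profile of the source of the auxiliary forward solution.
  have hz := ae_eq_zero_of_integral_contDiff_smul_eq_zero (hvl.sub hQl) fun g hg hgc => by
    set χ : ℝ → ℂ := fun t => (g t : ℂ) with hχ
    have hχt : IsTest χ := ⟨Complex.ofRealCLM.contDiff.comp hg, hgc.comp_left Complex.ofReal_zero⟩
    have hχi : Integrable χ := hχt.continuous.integrable_of_hasCompactSupport hχt.2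
    obtain ⟨a, b, hab⟩ := hχt.exists_Icc
    obtain ⟨a', b', hab'⟩ := hφ.exists_Icc
    obtain ⟨u, F, hu, -, hu0, -⟩ := exists_isSol hω hn hM hν hA hχt.continuous ψ' hab
    set R := max (max |a| |b|) (max |a'| |b'|) with hR
    have ha : |a| ≤ R := (le_max_left _ _).trans (le_max_left _ _)
    have hb : |b| ≤ R := (le_max_right _ _).trans (le_max_left _ _)
    have ha' : |a'| ≤ R := (le_max_left _ _).trans (le_max_right _ _)
    have hb' : |b'| ≤ R := (le_max_right _ _).trans (le_max_right _ _)
    rw [abs_le] at ha hb ha' hb'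
    -- R exceeds the supports of both sources, so u(-R) = 0 and v(-R) = 0. These are factors of the
    -- two boundary terms, which therefore vanish.
    have hp := hu.pairing hω hM hA hv (a := -R) (b := R) (by linarith [ha.1, ha.2])
    rw [hu0 (-R) ha.1, hv.eq_zero hω hn hM hν (hA.rev hω hM) hφ.continuous hab' ha'.1,
      inner_zero_left, inner_zero_right, sub_zero, eq_comm, sub_eq_zero,
      setIntegral_eq_integral_of_forall_compl_eq_zero (fun t ht => ?_),
      setIntegral_eq_integral_of_forall_compl_eq_zero (fun t ht => ?_)] at hp
    rotate_left
    · rw [hab' (-t) fun h => ht ⟨by linarith [h.2], by linarith [h.1]⟩, map_zero, zero_mul]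
    · rw [hab t fun h => ht ⟨by linarith [h.1], by linarith [h.2]⟩, zero_mul]
    have e1 : ∫ t, conj (φ (-t)) * inner ℂ ψ (u t) =
        ∫ t, ∫ s, conj (φ (-t)) * (χ s * inner ℂ ψ (Γ t s ψ')) := by
      refine integral_congr_ae ((hΓ.repr_ae hω hn hM hν hA hχt hψ' hu hψ).mono fun t ht => ?_)
      simp only
      rw [ht, integral_const_mul]
    have hI : Integrable (Function.uncurry fun t s : ℝ =>
        conj (φ (-t)) * (χ s * inner ℂ ψ (Γ t s ψ'))) (volume.prod volume) := by
      refine Integrable.mono' ((hφi.norm.mul_prod hχi.norm).mul_const (‖ψ‖ * (C * ‖ψ'‖)))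
        ?_ (Eventually.of_forall fun p => ?_)
      · exact ((hφn.continuous.measurable.comp measurable_fst).mul
          ((hχt.continuous.measurable.comp measurable_snd).mul hm)).aestronglyMeasurable
      · simp only [Function.uncurry, norm_mul]
        rw [← mul_assoc]
        gcongr
        exact hbd _ _
    rw [e1, integral_integral_swap hI] at hp
    have e2 : ∀ s, ∫ t, conj (φ (-t)) * (χ s * inner ℂ ψ (Γ t s ψ')) = χ s * Q s := fun s => by
      rw [hQ, ← integral_const_mul]
      congr 1 with t
      ring
    simp only [e2] at hp
    have e3 : ∀ s, g s • ((fun s => inner ℂ (v (-s)) ψ') - Q) s =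
        χ s * inner ℂ (v (-s)) ψ' - χ s * Q s := fun s => by
      rw [Pi.sub_apply, Complex.real_smul, mul_sub]
    simp only [e3]
    rw [integral_sub, hp, sub_self]
    · exact integrable_mul_test hχt.continuous hχt.2 hvl
    · exact integrable_mul_test hχt.continuous hχt.2 hQl
  exact hz.mono fun s hs => sub_eq_zero.1 hs

/-- The reversed family is the fundamental solution of the reversed operator. -/
theorem IsFundSol.rev (hω : IsA2Weight ω) (hn : 1 ≤ n) (hM : 0 ≤ M) (hν : 0 < ν)
    (hA : IsElliptic ω A M ν) (hΓ : IsFundSol ω A Γ) : IsFundSol ω (revCoeff A) (revFund Γ) where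
  bdd := by
    obtain ⟨C, hC⟩ := hΓ.bdd
    exact ⟨C, fun t s => by rw [revFund, LinearIsometryEquiv.norm_map]; exact hC _ _⟩
  causal t s hts := by rw [revFund, hΓ.causal _ _ (neg_lt_neg hts), map_zero]
  meas ψ ψ' hψ hψ' := by
    simp only [ip_revFund]
    exact Complex.continuous_conj.measurable.comp ((hΓ.meas ψ' ψ hψ' hψ).comp
      (measurable_snd.neg.prodMk measurable_fst.neg))
  cont_fst s ψ ψ' := by
    simp only [ip_revFund]
    exact Complex.continuous_conj.comp_continuousOn ((hΓ.cont_snd (-s) ψ' ψ).comp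
      continuous_neg.continuousOn fun t ht => neg_le_neg (mem_Ici.1 ht))
  cont_snd t ψ ψ' := by
    simp only [ip_revFund]
    exact Complex.continuous_conj.comp_continuousOn ((hΓ.cont_fst (-t) ψ' ψ).comp
      continuous_neg.continuousOn fun s hs => neg_le_neg (mem_Iic.1 hs))
  repr φ ψ hφ hψ v G hE hS ψ' hψ' := by
    obtain ⟨w, hw, hvw⟩ := hS.exists_isSol hω hn hM hν (hA.rev hω hM) hE hφ.continuous
    have h1 := hΓ.rev_repr hω hn hM hν hA hφ hψ hw hψ'
    have h2 := (Measure.measurePreserving_neg (volume : Measure ℝ)).quasiMeasurePreserving.ae h1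
    filter_upwards [h2, hvw] with τ hτ hvτ
    rw [neg_neg] at hτ
    rw [setIntegral_eq_integral_of_forall_compl_eq_zero, ip, hvτ, ← inner_conj_symm, hτ,
      ← integral_conj, ← integral_neg_eq_self]
    · congr 1 with σ
      rw [neg_neg, ip_revFund, ip, map_mul, Complex.conj_conj]
    · intro s hs
      rw [ip_revFund, hΓ.causal _ _ (neg_lt_neg (not_le.1 hs)), ip]
      simp

/-- No problem with initial datum u(r) is solved. Instead u is paired on [r, c] with a reversed
solution v whose source, seen in forward time, lies after r. The source of u is already over, so
⟨v(-r), u(r)⟩ equals an average of u against θ, while v(-r) is represented by the adjoint family. -/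
theorem IsFundSol.evolve (hω : IsA2Weight ω) (hn : 1 ≤ n) (hM : 0 ≤ M) (hν : 0 < ν)
    (hA : IsElliptic ω A M ν) (hΓ : IsFundSol ω A Γ) {φ : ℝ → ℂ} {ψ : L2w ω}
    {u : ℝ → L2w ω} {G : ℝ → L2wVec ω} (hu : IsSol ω A ν φ ψ u G)
    {r t : ℝ} (hs : tsupport φ ⊆ Iio r) (ht : r < t) : u t = Γ t r (u r) := by
  have hΓr := hΓ.rev hω hn hM hν hA
  refine eq_of_inner_testClass hω fun θ hθ => ?_
  have key : inner ℂ (u r) (revFund Γ (-r) (-t) θ) = inner ℂ (u (-(-t))) θ := by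
    refine eq_of_test (U := Iio (-r)) isOpen_Iio (hΓr.continuousOn_snd le_rfl θ (u r))
      (g := fun σ => inner ℂ (u (-σ)) θ)
      ((hu.cont.comp continuous_neg).inner continuous_const).continuousOn
      (fun χ hχ hsχ => ?_) (mem_Iio.2 (neg_lt_neg ht))
    obtain ⟨a, b, hab⟩ := hχ.exists_Icc
    -- Lowering the left endpoint to at most -r ensures r ≤ c, where c is the forward time from
    -- which v(-t) vanishes.
    have hab2 : ∀ t ∉ Icc (min a (-r)) b, χ t = 0 := fun t ht =>
      hab t fun h => ht ⟨(min_le_left _ _).trans h.1, h.2⟩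
    obtain ⟨v, F, hv, -, hv0, -⟩ :=
      exists_isSol hω hn hM hν (hA.rev hω hM) hχ.continuous θ hab2
    set c := -min a (-r) with hc
    have hrc : r ≤ c := by rw [hc]; linarith [min_le_right a (-r)]
    have hp := hu.pairing hω hM hA hv hrc
    have e0 : ∫ t in Icc r c, φ t * inner ℂ (v (-t)) ψ = 0 := by
      refine setIntegral_eq_zero_of_forall_eq_zero fun t ht => ?_
      have : φ t = 0 := image_eq_zero_of_notMem_tsupport fun h => not_lt.2 ht.1 (hs h)
      rw [this, zero_mul]
    rw [hv0 (-c) (by rw [hc, neg_neg]), inner_zero_left, zero_sub, e0, zero_sub, neg_inj,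
      setIntegral_eq_integral_of_forall_compl_eq_zero] at hp
    · have h1 := hΓr.repr_all hω hn hM hν (hA.rev hω hM) hχ hθ hv hsχ le_rfl
      have h2 : ∫ s, χ s * inner ℂ (u r) (revFund Γ (-r) s θ) = inner ℂ (u r) (v (-r)) := by
        rw [h1, ← integral_inner (hΓr.integrable hω hχ le_rfl hsχ θ)]
        simp only [inner_smul_right]
      rw [h2, ← inner_conj_symm, hp, ← integral_conj, ← integral_neg_eq_self]
      congr 1 with s
      rw [map_mul, Complex.conj_conj, neg_neg, inner_conj_symm]
    · intro t ht
      have : χ (-t) = 0 := by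
        by_contra h
        have h1 : -t < -r := hsχ (subset_tsupport _ h)
        have h2 : -t ∈ Icc (min a (-r)) b := by_contra fun h' => h (hab2 _ h')
        exact ht ⟨by linarith, by rw [hc]; linarith [h2.1]⟩
      rw [this, map_zero, zero_mul]
  rw [neg_neg, revFund, neg_neg, neg_neg, ContinuousLinearMap.adjoint_inner_right] at key
  rw [← inner_conj_symm, ← key, inner_conj_symm]

/-- The **Chapman–Kolmogorov** relation. -/
theorem IsFundSol.comp (hω : IsA2Weight ω) (hn : 1 ≤ n) (hM : 0 ≤ M) (hν : 0 < ν)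
    (hA : IsElliptic ω A M ν) (hΓ : IsFundSol ω A Γ) {s r t : ℝ} (hsr : s < r) (hrt : r < t) :
    Γ t s = (Γ t r).comp (Γ r s) := by
  refine clm_ext_testClass hω fun ψ hψ => ext_inner_left ℂ fun ψ' => ?_
  rw [ContinuousLinearMap.comp_apply, ← ContinuousLinearMap.adjoint_inner_left (Γ t r)]
  refine eq_of_test isOpen_Iio (hΓ.continuousOn_snd hrt.le ψ ψ')
    (hΓ.continuousOn_snd le_rfl ψ _) (fun φ hφ hs => ?_) (mem_Iio.2 hsr)
  -- Averaged against φ, both sides become ⟨ψ', u(t)⟩ for the solution with source φ ⊗ ψ: one by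
  -- representing u(t) directly, the other by representing u(r) and evolving it.
  obtain ⟨a, b, hab⟩ := hφ.exists_Icc
  obtain ⟨u, G, hu, -, -, -⟩ := exists_isSol hω hn hM hν hA hφ.continuous ψ hab
  have h1 := hΓ.repr_all hω hn hM hν hA hφ hψ hu hs hrt.le
  have h2 := hΓ.repr_all hω hn hM hν hA hφ hψ hu hs le_rfl
  have h3 := hΓ.evolve hω hn hM hν hA hu hs hrt
  have e1 := integral_inner (𝕜 := ℂ) (hΓ.integrable hω hφ hrt.le hs ψ) ψ'
  have e2 := integral_inner (𝕜 := ℂ) (hΓ.integrable hω hφ le_rfl hs ψ)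
    (ContinuousLinearMap.adjoint (Γ t r) ψ')
  rw [← h1] at e1
  rw [← h2, ContinuousLinearMap.adjoint_inner_left, ← h3] at e2
  simp only [inner_smul_right] at e1 e2
  rw [e1, e2]

end FundSol


/-! ### The backward operator as a reversed forward operator -/

section Backward

variable {n : ℕ} {ω : E n → ℝ} {A : Coeff n} {M ν : ℝ}

theorem IsTest.timeReflect {η : ℝ × E n → ℂ} (hη : IsTest η) :
    IsTest fun p : ℝ × E n => η (-p.1, p.2) := by
  refine ⟨hη.1.comp (contDiff_fst.neg.prodMk contDiff_snd), ?_⟩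
  exact hη.2.comp_homeomorph ((Homeomorph.neg ℝ).prodCongr (Homeomorph.refl (E n)))

theorem IsTest.neg_arg {φ : ℝ → ℂ} (hφ : IsTest φ) : IsTest fun t => φ (-t) :=
  ⟨hφ.1.comp contDiff_neg, hφ.2.comp_homeomorph (Homeomorph.neg ℝ)⟩

theorem solvesBackward_iff {v : ℝ → L2w ω} {G : ℝ → L2wVec ω} {f : ℝ → E n → ℂ} :
    SolvesBackward ω A v G f ↔
      SolvesForward ω (revCoeff A) (fun t => v (-t)) (fun t => G (-t)) (fun t => f (-t)) := by
  have key : ∀ η : ℝ × E n → ℂ,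
      (∫ s : ℝ, ∫ x, (v s x * deriv (fun τ : ℝ => η (-τ, x)) s
        + ((ω x : ℂ))⁻¹ * (((A s x)ᴴ *ᵥ (G s x).ofLp) ⬝ᵥ grad (fun y => η (-s, y)) x))
          ∂(wMeasure ω)) =
      ∫ t : ℝ, ∫ x, (- (v (-t) x * deriv (fun τ : ℝ => η (τ, x)) t)
        + ((ω x : ℂ))⁻¹ * ((revCoeff A t x *ᵥ (G (-t) x).ofLp) ⬝ᵥ grad (fun y => η (t, y)) x))
          ∂(wMeasure ω) := by
    intro η
    rw [← integral_neg_eq_self]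
    congr 1 with t
    congr 1 with x
    rw [deriv_comp_neg (fun τ => η (τ, x)), neg_neg, revCoeff, mul_neg]
  have key2 : ∀ η : ℝ × E n → ℂ, (∫ s : ℝ, ∫ x, f s x * η (-s, x) ∂(wMeasure ω)) =
      ∫ t : ℝ, ∫ x, f (-t) x * η (t, x) ∂(wMeasure ω) := by
    intro η
    rw [← integral_neg_eq_self]
    congr 1 with t
    rw [neg_neg]
  constructor
  · intro h η hη
    rw [← key η, ← key2 η]
    exact h _ hη.timeReflect
  · intro h η hη
    have h1 := ((key fun p => η (-p.1, p.2)).trans (h _ hη.timeReflect)).trans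
      (key2 fun p => η (-p.1, p.2)).symm
    simpa only [neg_neg] using h1

theorem InEnergyClass.reflect {u : ℝ → L2w ω} {G : ℝ → L2wVec ω} (h : InEnergyClass u G) :
    InEnergyClass (fun t => u (-t)) (fun t => G (-t)) where
  locInt := by
    rw [locallyIntegrable_iff]
    intro k hk
    exact ((Measure.measurePreserving_neg (volume : Measure ℝ)).integrableOn_image
      (Homeomorph.neg ℝ).measurableEmbedding).1
      (locallyIntegrable_iff.1 h.locInt _ (hk.image (f := fun t : ℝ => -t) (by fun_prop)))
  gradMem := h.gradMem.comp_measurePreserving (Measure.measurePreserving_neg volume)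
  isGrad := (Measure.measurePreserving_neg (volume : Measure ℝ)).quasiMeasurePreserving.ae h.isGrad

theorem setIntegral_Ici_neg (f : ℝ → ℂ) (t : ℝ) :
    ∫ s in Ici t, f s = ∫ s in Iic (-t), f (-s) := by
  rw [← integral_indicator measurableSet_Ici, ← integral_indicator measurableSet_Iic,
    ← integral_neg_eq_self (fun s => (Ici t).indicator f s)]
  congr 1 with s
  by_cases hs : s ≤ -t
  · rw [indicator_of_mem (mem_Iic.2 hs), indicator_of_mem (mem_Ici.2 (by linarith))]
  · rw [indicator_of_notMem (mt mem_Iic.1 hs), indicator_of_notMem]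
    rw [mem_Ici]; intro h; exact hs (by linarith)

theorem isAdjFundSol_iff {Γ' : ℝ → ℝ → (L2w ω →L[ℂ] L2w ω)} :
    IsAdjFundSol ω A Γ' ↔ IsFundSol ω (revCoeff A) (fun t s => Γ' (-t) (-s)) := by
  constructor
  · intro h
    refine ⟨?_, fun t s hts => h.causal _ _ (neg_lt_neg hts), fun ψ ψ' hψ hψ' => ?_, ?_,
      fun s ψ ψ' => ?_, fun t ψ ψ' => ?_⟩
    · obtain ⟨C, hC⟩ := h.bdd
      exact ⟨C, fun t s => hC _ _⟩
    · exact (h.meas ψ ψ' hψ hψ').comp (measurable_fst.neg.prodMk measurable_snd.neg)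
    · intro φ ψ hφ hψ u G hE hS ψ' hψ'
      have hb : SolvesBackward ω A (fun t => u (-t)) (fun t => G (-t)) (fun s x => φ (-s) * ψ x) :=
        solvesBackward_iff.2 (by simpa only [neg_neg] using hS)
      have h1 := h.repr _ ψ hφ.neg_arg hψ _ _ hE.reflect hb ψ' hψ'
      filter_upwards [(Measure.measurePreserving_neg
        (volume : Measure ℝ)).quasiMeasurePreserving.ae h1] with t ht
      rw [setIntegral_Ici_neg] at ht
      simpa only [neg_neg] using ht
    · exact (h.cont_fst (-s) ψ ψ').comp continuous_neg.continuousOn fun t ht =>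
        neg_le_neg (mem_Ici.1 ht)
    · exact (h.cont_snd (-t) ψ ψ').comp continuous_neg.continuousOn fun s hs =>
        neg_le_neg (mem_Iic.1 hs)
  · intro h
    refine ⟨?_, fun s t hts => ?_, fun ψ ψ' hψ hψ' => ?_, ?_, fun t ψ ψ' => ?_, fun s ψ ψ' => ?_⟩
    · obtain ⟨C, hC⟩ := h.bdd
      exact ⟨C, fun t s => by simpa only [neg_neg] using hC (-t) (-s)⟩
    · simpa only [neg_neg] using h.causal _ _ (neg_lt_neg hts)
    · have h1 : Measurable fun p : ℝ × ℝ => ip (Γ' (- -p.1) (- -p.2) ψ) ψ' :=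
        (h.meas ψ ψ' hψ hψ').comp (measurable_fst.neg.prodMk measurable_snd.neg)
      simpa only [neg_neg] using h1
    · intro φ ψ hφ hψ v G hE hS ψ' hψ'
      have h1 := h.repr _ ψ hφ.neg_arg hψ _ _ hE.reflect (solvesBackward_iff.1 hS) ψ' hψ'
      filter_upwards [(Measure.measurePreserving_neg
        (volume : Measure ℝ)).quasiMeasurePreserving.ae h1] with t ht
      rw [setIntegral_Ici_neg]
      simpa only [neg_neg] using ht
    · have h1 := (h.cont_fst (-t) ψ ψ').comp continuous_neg.continuousOn
        (fun s (hs : s ∈ Iic t) => neg_le_neg (mem_Iic.1 hs))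
      simpa only [Function.comp_def, neg_neg] using h1
    · have h1 := (h.cont_snd (-s) ψ ψ').comp continuous_neg.continuousOn
        (fun t (ht : t ∈ Ici s) => neg_le_neg (mem_Ici.1 ht))
      simpa only [Function.comp_def, neg_neg] using h1

theorem gaussBound_comm (K₀ k₀ r : ℝ) (x y : E n) :
    gaussBound ω K₀ k₀ r x y = gaussBound ω K₀ k₀ r y x := by
  rw [gaussBound, gaussBound, mul_comm (√(ballMass ω r x)), norm_sub_rev]

theorem ae_swap {P : E n × E n → Prop} (h : ∀ᵐ p : E n × E n, P p) :
    ∀ᵐ p : E n × E n, P p.swap :=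
  (Measure.measurePreserving_swap (μ := (volume : Measure (E n)))
    (ν := (volume : Measure (E n)))).quasiMeasurePreserving.ae h

theorem adjHasGaussianUpperBounds_iff :
    AdjHasGaussianUpperBounds ω A ↔ HasGaussianUpperBounds ω (revCoeff A) := by
  constructor
  · rintro ⟨Γ', hΓ', k', K₀, k₀, hK, hk, h⟩
    refine ⟨_, isAdjFundSol_iff.1 hΓ', fun t x s y => k' (-t) x (-s) y, K₀, k₀, hK, hk,
      fun t s hst => ?_⟩
    obtain ⟨h1, h2⟩ := h (-s) (-t) (neg_lt_neg hst)
    refine ⟨h1, (ae_swap h2).mono fun p hp => ?_⟩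
    rw [gaussBound_comm]
    simpa only [Prod.fst_swap, Prod.snd_swap, neg_sub_neg] using hp
  · rintro ⟨Γ, hΓ, k, K₀, k₀, hK, hk, h⟩
    refine ⟨fun s t => Γ (-s) (-t), isAdjFundSol_iff.2 (by simpa only [neg_neg] using hΓ),
      fun s y t x => k (-s) y (-t) x, K₀, k₀, hK, hk, fun t s hst => ?_⟩
    obtain ⟨h1, h2⟩ := h (-s) (-t) (neg_lt_neg hst)
    refine ⟨h1, (ae_swap h2).mono fun p hp => ?_⟩
    rw [gaussBound_comm]
    simpa only [Prod.fst_swap, Prod.snd_swap, neg_sub_neg] using hp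

end Backward


/-! ### Integral operators with decaying kernels -/

section Kernel

variable {X : Type*} [MeasurableSpace X] {μ : Measure X}

/-- Sets with zero integral form a λ-system containing the π-system `𝒞`; the whole space belongs to
`𝒞`, which settles complements. -/
theorem ae_eq_zero_of_generating {𝒞 : Set (Set X)} (h𝒞 : IsSetAlgebra 𝒞)
    (hgen : ‹MeasurableSpace X› = MeasurableSpace.generateFrom 𝒞) {d : X → ℂ}
    (hd : Integrable d μ) (h : ∀ S ∈ 𝒞, ∫ x in S, d x ∂μ = 0) : d =ᵐ[μ] 0 := by
  have huniv : ∫ x, d x ∂μ = 0 := by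
    rw [← setIntegral_univ]
    exact h _ h𝒞.univ_mem
  have key : ∀ S, MeasurableSet S → ∫ x in S, d x ∂μ = 0 := by
    intro S hS
    induction S, hS using MeasurableSpace.induction_on_inter hgen
      (fun s hs t ht _ => h𝒞.inter_mem hs ht) with
    | empty => simp
    | basic S hS => exact h S hS
    | compl S hS ih =>
      have := integral_add_compl hS hd
      rwa [ih, zero_add, huniv] at this
    | iUnion f hdisj hf ih =>
      rw [integral_iUnion hf hdisj hd.integrableOn]
      simp only [ih, tsum_zero]
  exact hd.ae_eq_zero_of_forall_setIntegral_eq_zero fun S hS _ => key S hS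

theorem ae_of_forall_restrict {B : ℕ → Set X} (hBU : ⋃ N, B N = univ) {P : X → Prop}
    (h : ∀ N, ∀ᵐ x ∂(μ.restrict (B N)), P x) : ∀ᵐ x ∂μ, P x := by
  rw [← Measure.restrict_univ (μ := μ), ← hBU, ae_restrict_iUnion_iff]
  exact h

/-- The exceptional null set of x depends on S. Only countably many S can be handled at once, and a
countable algebra generating the σ-algebra is enough to determine each section. -/
theorem kernel_ae_eq [MeasurableSpace.CountablyGenerated X] [SFinite μ] {B : ℕ → Set X}
    (hB : ∀ N, MeasurableSet (B N)) (hBU : ⋃ N, B N = univ) {k₁ k₂ : X × X → ℂ}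
    (h₁ : AEStronglyMeasurable k₁ (μ.prod μ)) (h₂ : AEStronglyMeasurable k₂ (μ.prod μ))
    (h : ∀ N S, MeasurableSet S → S ⊆ B N → ∀ᵐ x ∂μ,
      IntegrableOn (fun y => k₁ (x, y)) S μ ∧ IntegrableOn (fun y => k₂ (x, y)) S μ ∧
        ∫ y in S, k₁ (x, y) ∂μ = ∫ y in S, k₂ (x, y) ∂μ) :
    k₁ =ᵐ[μ.prod μ] k₂ := by
  set 𝒞 := generateSetAlgebra (MeasurableSpace.countableGeneratingSet X) with h𝒞
  have hcount : 𝒞.Countable :=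
    countable_generateSetAlgebra (MeasurableSpace.countable_countableGeneratingSet (α := X))
  have hgen : ‹MeasurableSpace X› = MeasurableSpace.generateFrom 𝒞 := by
    rw [h𝒞, generateFrom_generateSetAlgebra_eq,
      MeasurableSpace.generateFrom_countableGeneratingSet]
  have hmeas : ∀ S ∈ 𝒞, MeasurableSet S := fun S hS => by
    rw [hgen]; exact MeasurableSpace.measurableSet_generateFrom hS
  have hall : ∀ᵐ x ∂μ, ∀ N, ∀ S ∈ 𝒞, IntegrableOn (fun y => k₁ (x, y)) (S ∩ B N) μ ∧
      IntegrableOn (fun y => k₂ (x, y)) (S ∩ B N) μ ∧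
        ∫ y in S ∩ B N, k₁ (x, y) ∂μ = ∫ y in S ∩ B N, k₂ (x, y) ∂μ := by
    rw [ae_all_iff]
    intro N
    rw [ae_ball_iff hcount]
    exact fun S hS => h N _ ((hmeas S hS).inter (hB N)) inter_subset_right
  have halg : IsSetAlgebra 𝒞 := isSetAlgebra_generateSetAlgebra
  have hx : ∀ᵐ x ∂μ, ∀ᵐ y ∂μ, k₁ (x, y) = k₂ (x, y) := by
    filter_upwards [hall] with x hx
    refine ae_of_forall_restrict hBU fun N => ?_
    have h1 := (hx N univ halg.univ_mem).1
    have h2 := (hx N univ halg.univ_mem).2.1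
    rw [univ_inter] at h1 h2
    refine (ae_eq_zero_of_generating halg hgen (h1.sub h2) fun S hS => ?_).mono
      fun y hy => sub_eq_zero.1 hy
    obtain ⟨e1, e2, e3⟩ := hx N S hS
    rw [Measure.restrict_restrict (hmeas S hS), integral_sub' e1 e2, e3, sub_self]
  -- Passing from almost every section to almost every point of the product needs a measurable
  -- equality set, hence the measurable representatives.
  have hx' : ∀ᵐ x ∂μ, ∀ᵐ y ∂μ, h₁.mk k₁ (x, y) = h₂.mk k₂ (x, y) := by
    filter_upwards [hx, Measure.ae_ae_of_ae_prod h₁.ae_eq_mk,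
      Measure.ae_ae_of_ae_prod h₂.ae_eq_mk] with x e1 e2 e3
    filter_upwards [e1, e2, e3] with y f1 f2 f3
    rw [← f2, ← f3, f1]
  have hmk : h₁.mk k₁ =ᵐ[μ.prod μ] h₂.mk k₂ :=
    (Measure.ae_prod_iff_ae_ae (p := fun p => h₁.mk k₁ p = h₂.mk k₂ p)
      (h₁.stronglyMeasurable_mk.measurableSet_eq_fun h₂.stronglyMeasurable_mk)).2 hx'
  exact h₁.ae_eq_mk.trans (hmk.trans h₂.ae_eq_mk.symm)

/-- `T` is an integral operator on `L²(μ)` with kernel `k`. -/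
structure KernelOp (μ : Measure X) (T : Lp ℂ 2 μ →L[ℂ] Lp ℂ 2 μ) (k : X × X → ℂ) : Prop where
  meas : AEStronglyMeasurable k (μ.prod μ)
  ae_apply : ∀ f : Lp ℂ 2 μ, ∀ᵐ x ∂μ, Integrable (fun y => k (x, y) * f y) μ ∧
    T f x = ∫ y, k (x, y) * f y ∂μ

/-- The kernel decays like `w` in the first variable, locally uniformly in the second one. -/
def HasDecay (μ : Measure X) (B : ℕ → Set X) (w : X → ℝ) (k : X × X → ℂ) : Prop :=
  ∀ N, ∃ C : ℝ, ∀ᵐ p ∂(μ.prod μ), p.2 ∈ B N → ‖k p‖ ≤ C * w p.1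

theorem HasDecay.conj {B : ℕ → Set X} {w : X → ℝ} {k : X × X → ℂ} (h : HasDecay μ B w k) :
    HasDecay μ B w fun p => conj (k p) := fun N => by
  obtain ⟨C, hC⟩ := h N
  exact ⟨C, hC.mono fun p hp hB => by rw [RCLike.norm_conj]; exact hp hB⟩

/-- The domination |g k| ≤ C |g| w on X × S with S of finite measure; every later use of Fubini
rests on it. -/
theorem HasDecay.integrable_prod [SFinite μ] {B : ℕ → Set X}
    (hBf : ∀ N, μ (B N) < ∞) {w : X → ℝ} {k : X × X → ℂ} (hk : AEStronglyMeasurable k (μ.prod μ))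
    (hd : HasDecay μ B w k) {g : X → ℂ} (hg : AEStronglyMeasurable g μ)
    (hgw : Integrable (fun x => ‖g x‖ * w x) μ) {N : ℕ} {S : Set X} (hS : MeasurableSet S)
    (hSB : S ⊆ B N) : Integrable (fun p : X × X => g p.1 * k p) (μ.prod (μ.restrict S)) := by
  have hr : μ.prod (μ.restrict S) = (μ.prod μ).restrict (univ ×ˢ S) := by
    rw [← Measure.prod_restrict, Measure.restrict_univ]
  obtain ⟨C, hC⟩ := hd N
  have : IsFiniteMeasure (μ.restrict S) :=
    ⟨by rw [Measure.restrict_apply_univ]; exact (measure_mono hSB).trans_lt (hBf N)⟩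
  have h1 : Integrable (fun p : X × X => ‖g p.1‖ * w p.1 * C) (μ.prod (μ.restrict S)) :=
    hgw.mul_prod (integrable_const C)
  refine h1.mono' (hg.comp_fst.mul (by rw [hr]; exact hk.restrict)) ?_
  rw [hr]
  filter_upwards [ae_restrict_of_ae hC, ae_restrict_mem (MeasurableSet.univ.prod hS)] with p hp hm
  rw [norm_mul, mul_assoc, mul_comm (w p.1)]
  exact mul_le_mul_of_nonneg_left (hp (hSB hm.2)) (norm_nonneg _)

theorem KernelOp.indicator {T : Lp ℂ 2 μ →L[ℂ] Lp ℂ 2 μ} {k : X × X → ℂ} (h : KernelOp μ T k)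
    {S : Set X} (hS : MeasurableSet S) (hμS : μ S ≠ ∞) :
    ∀ᵐ x ∂μ, IntegrableOn (fun y => k (x, y)) S μ ∧
      T (indicatorConstLp 2 hS hμS (1 : ℂ)) x = ∫ y in S, k (x, y) ∂μ := by
  filter_upwards [h.ae_apply (indicatorConstLp 2 hS hμS (1 : ℂ))] with x hx
  have e : (fun y => k (x, y) * (indicatorConstLp 2 hS hμS (1 : ℂ) : X → ℂ) y) =ᵐ[μ]
      S.indicator fun y => k (x, y) := by
    filter_upwards [indicatorConstLp_coeFn (p := 2) (hs := hS) (hμs := hμS) (c := (1 : ℂ))]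
      with y hy
    rw [hy]
    by_cases hyS : y ∈ S
    · rw [indicator_of_mem hyS, indicator_of_mem hyS, mul_one]
    · rw [indicator_of_notMem hyS, indicator_of_notMem hyS, mul_zero]
  exact ⟨(integrable_indicator_iff hS).1 (hx.1.congr e),
    by rw [hx.2, integral_congr_ae e, integral_indicator hS]⟩

theorem KernelOp.ae_eq [MeasurableSpace.CountablyGenerated X] [SFinite μ] {B : ℕ → Set X}
    (hB : ∀ N, MeasurableSet (B N)) (hBU : ⋃ N, B N = univ) (hBf : ∀ N, μ (B N) < ∞)
    {T : Lp ℂ 2 μ →L[ℂ] Lp ℂ 2 μ} {k₁ k₂ : X × X → ℂ}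
    (h₁ : KernelOp μ T k₁) (h₂ : KernelOp μ T k₂) : k₁ =ᵐ[μ.prod μ] k₂ := by
  refine kernel_ae_eq hB hBU h₁.meas h₂.meas fun N S hS hSB => ?_
  have hf : μ S ≠ ∞ := ((measure_mono hSB).trans_lt (hBf N)).ne
  filter_upwards [h₁.indicator hS hf, h₂.indicator hS hf] with x e1 e2
  exact ⟨e1.1, e2.1, by rw [← e1.2, ← e2.2]⟩

/-- Pairing with the indicator of a subset of B N turns the adjoint back into T, whose action on
indicators is known; Fubini then identifies T⋆f on each B N. -/
theorem KernelOp.adjoint [SFinite μ] {B : ℕ → Set X}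
    (hB : ∀ N, MeasurableSet (B N)) (hBU : ⋃ N, B N = univ) (hBf : ∀ N, μ (B N) < ∞)
    {w : X → ℝ} (hw : MemLp w 2 μ) {T : Lp ℂ 2 μ →L[ℂ] Lp ℂ 2 μ} {k : X × X → ℂ}
    (h : KernelOp μ T k) (hd : HasDecay μ B w k) :
    KernelOp μ (ContinuousLinearMap.adjoint T) fun p => conj (k p.swap) := by
  have hkc : AEStronglyMeasurable (fun p => conj (k p)) (μ.prod μ) :=
    Complex.continuous_conj.comp_aestronglyMeasurable h.meas
  refine ⟨hkc.prod_swap, fun f => ae_of_forall_restrict hBU fun N => ?_⟩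
  have hfm : AEStronglyMeasurable f μ := (Lp.memLp f).1
  have hfw : Integrable (fun x => ‖f x‖ * w x) μ := (Lp.memLp f).norm.integrable_mul hw
  have hint : ∀ S, MeasurableSet S → S ⊆ B N → Integrable (fun p : X × X => f p.1 * conj (k p))
      (μ.prod (μ.restrict S)) := fun S hS hSB =>
    hd.conj.integrable_prod hBf hkc hfm hfw hS hSB
  have hN := hint _ (hB N) subset_rfl
  have : IsFiniteMeasure (μ.restrict (B N)) :=
    ⟨by rw [Measure.restrict_apply_univ]; exact hBf N⟩
  have heq : (ContinuousLinearMap.adjoint T f : X → ℂ) =ᵐ[μ.restrict (B N)]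
      fun y => ∫ x, f x * conj (k (x, y)) ∂μ := by
    refine Integrable.ae_eq_of_forall_setIntegral_eq _ _
      (((Lp.memLp (ContinuousLinearMap.adjoint T f)).restrict (B N)).integrable one_le_two)
      hN.integral_prod_right fun S hS _ => ?_
    have hS' := hS.inter (hB N)
    have hf : μ (S ∩ B N) ≠ ∞ := ((measure_mono inter_subset_right).trans_lt (hBf N)).ne
    rw [Measure.restrict_restrict hS, ← L2.inner_indicatorConstLp_one (𝕜 := ℂ) hS' hf,
      ContinuousLinearMap.adjoint_inner_right, L2.inner_def,
      ← integral_integral_swap (hint _ hS' inter_subset_right)]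
    refine integral_congr_ae ((h.indicator hS' hf).mono fun x hx => ?_)
    simp only [RCLike.inner_apply]
    rw [hx.2, integral_const_mul, integral_conj]
  filter_upwards [heq, hN.prod_left_ae] with y h1 h2
  simp only [Prod.swap_prod_mk, mul_comm (conj (k (_, y)))]
  exact ⟨h2, h1⟩

/-- The composed kernel integrates over any subset of some B N to the operator applied to its
indicator, by Fubini, so uniqueness of kernels identifies it with k. -/
theorem KernelOp.comp [MeasurableSpace.CountablyGenerated X] [SFinite μ] {B : ℕ → Set X}
    (hB : ∀ N, MeasurableSet (B N)) (hBU : ⋃ N, B N = univ) (hBf : ∀ N, μ (B N) < ∞)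
    {w : X → ℝ} (hw : MemLp w 2 μ) {T₁ T₂ : Lp ℂ 2 μ →L[ℂ] Lp ℂ 2 μ}
    {k₁ k₂ k : X × X → ℂ} (h₁ : KernelOp μ T₁ k₁) (h₂ : KernelOp μ T₂ k₂)
    (hd : HasDecay μ B w k₂) (h : KernelOp μ (T₁.comp T₂) k) :
    ∀ᵐ p ∂(μ.prod μ), Integrable (fun z => k₁ (p.1, z) * k₂ (z, p.2)) μ ∧
      ∫ z, k₁ (p.1, z) * k₂ (z, p.2) ∂μ = k p := by
  have hwc : MemLp (fun x => (w x : ℂ)) 2 μ := hw.ofReal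
  -- The operator T₁ acts on w, which is in L². Hence k₁(x,·) is integrable against w for almost
  -- every x, and k₁ itself need not decay.
  have hgood : ∀ᵐ x ∂μ, AEStronglyMeasurable (fun z => k₁ (x, z)) μ ∧
      Integrable (fun z => ‖k₁ (x, z)‖ * w z) μ := by
    filter_upwards [h₁.meas.prodMk_left, h₁.ae_apply (toL2 μ fun x => (w x : ℂ))] with x e1 e2
    refine ⟨e1, ?_⟩
    have e3 : Integrable (fun z => k₁ (x, z) * (w z : ℂ)) μ := e2.1.congr
      ((toL2_coe hwc).mono fun z hz => by simp only [hz])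
    refine (integrable_norm_iff (e1.norm.mul hw.1)).1 (e3.norm.congr (ae_of_all _ fun z => ?_))
    simp
  have hF : ∀ N S, MeasurableSet S → S ⊆ B N → ∀ᵐ x ∂μ,
      Integrable (fun p : X × X => k₁ (x, p.1) * k₂ p) (μ.prod (μ.restrict S)) :=
    fun N S hS hSB => hgood.mono fun x hx => hd.integrable_prod hBf h₂.meas hx.1 hx.2 hS hSB
  -- measurability of the composed kernel
  have hcm : AEStronglyMeasurable (fun p : X × X => ∫ z, k₁ (p.1, z) * k₂ (z, p.2) ∂μ)
      (μ.prod μ) := by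
    have hs : StronglyMeasurable fun p : X × X =>
        ∫ z, h₁.meas.mk k₁ (p.1, z) * h₂.meas.mk k₂ (z, p.2) ∂μ :=
      StronglyMeasurable.integral_prod_right' (f := fun q : (X × X) × X =>
        h₁.meas.mk k₁ (q.1.1, q.2) * h₂.meas.mk k₂ (q.2, q.1.2))
        ((h₁.meas.stronglyMeasurable_mk.comp_measurable (by fun_prop)).mul
          (h₂.meas.stronglyMeasurable_mk.comp_measurable (by fun_prop)))
    refine ⟨_, hs, ?_⟩
    have e1 := Measure.quasiMeasurePreserving_fst (μ := μ) (ν := μ) |>.ae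
      (Measure.ae_ae_of_ae_prod h₁.meas.ae_eq_mk)
    have e2 := Measure.quasiMeasurePreserving_snd (μ := μ) (ν := μ) |>.ae
      (Measure.ae_ae_of_ae_prod
        (Measure.measurePreserving_swap.quasiMeasurePreserving.ae h₂.meas.ae_eq_mk))
    filter_upwards [e1, e2] with p f1 f2
    refine integral_congr_ae ?_
    filter_upwards [f1, f2] with z g1 g2
    rw [g1]
    exact congrArg _ g2
  have hint : ∀ᵐ p ∂(μ.prod μ), Integrable (fun z => k₁ (p.1, z) * k₂ (z, p.2)) μ := by
    choose C hC using hd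
    have e1 := Measure.quasiMeasurePreserving_fst (μ := μ) (ν := μ) |>.ae hgood
    have e2 := Measure.quasiMeasurePreserving_snd (μ := μ) (ν := μ) |>.ae
      (Measure.ae_ae_of_ae_prod
        (Measure.measurePreserving_swap.quasiMeasurePreserving.ae (ae_all_iff.2 hC)))
    have e3 := Measure.quasiMeasurePreserving_snd (μ := μ) (ν := μ) |>.ae
      h₂.meas.prod_swap.prodMk_left
    filter_upwards [e1, e2, e3] with p f1 f2 f3
    obtain ⟨N, hN⟩ := mem_iUnion.1 (hBU ▸ mem_univ p.2)
    refine (f1.2.const_mul (C N)).mono' (f1.1.mul f3) (f2.mono fun z hz => ?_)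
    rw [norm_mul, mul_left_comm]
    exact mul_le_mul_of_nonneg_left (hz N hN) (norm_nonneg _)
  have heq := kernel_ae_eq hB hBU hcm h.meas fun N S hS hSB => by
    have hf : μ S ≠ ∞ := ((measure_mono hSB).trans_lt (hBf N)).ne
    filter_upwards [h.indicator hS hf, hF N S hS hSB,
      h₁.ae_apply (T₂ (indicatorConstLp 2 hS hf (1 : ℂ)))] with x e1 e2 e3
    refine ⟨e2.integral_prod_right, e1.1, ?_⟩
    rw [← e1.2, ContinuousLinearMap.comp_apply, e3.2, ← integral_integral_swap e2]
    refine integral_congr_ae ((h₂.indicator hS hf).mono fun z hz => ?_)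
    simp only
    rw [hz.2, integral_const_mul]
  filter_upwards [hint, heq] with p e1 e2
  exact ⟨e1, e2⟩

end Kernel


/-! ### Gaussian kernels -/

section Gauss

variable {n : ℕ} {ω : E n → ℝ}

instance (ω : E n → ℝ) : SFinite (wMeasure ω) := by
  unfold wMeasure; infer_instance

theorem IsA2Weight.prod_ae_eq (hω : IsA2Weight ω) :
    ae ((wMeasure ω).prod (wMeasure ω)) = ae (volume : Measure (E n × E n)) :=
  le_antisymm (wMeasure_absolutelyContinuous.prod wMeasure_absolutelyContinuous).ae_le
    (hω.absolutelyContinuous.prod hω.absolutelyContinuous).ae_le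

theorem IsA2Weight.hasKernel_iff (hω : IsA2Weight ω) {T : L2w ω →L[ℂ] L2w ω}
    {k : E n → E n → ℂ} : HasKernel T k ↔ KernelOp (wMeasure ω) T fun p => k p.1 p.2 := by
  constructor
  · rintro ⟨h1, h2⟩
    refine ⟨h1.mono_ac (Measure.ae_le_iff_absolutelyContinuous.1 hω.prod_ae_eq.le), fun f => ?_⟩
    rw [hω.ae_eq]
    exact h2 f
  · rintro ⟨h1, h2⟩
    refine ⟨h1.mono_ac (Measure.ae_le_iff_absolutelyContinuous.1 hω.prod_ae_eq.ge), fun f => ?_⟩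
    rw [← hω.ae_eq]
    exact h2 f

theorem IsA2Weight.real_ball_pos (hω : IsA2Weight ω) (x : E n) {r : ℝ} (hr : 0 < r) :
    0 < (wMeasure ω).real (Metric.ball x r) :=
  ENNReal.toReal_pos (hω.ball_pos x hr).ne' (hω.ball_lt_top x).ne

/-- The ball around z is compared with a fixed ball at the origin inside B(0, ‖z‖ + √r). Doubling
costs a power of 1 + ‖z‖/√r, and 1 + x ≤ exp x. -/
theorem IsA2Weight.inv_sqrt_ballMass_le (hω : IsA2Weight ω) {r : ℝ} (hr : 0 < r) :
    ∃ D : ℝ, 0 ≤ D ∧ ∀ z : E n, (√(ballMass ω r z))⁻¹ ≤ D * Real.exp (n / √r * ‖z‖) := by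
  set m := (wMeasure ω).real (Metric.ball (0 : E n) √r) with hm
  have hs : 0 < √r := Real.sqrt_pos.2 hr
  have hm0 : 0 < m := hω.real_ball_pos 0 hs
  refine ⟨√((ballConst ω).toReal / m), Real.sqrt_nonneg _, fun z => ?_⟩
  have hz0 := norm_nonneg z
  have h1 := hω.ball_comparison (x := 0) (y := z) (r := ‖z‖ + √r) (ρ := √r) (by positivity) hs
    (Metric.ball_subset_ball' (by rw [dist_zero_right, add_comm]))
  have h2 : m ≤ (wMeasure ω).real (Metric.ball (0 : E n) (‖z‖ + √r)) :=
    measureReal_mono (Metric.ball_subset_ball (by linarith)) (hω.ball_lt_top 0).ne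
  have hb : 0 < ballMass ω r z := hω.real_ball_pos z hs
  have h3 : (ballMass ω r z)⁻¹ ≤ (ballConst ω).toReal / m * (((‖z‖ + √r) / √r) ^ n) ^ 2 := by
    rw [inv_le_iff_one_le_mul₀ hb, ← pow_mul, mul_comm n 2]
    have h4 := h2.trans h1
    calc (1 : ℝ) = m / m := (div_self hm0.ne').symm
      _ ≤ ((ballConst ω).toReal * ((‖z‖ + √r) / √r) ^ (2 * n) * ballMass ω r z) / m := by
        gcongr; exact h4
      _ = _ := by ring
  have h5 : ((‖z‖ + √r) / √r) ^ n ≤ Real.exp (n / √r * ‖z‖) := by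
    have : (‖z‖ + √r) / √r ≤ Real.exp (‖z‖ / √r) := by
      rw [add_div, div_self hs.ne']
      exact Real.add_one_le_exp _
    calc ((‖z‖ + √r) / √r) ^ n ≤ Real.exp (‖z‖ / √r) ^ n := by gcongr
      _ = _ := by rw [← Real.exp_nat_mul]; congr 1; ring
  rw [← Real.sqrt_inv]
  refine (Real.sqrt_le_sqrt h3).trans ?_
  rw [Real.sqrt_mul (by positivity), Real.sqrt_sq (by positivity)]
  gcongr

theorem IsA2Weight.gaussBound_le (hω : IsA2Weight ω) {K₀ k₀ r : ℝ} (hK : 0 < K₀) (hk : 0 < k₀)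
    (hr : 0 < r) (R : ℝ) : ∃ C : ℝ, ∀ x y : E n, ‖y‖ ≤ R →
      gaussBound ω K₀ k₀ r x y ≤ C * Real.exp (-‖x‖) := by
  obtain ⟨D, hD0, hD⟩ := hω.inv_sqrt_ballMass_le hr
  set a : ℝ := n / √r with ha
  have ha0 : 0 ≤ a := by positivity
  set b := k₀ / r with hb
  have hb0 : 0 < b := div_pos hk hr
  refine ⟨K₀ * D ^ 2 * Real.exp (2 * a * R + R + (a + 1) ^ 2 / (4 * b)), fun x y hy => ?_⟩
  have hxy : ‖x‖ ≤ ‖x - y‖ + R := (norm_le_norm_sub_add x y).trans (by linarith)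
  -- The right side is the maximum of the quadratic: a comes from the ball mass at x, the extra 1
  -- from the desired factor exp(-‖x‖), and -b from the Gaussian.
  have hsq : (a + 1) * ‖x - y‖ - b * ‖x - y‖ ^ 2 ≤ (a + 1) ^ 2 / (4 * b) := by
    rw [le_div_iff₀ (by positivity)]
    nlinarith [sq_nonneg (2 * b * ‖x - y‖ - (a + 1))]
  calc gaussBound ω K₀ k₀ r x y
      = K₀ * ((√(ballMass ω r x))⁻¹ * (√(ballMass ω r y))⁻¹) * Real.exp (-(b * ‖x - y‖ ^ 2)) := by
        rw [gaussBound, div_eq_mul_inv, mul_inv, hb]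
        congr 2; ring
    _ ≤ K₀ * ((D * Real.exp (a * ‖x‖)) * (D * Real.exp (a * ‖y‖))) *
          Real.exp (-(b * ‖x - y‖ ^ 2)) := by
        gcongr
        · exact hD x
        · exact hD y
    _ = K₀ * D ^ 2 * Real.exp (a * ‖x‖ + a * ‖y‖ + -(b * ‖x - y‖ ^ 2)) := by
        rw [Real.exp_add, Real.exp_add]; ring
    _ ≤ K₀ * D ^ 2 * Real.exp (2 * a * R + R + (a + 1) ^ 2 / (4 * b) + -‖x‖) := by
        refine mul_le_mul_of_nonneg_left (Real.exp_le_exp.2 ?_) (by positivity)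
        have h1 : a * ‖x‖ ≤ a * (‖x - y‖ + R) := by gcongr
        have h2 : a * ‖y‖ ≤ a * R := by gcongr
        nlinarith
    _ = _ := by rw [Real.exp_add]; ring

/-- With N = ⌊‖x‖⌋ the integrand is at most exp(-N) on a ball of radius N + 1, and doubling makes
the masses of these balls grow only polynomially. -/
theorem IsA2Weight.integrable_exp_neg_norm (hω : IsA2Weight ω) :
    Integrable (fun x : E n => Real.exp (-‖x‖)) (wMeasure ω) := by
  have hmeas : AEStronglyMeasurable (fun x : E n => Real.exp (-‖x‖)) (wMeasure ω) :=
    (by fun_prop : Continuous fun x : E n => Real.exp (-‖x‖)).aestronglyMeasurable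
  refine ⟨hmeas, ?_⟩
  rw [hasFiniteIntegral_iff_ofReal (ae_of_all _ fun x => (Real.exp_pos _).le)]
  set b : ℕ → ℝ := fun N => (wMeasure ω).real (Metric.ball (0 : E n) (N + 1)) with hb
  have hbd : ∀ N : ℕ, Real.exp (-(N : ℝ)) * b N ≤
      (ballConst ω).toReal * (wMeasure ω).real (Metric.ball (0 : E n) 1) * Real.exp 1 *
        (((N + 1 : ℕ) : ℝ) ^ (2 * n) * Real.exp (-1 * ((N + 1 : ℕ) : ℝ))) := fun N => by
    have h1 := hω.ball_comparison (x := 0) (y := 0) (r := (N : ℝ) + 1) (ρ := 1) (by positivity)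
      one_pos (Metric.ball_subset_ball (by linarith [(Nat.cast_nonneg N : (0 : ℝ) ≤ N)]))
    rw [div_one] at h1
    calc Real.exp (-(N : ℝ)) * b N ≤ Real.exp (-(N : ℝ)) * _ :=
          mul_le_mul_of_nonneg_left h1 (Real.exp_pos _).le
      _ = _ := by
        have : Real.exp (-(N : ℝ)) = Real.exp 1 * Real.exp (-1 * ((N + 1 : ℕ) : ℝ)) := by
          rw [← Real.exp_add]; congr 1; push_cast; ring
        rw [this]; push_cast; ring
  have hsum : Summable fun N : ℕ => Real.exp (-(N : ℝ)) * b N :=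
    Summable.of_nonneg_of_le (fun N => mul_nonneg (Real.exp_pos _).le measureReal_nonneg) hbd
      (((summable_nat_add_iff 1).2
        (Real.summable_pow_mul_exp_neg_nat_mul (2 * n) one_pos)).mul_left _)
  calc ∫⁻ x, ENNReal.ofReal (Real.exp (-‖x‖)) ∂(wMeasure ω)
      ≤ ∫⁻ x, ∑' N : ℕ, (Metric.ball (0 : E n) (N + 1)).indicator
          (fun _ => ENNReal.ofReal (Real.exp (-(N : ℝ)))) x ∂(wMeasure ω) := by
        refine lintegral_mono fun x => ?_
        refine le_trans ?_ (ENNReal.le_tsum ⌊‖x‖⌋₊)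
        rw [indicator_of_mem (mem_ball_zero_iff.2 (Nat.lt_floor_add_one _))]
        exact ENNReal.ofReal_le_ofReal (Real.exp_le_exp.2 (neg_le_neg
          (Nat.floor_le (norm_nonneg x))))
    _ = ∑' N : ℕ, ENNReal.ofReal (Real.exp (-(N : ℝ)) * b N) := by
        rw [lintegral_tsum fun N => (measurable_const.indicator measurableSet_ball).aemeasurable]
        congr 1 with N
        rw [lintegral_indicator_const measurableSet_ball, ENNReal.ofReal_mul (Real.exp_pos _).le,
          hb, ofReal_measureReal (hω.ball_lt_top 0).ne]
    _ < ∞ := by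
        rw [← ENNReal.ofReal_tsum_of_nonneg
          (fun N => mul_nonneg (Real.exp_pos _).le measureReal_nonneg) hsum]
        exact ENNReal.ofReal_lt_top

theorem IsA2Weight.memLp_exp_neg_norm (hω : IsA2Weight ω) :
    MemLp (fun x : E n => Real.exp (-‖x‖)) 2 (wMeasure ω) := by
  have hmeas : AEStronglyMeasurable (fun x : E n => Real.exp (-‖x‖)) (wMeasure ω) :=
    (by fun_prop : Continuous fun x : E n => Real.exp (-‖x‖)).aestronglyMeasurable
  rw [memLp_two_iff_integrable_sq hmeas]
  refine hω.integrable_exp_neg_norm.mono' (hmeas.pow 2) (ae_of_all _ fun x => ?_)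
  have h1 : Real.exp (-‖x‖) ≤ 1 := Real.exp_le_one_iff.2 (neg_nonpos.2 (norm_nonneg x))
  rw [Real.norm_of_nonneg (by positivity)]
  nlinarith [Real.exp_pos (-‖x‖)]

/-- The balls around the origin with natural radii. -/
def natBall (n N : ℕ) : Set (E n) := Metric.ball 0 N

theorem measurableSet_natBall (N : ℕ) : MeasurableSet (natBall n N) := measurableSet_ball

theorem iUnion_natBall : ⋃ N, natBall n N = univ :=
  Metric.iUnion_ball_nat 0

theorem IsA2Weight.natBall_lt_top (hω : IsA2Weight ω) (N : ℕ) : wMeasure ω (natBall n N) < ∞ :=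
  hω.ball_lt_top 0

/-- Exponential decay of a kernel in the first variable. -/
def ExpDecay (ω : E n → ℝ) (k : E n → E n → ℂ) : Prop :=
  HasDecay (wMeasure ω) (natBall n) (fun x => Real.exp (-‖x‖)) fun p => k p.1 p.2

theorem IsA2Weight.expDecay (hω : IsA2Weight ω) {K₀ k₀ r : ℝ} (hK : 0 < K₀) (hk : 0 < k₀)
    (hr : 0 < r) {k : E n → E n → ℂ}
    (h : ∀ᵐ p : E n × E n, ‖k p.1 p.2‖ ≤ gaussBound ω K₀ k₀ r p.1 p.2) : ExpDecay ω k := by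
  intro N
  obtain ⟨C, hC⟩ := hω.gaussBound_le hK hk hr N
  refine ⟨C, ?_⟩
  rw [hω.prod_ae_eq]
  exact h.mono fun p hp hB => hp.trans (hC _ _ (mem_ball_zero_iff.1 hB).le)

theorem IsA2Weight.expDecay_conj_swap (hω : IsA2Weight ω) {K₀ k₀ r : ℝ} (hK : 0 < K₀)
    (hk : 0 < k₀) (hr : 0 < r) {k : E n → E n → ℂ}
    (h : ∀ᵐ p : E n × E n, ‖k p.1 p.2‖ ≤ gaussBound ω K₀ k₀ r p.1 p.2) :
    ExpDecay ω fun x y => conj (k y x) :=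
  hω.expDecay hK hk hr ((ae_swap h).mono fun p hp => by
    rw [RCLike.norm_conj, gaussBound_comm]; exact hp)

theorem HasKernel.ae_eq (hω : IsA2Weight ω) {T : L2w ω →L[ℂ] L2w ω} {k₁ k₂ : E n → E n → ℂ}
    (h₁ : HasKernel T k₁) (h₂ : HasKernel T k₂) :
    ∀ᵐ p : E n × E n, k₁ p.1 p.2 = k₂ p.1 p.2 := by
  rw [← hω.prod_ae_eq]
  exact KernelOp.ae_eq (k₁ := fun p => k₁ p.1 p.2) (k₂ := fun p => k₂ p.1 p.2) measurableSet_natBall iUnion_natBall hω.natBall_lt_top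
    (hω.hasKernel_iff.1 h₁) (hω.hasKernel_iff.1 h₂)

theorem HasKernel.adjoint (hω : IsA2Weight ω) {T : L2w ω →L[ℂ] L2w ω} {k : E n → E n → ℂ}
    (h : HasKernel T k) (hd : ExpDecay ω k) :
    HasKernel (ContinuousLinearMap.adjoint T) fun y x => conj (k x y) :=
  hω.hasKernel_iff.2 (KernelOp.adjoint (k := fun p => k p.1 p.2) measurableSet_natBall iUnion_natBall hω.natBall_lt_top
    hω.memLp_exp_neg_norm (hω.hasKernel_iff.1 h) hd)

theorem HasKernel.comp (hω : IsA2Weight ω) {T₁ T₂ : L2w ω →L[ℂ] L2w ω}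
    {k₁ k₂ k : E n → E n → ℂ} (h₁ : HasKernel T₁ k₁) (h₂ : HasKernel T₂ k₂)
    (hd : ExpDecay ω k₂) (h : HasKernel (T₁.comp T₂) k) :
    ∀ᵐ p : E n × E n, Integrable (fun z => k₁ p.1 z * k₂ z p.2) (wMeasure ω) ∧
      ∫ z, k₁ p.1 z * k₂ z p.2 ∂(wMeasure ω) = k p.1 p.2 := by
  rw [← hω.prod_ae_eq]
  exact KernelOp.comp (k₁ := fun p => k₁ p.1 p.2) (k₂ := fun p => k₂ p.1 p.2)
    (k := fun p => k p.1 p.2) measurableSet_natBall iUnion_natBall hω.natBall_lt_top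
    hω.memLp_exp_neg_norm (hω.hasKernel_iff.1 h₁) (hω.hasKernel_iff.1 h₂) hd
    (hω.hasKernel_iff.1 h)

end Gauss


/-! ### Conservation -/

section Conservation

variable {n : ℕ} {ω : E n → ℝ} {A : Coeff n} {M ν : ℝ}

/-- A smooth weight that is `1` near the origin and `exp R` where `R ≤ ‖x‖`. -/
def expWeight (n : ℕ) (R : ℝ) (x : E n) : ℝ := Real.exp (R * (1 - cutoff n (R / 2) x))

theorem expWeight_contDiff (R : ℝ) : ContDiff ℝ ((⊤ : ℕ∞) : WithTop ℕ∞) (expWeight n R) :=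
  (contDiff_const.mul (contDiff_const.sub (cutoff_contDiff _))).exp

theorem expWeight_abs_le {R : ℝ} (hR : 0 < R) (x : E n) : |expWeight n R x| ≤ Real.exp (2 * R) := by
  rw [expWeight, abs_of_pos (Real.exp_pos _)]
  have := abs_le.1 (cutoff_abs_le (n := n) (R / 2) x)
  exact Real.exp_le_exp.2 (by nlinarith)

theorem expWeight_eq_one {R : ℝ} (hR : 0 < R) {x : E n} (hx : ‖x‖ ≤ R / 2) :
    expWeight n R x = 1 := by
  rw [expWeight, cutoff_eq_one (half_pos hR) hx, sub_self, mul_zero, Real.exp_zero]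

theorem expWeight_eq_exp {R : ℝ} (hR : 0 < R) {x : E n} (hx : R ≤ ‖x‖) :
    expWeight n R x = Real.exp R := by
  rw [expWeight, cutoff_eq_zero (half_pos hR) (by linarith), sub_zero, mul_one]

theorem gradV_expWeight (R : ℝ) (x : E n) :
    gradV (fun y => (expWeight n R y : ℂ)) x =
      (-(R * expWeight n R x) : ℂ) • gradV (fun y => (cutoff n (R / 2) y : ℂ)) x := by
  have hc : HasFDerivAt (fun y => (cutoff n (R / 2) y : ℂ))
      (fderiv ℝ (fun y => (cutoff n (R / 2) y : ℂ)) x) x :=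
    ((contDiff_coe (cutoff_contDiff (R / 2))).differentiable (by simp) x).hasFDerivAt
  have h1 := ((hc.const_sub 1).const_mul (R : ℂ)).cexp
  have e : (fun y : E n => (expWeight n R y : ℂ)) =
      fun y => Complex.exp ((R : ℂ) * (1 - (cutoff n (R / 2) y : ℂ))) := by
    funext y
    rw [expWeight]; push_cast; rfl
  ext i
  rw [gradV_apply, grad, e, h1.fderiv, PiLp.smul_apply, gradV_apply, grad]
  rw [show (expWeight n R x : ℂ) = _ from congrFun e x]
  simp only [_root_.smul_apply, _root_.neg_apply, smul_eq_mul]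
  ring

/-- The amplitude R in the exponent compensates the cutoff gradient, of size C/(R/2); so the
logarithmic gradient is at most 2C for every R. -/
theorem exists_expWeight_grad_le (n : ℕ) : ∃ L : ℝ, 0 ≤ L ∧ ∀ R : ℝ, 0 < R → ∀ x : E n,
    ‖gradV (fun y => (expWeight n R y : ℂ)) x‖ ≤ L * expWeight n R x := by
  obtain ⟨C, hC0, hC⟩ := exists_cutoff_grad_le n
  refine ⟨2 * C, by positivity, fun R hR x => ?_⟩
  have hpos : 0 < expWeight n R x := Real.exp_pos _
  rw [gradV_expWeight, norm_smul, norm_neg, norm_mul, Complex.norm_real, Complex.norm_real,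
    Real.norm_of_nonneg hR.le, Real.norm_of_nonneg hpos.le]
  calc R * expWeight n R x * _ ≤ R * expWeight n R x * (C / (R / 2)) :=
        mul_le_mul_of_nonneg_left (hC _ (half_pos hR) x) (by positivity)
    _ = _ := by field_simp

theorem inner_mulF_symm {F : Type*} [NormedAddCommGroup F] [InnerProductSpace ℂ F]
    [CompleteSpace F] {μ : Measure (E n)} {ζ : E n → ℝ} (hζ : Continuous ζ) {C : ℝ}
    (hC : ∀ x, |ζ x| ≤ C) (f g : Lp F 2 μ) :
    inner ℂ (ptOp μ (mulF F ζ) f) g = inner ℂ f (ptOp μ (mulF F ζ) g) := by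
  rw [inner_ptOp_left (isBddField_mulF μ hζ hC)]
  congr 2
  congr 1
  funext x
  refine ((ContinuousLinearMap.eq_adjoint_iff _ _).2 fun y z => ?_).symm
  rw [mulF_apply, mulF_apply, inner_smul_left, inner_smul_right, Complex.conj_ofReal]

/-- Scalar multiplication commutes with the matrix field, and the commutator with the gradient is
multiplication by ∇ζ, so |∇ζ| ≤ Lζ is the required control. -/
theorem isMultiplier_of_grad_le (hω : IsA2Weight ω) (hM : 0 ≤ M) (hA : IsElliptic ω A M ν)
    {ζ : E n → ℝ} (hζ : ContDiff ℝ ((⊤ : ℕ∞) : WithTop ℕ∞) ζ) {C L : ℝ} (hL0 : 0 ≤ L)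
    (hC : ∀ x, |ζ x| ≤ C) (hL : ∀ x, ‖gradV (fun y => (ζ y : ℂ)) x‖ ≤ L * ζ x) :
    IsMultiplier (gradGraph ω) (coefOp ω A ν) (ptOp (wMeasure ω) (mulF ℂ ζ))
      (ptOp (wMeasure ω) (mulF (V n) ζ)) (ptOp (wMeasure ω) (gradF ζ)) L := by
  have hD : ∀ x, ‖gradV (fun y => (ζ y : ℂ)) x‖ ≤ L * C := fun x =>
    (hL x).trans (mul_le_mul_of_nonneg_left ((le_abs_self _).trans (hC x)) hL0)
  have hm := isBddField_mulF (F := ℂ) (wMeasure ω) hζ.continuous hC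
  have hm' := isBddField_mulF (F := V n) (wMeasure ω) hζ.continuous hC
  have hN := isBddField_gradF (wMeasure ω) hζ hD
  refine ⟨inner_mulF_symm hζ.continuous hC, inner_mulF_symm hζ.continuous hC, fun t g => ?_,
    fun f => ?_, fun f => ?_, fun f g h => mul_mem_gradGraph hω hζ hC hD h⟩
  · rw [coefOp]
    split_ifs with ht
    · have hB := hA.isBddField hω hM ht
      exact ptOp_comm hB hm' hm' hB (ae_of_all _ fun x y => by
        rw [mulF_apply, mulF_apply, map_smul]) g
    · simp only [_root_.smul_apply, ContinuousLinearMap.id_apply, map_smul]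
  · refine Lp.norm_le_mul_norm_of_ae_le_mul ?_
    filter_upwards [ptOp_coe hN f, ptOp_coe hm f] with x h1 h2
    rw [h1, h2, gradF_apply, mulF_apply, norm_smul, norm_smul, Complex.norm_real]
    calc ‖f x‖ * _ ≤ ‖f x‖ * (L * ‖ζ x‖) := mul_le_mul_of_nonneg_left
          ((hL x).trans (mul_le_mul_of_nonneg_left (le_abs_self _) hL0)) (norm_nonneg _)
      _ = _ := by ring
  · exact ptOp_comm hm hN hN hm' (ae_of_all _ fun x y => by
      simp only [mulF_apply, gradF_apply, smul_smul, smul_eq_mul]) f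

/-- The cutoff gradient vanishes where ‖x‖ < R, and elsewhere the weight is exp R. It is therefore
the weight times exp(-R) times itself, which exhibits the gain exp(-R). -/
theorem cutoff_pair_mem (hω : IsA2Weight ω) {R : ℝ} (hR : 0 < R) :
    WithLp.toLp 2 (toL2 (wMeasure ω) (fun x => (cutoff n R x : ℂ)),
      ptOp (wMeasure ω) (mulF (V n) (expWeight n R)) ((Real.exp (-R) : ℂ) •
        toL2 (wMeasure ω) (gradV fun x => (cutoff n R x : ℂ)))) ∈ gradGraph ω := by
  have h := testPair_mem hω (cutoff_isTest (n := n) hR)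
  rw [testPair] at h
  convert h using 3
  have hT := cutoff_isTest (n := n) hR
  have hg := hT.memLp_gradV hω
  rw [map_smul, ptOp_apply (isBddField_mulF _ (expWeight_contDiff R).continuous
    (expWeight_abs_le hR))]
  have e : (fun x => mulF (V n) (expWeight n R) x
      (toL2 (wMeasure ω) (gradV fun x => (cutoff n R x : ℂ)) x)) =ᵐ[wMeasure ω]
      fun x => (Real.exp R : ℂ) • gradV (fun x => (cutoff n R x : ℂ)) x := by
    filter_upwards [toL2_coe hg] with x hx
    rw [hx, mulF_apply]
    rcases lt_or_ge ‖x‖ R with h1 | h1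
    · rw [cutoff_grad_eq_zero hR (Or.inl h1), smul_zero, smul_zero]
    · rw [expWeight_eq_exp hR h1]
  rw [toL2_congr e, toL2_smul _ hg, smul_smul, ← Complex.ofReal_mul, ← Real.exp_add,
    neg_add_cancel, Real.exp_zero, Complex.ofReal_one, one_smul]

/-- For sources φ ⊗ ψ with φ supported in (s - 1, t), the conservation defect is at most a constant
times ∫|φ|. Concentrating φ at s yields the bound for Γ(t,s) itself; s - 1 is just a convenient
starting time before s. -/
theorem IsFundSol.inner_sub_le (hω : IsA2Weight ω) (hn : 1 ≤ n) (hM : 0 ≤ M) (hν : 0 < ν)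
    (hA : IsElliptic ω A M ν) {Γ : ℝ → ℝ → (L2w ω →L[ℂ] L2w ω)} (hΓ : IsFundSol ω A Γ)
    {ψ : L2w ω} (hψ : IsTestClass ψ) {m : L2w ω →L[ℂ] L2w ω} {m' : L2wVec ω →L[ℂ] L2wVec ω}
    {N : L2w ω →L[ℂ] L2wVec ω} {L : ℝ}
    (hm : IsMultiplier (gradGraph ω) (coefOp ω A ν) m m' N L) {p : L2w ω} {q : L2wVec ω}
    (hp : WithLp.toLp 2 (p, m' q) ∈ gradGraph ω) {t s : ℝ} (hst : s < t) :
    ‖inner ℂ p (Γ t s ψ) - inner ℂ p ψ‖ ≤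
      M * ‖q‖ * √(t - (s - 1)) *
        √(4 / ν * Real.exp (2 * (2 * (M * L) ^ 2 / ν) * (t - (s - 1)))) * ‖m ψ‖ := by
  have hsc := hω.secondCountable
  have hsc' := hω.secondCountable'
  set a := s - 1 with ha
  have hab : a ≤ t := by linarith
  have hcont : ContinuousOn (fun σ => inner ℂ p (Γ t σ ψ) - inner ℂ p ψ) (Ioo a t) :=
    ((hΓ.continuousOn_snd le_rfl ψ p).mono Ioo_subset_Iio_self).sub continuousOn_const
  refine norm_le_of_test isOpen_Ioo hcont (fun φ hφ hsupp => ?_) (s := s) ⟨by linarith, hst⟩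
  have h0 : ∀ τ ∉ Icc a t, φ τ = 0 := fun τ hτ => by
    by_contra h
    exact hτ (Ioo_subset_Icc_self (hsupp (subset_tsupport _ h)))
  obtain ⟨u, G, hu, -, hzero, -⟩ := exists_isSol hω hn hM hν hA hφ.continuous ψ h0
  have hlt : tsupport φ ⊆ Iio t := hsupp.trans Ioo_subset_Iio_self
  have hrep := hΓ.repr_all hω hn hM hν hA hφ hψ hu hlt le_rfl
  have hE := hu.data.pairing_const_le (isClosed_gradGraph ω) (hA.isEllipticFamily hω hn hM hν)
    hM hν hm hu.cont hab (hzero a le_rfl) hp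
  have hI : ∀ g : ℝ → ℝ, (∀ τ, φ τ = 0 → g τ = 0) → ∫ τ in Icc a t, g τ = ∫ τ, g τ :=
    fun g hg => setIntegral_eq_integral_of_forall_compl_eq_zero fun τ hτ => hg τ (h0 τ hτ)
  have e1 : ∫ τ in Icc a t, ‖m (φ τ • ψ)‖ = (∫ τ, ‖φ τ‖) * ‖m ψ‖ := by
    rw [hI _ fun τ hτ => by rw [hτ, zero_smul, map_zero, norm_zero], ← integral_mul_const]
    simp only [map_smul, norm_smul]
  have e2 : ∫ τ in Icc a t, inner ℂ p (φ τ • ψ) = ∫ τ, φ τ * inner ℂ p ψ := by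
    rw [setIntegral_eq_integral_of_forall_compl_eq_zero fun τ hτ => by
      rw [h0 τ hτ, zero_smul, inner_zero_right]]
    simp only [inner_smul_right]
  have i1 := integrable_mul_of_tsupport isOpen_Iio (hΓ.continuousOn_snd le_rfl ψ p) hφ hlt
  have i2 : Integrable fun τ => φ τ * inner ℂ p ψ :=
    (hφ.continuous.integrable_of_hasCompactSupport hφ.2).mul_const _
  have e3 : inner ℂ p (u t) = ∫ τ, φ τ * inner ℂ p (Γ t τ ψ) := by
    rw [hrep, ← integral_inner (hΓ.integrable hω hφ le_rfl hlt ψ)]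
    simp only [inner_smul_right]
  have e4 : ∫ τ, φ τ * (inner ℂ p (Γ t τ ψ) - inner ℂ p ψ) =
      inner ℂ p (u t) - ∫ τ in Icc a t, inner ℂ p (φ τ • ψ) := by
    rw [e2, e3, ← integral_sub i1 i2]
    simp only [mul_sub]
  rw [e4]
  refine hE.trans (le_of_eq ?_)
  rw [e1]; ring

end Conservation


/-! ### Mass of the kernel in its first variable -/

section Mass

variable {n : ℕ} {ω : E n → ℝ} {A : Coeff n} {M ν : ℝ}

/-- The gradient is bounded by C/R and vanishes off B(0,3R), whose mass grows at most like R²ⁿ. Any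
polynomial rate would do against exp(-R). -/
theorem IsA2Weight.exists_norm_cutoff_grad_le (hω : IsA2Weight ω) : ∃ K : ℝ, ∀ R : ℝ, 1 ≤ R →
    ‖toL2 (wMeasure ω) (gradV fun x => (cutoff n R x : ℂ))‖ ≤ K * R ^ n := by
  obtain ⟨C, hC0, hC⟩ := exists_cutoff_grad_le n
  set m := (wMeasure ω).real (Metric.ball (0 : E n) 1) with hm
  refine ⟨√((ballConst ω).toReal * m) * 3 ^ n * C, fun R hR => ?_⟩
  have hR0 : 0 < R := by linarith
  have h1 := hω.norm_toL2_le ((cutoff_isTest hR0).memLp_gradV hω) (R := 3 * R)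
    (by positivity : 0 ≤ C / R) (hC R hR0) fun x hx => cutoff_grad_eq_zero hR0 (Or.inr (by
      rw [mem_ball_zero_iff, not_lt] at hx; linarith))
  have h2 := hω.ball_comparison (x := 0) (y := 0) (r := 3 * R) (ρ := 1) (by positivity) one_pos
    (Metric.ball_subset_ball (by linarith))
  rw [div_one] at h2
  have h3 : √((wMeasure ω).real (Metric.ball (0 : E n) (3 * R))) ≤
      √((ballConst ω).toReal * m) * (3 * R) ^ n := by
    rw [← Real.sqrt_sq (by positivity : 0 ≤ (3 * R) ^ n), ← Real.sqrt_mul (by positivity)]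
    refine Real.sqrt_le_sqrt (h2.trans (le_of_eq ?_))
    rw [← pow_mul, mul_comm n 2]; ring
  calc _ ≤ √((ballConst ω).toReal * m) * (3 * R) ^ n * C := h1.trans
        (mul_le_mul h3 (div_le_self hC0 hR) (by positivity) (by positivity))
    _ = _ := by rw [mul_pow]; ring

theorem ptOp_expWeight_eq (hω : IsA2Weight ω) {ψ : L2w ω} {η : E n → ℂ} (hη : ψ =ᵐ[volume] η)
    {R : ℝ} (hR : 0 < R) (h0 : ∀ x, R / 2 < ‖x‖ → η x = 0) :
    ptOp (wMeasure ω) (mulF ℂ (expWeight n R)) ψ = ψ := by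
  refine Lp.ext ?_
  filter_upwards [ptOp_coe (isBddField_mulF (wMeasure ω) (expWeight_contDiff R).continuous
    (expWeight_abs_le hR)) ψ, hω.ae_eq_iff.2 hη] with x h1 h2
  rw [h1, mulF_apply, h2]
  rcases le_or_gt ‖x‖ (R / 2) with h | h
  · rw [expWeight_eq_one hR h, Complex.ofReal_one, one_smul]
  · rw [h0 x h, smul_zero]

theorem IsTest.exists_radius {η : E n → ℂ} (hη : IsTest η) : ∃ R : ℝ, ∀ x, R < ‖x‖ → η x = 0 := by
  obtain ⟨R, hR⟩ := hη.2.isCompact.isBounded.subset_closedBall (0 : E n)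
  refine ⟨R, fun x hx => by_contra fun h => ?_⟩
  exact absurd (mem_closedBall_zero_iff.1 (hR (subset_tsupport _ h))) (not_le.2 hx)

/-- For large R the weight is 1 on the support of ψ and costs nothing there. The factor exp(-R) from
the cutoff gradient then beats its norm, of order Rⁿ. -/
theorem IsFundSol.tendsto_inner_cutoff (hω : IsA2Weight ω) (hn : 1 ≤ n) (hM : 0 ≤ M) (hν : 0 < ν)
    (hA : IsElliptic ω A M ν) {Γ : ℝ → ℝ → (L2w ω →L[ℂ] L2w ω)} (hΓ : IsFundSol ω A Γ)
    {ψ : L2w ω} (hψ : IsTestClass ψ) {t s : ℝ} (hst : s < t) :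
    Tendsto (fun k : ℕ =>
      inner ℂ (toL2 (wMeasure ω) fun x => (cutoff n ((k : ℝ) + 1) x : ℂ)) (Γ t s ψ) -
        inner ℂ (toL2 (wMeasure ω) fun x => (cutoff n ((k : ℝ) + 1) x : ℂ)) ψ) atTop (𝓝 0) := by
  obtain ⟨L, hL0, hL⟩ := exists_expWeight_grad_le n
  obtain ⟨K, hK⟩ := hω.exists_norm_cutoff_grad_le
  obtain ⟨η, hη, hψη⟩ := hψ
  obtain ⟨ρ, hρ⟩ := hη.exists_radius
  set D := √(t - (s - 1)) *
    √(4 / ν * Real.exp (2 * (2 * (M * L) ^ 2 / ν) * (t - (s - 1)))) with hD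
  have hlim : Tendsto (fun k : ℕ => M * K * D * ‖ψ‖ *
      (((k : ℝ) + 1) ^ n * Real.exp (-((k : ℝ) + 1)))) atTop (𝓝 0) := by
    have h1 := ((Real.tendsto_pow_mul_exp_neg_atTop_nhds_zero n).comp
      (tendsto_atTop_add_const_right _ (1 : ℝ) tendsto_natCast_atTop_atTop)).const_mul
        (M * K * D * ‖ψ‖)
    rw [mul_zero] at h1
    exact h1
  refine squeeze_zero_norm' ?_ hlim
  obtain ⟨k₀, hk₀⟩ := exists_nat_ge (2 * ρ)
  filter_upwards [eventually_ge_atTop k₀] with k hk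
  have hk' : (k₀ : ℝ) ≤ k := by exact_mod_cast hk
  set R : ℝ := (k : ℝ) + 1 with hR
  have hR1 : 1 ≤ R := by rw [hR]; linarith [(Nat.cast_nonneg k : (0 : ℝ) ≤ k)]
  have hR0 : 0 < R := by linarith
  have hmul := isMultiplier_of_grad_le hω hM hA (expWeight_contDiff R) hL0 (expWeight_abs_le hR0)
    (hL R hR0)
  have h1 := hΓ.inner_sub_le hω hn hM hν hA ⟨η, hη, hψη⟩ hmul (cutoff_pair_mem hω hR0) hst
  rw [ptOp_expWeight_eq hω hψη hR0 fun x hx => hρ x (by linarith), norm_smul, Complex.norm_real,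
    Real.norm_of_nonneg (Real.exp_pos _).le] at h1
  refine h1.trans ?_
  calc _ = M * (Real.exp (-R) * ‖toL2 (wMeasure ω) (gradV fun x => (cutoff n R x : ℂ))‖) * D *
        ‖ψ‖ := by rw [hD]; ring
    _ ≤ M * (Real.exp (-R) * (K * R ^ n)) * D * ‖ψ‖ := by
        have := hK R hR1
        have hD0 : 0 ≤ D := by positivity
        exact mul_le_mul_of_nonneg_right (mul_le_mul_of_nonneg_right (mul_le_mul_of_nonneg_left
          (mul_le_mul_of_nonneg_left this (Real.exp_pos _).le) hM) hD0) (norm_nonneg _)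
    _ = _ := by ring

theorem tendsto_inner_cutoff_integral (hω : IsA2Weight ω) {g : L2w ω}
    (hg : Integrable g (wMeasure ω)) :
    Tendsto (fun k : ℕ => inner ℂ (toL2 (wMeasure ω) fun x => (cutoff n ((k : ℝ) + 1) x : ℂ)) g)
      atTop (𝓝 (∫ x, g x ∂(wMeasure ω))) := by
  have hk0 : ∀ k : ℕ, (0 : ℝ) < (k : ℝ) + 1 := fun k => by positivity
  have e : ∀ k : ℕ, inner ℂ (toL2 (wMeasure ω) fun x => (cutoff n ((k : ℝ) + 1) x : ℂ)) g =
      ∫ x, (cutoff n ((k : ℝ) + 1) x : ℂ) * g x ∂(wMeasure ω) := fun k => by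
    rw [inner_toL2_eq (hω.memLp_of_cpt (cutoff_isTest (hk0 k)).cont (cutoff_isTest (hk0 k)).2)]
    simp only [RCLike.inner_apply, Complex.conj_ofReal, mul_comm]
  simp only [e]
  refine tendsto_integral_of_dominated_convergence (fun x => ‖g x‖)
    (fun k => (cutoff_isTest (hk0 k)).cont.aestronglyMeasurable.mul hg.1) hg.norm
    (fun k => ae_of_all _ fun x => ?_) (ae_of_all _ fun x => ?_)
  · rw [norm_mul, Complex.norm_real]
    exact mul_le_of_le_one_left (norm_nonneg _) (cutoff_abs_le _ x)
  · refine tendsto_const_nhds.congr' ?_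
    obtain ⟨k₀, hk₀⟩ := exists_nat_ge ‖x‖
    filter_upwards [eventually_ge_atTop k₀] with k hk
    have hk' : (k₀ : ℝ) ≤ k := by exact_mod_cast hk
    rw [cutoff_eq_one (hk0 k) (by linarith), Complex.ofReal_one, one_mul]

theorem IsFundSol.integral_eq (hω : IsA2Weight ω) (hn : 1 ≤ n) (hM : 0 ≤ M) (hν : 0 < ν)
    (hA : IsElliptic ω A M ν) {Γ : ℝ → ℝ → (L2w ω →L[ℂ] L2w ω)} (hΓ : IsFundSol ω A Γ)
    {ψ : L2w ω} (hψ : IsTestClass ψ) {t s : ℝ} (hst : s < t) (hi : Integrable ψ (wMeasure ω))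
    (hi' : Integrable (Γ t s ψ) (wMeasure ω)) :
    ∫ x, Γ t s ψ x ∂(wMeasure ω) = ∫ x, ψ x ∂(wMeasure ω) :=
  sub_eq_zero.1 (tendsto_nhds_unique ((tendsto_inner_cutoff_integral hω hi').sub
    (tendsto_inner_cutoff_integral hω hi)) (hΓ.tendsto_inner_cutoff hω hn hM hν hA hψ hst))

/-- Conservation for a smooth compactly supported g reads ∫ mass·g dω = ∫ g dω after Fubini, and g
is arbitrary. Decay of the kernel in x, locally uniform in y, justifies the exchange. -/
theorem IsFundSol.integral_kernel_fst (hω : IsA2Weight ω) (hn : 1 ≤ n) (hM : 0 ≤ M) (hν : 0 < ν)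
    (hA : IsElliptic ω A M ν) {Γ : ℝ → ℝ → (L2w ω →L[ℂ] L2w ω)} (hΓ : IsFundSol ω A Γ)
    {t s : ℝ} (hst : s < t) {k : E n → E n → ℂ} (hk : HasKernel (Γ t s) k) (hd : ExpDecay ω k) :
    ∀ᵐ y : E n, Integrable (fun x => k x y) (wMeasure ω) ∧ ∫ x, k x y ∂(wMeasure ω) = 1 := by
  have hlf := hω.isLocallyFiniteMeasure
  have hK := hω.hasKernel_iff.1 hk
  have hF : ∀ N, Integrable (fun p : E n × E n => k p.1 p.2)
      ((wMeasure ω).prod ((wMeasure ω).restrict (natBall n N))) := fun N => by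
    have h1 := hd.integrable_prod (g := fun _ => 1) hω.natBall_lt_top hK.meas
      aestronglyMeasurable_const (by simpa using hω.integrable_exp_neg_norm)
      (measurableSet_natBall N) (subset_refl (natBall n N))
    simpa only [one_mul] using h1
  set mass : E n → ℂ := fun y => ∫ x, k x y ∂(wMeasure ω) with hmass
  have hmassN : ∀ N, IntegrableOn mass (natBall n N) (wMeasure ω) := fun N =>
    (hF N).integral_prod_right
  have hloc : LocallyIntegrable (fun y => mass y - 1) (wMeasure ω) := by
    refine LocallyIntegrable.sub (fun x => ?_) (locallyIntegrable_const 1)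
    obtain ⟨N, hN⟩ := mem_iUnion.1 (iUnion_natBall (n := n) ▸ mem_univ x)
    exact ⟨natBall n N, Metric.isOpen_ball.mem_nhds hN, hmassN N⟩
  have hzero : ∀ᵐ y ∂(wMeasure ω), mass y - 1 = 0 := by
    refine ae_eq_zero_of_integral_contDiff_smul_eq_zero hloc fun g hg hgc => ?_
    have hT : IsTest fun x : E n => (g x : ℂ) :=
      ⟨contDiff_coe hg, hgc.comp_left Complex.ofReal_zero⟩
    set ψ : L2w ω := toL2 (wMeasure ω) fun x : E n => (g x : ℂ) with hψdef
    have hψ : ψ =ᵐ[wMeasure ω] fun x => (g x : ℂ) := hω.ae_eq_iff.2 (hT.toL2_coe hω)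
    have hgi : Integrable (fun x => (g x : ℂ)) (wMeasure ω) :=
      hT.cont.integrable_of_hasCompactSupport hT.2
    obtain ⟨R, hR⟩ := hT.exists_radius
    obtain ⟨N, hN⟩ := exists_nat_gt R
    have h0 : ∀ y ∉ natBall n N, g y = 0 := fun y hy => by
      have := hR y (hN.trans_le (not_lt.1 fun h => hy (mem_ball_zero_iff.2 h)))
      exact_mod_cast this
    obtain ⟨C, hC⟩ := hg.continuous.bounded_above_of_compact_support hgc
    have hΦ : Integrable (fun p : E n × E n => k p.1 p.2 * (g p.2 : ℂ))
        ((wMeasure ω).prod ((wMeasure ω).restrict (natBall n N))) := by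
      refine (hF N).mul_bdd (c := C) ?_ (ae_of_all _ fun p => ?_)
      · exact (hT.cont.comp continuous_snd).aestronglyMeasurable
      · rw [Complex.norm_real]; exact hC _
    have hrep : Γ t s ψ =ᵐ[wMeasure ω]
        fun x => ∫ y in natBall n N, k x y * (g y : ℂ) ∂(wMeasure ω) := by
      filter_upwards [hK.ae_apply ψ] with x hx
      rw [hx.2, setIntegral_eq_integral_of_forall_compl_eq_zero fun y hy => by
        rw [h0 y hy, Complex.ofReal_zero, mul_zero]]
      exact integral_congr_ae (hψ.mono fun y hy => by simp only [hy])
    have hI := hΓ.integral_eq hω hn hM hν hA ⟨_, hT, hω.ae_eq_iff.1 hψ⟩ hst (hgi.congr hψ.symm)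
      (hΦ.integral_prod_left.congr hrep.symm)
    rw [integral_congr_ae hrep, integral_congr_ae hψ, integral_integral_swap hΦ] at hI
    simp only [integral_mul_const] at hI
    have e1 : ∫ y in natBall n N, mass y * (g y : ℂ) ∂(wMeasure ω) =
        ∫ y, mass y * (g y : ℂ) ∂(wMeasure ω) :=
      setIntegral_eq_integral_of_forall_compl_eq_zero fun y hy => by
        rw [h0 y hy, Complex.ofReal_zero, mul_zero]
    have i1 : Integrable (fun y => mass y * (g y : ℂ)) (wMeasure ω) := by
      rw [← integrableOn_iff_integrable_of_support_subset (s := natBall n N) fun y hy => by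
        by_contra h; exact hy (by simp only [h0 y h, Complex.ofReal_zero, mul_zero])]
      exact (hmassN N).mul_bdd (c := C) hT.cont.aestronglyMeasurable
        (ae_of_all _ fun p => by rw [Complex.norm_real]; exact hC _)
    calc ∫ y, g y • (mass y - 1) ∂(wMeasure ω)
        = ∫ y, (mass y * (g y : ℂ) - (g y : ℂ)) ∂(wMeasure ω) := by
          congr 1 with y
          rw [Complex.real_smul]; ring
      _ = 0 := by rw [integral_sub i1 hgi, ← e1, hI, sub_self]
  have hint : ∀ᵐ y ∂(wMeasure ω), Integrable (fun x => k x y) (wMeasure ω) :=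
    ae_of_forall_restrict iUnion_natBall fun N => (hF N).prod_left_ae
  rw [← hω.ae_eq]
  filter_upwards [hint, hzero] with y h1 h2
  exact ⟨h1, sub_eq_zero.1 h2⟩

end Mass


/-! ### Transfer to the adjoint operator and to arbitrary kernels -/

section Final

variable {n : ℕ} {ω : E n → ℝ} {A : Coeff n} {M ν : ℝ}

/-- The Gaussian bound is known for some fundamental solution and some kernel; uniqueness of both
carries it to the given ones. The bound is symmetric, so decay holds in either variable. -/
theorem HasGaussianUpperBounds.expDecay (hω : IsA2Weight ω) (hn : 1 ≤ n) (hM : 0 ≤ M) (hν : 0 < ν)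
    (hA : IsElliptic ω A M ν) (h : HasGaussianUpperBounds ω A)
    {Γ : ℝ → ℝ → (L2w ω →L[ℂ] L2w ω)} (hΓ : IsFundSol ω A Γ) {t s : ℝ} (hst : s < t)
    {k : E n → E n → ℂ} (hk : HasKernel (Γ t s) k) :
    ExpDecay ω k ∧ ExpDecay ω fun x y => conj (k y x) := by
  obtain ⟨Γ₀, hΓ₀, k₀, K₀, c₀, hK, hc, hk₀⟩ := h
  obtain ⟨h1, h2⟩ := hk₀ t s hst
  rw [hΓ₀.unique hω hn hM hν hA hΓ hst] at h1
  have h3 : ∀ᵐ p : E n × E n, ‖k p.1 p.2‖ ≤ gaussBound ω K₀ c₀ (t - s) p.1 p.2 := by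
    filter_upwards [h2, hk.ae_eq hω h1] with p e1 e2
    rw [e2]; exact e1
  exact ⟨hω.expDecay hK hc (sub_pos.2 hst) h3, hω.expDecay_conj_swap hK hc (sub_pos.2 hst) h3⟩

theorem HasGaussianUpperBounds.rev (hω : IsA2Weight ω) (hn : 1 ≤ n) (hM : 0 ≤ M) (hν : 0 < ν)
    (hA : IsElliptic ω A M ν) (h : HasGaussianUpperBounds ω A) :
    HasGaussianUpperBounds ω (revCoeff A) := by
  obtain ⟨Γ, hΓ, k, K₀, k₀, hK, hk, hker⟩ := h
  refine ⟨revFund Γ, hΓ.rev hω hn hM hν hA, fun t x s y => conj (k (-s) y (-t) x), K₀, k₀, hK, hk,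
    fun t s hst => ?_⟩
  obtain ⟨h1, h2⟩ := hker (-s) (-t) (neg_lt_neg hst)
  have hpos : 0 < -s - -t := by linarith
  refine ⟨h1.adjoint hω (hω.expDecay hK hk hpos h2), (ae_swap h2).mono fun p hp => ?_⟩
  rw [RCLike.norm_conj, gaussBound_comm]
  simpa only [Prod.fst_swap, Prod.snd_swap, neg_sub_neg] using hp

theorem hasGaussianUpperBounds_rev_iff (hω : IsA2Weight ω) (hn : 1 ≤ n) (hM : 0 ≤ M) (hν : 0 < ν)
    (hA : IsElliptic ω A M ν) :
    HasGaussianUpperBounds ω (revCoeff A) ↔ HasGaussianUpperBounds ω A := by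
  refine ⟨fun h => ?_, fun h => h.rev hω hn hM hν hA⟩
  have h1 := h.rev hω hn hM hν (hA.rev hω hM)
  rwa [revCoeff_revCoeff] at h1

theorem IsAdjFundSol.eq_adjoint (hω : IsA2Weight ω) (hn : 1 ≤ n) (hM : 0 ≤ M) (hν : 0 < ν)
    (hA : IsElliptic ω A M ν) {Γ Γ' : ℝ → ℝ → (L2w ω →L[ℂ] L2w ω)} (hΓ' : IsAdjFundSol ω A Γ')
    (hΓ : IsFundSol ω A Γ) {t s : ℝ} (hst : s < t) :
    Γ' s t = ContinuousLinearMap.adjoint (Γ t s) := by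
  have h1 := (isAdjFundSol_iff.1 hΓ').unique hω hn hM hν (hA.rev hω hM)
    (hΓ.rev hω hn hM hν hA) (neg_lt_neg hst)
  simpa only [revFund, neg_neg] using h1

/-- The conjugate transposed kernel belongs to the fundamental solution of the reversed operator,
where y plays the role of the first variable. -/
theorem IsFundSol.integral_kernel_snd (hω : IsA2Weight ω) (hn : 1 ≤ n) (hM : 0 ≤ M) (hν : 0 < ν)
    (hA : IsElliptic ω A M ν) {Γ : ℝ → ℝ → (L2w ω →L[ℂ] L2w ω)} (hΓ : IsFundSol ω A Γ)
    {t s : ℝ} (hst : s < t) {k : E n → E n → ℂ} (hk : HasKernel (Γ t s) k) (hd : ExpDecay ω k)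
    (hd' : ExpDecay ω fun x y => conj (k y x)) :
    ∀ᵐ x : E n, Integrable (fun y => k x y) (wMeasure ω) ∧ ∫ y, k x y ∂(wMeasure ω) = 1 := by
  have hk' : HasKernel (revFund Γ (-s) (-t)) fun y x => conj (k x y) := by
    simpa only [revFund, neg_neg] using hk.adjoint hω hd
  filter_upwards [(hΓ.rev hω hn hM hν hA).integral_kernel_fst hω hn hM hν (hA.rev hω hM)
    (neg_lt_neg hst) hk' hd'] with x hx
  have hc := hx.2
  rw [integral_conj] at hc
  refine ⟨?_, by rw [← Complex.conj_conj (∫ y, k x y ∂(wMeasure ω)), hc, map_one]⟩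
  have h1 := (Complex.conjCLE.toContinuousLinearMap.integrable_comp hx.1)
  simpa using h1

end Final

end DegParabolic

end

theorem mainTheorem4 {n : ℕ} (hn : 1 ≤ n)
    (ω : DegParabolic.E n → ℝ) (hω : DegParabolic.IsA2Weight ω)
    (A : DegParabolic.Coeff n) (M ν : ℝ) (hM : 0 < M) (hν : 0 < ν)
    (hA : DegParabolic.IsElliptic ω A M ν) :
    (DegParabolic.HasGaussianUpperBounds ω A ↔ DegParabolic.AdjHasGaussianUpperBounds ω A) ∧
    (DegParabolic.HasGaussianUpperBounds ω A →
      ∀ Γ Γ' : ℝ → ℝ → (DegParabolic.L2w ω →L[ℂ] DegParabolic.L2w ω),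
      DegParabolic.IsFundSol ω A Γ → DegParabolic.IsAdjFundSol ω A Γ' →
      ∀ k k' : ℝ → DegParabolic.E n → ℝ → DegParabolic.E n → ℂ,
      (∀ t s : ℝ, s < t → DegParabolic.HasKernel (Γ t s) (fun x y => k t x s y)) →
      (∀ t s : ℝ, s < t → DegParabolic.HasKernel (Γ' s t) (fun y x => k' s y t x)) →
      ∀ t s : ℝ, s < t →
        (∀ᵐ p : DegParabolic.E n × DegParabolic.E n,
          k' s p.2 t p.1 = conj (k t p.1 s p.2)) ∧
        (∀ r : ℝ, s < r → r < t →
          ∀ᵐ p : DegParabolic.E n × DegParabolic.E n,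
            Integrable (fun z => k t p.1 r z * k r z s p.2) (DegParabolic.wMeasure ω) ∧
            ∫ z, k t p.1 r z * k r z s p.2 ∂(DegParabolic.wMeasure ω) = k t p.1 s p.2) ∧
        (∀ᵐ x : DegParabolic.E n,
          Integrable (fun y => k t x s y) (DegParabolic.wMeasure ω) ∧
          ∫ y, k t x s y ∂(DegParabolic.wMeasure ω) = 1)) := by
  open DegParabolic in
  refine ⟨(adjHasGaussianUpperBounds_iff.trans
    (hasGaussianUpperBounds_rev_iff hω hn hM.le hν hA)).symm, ?_⟩
  intro h Γ Γ' hΓ hΓ' k k' hk hk' t s hst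
  have hdecay := fun {t s : ℝ} (hst : s < t) => h.expDecay hω hn hM.le hν hA hΓ hst (hk t s hst)
  refine ⟨?_, fun r hsr hrt => ?_, ?_⟩
  · have h1 := (hk t s hst).adjoint hω (hdecay hst).1
    rw [← hΓ'.eq_adjoint hω hn hM.le hν hA hΓ hst] at h1
    exact DegParabolic.ae_swap ((hk' t s hst).ae_eq hω h1)
  · have h1 := hk t s hst
    rw [hΓ.comp hω hn hM.le hν hA hsr hrt] at h1
    exact (hk t r hrt).comp hω (hk r s hsr) (hdecay hsr).1 h1
  · exact hΓ.integral_kernel_snd hω hn hM.le hν hA hst (hk t s hst) (hdecay hst).1 (hdecay hst).2
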